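/- Let $m,n\ge 0$ be integers with $(m,n)\neq(2,0)$, $\ell=\lfloor m/2\rfloor$, $L=\ell+n$, $N=m+2n$, and let $\mathbb F=\mathbb C(q)$. Fix an ordering $\mathcal E_1,\dots,\mathcal E_L$ of $\varepsilon_1,\dots,\varepsilon_\ell,\delta_1,\dots,\delta_n$ in which the $\varepsilon$'s and the $\delta$'s each keep their natural order. Let $(\varepsilon_i,\varepsilon_j)=\delta_{ij}$, $(\delta_i,\delta_j)=-\delta_{ij}$, $(\varepsilon_i,\delta_j)=0$, let $\varepsilon_i$ be even and $\delta_j$ odd, and take the simple roots $\alpha_i=\mathcal E_i-\mathcal E_{i+1}$ ($i<L$) and $\alpha_L=\mathcal E_L$ if $m$ is odd, $\alpha_L=2\mathcal E_L$ if $m$ is even and $\mathcal E_L=\delta_n$, $\alpha_L=\mathcal E_{L-1}+\mathcal E_L$ if $m$ is even and $\mathcal E_L=\varepsilon_\ell$. Let $\mathrm U_q$ be the corresponding quantum supergroup of $\mathfrak{osp}_{m|2n}$ over $\mathbb F$, with generators $e_i,f_i,k_i^{\pm1}$, together with, for odd $m$, a central group-like involution $\sigma$, and with coproduct $\Delta(e_i)=e_i\otimes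 k_i+1\otimes e_i$, $\Delta(f_i)=f_i\otimes 1+k_i^{-1}\otimes f_i$, $\Delta(k_i)=k_i\otimes k_i$. Let $V_q$ be its natural module, of dimension $N$ with weights $\pm\mathcal E_i$ (and $0$ if $m$ is odd), on which $\sigma$ acts as $-1$. Module homomorphisms are even. (1) There is exactly one operator $R$ on $V_q\otimes V_q$ (the action of the universal $R$-matrix) such that $R\,\Delta(x)=\Delta^{op}(x)R$ for all $x\in\mathrm U_q$ and such that, for $v,w$ of weights $\lambda,\mu$, $R(v\otimes w)$ is $q^{(\lambda,\mu)}v\otimes w$ plus a sum of terms of weights $(\lambda+\nu,\mu-\nu)$ with $\nu$ a non-zero sum of simple roots. There is a non-degenerate even bilinear form on $V_q$ with $(xv,w)=(-1)^{[v][x]}(v,S(x)w)$ for all $x\in \mathrm U_q$. (2) Let $\tau(v\otimes w)=(-1)^{[v][w]}w\otimes v$, $c=\tau\circ R$, fix any form $(\ ,\ )$ as in (1), and let $\mathcal H'$ be the category of non-directed ribbon graphs (objects $0,1,2,\dots$; morphisms $k\to l$ the isotopy classes of non-directed ribbon $(k,l)$-graphs), presented as a strict monoidal category by the crossings $X^{\pm}$,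 the cup $U$ and the cap $\Omega$ with the framed Reidemeister relations. There is a unique functor $\mathcal F$ from $\mathcal H'$ to the category of tensor modules $V_q^{\otimes k}$ and $\mathrm U_q$-homomorphisms, with $\mathcal F(k)=V_q^{\otimes k}$, compatible with adding vertical strands on the left and on the right of the generators, such that $\mathcal F(X^{\pm})=c^{\pm1}$, $\mathcal F(\Omega)(v\otimes w)=(v,w)$, and $\mathcal F(U):\mathbb F\to V_q\otimes V_q$ is the dual coevaluation, given by the inverse matrix of the form. (3) For $r\ge 0$ let $\mathcal H'^r_r(\mathbb F)$ be the $\mathbb F$-algebra with the non-directed ribbon $(r,r)$-graphs as basis and composition as product, and let $\nu_r:\mathcal H'^r_r(\mathbb F)\to\mathrm{End}_{\mathrm U_q}(V_q^{\otimes r})$ be the representation given by $\mathcal F$. Let $z=q-q^{-1}$, $y=q^{-m+2n+1}$, and let $BMW_r(y,z)$ be the $\mathbb F$-algebra with generators $g_i^{\pm1},e_i$ ($1\le i\le r-1$) and relations $g_ig_i^{-1}=g_i^{-1}g_i=1$; $g_ig_j=g_jg_i$ for $|i-j|\ge2$; $g_ig_{i+1}g_i=g_{i+1}g_ig_{i+1}$;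 $g_i-g_i^{-1}=z(1-e_i)$; $g_ie_i=e_ig_i=ye_i$; $e_ig_j^{\pm1}e_i=y^{\mp1}e_i$ for $|i-j|=1$. Then $\nu_r$ factors through $BMW_r(y,z)$: for every $r$ there are $\mathbb F$-algebra homomorphisms $\pi:\mathcal H'^r_r(\mathbb F)\to BMW_r(y,z)$ and $\rho:BMW_r(y,z)\to\mathrm{End}_{\mathrm U_q}(V_q^{\otimes r})$ with $\nu_r=\rho\circ\pi$, $\pi(X_i^{+})=g_i$ and $\pi(E_i)=e_i$, where $X_i^{+}$ and $E_i$ are $X^+$ and $U\circ\Omega$ on the strands $i,i+1$. -/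

import Mathlib

open CategoryTheory

namespace OspBMW

noncomputable section

/-! ## The ground field `ℂ(q)` -/

/-- The field `ℂ(q)` of rational functions in the indeterminate `q`. -/
abbrev Cq : Type := RatFunc ℂ

/-- The indeterminate `q`. -/
def q : Cq := RatFunc.X

/-! ## Root data of `osp_{m|2n}`

The weight lattice has the basis `ℰ_0, …, ℰ_{L-1}`, `L = ⌊m/2⌋ + n`, which is an admissible ordering of
`ε_1, …, ε_ℓ, δ_1, …, δ_n` (`ℓ = ⌊m/2⌋`): the `ε`'s and the `δ`'s each occur in their natural order.
Such an ordering is the same thing as the choice of the positions that carry a `δ`.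
Weights are written as integer vectors in the basis `ℰ`. -/

/-- An admissible ordering of `ε_1, …, ε_ℓ, δ_1, …, δ_n`. -/
structure RootDatum (m n : ℕ) where
  /-- whether `ℰ_j` is one of the `δ`'s -/
  isDelta : Fin (m / 2 + n) → Bool
  card_isDelta : (Finset.univ.filter fun j => isDelta j = true).card = n

/-- The weight lattice, in the basis `ℰ`. -/
abbrev Wt (m n : ℕ) : Type := Fin (m / 2 + n) → ℤ

/-- The index set of the weight basis `v_0, …, v_{N-1}`, `N = m + 2n`, of the natural module. -/
abbrev Idx (m n : ℕ) : Type := Fin (m + 2 * n)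

/-- The weight of `v_a`. In the order of the basis, the weights are
`ℰ_0, …, ℰ_{L-1}, (0 if m is odd), -ℰ_{L-1}, …, -ℰ_0`. -/
def wt {m n : ℕ} (a : Idx m n) : Wt m n := fun j =>
  if a.val = j.val then 1 else if a.val + j.val + 1 = m + 2 * n then -1 else 0

/-- The sign `(-1)^{[s][t]}` of a transposition of homogeneous elements of degrees `s` and `t`. -/
def ksign (s t : ZMod 2) : Cq := if s = 1 ∧ t = 1 then -1 else 1

namespace RootDatum

variable {m n : ℕ} (D : RootDatum m n)

/-- The bilinear form on weights: `(ε_i, ε_j) = δ_{ij}`, `(δ_i, δ_j) = -δ_{ij}`, `(ε_i, δ_j) = 0`. -/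
def ip (x y : Wt m n) : ℤ := ∑ j, (if D.isDelta j = true then -1 else 1) * x j * y j

/-- The parity of a weight: the `ε_i` are even and the `δ_j` are odd. -/
def par (x : Wt m n) : ZMod 2 := ∑ j, if D.isDelta j = true then (x j : ZMod 2) else 0

/-- The parity of the basis vector `v_a`. -/
def vpar (a : Idx m n) : ZMod 2 := D.par (wt a)

/-- The simple roots `ℰ_i - ℰ_{i+1}` (`i + 1 < L`), and the last one, which is
`ℰ_{L-1}` for odd `m`; for even `m` it is `2ℰ_{L-1}` if `ℰ_{L-1}` is a `δ`,
and `ℰ_{L-2} + ℰ_{L-1}` if it is an `ε`. -/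
def simpleRoot (i : Fin (m / 2 + n)) : Wt m n := fun j =>
  if i.val + 1 < m / 2 + n then
    (if j = i then 1 else if j.val = i.val + 1 then -1 else 0)
  else if m % 2 = 1 then (if j = i then 1 else 0)
  else if D.isDelta i = true then (if j = i then 2 else 0)
  else (if j = i ∨ j.val + 1 = i.val then 1 else 0)

end RootDatum

/-! ## The quantum supergroup and its natural module -/

/-- The generators `e_i, f_i, k_i, k_i⁻¹` of the quantum supergroup `U_q(osp_{m|2n})`; for odd `m` there is
in addition the generator `σ` of the group `ℤ/2`. -/
inductive Gen (m n : ℕ) : Type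
  | e (i : Fin (m / 2 + n))
  | f (i : Fin (m / 2 + n))
  | k (i : Fin (m / 2 + n))
  | kInv (i : Fin (m / 2 + n))
  | sigma (h : m % 2 = 1)

namespace RootDatum

variable {m n : ℕ} (D : RootDatum m n)

/-- The parity of a generator. -/
def genPar : Gen m n → ZMod 2
  | .e i => D.par (D.simpleRoot i)
  | .f i => D.par (D.simpleRoot i)
  | _ => 0

/-- `k_i` on `V_q`: the vector `v_a` is multiplied by `q^{(α_i, wt v_a)}`. -/
def kMat (i : Fin (m / 2 + n)) : Matrix (Idx m n) (Idx m n) Cq :=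
  Matrix.diagonal fun a => q ^ D.ip (D.simpleRoot i) (wt a)

/-- `k_i⁻¹` on `V_q`. -/
def kInvMat (i : Fin (m / 2 + n)) : Matrix (Idx m n) (Idx m n) Cq :=
  Matrix.diagonal fun a => q ^ (-D.ip (D.simpleRoot i) (wt a))

/-- `e_i` on `V_q`: the sum of the matrix units `v_b ↦ v_a` with `wt v_a = wt v_b + α_i`. -/
def eMat (i : Fin (m / 2 + n)) : Matrix (Idx m n) (Idx m n) Cq :=
  Matrix.of fun a b => if wt a = wt b + D.simpleRoot i then 1 else 0

/-- `f_i` on `V_q`, normalised by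
`e_i f_j - (-1)^{[e_i][f_j]} f_j e_i = δ_{ij} (k_i - k_i⁻¹) / (q - q⁻¹)`. It maps `v_a` to
`(-1)^{[a]} v_b` where `wt v_b = wt v_a - α_i`; if `α_i = 2δ_j` there is an additional
factor `q + q⁻¹`. -/
def fMat (i : Fin (m / 2 + n)) : Matrix (Idx m n) (Idx m n) Cq :=
  Matrix.of fun b a =>
    if wt a = wt b + D.simpleRoot i then
      (if D.vpar a = 1 then -1 else 1) * (if D.simpleRoot i i = 2 then q + q⁻¹ else 1)
    else 0

/-- The generators on the natural module `V_q`; for odd `m` the element `σ` acts by `-1`. -/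
def natOp : Gen m n → Matrix (Idx m n) (Idx m n) Cq
  | .e i => D.eMat i
  | .f i => D.fMat i
  | .k i => D.kMat i
  | .kInv i => D.kInvMat i
  | .sigma _ => -1

/-- The action on `V_q` of the antipodes of the generators:
`S(e_i) = -e_i k_i⁻¹`, `S(f_i) = -k_i f_i`, `S(k_i) = k_i⁻¹`, `S(σ) = σ⁻¹ = σ`. -/
def antipodeOp : Gen m n → Matrix (Idx m n) (Idx m n) Cq
  | .e i => -(D.eMat i * D.kInvMat i)
  | .f i => -(D.kMat i * D.fMat i)
  | .k i => D.kInvMat i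
  | .kInv i => D.kMat i
  | .sigma _ => -1

/-- The operator `v_a ↦ (-1)^{s[a]} v_a`. -/
def parityMat (s : ZMod 2) : Matrix (Idx m n) (Idx m n) Cq :=
  Matrix.diagonal fun a => ksign s (D.vpar a)

end RootDatum

/-! ## Tensor powers of the natural module

The basis of `V_q^{⊗r}` is indexed by words `Fin r → Idx m n`. A linear map
`V_q^{⊗k} → V_q^{⊗l}` is a matrix, acting on column vectors. -/

/-- Words of length `r`, indexing the basis of `V_q^{⊗r}`. -/
abbrev Word (m n r : ℕ) : Type := Fin r → Idx m n

/-- Linear maps `V_q^{⊗k} → V_q^{⊗l}`. -/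
abbrev TMat (m n k l : ℕ) : Type := Matrix (Word m n l) (Word m n k) Cq

/-- The matrix of `A ⊗ A ⊗ ⋯ ⊗ A`. -/
def powMat {m n : ℕ} (A : Matrix (Idx m n) (Idx m n) Cq) (r : ℕ) : TMat m n r r :=
  Matrix.of fun w' w => ∏ j, A (w' j) (w j)

/-- The matrix of `∑_t A ⊗ ⋯ ⊗ A ⊗ X ⊗ B ⊗ ⋯ ⊗ B`, with `X` in the factor `t`. -/
def sumMat {m n : ℕ} (A X B : Matrix (Idx m n) (Idx m n) Cq) (r : ℕ) : TMat m n r r :=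
  Matrix.of fun w' w => ∑ t : Fin r, ∏ j : Fin r,
    if j < t then A (w' j) (w j) else if j = t then X (w' j) (w j) else B (w' j) (w j)

namespace RootDatum

variable {m n : ℕ} (D : RootDatum m n)

/-- The action of the generators on `V_q^{⊗r}` through the iterated coproduct of
`Δ(e_i) = e_i ⊗ k_i + 1 ⊗ e_i`, `Δ(f_i) = f_i ⊗ 1 + k_i⁻¹ ⊗ f_i`, with `k_i` and `σ` group-like,
and the sign rule `(x ⊗ y)(v ⊗ w) = (-1)^{[y][v]} xv ⊗ yw`, which gives
the parity operators to the left of an odd generator. For `r = 0` this is the counit. -/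
def genOp (r : ℕ) : Gen m n → TMat m n r r
  | .e i => sumMat (D.parityMat (D.genPar (.e i))) (D.eMat i) (D.kMat i) r
  | .f i => sumMat (D.kInvMat i * D.parityMat (D.genPar (.f i))) (D.fMat i) 1 r
  | .k i => powMat (D.kMat i) r
  | .kInv i => powMat (D.kInvMat i) r
  | .sigma h => powMat (D.natOp (.sigma h)) r

/-- The parity of a word. -/
def wpar {r : ℕ} (w : Word m n r) : ZMod 2 := ∑ j, D.vpar (w j)

/-- `A : V_q^{⊗k} → V_q^{⊗l}` is a morphism of `ℤ/2`-graded `U_q(osp_{m|2n})`-modules: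
an even linear map that commutes with the action of the quantum supergroup, that is, with
the action of its generators. -/
def IsHom {k l : ℕ} (A : TMat m n k l) : Prop :=
  (∀ w' w, A w' w ≠ 0 → D.wpar w' = D.wpar w) ∧
  ∀ x : Gen m n, A * D.genOp k x = D.genOp l x * A

/-- The algebra `End_{U_q}(V_q^{⊗r})`. -/
def endUq (r : ℕ) : Subalgebra Cq (TMat m n r r) where
  carrier := {A | D.IsHom A}
  mul_mem' := by
    rintro A B ⟨hA, hA'⟩ ⟨hB, hB'⟩
    refine ⟨fun w' w h => ?_, fun x => ?_⟩
    · rw [Matrix.mul_apply] at h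
      obtain ⟨u, -, hu⟩ := Finset.exists_ne_zero_of_sum_ne_zero h
      exact (hA w' u (left_ne_zero_of_mul hu)).trans (hB u w (right_ne_zero_of_mul hu))
    · rw [mul_assoc, hB' x, ← mul_assoc, hA' x, mul_assoc]
  add_mem' := by
    rintro A B ⟨hA, hA'⟩ ⟨hB, hB'⟩
    refine ⟨fun w' w h => ?_, fun x => ?_⟩
    · by_cases h0 : A w' w = 0
      · refine hB w' w fun h1 => h ?_
        simp [h0, h1]
      · exact hA w' w h0
    · rw [add_mul, mul_add, hA' x, hB' x]
  algebraMap_mem' := by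
    intro c
    refine ⟨fun w' w h => ?_, fun x => (Algebra.commutes c _)⟩
    by_contra hne
    apply h
    have hw : w' ≠ w := fun h' => hne (by rw [h'])
    simp [Matrix.algebraMap_matrix_apply, hw]

/-! ## The `R`-matrix and the invariant form -/

/-- The graded flip `v ⊗ w ↦ (-1)^{[v][w]} w ⊗ v` on `V_q ⊗ V_q`. -/
def flip : TMat m n 2 2 :=
  Matrix.of fun w' w =>
    if w' 0 = w 1 ∧ w' 1 = w 0 then ksign (D.vpar (w 0)) (D.vpar (w 1)) else 0

/-- `R` is the action on `V_q ⊗ V_q` of the universal `R`-matrix of `U_q(osp_{m|2n})`. That is,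
`R Δ(x) = Δ^{op}(x) R` for all `x`, in other words `τ ∘ R` is a module endomorphism of `V_q ⊗ V_q`,
and `R = K Θ`, where `K` is multiplication by `q^{(λ, μ)}` on the tensor product of the
weight spaces of weights `λ` and `μ`, and where `Θ - 1` is a sum of terms that raise the weight of the
first factor and lower that of the second by the same non-zero sum of simple roots. -/
structure IsRMatrix (R : TMat m n 2 2) : Prop where
  intertwines : D.IsHom (D.flip * R)
  diag : ∀ w, R w w = q ^ D.ip (wt (w 0)) (wt (w 1))
  triangular : ∀ w' w, w' ≠ w → R w' w ≠ 0 → ∃ ν : Fin (m / 2 + n) → ℕ, ν ≠ 0 ∧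
    wt (w' 0) = wt (w 0) + ∑ i, ν i • D.simpleRoot i ∧
    wt (w' 1) = wt (w 1) - ∑ i, ν i • D.simpleRoot i

/-- `B a b = (v_a, v_b)` is an even non-degenerate bilinear form on `V_q` that is contravariant,
`(x v, w) = (-1)^{[v][x]} (v, S(x) w)`. -/
structure IsContravariantForm (B : Matrix (Idx m n) (Idx m n) Cq) : Prop where
  even : ∀ a b, B a b ≠ 0 → D.vpar a = D.vpar b
  nondegenerate : IsUnit B.det
  contravariant : ∀ (x : Gen m n) (a b : Idx m n),
    ∑ c, D.natOp x c a * B c b = ksign (D.vpar a) (D.genPar x) * ∑ c, B a c * D.antipodeOp x c b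

end RootDatum

/-! ## Non-directed ribbon graphs

The category of non-directed ribbon graphs is presented as a strict monoidal category
by the generators `X⁺, X⁻, U, Ω` and the framed Reidemeister relations. Morphisms are read from bottom to
top: a graph from `k` to `l` is a sequence of slices, each of which is a generator with some
vertical strands to its left and to its right. -/

/-- The generators: the two crossings (inverse to each other), the cup `U` and the cap `Ω`. -/
inductive Piece : Type
  | xPos
  | xNeg
  | cup
  | cap

/-- The number of strands at the bottom of a generator. -/
def Piece.src : Piece → ℕ
  | .xPos => 2
  | .xNeg => 2
  | .cup => 0
  | .cap => 2

/-- The number of strands at the top of a generator. -/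
def Piece.tgt : Piece → ℕ
  | .xPos => 2
  | .xNeg => 2
  | .cup => 2
  | .cap => 0

/-- A slice `id^{⊗left} ⊗ piece ⊗ id^{⊗right}` from `k` to `l` strands. -/
structure Slice (k l : ℕ) where
  piece : Piece
  left : ℕ
  right : ℕ
  hk : k = left + piece.src + right
  hl : l = left + piece.tgt + right

/-- The objects `0, 1, 2, …`. -/
structure Strands where
  num : ℕ

instance : Quiver Strands where
  Hom k l := Slice k.num l.num

/-- The sequence of the generators of a sequence of slices, each with the number of strands
to its left; the first entry is at the bottom. -/
def pieces {k : Strands} : {l : Strands} → Quiver.Path k l → List (Piece × ℕ)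
  | _, .nil => []
  | _, .cons p s => pieces p ++ [((s : Slice _ _).piece, (s : Slice _ _).left)]

/-- The relations between ribbon graphs. -/
inductive LocalRel : List (Piece × ℕ) → List (Piece × ℕ) → Prop
  /-- generators at disjoint places can be interchanged (`c` strands between them) -/
  | interchange (g h : Piece) (c : ℕ) :
      LocalRel [(g, 0), (h, g.tgt + c)] [(h, g.src + c), (g, 0)]
  /-- `(Ω ⊗ I)(I ⊗ U) = I` -/
  | zigzag_left : LocalRel [(.cup, 1), (.cap, 0)] []
  /-- `(I ⊗ Ω)(U ⊗ I) = I` -/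
  | zigzag_right : LocalRel [(.cup, 0), (.cap, 1)] []
  /-- `X⁻ X⁺ = I ⊗ I` -/
  | neg_pos : LocalRel [(.xPos, 0), (.xNeg, 0)] []
  /-- `X⁺ X⁻ = I ⊗ I` -/
  | pos_neg : LocalRel [(.xNeg, 0), (.xPos, 0)] []
  /-- the braid relation -/
  | braid : LocalRel [(.xPos, 0), (.xPos, 1), (.xPos, 0)] [(.xPos, 1), (.xPos, 0), (.xPos, 1)]
  /-- `(Ω ⊗ I)(I ⊗ X⁺) = (I ⊗ Ω)(X⁻ ⊗ I)` -/
  | cap_pos : LocalRel [(.xPos, 1), (.cap, 0)] [(.xNeg, 0), (.cap, 1)]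
  /-- `(Ω ⊗ I)(I ⊗ X⁻) = (I ⊗ Ω)(X⁺ ⊗ I)` -/
  | cap_neg : LocalRel [(.xNeg, 1), (.cap, 0)] [(.xPos, 0), (.cap, 1)]
  /-- `(I ⊗ X⁺)(U ⊗ I) = (X⁻ ⊗ I)(I ⊗ U)` -/
  | cup_pos : LocalRel [(.cup, 0), (.xPos, 1)] [(.cup, 1), (.xNeg, 0)]
  /-- `(I ⊗ X⁻)(U ⊗ I) = (X⁺ ⊗ I)(I ⊗ U)` -/
  | cup_neg : LocalRel [(.cup, 0), (.xNeg, 1)] [(.cup, 1), (.xPos, 0)]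
  /-- the framing relation: the right and the left positive curl are both the positive full twist -/
  | curl : LocalRel [(.cup, 1), (.xPos, 0), (.cap, 1)] [(.cup, 0), (.xPos, 1), (.cap, 0)]

/-- The relations, with `i` strands added on the left (and any number of strands on the right). -/
def ribbonRel : HomRel (Paths Strands) := fun _ _ p p' =>
  ∃ (i : ℕ) (w w' : List (Piece × ℕ)), LocalRel w w' ∧
    pieces p = w.map (fun x => (x.1, i + x.2)) ∧ pieces p' = w'.map (fun x => (x.1, i + x.2))

/-- The category of non-directed ribbon graphs. -/
abbrev RibbonCat : Type := CategoryTheory.Quotient ribbonRel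

/-- The object `k`. -/
def pts (k : ℕ) : RibbonCat :=
  (CategoryTheory.Quotient.functor ribbonRel).obj ((Paths.of Strands).obj ⟨k⟩)

/-- Non-directed ribbon `(k, l)`-graphs. -/
abbrev RibbonGraph (k l : ℕ) : Type := pts k ⟶ pts l

/-- The ribbon graph that consists of one slice. -/
def ofSlice {k l : ℕ} (s : Slice k l) : RibbonGraph k l :=
  (CategoryTheory.Quotient.functor ribbonRel).map
    ((Paths.of Strands).map (X := ⟨k⟩) (Y := ⟨l⟩) s)

/-- The algebra of non-directed ribbon `(r, r)`-graphs over `ℂ(q)`: its basis is the set of ribbon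
`(r, r)`-graphs, its product is the composition. -/
abbrev RibbonAlg (r : ℕ) : Type := MonoidAlgebra Cq (End (pts r))

/-- The ribbon graph `X_i⁺` (`i = 0, …, r - 2`). -/
def graphX {r : ℕ} (i : Fin (r - 1)) : End (pts r) :=
  ofSlice ⟨.xPos, i, r - 2 - i, by simp only [Piece.src]; omega, by simp only [Piece.tgt]; omega⟩

/-- The ribbon graph `X_i⁻` (`i = 0, …, r - 2`). -/
def graphXInv {r : ℕ} (i : Fin (r - 1)) : End (pts r) :=
  ofSlice ⟨.xNeg, i, r - 2 - i, by simp only [Piece.src]; omega, by simp only [Piece.tgt]; omega⟩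

/-- The ribbon graph `E_i` (`i = 0, …, r - 2`): a cap with a cup above it. -/
def graphE {r : ℕ} (i : Fin (r - 1)) : End (pts r) :=
  ofSlice (k := r) (l := r - 2) ⟨.cap, i, r - 2 - i, by simp only [Piece.src]; omega,
      by simp only [Piece.tgt]; omega⟩ ≫
    ofSlice (k := r - 2) (l := r) ⟨.cup, i, r - 2 - i, by simp only [Piece.src]; omega,
      by simp only [Piece.tgt]; omega⟩

/-! ## The functor from ribbon graphs to tensor modules -/

/-- The matrix of `id^{⊗left} ⊗ A ⊗ id^{⊗right}` for an (even) map `A` with the source and the target of the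
generator of the slice. -/
def whisker {m n k l : ℕ} (s : Slice k l) (A : TMat m n s.piece.src s.piece.tgt) : TMat m n k l :=
  Matrix.of fun w' w =>
    if (∀ t : Fin s.left,
          w' ⟨t, by have := s.hl; omega⟩ = w ⟨t, by have := s.hk; omega⟩) ∧
        (∀ t : Fin s.right,
          w' ⟨s.left + s.piece.tgt + t, by have := s.hl; omega⟩ =
            w ⟨s.left + s.piece.src + t, by have := s.hk; omega⟩)
    then A (fun t => w' ⟨s.left + t, by have := s.hl; omega⟩)
      (fun t => w ⟨s.left + t, by have := s.hk; omega⟩)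
    else 0

namespace RootDatum

variable {m n : ℕ} (D : RootDatum m n)

/-- The images of the generators: the braiding `τ ∘ R` for `X⁺`, its inverse for `X⁻`, the form
`v ⊗ w ↦ (v, w)` for `Ω`, and for `U` the vector `∑ (B⁻¹)_{ab} v_a ⊗ v_b`, which is
the coevaluation after the identification of `V_q` with its dual by the form. -/
def pieceVal (R : TMat m n 2 2) (B : Matrix (Idx m n) (Idx m n) Cq) :
    (g : Piece) → TMat m n g.src g.tgt
  | .xPos => (D.flip * R : TMat m n 2 2)
  | .xNeg => ((D.flip * R)⁻¹ : TMat m n 2 2)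
  | .cup => (Matrix.of fun w _ => B⁻¹ (w 0) (w 1) : TMat m n 0 2)
  | .cap => (Matrix.of fun _ w => B (w 0) (w 1) : TMat m n 2 0)

/-- The tensor functor from the category of non-directed ribbon graphs to the category of the tensor modules
`V_q^{⊗k}`: it maps `k` to `V_q^{⊗k}` and is given on generators by `pieceVal`. -/
structure RibbonFunctor (R : TMat m n 2 2) (B : Matrix (Idx m n) (Idx m n) Cq) where
  map : ∀ {k l : ℕ}, RibbonGraph k l → TMat m n k l
  isHom_map : ∀ {k l : ℕ} (Γ : RibbonGraph k l), D.IsHom (map Γ)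
  map_id : ∀ k : ℕ, map (𝟙 (pts k)) = 1
  map_comp : ∀ {k l p : ℕ} (Γ : RibbonGraph k l) (Γ' : RibbonGraph l p),
    map (Γ ≫ Γ') = map Γ' * map Γ
  map_slice : ∀ {k l : ℕ} (s : Slice k l),
    map (ofSlice s) = whisker s (D.pieceVal R B s.piece)

/-- The representation `ν_r` of the algebra of ribbon `(r, r)`-graphs on `V_q^{⊗r}`,
given by the functor. -/
def RibbonFunctor.nu {R : TMat m n 2 2} {B : Matrix (Idx m n) (Idx m n) Cq}
    {D : RootDatum m n} (𝓕 : D.RibbonFunctor R B) (r : ℕ) : RibbonAlg r →ₐ[Cq] D.endUq r :=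
  MonoidAlgebra.lift Cq (D.endUq r) (End (pts r))
    { toFun := fun Γ => ⟨𝓕.map Γ, 𝓕.isHom_map Γ⟩
      map_one' := Subtype.ext (𝓕.map_id r)
      map_mul' := fun Γ Γ' => Subtype.ext (𝓕.map_comp Γ' Γ) }

end RootDatum

/-! ## The Birman–Wenzl–Murakami algebra -/

/-- The generators `g_i^{±1}, e_i` (`i = 0, …, r - 2`) of the BMW algebra. -/
inductive BMWGen (r : ℕ) : Type
  | g (i : Fin (r - 1))
  | gInv (i : Fin (r - 1))
  | e (i : Fin (r - 1))

namespace BMWGen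

variable (K : Type*) [Field K] {r : ℕ}

/-- `g_i` in the free algebra. -/
abbrev G (i : Fin (r - 1)) : FreeAlgebra K (BMWGen r) := FreeAlgebra.ι K (.g i)

/-- `g_i⁻¹` in the free algebra. -/
abbrev GInv (i : Fin (r - 1)) : FreeAlgebra K (BMWGen r) := FreeAlgebra.ι K (.gInv i)

/-- `e_i` in the free algebra. -/
abbrev E (i : Fin (r - 1)) : FreeAlgebra K (BMWGen r) := FreeAlgebra.ι K (.e i)

end BMWGen

open BMWGen in
/-- The relations of the BMW algebra with parameters `y` and `z`: the braid relations, the Kauffman skein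
relation `g_i - g_i⁻¹ = z (1 - e_i)`, and the delooping relations. -/
inductive BMWRel {K : Type*} [Field K] {r : ℕ} (y z : K) :
    FreeAlgebra K (BMWGen r) → FreeAlgebra K (BMWGen r) → Prop
  | g_gInv (i) : BMWRel y z (G K i * GInv K i) 1
  | gInv_g (i) : BMWRel y z (GInv K i * G K i) 1
  | comm (i j : Fin (r - 1)) (h : i.val + 1 < j.val) : BMWRel y z (G K i * G K j) (G K j * G K i)
  | braid (i j : Fin (r - 1)) (h : j.val = i.val + 1) :
      BMWRel y z (G K i * G K j * G K i) (G K j * G K i * G K j)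
  | skein (i) : BMWRel y z (G K i - GInv K i) (z • (1 - E K i))
  | g_e (i) : BMWRel y z (G K i * E K i) (y • E K i)
  | e_g (i) : BMWRel y z (E K i * G K i) (y • E K i)
  | e_g_e (i j : Fin (r - 1)) (h : j.val = i.val + 1 ∨ i.val = j.val + 1) :
      BMWRel y z (E K i * G K j * E K i) (y⁻¹ • E K i)
  | e_gInv_e (i j : Fin (r - 1)) (h : j.val = i.val + 1 ∨ i.val = j.val + 1) :
      BMWRel y z (E K i * GInv K j * E K i) (y • E K i)

/-- The BMW algebra `BMW_r(y, z)`. -/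
abbrev BMW {K : Type*} [Field K] (r : ℕ) (y z : K) : Type _ := RingQuot (BMWRel (r := r) y z)

/-- The element `g_i` of the BMW algebra. -/
def BMW.g {K : Type*} [Field K] {r : ℕ} (y z : K) (i : Fin (r - 1)) : BMW r y z :=
  RingQuot.mkAlgHom K (BMWRel y z) (FreeAlgebra.ι K (BMWGen.g i))

/-- The element `e_i` of the BMW algebra. -/
def BMW.e {K : Type*} [Field K] {r : ℕ} (y z : K) (i : Fin (r - 1)) : BMW r y z :=
  RingQuot.mkAlgHom K (BMWRel y z) (FreeAlgebra.ι K (BMWGen.e i))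

end

end OspBMW

/-! The weight diagram of `V_q` is simple enough for all operators to be written down. In the weight
basis a contravariant form is antidiagonal, and its coefficients `κ` obey a recursion along the
arrows of the `e_i` (`IsKappa`); the recursion is solvable (`exists_isKappa`), and every
contravariant form arises in this way (`exists_kappa`). The braiding `c` is the graded swap with
factors `q^{(λ,μ)}`, plus one triangular half of `(q - q⁻¹)(1 - U Ω)`. The other half gives a
candidate for `c⁻¹`, and the difference of the two is the skein relation (`braid_sub_braidInv`).

Since `1 - U Ω` is equivariant, both candidates have the same commutators with `e_i` and `f_i`.
Their triangularity is opposite, so only the entries on two weight strata have to be compared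
(`braid_comm_e`, `braid_comm_f`). Moreover a homomorphism into `V_q^{⊗(l+1)}` is determined by its
components with the lowest weight vector in the last factor (`IsHom.eq_zero_of_last`), and on these
`c` is a mere swap. This yields the uniqueness of `R`, the invertibility of `c`, the braid relation
and the eigenvalue `y` of `c` on the cup. Slides and zigzags are checked entrywise. Then every
relation between ribbon graphs holds, the functor exists, and it is unique because slices generate.

The factorization needs more: a ribbon graph must be given a value in the BMW algebra itself and not
only in its image on `V_q`. A faithful representation takes the place of a topological argument.
Three facts are combined. `BMW_r` is spanned by `(2r-1)!!` elements, by straightening words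
(`spannedBy_main`). A ribbon `(r,r)`-graph with `r ≥ 1` acts on all modules with the same `y`
through one element of `BMW_r` (`exists_lift_eq_ribbonMap`), since cups and caps can be moved to the
right and removed by `e_n A_{n+2} e_n ⊆ A_n e_n`. If `m + 2n ≥ 2r`, the graphs span a space of
dimension at least `(2r-1)!!` (`oddFactorial_le_finrank`).

Adding `2k` to `m` and `k` to `n` does not change `y`, so each `y` occurs for a large module
(`exists_large`), on which `BMW_r` acts faithfully (`lift_injective`). Hence the element attached to
a graph is unique and depends multiplicatively on the graph. This defines `π`, and evaluation on the
original module gives `ν_r = ρ ∘ π`. For `r = 0` the operators are scalars. -/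

namespace OspBMW

/-! ## Families of elements satisfying the relations of the BMW algebra -/

/-- Elements `g_i, g_i⁻¹, e_i` (`i + 1 < r`) of an algebra that satisfy the BMW relations. -/
structure BMWFamily (K A : Type*) [Field K] [Ring A] [Algebra K A] (r : ℕ) (y z : K) where
  g : ℕ → A
  gi : ℕ → A
  e : ℕ → A
  y_ne : y ≠ 0
  z_ne : z ≠ 0
  g_gi : ∀ i, i + 1 < r → g i * gi i = 1
  gi_g : ∀ i, i + 1 < r → gi i * g i = 1
  comm : ∀ i j, i + 1 < j → j + 1 < r → g i * g j = g j * g i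
  braid : ∀ i, i + 2 < r → g i * g (i + 1) * g i = g (i + 1) * g i * g (i + 1)
  skein : ∀ i, i + 1 < r → g i - gi i = z • (1 - e i)
  g_e : ∀ i, i + 1 < r → g i * e i = y • e i
  e_g : ∀ i, i + 1 < r → e i * g i = y • e i
  e_g_e : ∀ i j, (j = i + 1 ∨ i = j + 1) → i + 1 < r → j + 1 < r → e i * g j * e i = y⁻¹ • e i
  e_gi_e : ∀ i j, (j = i + 1 ∨ i = j + 1) → i + 1 < r → j + 1 < r → e i * gi j * e i = y • e i

/-- `x_a x_{a+1} ⋯ x_{a+n-1}` -/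
def up {A : Type*} [Monoid A] (x : ℕ → A) : ℕ → ℕ → A
  | _, 0 => 1
  | a, n + 1 => x a * up x (a + 1) n

/-- `x_{a+n-1} ⋯ x_{a+1} x_a` -/
def dn {A : Type*} [Monoid A] (x : ℕ → A) : ℕ → ℕ → A
  | _, 0 => 1
  | a, n + 1 => x (a + n) * dn x a n

/-! ### Ascending and descending products -/

section prods
variable {A : Type*} [Monoid A] (x : ℕ → A)

@[simp] theorem up_zero (a : ℕ) : up x a 0 = 1 := rfl
@[simp] theorem dn_zero (a : ℕ) : dn x a 0 = 1 := rfl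
theorem up_succ (a n : ℕ) : up x a (n + 1) = x a * up x (a + 1) n := rfl
theorem dn_succ (a n : ℕ) : dn x a (n + 1) = x (a + n) * dn x a n := rfl

theorem up_add (a n k : ℕ) : up x a (n + k) = up x a n * up x (a + n) k := by
  induction n generalizing a with
  | zero => simp
  | succ n ih =>
    rw [show n + 1 + k = (n + k) + 1 by omega, up_succ, up_succ, ih, mul_assoc,
      show a + 1 + n = a + (n + 1) by omega]

theorem dn_add (a n k : ℕ) : dn x a (n + k) = dn x (a + n) k * dn x a n := by
  induction k with
  | zero => simp
  | succ k ih => rw [show n + (k + 1) = (n + k) + 1 by omega, dn_succ, dn_succ, ih, mul_assoc, add_assoc]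

theorem up_succ' (a n : ℕ) : up x a (n + 1) = up x a n * x (a + n) := by
  rw [up_add]; simp [up_succ]

theorem dn_succ' (a n : ℕ) : dn x a (n + 1) = dn x (a + 1) n * x a := by
  rw [add_comm, dn_add]; simp [dn_succ]

variable {x}

theorem up_commute {a n : ℕ} {y : A} (h : ∀ t, a ≤ t → t < a + n → Commute (x t) y) :
    Commute (up x a n) y := by
  induction n generalizing a with
  | zero => simp
  | succ n ih =>
    exact (h a le_rfl (by omega)).mul_left (ih fun t h1 h2 => h t (by omega) (by omega))

theorem dn_commute {a n : ℕ} {y : A} (h : ∀ t, a ≤ t → t < a + n → Commute (x t) y) :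
    Commute (dn x a n) y := by
  induction n with
  | zero => simp
  | succ n ih =>
    exact (h (a + n) (by omega) (by omega)).mul_left (ih fun t h1 h2 => h t (by omega) (by omega))

theorem dn_mul_up_cancel {x' : ℕ → A} {a n : ℕ} (h : ∀ t, a ≤ t → t < a + n → x t * x' t = 1) :
    dn x a n * up x' a n = 1 := by
  induction n generalizing a with
  | zero => simp
  | succ n ih =>
    rw [dn_succ', up_succ, mul_assoc, ← mul_assoc (x a), h a le_rfl (by omega), one_mul,
      ih fun t h1 h2 => h t (by omega) (by omega)]

end prods

theorem asc {A : Type*} [Semigroup A] {a b c : A} (h : a * b = c) (x : A) : a * (b * x) = c * x := by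
  rw [← mul_assoc, h]

theorem asc3 {A : Type*} [Semigroup A] {a b c d : A} (h : a * b * c = d) (x : A) :
    a * (b * (c * x)) = d * x := by
  rw [← h]; simp only [mul_assoc]

/-! ### Consequences of the BMW relations -/

namespace BMWFamily

variable {K A : Type*} [Field K] [Ring A] [Algebra K A] {r : ℕ} {y z : K}

theorem commute_inv {x u v : A} (huv : u * v = 1) (hvu : v * u = 1) (h : Commute x u) : Commute x v := by
  have h1 : v * (x * u) * v = v * (u * x) * v := by rw [h.eq]
  have h2 : v * (x * u) * v = v * x := by rw [mul_assoc, mul_assoc, huv, mul_one]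
  have h3 : v * (u * x) * v = x * v := by rw [← mul_assoc v u, hvu, one_mul]
  show x * v = v * x
  rw [← h3, ← h1, h2]

/-- The family in the opposite algebra. -/
def op (F : BMWFamily K A r y z) : BMWFamily K Aᵐᵒᵖ r y z where
  g i := MulOpposite.op (F.g i)
  gi i := MulOpposite.op (F.gi i)
  e i := MulOpposite.op (F.e i)
  y_ne := F.y_ne
  z_ne := F.z_ne
  g_gi i h := by rw [← MulOpposite.op_mul, F.gi_g i h, MulOpposite.op_one]
  gi_g i h := by rw [← MulOpposite.op_mul, F.g_gi i h, MulOpposite.op_one]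
  comm i j h h' := by rw [← MulOpposite.op_mul, ← MulOpposite.op_mul, F.comm i j h h']
  braid i h := by
    simp only [← MulOpposite.op_mul, ← mul_assoc]; rw [F.braid i h]
  skein i h := by
    rw [← MulOpposite.op_sub, F.skein i h, MulOpposite.op_smul, MulOpposite.op_sub, MulOpposite.op_one]
  g_e i h := by rw [← MulOpposite.op_mul, F.e_g i h, MulOpposite.op_smul]
  e_g i h := by rw [← MulOpposite.op_mul, F.g_e i h, MulOpposite.op_smul]
  e_g_e i j h h1 h2 := by
    simp only [← MulOpposite.op_mul, ← mul_assoc]; rw [F.e_g_e i j h h1 h2, MulOpposite.op_smul]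
  e_gi_e i j h h1 h2 := by
    simp only [← MulOpposite.op_mul, ← mul_assoc]; rw [F.e_gi_e i j h h1 h2, MulOpposite.op_smul]

variable (F : BMWFamily K A r y z)

/-- As `z` is invertible, the skein relation eliminates `e_i`; what is known about `g_i` and its
inverse passes to `e_i` by linearity. -/
theorem e_eq {i : ℕ} (h : i + 1 < r) : F.e i = 1 - z⁻¹ • (F.g i - F.gi i) := by
  rw [F.skein i h, smul_smul, inv_mul_cancel₀ F.z_ne, one_smul, sub_sub_cancel]

theorem gi_e {i : ℕ} (h : i + 1 < r) : F.gi i * F.e i = y⁻¹ • F.e i := by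
  have h1 : F.gi i * (F.g i * F.e i) = y • (F.gi i * F.e i) := by rw [F.g_e i h, mul_smul_comm]
  rw [← mul_assoc, F.gi_g i h, one_mul] at h1
  conv_rhs => rw [h1]
  rw [smul_smul, inv_mul_cancel₀ F.y_ne, one_smul]

theorem g_sq {i : ℕ} (h : i + 1 < r) : F.g i * F.g i = 1 + z • F.g i - (z * y) • F.e i := by
  have h1 : F.g i * (F.g i - F.gi i) = F.g i * (z • (1 - F.e i)) := by rw [F.skein i h]
  rw [mul_sub, F.g_gi i h, mul_smul_comm, mul_sub, mul_one, F.g_e i h, smul_sub, smul_smul] at h1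
  rw [sub_eq_iff_eq_add] at h1
  rw [h1]; abel

theorem gi_eq {i : ℕ} (h : i + 1 < r) : F.gi i = F.g i - z • (1 - F.e i) := by
  rw [← F.skein i h]; abel

/-- Here the inverse is eliminated too, which is why the subalgebras `alg` can be generated by the
`g_i` alone. -/
theorem e_eq' {i : ℕ} (h : i + 1 < r) :
    F.e i = (z * y)⁻¹ • (1 + z • F.g i - F.g i * F.g i) := by
  rw [F.g_sq h, sub_sub_cancel, smul_smul, inv_mul_cancel₀ (mul_ne_zero F.z_ne F.y_ne), one_smul]

/-- the value of a loop -/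
def loop (_ : BMWFamily K A r y z) : K := 1 - z⁻¹ * (y - y⁻¹)

theorem e_e {i : ℕ} (h : i + 1 < r) : F.e i * F.e i = F.loop • F.e i := by
  nth_rewrite 1 [F.e_eq h]
  rw [sub_mul, one_mul, smul_mul_assoc, sub_mul, F.g_e i h, F.gi_e h, ← sub_smul, smul_smul, loop,
    sub_smul, one_smul]

theorem commute_gg {i j : ℕ} (h : i + 1 < j ∨ j + 1 < i) (hi : i + 1 < r) (hj : j + 1 < r) :
    Commute (F.g i) (F.g j) := by
  rcases h with h | h
  · exact F.comm i j h hj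
  · exact (F.comm j i h hi).symm

theorem commute_gi_of {i : ℕ} {x : A} (hi : i + 1 < r) (h : Commute x (F.g i)) : Commute x (F.gi i) :=
  commute_inv (F.g_gi i hi) (F.gi_g i hi) h

theorem commute_e_of {i : ℕ} {x : A} (hi : i + 1 < r) (h : Commute x (F.g i)) : Commute x (F.e i) := by
  rw [F.e_eq hi]
  exact (Commute.one_right x).sub_right ((h.sub_right (F.commute_gi_of hi h)).smul_right _)

section adj
variable {i j : ℕ} (h : j = i + 1 ∨ i = j + 1) (hi : i + 1 < r) (hj : j + 1 < r)
include h hi hj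

theorem braid' : F.g i * F.g j * F.g i = F.g j * F.g i * F.g j := by
  rcases h with rfl | rfl
  · exact F.braid i (by omega)
  · exact (F.braid j (by omega)).symm

/-- The braid relation carries `g_i` and its inverse past `g_i g_j` to those with index `j`; by the
skein relation the same happens to `e_i`. -/
theorem gge_move : F.g i * F.g j * F.e i = F.e j * (F.g i * F.g j) := by
  have hb := F.braid' h hi hj
  have h1 : F.g i * F.g j * F.g i = F.g j * (F.g i * F.g j) := by rw [hb, mul_assoc]
  have h2 : F.g i * F.g j * F.gi i = F.gi j * (F.g i * F.g j) := by
    calc F.g i * F.g j * F.gi i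
        = F.gi j * (F.g j * (F.g i * F.g j)) * F.gi i := by
          rw [← mul_assoc (F.gi j), F.gi_g j hj, one_mul]
      _ = F.gi j * (F.g i * F.g j) := by
          rw [← h1]; simp only [mul_assoc]; rw [F.g_gi i hi, mul_one]
  rw [F.e_eq hi, F.e_eq hj]
  simp only [mul_sub, sub_mul, mul_one, one_mul, mul_smul_comm, smul_mul_assoc, h1, h2]

/-- The product `g_i g_j e_i g_j⁻¹ e_i` is evaluated twice: moving the first `e_i` to the left
leaves `y e_j e_i`, and delooping `e_i g_j⁻¹ e_i` leaves `y g_i g_j e_i`. -/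
theorem gge : F.g i * F.g j * F.e i = F.e j * F.e i := by
  have h1 : F.g i * F.g j * F.e i * F.gi j * F.e i = y • (F.e j * F.e i) := by
    rw [F.gge_move h hi hj]
    simp only [mul_assoc]
    rw [asc (F.g_gi j hj), one_mul, F.g_e i hi, mul_smul_comm]
  have h2 : F.g i * F.g j * F.e i * F.gi j * F.e i = y • (F.g i * F.g j * F.e i) := by
    simp only [mul_assoc]
    rw [← mul_assoc (F.e i), F.e_gi_e i j h hi hj, mul_smul_comm, mul_smul_comm]
  have h3 := h2.symm.trans h1
  exact smul_right_injective A F.y_ne h3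

/-- This tangle relation is not among the defining ones. With the skein expression for the middle
factor, the loop value and the two delooping scalars combine to `1`. -/
theorem eee : F.e i * F.e j * F.e i = F.e i := by
  rw [F.e_eq hj]
  rw [mul_sub, sub_mul, mul_one, F.e_e hi, mul_smul_comm, smul_mul_assoc, mul_sub, sub_mul,
    F.e_g_e i j h hi hj, F.e_gi_e i j h hi hj, ← sub_smul, smul_smul, ← sub_smul, loop]
  convert one_smul K (F.e i) using 2
  ring

end adj

section adj2
variable {i j : ℕ} (h : j = i + 1 ∨ i = j + 1) (hi : i + 1 < r) (hj : j + 1 < r)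
include h hi hj

theorem egg : F.e i * (F.g j * F.g i) = F.e i * F.e j :=
  MulOpposite.op_injective (F.op.gge h hi hj)

/-- The relation `egg` with the indices exchanged is solved for `e_j`; inserted into `e_i e_j e_i =
e_i`, it turns the positive crossings into inverse ones. -/
theorem egi_gi : F.e i * (F.gi j * F.gi i) = F.e i * F.e j := by
  have h1 := F.egg h.symm hj hi
  have h2 : F.e j = F.e j * F.e i * F.gi j * F.gi i := by
    rw [← h1]; simp only [mul_assoc]
    rw [asc (F.g_gi j hj), one_mul, F.g_gi i hi, mul_one]
  calc F.e i * (F.gi j * F.gi i) = F.e i * F.e j * F.e i * (F.gi j * F.gi i) := by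
        rw [F.eee h hi hj]
    _ = F.e i * (F.e j * F.e i * F.gi j * F.gi i) := by simp only [mul_assoc]
    _ = F.e i * F.e j := by rw [← h2]

theorem e_g_adj : F.e i * F.g j = F.e i * F.e j * F.gi i := by
  rw [← F.egg h hi hj]; simp only [mul_assoc]; rw [F.g_gi i hi, mul_one]

theorem e_gi_adj : F.e i * F.gi j = F.e i * F.e j * F.g i := by
  rw [← F.egi_gi h hi hj]; simp only [mul_assoc]; rw [F.gi_g i hi, mul_one]

end adj2

section adj3
variable {i j : ℕ} (h : j = i + 1 ∨ i = j + 1) (hi : i + 1 < r) (hj : j + 1 < r)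
include h hi hj

theorem g_e_adj : F.g j * F.e i = F.gi i * (F.e j * F.e i) :=
  MulOpposite.op_injective (F.op.e_g_adj h hi hj)

theorem gi_e_adj : F.gi j * F.e i = F.g i * (F.e j * F.e i) :=
  MulOpposite.op_injective (F.op.e_gi_adj h hi hj)

end adj3

/-- A chain of `e`'s transports a strand by two places, so a crossing passes through it with its
index shifted by two. -/
theorem eee_slide {t : ℕ} (h : t + 3 < r) :
    F.e t * F.e (t + 1) * F.e (t + 2) * F.g t = F.g (t + 2) * (F.e t * F.e (t + 1) * F.e (t + 2)) := by
  have c1 : Commute (F.e (t + 2)) (F.g t) :=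
    (F.commute_e_of (by omega) (F.commute_gg (Or.inl (by omega)) (by omega) (by omega))).symm
  have c2 : Commute (F.g (t + 2)) (F.e t) :=
    F.commute_e_of (by omega) (F.commute_gg (Or.inr (by omega)) (by omega) (by omega))
  calc F.e t * F.e (t + 1) * F.e (t + 2) * F.g t
      = F.e t * F.e (t + 1) * F.g t * F.e (t + 2) := by rw [mul_assoc, c1.eq, ← mul_assoc]
    _ = F.e t * (F.gi (t + 1) * F.e (t + 2)) := by
        rw [← F.e_gi_adj (Or.inl rfl) (by omega) (by omega), mul_assoc]
    _ = F.e t * (F.g (t + 2) * (F.e (t + 1) * F.e (t + 2))) := by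
        rw [F.gi_e_adj (Or.inr rfl) (by omega) (by omega)]
    _ = F.g (t + 2) * (F.e t * F.e (t + 1) * F.e (t + 2)) := by
        rw [← mul_assoc, ← c2.eq]; simp only [mul_assoc]

theorem up_e_slide {j n t : ℕ} (h1 : j ≤ t) (h2 : t + 2 < j + n) (h3 : j + n < r) :
    up F.e j n * F.g t = F.g (t + 2) * up F.e j n := by
  obtain ⟨a, rfl⟩ := Nat.exists_eq_add_of_le h1
  obtain ⟨b, rfl⟩ : ∃ b, n = a + (3 + b) := ⟨n - a - 3, by omega⟩
  have hR : Commute (up F.e (j + a + 3) b) (F.g (j + a)) := up_commute fun t _ _ =>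
    (F.commute_e_of (by omega) (F.commute_gg (Or.inl (by omega)) (by omega) (by omega))).symm
  have hL : Commute (up F.e j a) (F.g (j + a + 2)) := up_commute fun t _ _ =>
    (F.commute_e_of (by omega) (F.commute_gg (Or.inr (by omega)) (by omega) (by omega))).symm
  have h3' : up F.e (j + a) 3 = F.e (j + a) * F.e (j + a + 1) * F.e (j + a + 2) := by
    simp [up_succ, mul_assoc]
  rw [up_add, up_add, mul_assoc, mul_assoc, hR.eq, ← mul_assoc (up F.e (j + a) 3), h3',
    F.eee_slide (by omega)]
  rw [← mul_assoc, ← mul_assoc, ← mul_assoc, hL.eq]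
  simp only [mul_assoc]

theorem up_op {x : ℕ → A} (a n : ℕ) :
    up (fun i => MulOpposite.op (x i)) a n = MulOpposite.op (dn x a n) := by
  induction n generalizing a with
  | zero => rfl
  | succ n ih => rw [up_succ, ih, dn_succ', MulOpposite.op_mul]

theorem dn_op {x : ℕ → A} (a n : ℕ) :
    dn (fun i => MulOpposite.op (x i)) a n = MulOpposite.op (up x a n) := by
  induction n generalizing a with
  | zero => rfl
  | succ n ih => rw [dn_succ', ih, up_succ, MulOpposite.op_mul]

theorem up_g_slide {j n t : ℕ} (h1 : j ≤ t) (h2 : t + 1 < j + n) (h3 : j + n < r) :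
    F.g (t + 1) * up F.g j n = up F.g j n * F.g t := by
  obtain ⟨a, rfl⟩ := Nat.exists_eq_add_of_le h1
  obtain ⟨b, rfl⟩ : ∃ b, n = a + (2 + b) := ⟨n - a - 2, by omega⟩
  have hR : Commute (up F.g (j + a + 2) b) (F.g (j + a)) := up_commute fun t _ _ =>
    F.commute_gg (Or.inr (by omega)) (by omega) (by omega)
  have hL : Commute (up F.g j a) (F.g (j + a + 1)) := up_commute fun t _ _ =>
    F.commute_gg (Or.inl (by omega)) (by omega) (by omega)
  have h3' : up F.g (j + a) 2 = F.g (j + a) * F.g (j + a + 1) := by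
    simp [up_succ]
  rw [up_add, up_add, ← mul_assoc, ← hL.eq, mul_assoc, mul_assoc, mul_assoc, hR.eq,
    ← mul_assoc (up F.g (j + a) 2), h3', F.braid _ (by omega)]
  simp only [mul_assoc]

theorem dn_g_slide {j n t : ℕ} (h1 : j ≤ t) (h2 : t + 1 < j + n) (h3 : j + n < r) :
    dn F.g j n * F.g (t + 1) = F.g t * dn F.g j n := by
  have h := F.op.up_g_slide h1 h2 h3
  rw [show F.op.g = fun i => MulOpposite.op (F.g i) from rfl, up_op] at h
  exact MulOpposite.op_injective h

/-- A crossing next to `e_i` can be traded for `g_i⁻¹ e_j` (`g_e_adj`). Repeating this turns a run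
of crossings in front of an `e` into a chain of `e`'s behind inverse crossings, the form in which
the `e`-terms of `g_sq` are handled. -/
theorem dn_g_mul_e {l n : ℕ} (h : l + n + 1 < r) :
    dn F.g (l + 1) n * F.e l = up F.gi l n * dn F.e l (n + 1) := by
  induction n with
  | zero => simp [dn_succ]
  | succ n ih =>
    have hc : Commute (up F.gi l n) (F.g (l + 1 + n)) := up_commute fun t _ _ =>
      (F.commute_gi_of (by omega) (F.commute_gg (Or.inr (by omega)) (by omega) (by omega))).symm
    rw [dn_succ, mul_assoc, ih (by omega), ← mul_assoc, ← hc.eq, mul_assoc, dn_succ F.e l n,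
      ← mul_assoc (F.g _), F.g_e_adj (i := l + n) (Or.inl (by omega)) (by omega) (by omega),
      up_succ', dn_succ F.e l (n + 1), dn_succ F.e l n]
    simp only [mul_assoc, show l + 1 + n = l + (n + 1) by omega]

theorem e_mul_up_g {l n : ℕ} (h : l + n + 1 < r) :
    F.e l * up F.g (l + 1) n = up F.e l (n + 1) * dn F.gi l n := by
  have h' := F.op.dn_g_mul_e h
  rw [show F.op.g = fun i => MulOpposite.op (F.g i) from rfl,
    show F.op.e = fun i => MulOpposite.op (F.e i) from rfl,
    show F.op.gi = fun i => MulOpposite.op (F.gi i) from rfl, up_op, dn_op, dn_op] at h'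
  exact MulOpposite.op_injective h'

theorem dn_g_mul_dn_g {l n k : ℕ} (h : l + n < r) (hk : k < n) :
    dn F.g l n * dn F.g (l + n - k) k = dn F.g (l + n - k - 1) k * dn F.g l n := by
  induction k with
  | zero => simp
  | succ k ih =>
    have h1 : dn F.g (l + n - (k + 1)) (k + 1) = dn F.g (l + n - k) k * F.g (l + n - (k + 1)) := by
      rw [dn_succ', show l + n - (k + 1) + 1 = l + n - k by omega]
    have h2 : dn F.g (l + n - (k + 1) - 1) (k + 1) =
        dn F.g (l + n - k - 1) k * F.g (l + n - (k + 1) - 1) := by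
      rw [dn_succ', show l + n - (k + 1) - 1 + 1 = l + n - k - 1 by omega]
    rw [h1, ← mul_assoc, ih (by omega), mul_assoc, h2, mul_assoc,
      ← F.dn_g_slide (j := l) (n := n) (t := l + n - (k + 1) - 1) (by omega) (by omega) (by omega),
      show l + n - (k + 1) - 1 + 1 = l + n - (k + 1) by omega]

/-! ### The subalgebras of the first strands -/

/-- The subalgebra generated by `g_i`, `i + 1 < k`. -/
def alg (k : ℕ) : Subalgebra K A := Algebra.adjoin K {x | ∃ i, i + 1 < k ∧ x = F.g i}

theorem g_mem {i k : ℕ} (h : i + 1 < k) : F.g i ∈ F.alg k := Algebra.subset_adjoin ⟨i, h, rfl⟩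

theorem e_mem {i k : ℕ} (h : i + 1 < k) (hr : i + 1 < r) : F.e i ∈ F.alg k := by
  rw [F.e_eq' hr]
  exact Subalgebra.smul_mem _ (sub_mem (add_mem (one_mem _) (Subalgebra.smul_mem _ (F.g_mem h) _))
    (mul_mem (F.g_mem h) (F.g_mem h))) _

theorem gi_mem {i k : ℕ} (h : i + 1 < k) (hr : i + 1 < r) : F.gi i ∈ F.alg k := by
  rw [F.gi_eq hr]
  exact sub_mem (F.g_mem h) (Subalgebra.smul_mem _ (sub_mem (one_mem _) (F.e_mem h hr)) _)

theorem alg_mono {k l : ℕ} (h : k ≤ l) : F.alg k ≤ F.alg l :=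
  Algebra.adjoin_mono fun _ ⟨i, hi, hx⟩ => ⟨i, by omega, hx⟩

theorem alg_commute {k : ℕ} {x u : A} (hx : x ∈ F.alg k) (h : ∀ i, i + 1 < k → Commute (F.g i) u) :
    Commute x u := by
  induction hx using Algebra.adjoin_induction with
  | mem x hx => obtain ⟨i, hi, rfl⟩ := hx; exact h i hi
  | algebraMap c => exact Algebra.commutes c u
  | add a b _ _ ha hb => exact ha.add_left hb
  | mul a b _ _ ha hb => exact ha.mul_left hb

theorem alg_comm_g {k j : ℕ} {x : A} (hx : x ∈ F.alg k) (h : k ≤ j) (hj : j + 1 < r) :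
    Commute x (F.g j) :=
  F.alg_commute hx fun _ _ => F.commute_gg (Or.inl (by omega)) (by omega) hj

theorem alg_comm_e {k j : ℕ} {x : A} (hx : x ∈ F.alg k) (h : k ≤ j) (hj : j + 1 < r) :
    Commute x (F.e j) := F.commute_e_of hj (F.alg_comm_g hx h hj)

end BMWFamily

theorem up_mem {K A : Type*} [Field K] [Ring A] [Algebra K A] {S : Subalgebra K A} {x : ℕ → A} {a n : ℕ}
    (h : ∀ t, a ≤ t → t < a + n → x t ∈ S) : up x a n ∈ S := by
  induction n generalizing a with
  | zero => exact one_mem _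
  | succ n ih => exact mul_mem (h a le_rfl (by omega)) (ih fun t h1 h2 => h t (by omega) (by omega))

theorem dn_mem {K A : Type*} [Field K] [Ring A] [Algebra K A] {S : Subalgebra K A} {x : ℕ → A} {a n : ℕ}
    (h : ∀ t, a ≤ t → t < a + n → x t ∈ S) : dn x a n ∈ S := by
  induction n with
  | zero => exact one_mem _
  | succ n ih => exact mul_mem (h (a + n) (by omega) (by omega)) (ih fun t h1 h2 => h t (by omega) (by omega))

end OspBMW

/-! ### Straightening in the left ideals `A_{n+2} e_n` -/

namespace OspBMW

namespace BMWFamily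

variable {K A : Type*} [Field K] [Ring A] [Algebra K A] {r : ℕ} {y z : K}

theorem span_mul_mem {S : Set A} {W : Submodule K A} {u v : A} (h : ∀ x ∈ S, u * x * v ∈ W) :
    ∀ x ∈ Submodule.span K S, u * x * v ∈ W := by
  intro x hx
  have : Submodule.span K S ≤ W.comap (LinearMap.mulRight K v ∘ₗ LinearMap.mulLeft K u) :=
    Submodule.span_le.2 fun x hx => by simpa using h x hx
  simpa using this hx

variable (F : BMWFamily K A r y z)

/-- The spanning set of the left ideal `A_{n+2} e_n` according to the partner of the last top point. -/
def idealSpan (n : ℕ) : Submodule K A := Submodule.span K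
  ({x | ∃ j k a, j + k = n ∧ a ∈ F.alg n ∧ x = up F.g j k * a * F.e n} ∪
   {x | ∃ m j k b, n = m + 1 ∧ j + k = m ∧ b ∈ F.alg n.succ ∧ x = b * F.e m * F.e n * dn F.g j k})

/-- The spanning set of `A_n` according to the partner of the last top point. -/
def algSpan (n : ℕ) : Submodule K A := Submodule.span K
  ({x | ∃ j k a, j + k + 2 = n ∧ a ∈ F.alg n ∧ x = up F.g j k * F.e (j + k) * a} ∪
   {x | ∃ j k b, j + k + 1 = n ∧ b ∈ F.alg (j + k) ∧ x = b * dn F.g j k})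

theorem idealSpan_up {n j k : ℕ} {a : A} (h : j + k = n) (ha : a ∈ F.alg n) :
    up F.g j k * a * F.e n ∈ F.idealSpan n :=
  Submodule.subset_span (Or.inl ⟨j, k, a, h, ha, rfl⟩)

theorem idealSpan_dn {m j k : ℕ} {b : A} (h : j + k = m) (hb : b ∈ F.alg (m + 2)) :
    b * F.e m * F.e (m + 1) * dn F.g j k ∈ F.idealSpan (m + 1) :=
  Submodule.subset_span (Or.inr ⟨m, j, k, b, rfl, h, hb, rfl⟩)

theorem algSpan_up {n j k : ℕ} {a : A} (h : j + k + 2 = n) (ha : a ∈ F.alg n) :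
    up F.g j k * F.e (j + k) * a ∈ F.algSpan n :=
  Submodule.subset_span (Or.inl ⟨j, k, a, h, ha, rfl⟩)

theorem algSpan_dn {n j k : ℕ} {b : A} (h : j + k + 1 = n) (hb : b ∈ F.alg (j + k)) :
    b * dn F.g j k ∈ F.algSpan n :=
  Submodule.subset_span (Or.inr ⟨j, k, b, h, hb, rfl⟩)

theorem alg_mul_mem {k : ℕ} {W : Submodule K A} (h : ∀ i, i + 1 < k → ∀ w ∈ W, F.g i * w ∈ W)
    {a : A} (ha : a ∈ F.alg k) : ∀ w ∈ W, a * w ∈ W := by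
  induction ha using Algebra.adjoin_induction with
  | mem x hx => obtain ⟨i, hi, rfl⟩ := hx; exact h i hi
  | algebraMap c => intro w hw; rw [← Algebra.smul_def]; exact W.smul_mem c hw
  | add a b _ _ ha hb => intro w hw; rw [add_mul]; exact W.add_mem (ha w hw) (hb w hw)
  | mul a b _ _ ha hb => intro w hw; rw [mul_assoc]; exact ha _ (hb w hw)

theorem mul_alg_mem {k : ℕ} {W : Submodule K A} (h : ∀ i, i + 1 < k → ∀ w ∈ W, w * F.g i ∈ W)
    {a : A} (ha : a ∈ F.alg k) : ∀ w ∈ W, w * a ∈ W := by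
  induction ha using Algebra.adjoin_induction with
  | mem x hx => obtain ⟨i, hi, rfl⟩ := hx; exact h i hi
  | algebraMap c => intro w hw; rw [← Algebra.commutes, ← Algebra.smul_def]; exact W.smul_mem c hw
  | add a b _ _ ha hb => intro w hw; rw [mul_add]; exact W.add_mem (ha w hw) (hb w hw)
  | mul a b _ _ ha hb => intro w hw; rw [← mul_assoc]; exact hb _ (ha w hw)

/-- At the cost of two crossings a chain of `e`'s is lengthened by one place to the left, so that a
slide becomes applicable. -/
theorem e_eq_gg {j : ℕ} (h : j + 2 < r) : F.e (j + 1) = F.g j * F.g (j + 1) * F.e j * F.e (j + 1) := by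
  rw [F.gge (i := j) (j := j + 1) (Or.inl rfl) (by omega) (by omega),
    F.eee (i := j + 1) (j := j) (Or.inr rfl) (by omega) (by omega)]

theorem e_eq_gg' {j : ℕ} (h : j + 2 < r) : F.e (j + 1) = F.e (j + 1) * F.e j * F.g (j + 1) * F.g j := by
  rw [mul_assoc, mul_assoc, F.egg (i := j) (j := j + 1) (Or.inl rfl) (by omega) (by omega), ← mul_assoc,
    F.eee (i := j + 1) (j := j) (Or.inr rfl) (by omega) (by omega)]

theorem up_e_mul_e {j k : ℕ} (h : j + k + 2 < r) :
    up F.e j (k + 2) * F.e (j + k) = up F.e j (k + 1) := by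
  rw [up_succ', up_succ', mul_assoc, mul_assoc, ← mul_assoc (F.e (j + k)),
    show j + (k + 1) = j + k + 1 by omega,
    F.eee (i := j + k) (Or.inl rfl) (by omega) (by omega)]

theorem e_mul_dn_e {j k : ℕ} (h : j + k + 2 < r) :
    F.e (j + k) * dn F.e j (k + 2) = dn F.e j (k + 1) := by
  rw [dn_succ, dn_succ, ← mul_assoc, ← mul_assoc, show j + (k + 1) = j + k + 1 by omega,
    F.eee (i := j + k) (Or.inl rfl) (by omega) (by omega)]

theorem up_e_mul_up_g {j n l k : ℕ} (hj : j ≤ l) (hl : l + k + 2 ≤ j + n) (hr : j + n < r) :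
    up F.e j n * up F.g l k = up F.g (l + 2) k * up F.e j n := by
  induction k generalizing l with
  | zero => simp
  | succ k ih =>
    rw [up_succ, up_succ, ← mul_assoc, F.up_e_slide (by omega) (by omega) (by omega), mul_assoc,
      ih (l := l + 1) (by omega) (by omega)]
    simp only [mul_assoc]

theorem dn_g_mul_dn_e {j n l k : ℕ} (hj : j ≤ l) (hl : l + k + 2 ≤ j + n) (hr : j + n < r) :
    dn F.g l k * dn F.e j n = dn F.e j n * dn F.g (l + 2) k := by
  have h := F.op.up_e_mul_up_g hj hl hr
  rw [show F.op.g = fun i => MulOpposite.op (F.g i) from rfl,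
    show F.op.e = fun i => MulOpposite.op (F.e i) from rfl, up_op, up_op, up_op] at h
  exact MulOpposite.op_injective h

/-- Chains of `e`'s arise from `g_i²`. The element `a` is expanded by the induction hypothesis `hT`
on `A_n`. Either the chain meets an arc of the expansion and the crossings slide in front of it, or
its last member combines with `e_n` into an element of the second kind. -/
theorem up_e_mem_idealSpan {n : ℕ} (hn : n + 2 ≤ r) (hT : 0 < n → ∀ a ∈ F.alg n, a ∈ F.algSpan n)
    {j k : ℕ} (hjk : j + (k + 1) = n) : ∀ a ∈ F.alg n, up F.e j (k + 1) * a * F.e n ∈ F.idealSpan n := by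
  intro a ha
  refine span_mul_mem ?_ a (hT (by omega) a ha)
  rintro x (⟨l, k', a, h1, ha, rfl⟩ | ⟨l, k', b, h1, hb, rfl⟩)
  · obtain rfl : n = l + k' + 2 := h1.symm
    have hmem : ∀ {p q : ℕ}, p + q ≤ l + k' + 1 → up F.e p q ∈ F.alg (l + k' + 2) := fun h =>
      up_mem fun t _ _ => F.e_mem (by omega) (by omega)
    -- If the chain starts no later than the crossings, these slide through it. Otherwise the
    -- crossings before its start commute with it, and `e_eq_gg` extends it so as to cover the
    -- remaining ones.
    rcases le_or_gt j l with h2 | h2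
    · obtain ⟨k2, rfl⟩ : ∃ k2, k = k2 + 1 := ⟨k - 1, by omega⟩
      have e1 : up F.e j (k2 + 1 + 1) * (up F.g l k' * F.e (l + k') * a) =
          up F.g (l + 2) k' * (up F.e j (k2 + 1) * a) := by
        rw [← F.up_e_mul_e (j := j) (k := k2) (by omega)]
        rw [← mul_assoc, ← mul_assoc, F.up_e_mul_up_g h2 (by omega) (by omega)]
        simp only [mul_assoc]
        rw [show j + k2 = l + k' by omega]
      rw [e1]
      exact F.idealSpan_up (by omega) (mul_mem (hmem (by omega)) ha)
    · obtain ⟨c, rfl⟩ : ∃ c, j = l + c + 1 := ⟨j - l - 1, by omega⟩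
      obtain ⟨d, rfl⟩ : ∃ d, k' = c + d := ⟨k' - c, by omega⟩
      have hk : k = d := by omega
      subst hk
      have hc : Commute (up F.g l c) (up F.e (l + c + 1) (k + 1)) := up_commute fun t _ _ =>
        (up_commute fun s _ _ => (F.commute_e_of (by omega)
          (F.commute_gg (Or.inl (by omega)) (by omega) (by omega))).symm).symm
      have e0 : up F.e (l + c + 1) (k + 1) =
          F.g (l + c) * F.g (l + c + 1) * up F.e (l + c) (k + 2) := by
        rw [up_succ F.e (l + c + 1), F.e_eq_gg (by omega), up_succ F.e (l + c), up_succ F.e (l + c + 1)]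
        simp only [mul_assoc]
      have e1 : up F.e (l + c + 1) (k + 1) * (up F.g l (c + k) * F.e (l + (c + k)) * a) =
          up F.g l (c + k + 2) * (up F.e (l + c) (k + 1) * a) := by
        rw [up_add F.g l c k, ← mul_assoc, ← mul_assoc, ← mul_assoc, ← hc.eq, e0,
          ← F.up_e_mul_e (j := l + c) (k := k) (by omega), add_assoc c, up_add F.g l c (k + 2),
          up_succ F.g (l + c), up_succ F.g (l + c + 1)]
        simp only [mul_assoc]
        rw [← mul_assoc (up F.e _ _) (up F.g _ _), F.up_e_mul_up_g le_rfl (by omega) (by omega)]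
        simp only [mul_assoc, add_assoc]
      rw [e1]
      exact F.idealSpan_up (by omega) (mul_mem (hmem (by omega)) ha)
  · obtain ⟨m, rfl⟩ : ∃ m, n = m + 1 := ⟨j + k, by omega⟩
    have hd : Commute (dn F.g l k') (F.e (m + 1)) := dn_commute fun t _ _ =>
      F.commute_e_of (by omega) (F.commute_gg (Or.inl (by omega)) (by omega) (by omega))
    have hb' : Commute b (F.e m) := F.alg_comm_e hb (by omega) (by omega)
    have e1 : up F.e j (k + 1) * (b * dn F.g l k') * F.e (m + 1) =
        up F.e j k * b * F.e m * F.e (m + 1) * dn F.g l k' := by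
      rw [up_succ', show j + k = m by omega]
      simp only [mul_assoc]
      rw [hd.eq, hb'.symm.left_comm]
    rw [e1]
    exact F.idealSpan_dn (by omega) (mul_mem (up_mem fun t _ _ => F.e_mem (by omega) (by omega))
      (F.alg_mono (by omega) hb))

/-- The generator `g_i` commutes with the run of crossings, lengthens it, passes through it with its
index lowered, or meets its first crossing. Only the last case needs `g_sq`, and its chain of `e`'s
is absorbed by `up_e_mem_idealSpan`. -/
theorem g_mul_idealSpan {n i : ℕ} (hn : n + 2 ≤ r) (hT : 0 < n → ∀ a ∈ F.alg n, a ∈ F.algSpan n)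
    (hi : i + 1 < n + 1) : ∀ w ∈ F.idealSpan n, F.g i * w ∈ F.idealSpan n := by
  intro w hw
  rw [← mul_one (F.g i * w)]
  refine span_mul_mem ?_ w hw
  rintro x (⟨j, k, a, h1, ha, rfl⟩ | ⟨m, j, k, b, rfl, h1, hb, rfl⟩)
  · rw [mul_one]
    rcases lt_trichotomy i j with h | h | h
    · rcases Nat.lt_or_ge (i + 1) j with h2 | h2
      · have hc : Commute (F.g i) (up F.g j k) := (up_commute fun t _ _ =>
          F.commute_gg (Or.inr (by omega)) (by omega) (by omega)).symm
        have : F.g i * (up F.g j k * a * F.e n) = up F.g j k * (F.g i * a) * F.e n := by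
          simp only [mul_assoc]; rw [hc.left_comm]
        rw [this]
        exact F.idealSpan_up h1 (mul_mem (F.g_mem (by omega)) ha)
      · obtain rfl : j = i + 1 := by omega
        have : F.g i * (up F.g (i + 1) k * a * F.e n) = up F.g i (k + 1) * a * F.e n := by
          rw [up_succ]; simp only [mul_assoc]
        rw [this]
        exact F.idealSpan_up (by omega) ha
    · subst h
      obtain ⟨c, rfl⟩ : ∃ c, k = c + 1 := ⟨k - 1, by omega⟩
      have e1 : F.g i * (up F.g i (c + 1) * a * F.e n) = up F.g (i + 1) c * a * F.e n +
          z • (up F.g i (c + 1) * a * F.e n) -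
          (z * y) • (up F.e i (c + 1) * (dn F.gi i c * a) * F.e n) := by
        have : F.g i * (up F.g i (c + 1) * a * F.e n) =
            (F.g i * F.g i) * (up F.g (i + 1) c * a * F.e n) := by
          rw [up_succ]; simp only [mul_assoc]
        have t1 : F.g i * (up F.g (i + 1) c * a * F.e n) = up F.g i (c + 1) * a * F.e n := by
          rw [up_succ]; simp only [mul_assoc]
        have t2 : F.e i * (up F.g (i + 1) c * a * F.e n) =
            up F.e i (c + 1) * (dn F.gi i c * a) * F.e n := by
          rw [← mul_assoc, ← mul_assoc, ← mul_assoc, F.e_mul_up_g (by omega)]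
        rw [this, F.g_sq (by omega), sub_mul, add_mul, one_mul, smul_mul_assoc, smul_mul_assoc, t1, t2]
      rw [e1]
      exact sub_mem (add_mem (F.idealSpan_up (by omega) ha)
        (Submodule.smul_mem _ _ (F.idealSpan_up h1 ha)))
        (Submodule.smul_mem _ _ (F.up_e_mem_idealSpan hn hT h1 _
          (mul_mem (dn_mem fun t _ _ => F.gi_mem (by omega) (by omega)) ha)))
    · obtain ⟨t, rfl⟩ : ∃ t, i = t + 1 := ⟨i - 1, by omega⟩
      have : F.g (t + 1) * (up F.g j k * a * F.e n) = up F.g j k * (F.g t * a) * F.e n := by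
        simp only [← mul_assoc]; rw [F.up_g_slide (by omega) (by omega) (by omega)]
      rw [this]
      exact F.idealSpan_up h1 (mul_mem (F.g_mem (by omega)) ha)
  · have : F.g i * (b * F.e m * F.e (m + 1) * dn F.g j k) * 1 =
        (F.g i * b) * F.e m * F.e (m + 1) * dn F.g j k := by simp only [mul_assoc, mul_one]
    rw [this]
    exact F.idealSpan_dn h1 (mul_mem (F.g_mem (by omega)) hb)

theorem alg_mul_e_mul_mem {n : ℕ} (hn : n + 2 ≤ r) (hT : 0 < n → ∀ a ∈ F.alg n, a ∈ F.algSpan n) {x u : A}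
    (hx : x ∈ F.alg (n + 1)) (hu : u ∈ F.alg n) : x * (F.e n * u) ∈ F.idealSpan n := by
  refine F.alg_mul_mem (fun i hi => F.g_mul_idealSpan hn hT hi) hx _ ?_
  rw [← (F.alg_comm_e hu le_rfl (by omega)).eq, ← one_mul (u * F.e n), ← mul_assoc,
    ← up_zero F.g n]
  exact F.idealSpan_up rfl hu

/-- Two descending runs have to be merged into one. If the second starts further right, it passes
through the first, then commutes with the last two `e`'s and is absorbed on the left. Otherwise the
runs contain a double crossing, which `g_sq` resolves. -/
theorem dn_dn_mem_idealSpan {m : ℕ} (hn : m + 3 ≤ r) (hT : 0 < m + 1 → ∀ a ∈ F.alg (m + 1), a ∈ F.algSpan (m + 1))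
    {b : A} (hb : b ∈ F.alg (m + 1)) {l k1 j k m' : ℕ} (hm : m = m' + 1) (h1 : l + (k1 + 1) = m)
    (h2 : j + k = m) :
    b * F.e m' * F.e m * F.e (m + 1) * (dn F.g l (k1 + 1) * dn F.g j k) ∈ F.idealSpan (m + 1) := by
  have hbe : b * F.e m' ∈ F.alg (m + 1) :=
    mul_mem hb (F.e_mem (by omega) (by omega))
  have key : ∀ {u v : A}, u ∈ F.alg m → b * F.e m' * F.e m * F.e (m + 1) * (u * v) =
      (b * F.e m' * u) * F.e m * F.e (m + 1) * v := by
    intro u v hu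
    have c1 := F.alg_comm_e hu le_rfl (by omega : m + 1 < r)
    have c2 := F.alg_comm_e hu (Nat.le_succ m) (by omega : m + 1 + 1 < r)
    simp only [mul_assoc]
    rw [c2.symm.left_comm, c1.symm.left_comm]
  have hdn : ∀ {p q : ℕ}, p + q + 1 ≤ m → dn F.g p q ∈ F.alg m := fun h =>
    dn_mem fun t _ _ => F.g_mem (by omega)
  rcases Nat.lt_or_ge l j with h | h
  · have hs := F.dn_g_mul_dn_g (l := l) (n := k1 + 1) (k := k) (by omega) (by omega)
    rw [show l + (k1 + 1) - k = j by omega] at hs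
    rw [hs, key (hdn (by omega))]
    exact F.idealSpan_dn h1 (mul_mem (F.alg_mono (by omega) hbe) (F.alg_mono (by omega) (hdn (by omega))))
  · obtain ⟨d, rfl⟩ := Nat.exists_eq_add_of_le h
    have e1 : dn F.g j k = dn F.g (j + d + 1) k1 * F.g (j + d) * dn F.g j d := by
      rw [show k = d + (k1 + 1) by omega, dn_add, dn_succ']
    have e2 : dn F.g (j + d) (k1 + 1) * dn F.g (j + d + 1) k1 =
        dn F.g (j + d) k1 * (dn F.g (j + d + 1) k1 * F.g (j + d)) := by
      have hs := F.dn_g_mul_dn_g (l := j + d) (n := k1 + 1) (k := k1) (by omega) (by omega)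
      rw [show j + d + (k1 + 1) - k1 = j + d + 1 by omega, show j + d + 1 - 1 = j + d by omega,
        dn_succ' F.g (j + d) k1] at hs
      rw [dn_succ', hs]
    -- The double crossing sits at the place `j + d`; the three terms are those of `g_sq` there, the
    -- last one rewritten by `dn_g_mul_e`.
    have e3 : dn F.g (j + d) (k1 + 1) * dn F.g j k =
        dn F.g (j + d) k1 * dn F.g j d * dn F.g (j + d + 1) k1 +
        z • (dn F.g (j + d) k1 * dn F.g j k) -
        (z * y) • (dn F.e (j + d) (k1 + 1) * dn F.g j d) := by
      have hc : Commute (dn F.g j d) (dn F.g (j + d + 1) k1) := dn_commute fun t _ _ =>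
        (dn_commute fun s _ _ => F.commute_gg (Or.inr (by omega)) (by omega) (by omega)).symm
      have : dn F.g (j + d) (k1 + 1) * dn F.g j k =
          dn F.g (j + d) k1 * dn F.g (j + d + 1) k1 * (F.g (j + d) * F.g (j + d)) * dn F.g j d := by
        rw [e1, ← mul_assoc, ← mul_assoc, e2]; simp only [mul_assoc]
      rw [this, F.g_sq (by omega)]
      simp only [mul_sub, mul_add, sub_mul, add_mul, mul_one, mul_smul_comm, smul_mul_assoc]
      have t1 : dn F.g (j + d) k1 * dn F.g (j + d + 1) k1 * dn F.g j d =
          dn F.g (j + d) k1 * dn F.g j d * dn F.g (j + d + 1) k1 := by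
        rw [mul_assoc, mul_assoc, hc.eq]
      have t2 : dn F.g (j + d) k1 * dn F.g (j + d + 1) k1 * F.g (j + d) * dn F.g j d =
          dn F.g (j + d) k1 * dn F.g j k := by
        rw [e1]; simp only [mul_assoc]
      have t3 : dn F.g (j + d) k1 * dn F.g (j + d + 1) k1 * F.e (j + d) * dn F.g j d =
          dn F.e (j + d) (k1 + 1) * dn F.g j d := by
        rw [mul_assoc (dn F.g (j + d) k1), F.dn_g_mul_e (by omega), ← mul_assoc (dn F.g (j + d) k1),
          dn_mul_up_cancel fun t _ _ => F.g_gi t (by omega), one_mul]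
      rw [t1, t2, t3]
    rw [e3, mul_sub, mul_add, mul_smul_comm, mul_smul_comm]
    refine sub_mem (add_mem ?_ (Submodule.smul_mem _ _ ?_)) (Submodule.smul_mem _ _ ?_)
    · rw [key (mul_mem (hdn (by omega)) (hdn (by omega)))]
      exact F.idealSpan_dn (by omega) (mul_mem (F.alg_mono (by omega) hbe)
        (F.alg_mono (by omega) (mul_mem (hdn (by omega)) (hdn (by omega)))))
    · rw [key (hdn (by omega))]
      exact F.idealSpan_dn h2 (mul_mem (F.alg_mono (by omega) hbe) (F.alg_mono (by omega) (hdn (by omega))))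
    · subst hm
      have c := F.commute_e_of (x := F.e (m' + 1 + 1)) (i := m') (by omega)
        ((F.commute_e_of (by omega) (F.commute_gg (Or.inl (by omega)) (by omega) (by omega))).symm)
      rw [dn_succ, show j + d + k1 = m' by omega]
      have : b * F.e m' * F.e (m' + 1) * F.e (m' + 1 + 1) *
          (F.e m' * dn F.e (j + d) k1 * dn F.g j d) =
          b * F.e m' * (F.e (m' + 1 + 1) * (dn F.e (j + d) k1 * dn F.g j d)) := by
        simp only [mul_assoc]
        rw [c.left_comm, asc3 (F.eee (i := m') (Or.inl rfl) (by omega) (by omega))]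
      rw [this]
      refine F.alg_mul_e_mul_mem (by omega) hT (F.alg_mono (by omega) hbe) (mul_mem ?_ ?_)
      · exact dn_mem fun t _ _ => F.e_mem (by omega) (by omega)
      · exact F.alg_mono (by omega) (hdn (by omega))

/-- In an element of the second kind the factor `b e_m` hides what `g_n` meets, so it is first
expanded by the statement for `n - 1`, which is `hI`. Then `g_{m+1} e_m e_{m+1} = g_m⁻¹ e_{m+1}`
replaces the new generator by one of smaller index. -/
theorem g_last_mul_idealSpan {n : ℕ} (hn : n + 2 ≤ r) (hT : 0 < n → ∀ a ∈ F.alg n, a ∈ F.algSpan n)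
    (hI : ∀ m, n = m + 1 → ∀ a ∈ F.alg (m + 2), a * F.e m ∈ F.idealSpan m) :
    ∀ w ∈ F.idealSpan n, F.g n * w ∈ F.idealSpan n := by
  intro w hw
  rw [← mul_one (F.g n * w)]
  refine span_mul_mem ?_ w hw
  rintro x (⟨j, k, a, h1, ha, rfl⟩ | ⟨m, j, k, b, rfl, h1, hb, rfl⟩)
  · rw [mul_one]
    have ca := F.alg_comm_e ha le_rfl (by omega : n + 1 < r)
    have cg := F.alg_comm_g ha le_rfl (by omega : n + 1 < r)
    rcases k with _ | k
    · rw [up_zero, one_mul, ← mul_assoc, ← cg.eq, mul_assoc, F.g_e n (by omega), mul_smul_comm]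
      refine Submodule.smul_mem _ _ ?_
      rw [ca.eq, ← one_mul (F.e n * a)]
      exact F.alg_mul_e_mul_mem hn hT (one_mem _) ha
    · obtain ⟨m, rfl⟩ : ∃ m, n = m + 1 := ⟨j + k, by omega⟩
      have hc : Commute (F.g (m + 1)) (up F.g j k) := (up_commute fun t _ _ =>
          F.commute_gg (Or.inl (by omega)) (by omega) (by omega)).symm
      have : F.g (m + 1) * (up F.g j (k + 1) * a * F.e (m + 1)) =
          up F.g j k * F.e m * (F.e (m + 1) * a) := by
        rw [up_succ', show j + k = m by omega]
        simp only [mul_assoc]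
        rw [hc.left_comm, ca.eq, ← mul_assoc (F.g (m + 1)), ← mul_assoc (F.g (m + 1) * F.g m),
          F.gge (i := m + 1) (j := m) (Or.inr rfl) (by omega) (by omega)]
        simp only [mul_assoc]
      rw [this]
      refine F.alg_mul_e_mul_mem hn hT (mul_mem ?_ ?_) ha
      · exact up_mem fun t _ _ => F.g_mem (by omega)
      · exact F.e_mem (by omega) (by omega)
  · rw [mul_one]
    have hw : dn F.g j k ∈ F.alg (m + 1) := dn_mem fun t _ _ => F.g_mem (by omega)
    have e0 : F.g (m + 1) * (b * F.e m * F.e (m + 1) * dn F.g j k) =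
        F.g (m + 1) * (b * F.e m) * (F.e (m + 1) * dn F.g j k) := by simp only [mul_assoc]
    rw [e0]
    have gee : F.g (m + 1) * (F.e m * F.e (m + 1)) = F.gi m * F.e (m + 1) := by
      rw [← mul_assoc, F.g_e_adj (i := m) (Or.inl rfl) (by omega) (by omega), mul_assoc,
        F.eee (i := m + 1) (Or.inr rfl) (by omega) (by omega)]
    refine span_mul_mem ?_ _ (hI m rfl b hb)
    rintro x (⟨l, k', a, h2, ha, rfl⟩ | ⟨m', l, k', b, hm, h2, hb, rfl⟩)
    · have hu : up F.g l k' ∈ F.alg (m + 1) := up_mem fun t _ _ => F.g_mem (by omega)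
      have hc := F.alg_comm_g hu le_rfl (by omega : m + 1 + 1 < r)
      have ca := F.alg_comm_e ha le_rfl (by omega : m + 1 < r)
      have ca' := F.alg_comm_e ha (Nat.le_succ m) (by omega : m + 1 + 1 < r)
      have : F.g (m + 1) * (up F.g l k' * a * F.e m) * (F.e (m + 1) * dn F.g j k) =
          up F.g l k' * F.gi m * (F.e (m + 1) * (a * dn F.g j k)) := by
        simp only [mul_assoc]
        rw [hc.symm.left_comm, ca.left_comm, ca'.left_comm, ← mul_assoc (F.e m),
          ← mul_assoc (F.g (m + 1)), gee]
        simp only [mul_assoc]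
      rw [this]
      exact F.alg_mul_e_mul_mem hn hT (mul_mem (F.alg_mono (by omega) hu) (F.gi_mem (by omega) (by omega)))
        (mul_mem (F.alg_mono (by omega) ha) hw)
    · subst hm
      have cb := F.alg_comm_g (j := m' + 1 + 1) hb (by omega) (by omega)
      have ce : Commute (F.g (m' + 1 + 1)) (F.e m') :=
        F.commute_e_of (by omega) (F.commute_gg (Or.inr (by omega)) (by omega) (by omega))
      have cd : Commute (dn F.g l k') (F.e (m' + 1 + 1)) := dn_commute fun t _ _ =>
        F.commute_e_of (by omega) (F.commute_gg (Or.inl (by omega)) (by omega) (by omega))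
      have cg : Commute (F.g m') (F.e (m' + 1 + 1)) :=
        F.commute_e_of (by omega) (F.commute_gg (Or.inl (by omega)) (by omega) (by omega))
      have hb2 : F.alg (m' + 1).succ = F.alg (m' + 2) := rfl
      have : F.g (m' + 1 + 1) * (b * F.e m' * F.e (m' + 1) * dn F.g l k') *
          (F.e (m' + 1 + 1) * dn F.g j k) = b * F.e m' * F.e (m' + 1) * F.e (m' + 1 + 1) *
            (dn F.g l (k' + 1) * dn F.g j k) := by
        rw [dn_succ, show l + k' = m' by omega]
        simp only [mul_assoc]
        rw [cb.symm.left_comm, ce.left_comm, cd.left_comm, ← mul_assoc (F.e (m' + 1)),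
          ← mul_assoc (F.g (m' + 1 + 1)), gee, ← cg.left_comm, ← mul_assoc (F.e m'), ← mul_assoc (F.e m'),
          F.e_gi_adj (i := m') (Or.inl rfl) (by omega) (by omega)]
        simp only [mul_assoc]
      rw [this]
      exact F.dn_dn_mem_idealSpan (by omega) hT hb rfl (by omega) h1

theorem mul_e_mem_idealSpan {n : ℕ} (hn : n + 2 ≤ r) (hT : 0 < n → ∀ a ∈ F.alg n, a ∈ F.algSpan n)
    (hI : ∀ m, n = m + 1 → ∀ a ∈ F.alg (m + 2), a * F.e m ∈ F.idealSpan m) :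
    ∀ a ∈ F.alg (n + 2), a * F.e n ∈ F.idealSpan n := by
  intro a ha
  refine F.alg_mul_mem (fun i hi w hw => ?_) ha _ ?_
  · rcases Nat.lt_or_ge i n with h | h
    · exact F.g_mul_idealSpan hn hT (by omega) w hw
    · obtain rfl : i = n := by omega
      exact F.g_last_mul_idealSpan hn hT hI w hw
  · have := F.idealSpan_up (n := n) (j := n) (k := 0) (a := 1) rfl (one_mem _)
    simpa using this

end BMWFamily
end OspBMW

/-! ### Spanning sets of `A_n` and the inclusion `e_n A_{n+2} e_n ⊆ A_n e_n` -/

namespace OspBMW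

namespace BMWFamily

variable {K A : Type*} [Field K] [Ring A] [Algebra K A] {r : ℕ} {y z : K}
variable (F : BMWFamily K A r y z)

/-- The counterpart of `up_e_mem_idealSpan` for multiplication on the right: `b e_n` is expanded in
the left ideal, and the rest of the chain slides past the resulting crossings or is absorbed. -/
theorem mul_dn_e_mem_algSpan {n : ℕ} (hn : n + 2 ≤ r)
    (hI : ∀ a ∈ F.alg (n + 2), a * F.e n ∈ F.idealSpan n) {b : A} (hb : b ∈ F.alg (n + 1)) {p k : ℕ}
    (hpk : p + k = n) : b * dn F.e p (k + 1) ∈ F.algSpan (n + 2) := by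
  rw [dn_succ, hpk, ← mul_assoc, ← one_mul (b * F.e n)]
  have hmem : ∀ {j q : ℕ}, j + q ≤ n + 1 → dn F.e j q ∈ F.alg (n + 2) := fun h =>
    dn_mem fun t _ _ => F.e_mem (by omega) (by omega)
  refine span_mul_mem ?_ _ (hI b (F.alg_mono (by omega) hb))
  rintro x (⟨l, k', a, h1, ha, rfl⟩ | ⟨m, l, k', b, rfl, h1, hb, rfl⟩)
  · have ca := F.alg_comm_e ha le_rfl (by omega : n + 1 < r)
    have : 1 * (up F.g l k' * a * F.e n) * dn F.e p k =
        up F.g l k' * F.e (l + k') * (a * dn F.e p k) := by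
      rw [one_mul, h1]; simp only [mul_assoc]; rw [ca.left_comm]
    rw [this]
    exact F.algSpan_up (by omega) (mul_mem (F.alg_mono (by omega) ha) (hmem (by omega)))
  · have hb : b ∈ F.alg (m + 2) := hb
    have hw : Commute (dn F.g l k') (F.e (m + 1)) := dn_commute fun t _ _ =>
      F.commute_e_of (by omega) (F.commute_gg (Or.inl (by omega)) (by omega) (by omega))
    have hmem' : ∀ {j q : ℕ}, j + q ≤ m + 1 → dn F.e j q ∈ F.alg (m + 2) := fun h =>
      dn_mem fun t _ _ => F.e_mem (by omega) (by omega)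
    have e0 : 1 * (b * F.e m * F.e (m + 1) * dn F.g l k') * dn F.e p k =
        b * F.e m * dn F.g l k' * dn F.e p (k + 1) := by
      rw [dn_succ F.e, hpk]; simp only [mul_assoc, one_mul]; rw [hw.left_comm]
    rw [e0]
    rcases le_or_gt p l with h | h
    · obtain ⟨k2, rfl⟩ : ∃ k2, k = k2 + 1 := ⟨k - 1, by omega⟩
      have : b * F.e m * dn F.g l k' * dn F.e p (k2 + 1 + 1) =
          b * dn F.e p (k2 + 1) * dn F.g (l + 2) k' := by
        rw [mul_assoc, F.dn_g_mul_dn_e h (by omega) (by omega), mul_assoc, ← mul_assoc (F.e m),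
          show m = p + k2 by omega, F.e_mul_dn_e (by omega), mul_assoc]
      rw [this]
      refine F.algSpan_dn (by omega) ?_
      rw [show l + 2 + k' = m + 2 by omega]
      exact mul_mem hb (hmem' (by omega))
    · obtain ⟨c, rfl⟩ : ∃ c, p = l + c + 1 := ⟨p - l - 1, by omega⟩
      obtain rfl : k' = c + k := by omega
      have hc : Commute (dn F.g l c) (dn F.e (l + c + 1) (k + 1)) := dn_commute fun t _ _ =>
        (dn_commute fun s _ _ => (F.commute_e_of (by omega)
          (F.commute_gg (Or.inl (by omega)) (by omega) (by omega))).symm).symm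
      have e1 : dn F.e (l + c + 1) (k + 1) =
          dn F.e (l + c) (k + 2) * F.g (l + c + 1) * F.g (l + c) := by
        rw [dn_succ' F.e (l + c + 1), F.e_eq_gg' (by omega), dn_succ' F.e (l + c),
          dn_succ' F.e (l + c + 1)]
        simp only [mul_assoc]
      have : b * F.e m * dn F.g l (c + k) * dn F.e (l + c + 1) (k + 1) =
          b * dn F.e (l + c) (k + 1) * dn F.g l (c + k + 2) := by
        rw [dn_add F.g l c k, mul_assoc, mul_assoc (dn F.g (l + c) k), hc.eq, e1,
          ← F.e_mul_dn_e (j := l + c) (k := k) (by omega), add_assoc c, dn_add F.g l c (k + 2),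
          dn_succ' F.g (l + c), dn_succ' F.g (l + c + 1)]
        simp only [mul_assoc]
        rw [← mul_assoc (dn F.g _ _) (dn F.e _ _), F.dn_g_mul_dn_e le_rfl (by omega) (by omega),
          show m = l + c + k by omega]
        simp only [mul_assoc, add_assoc]
      rw [this]
      refine F.algSpan_dn (by omega) ?_
      rw [show l + (c + k + 2) = m + 2 by omega]
      exact mul_mem hb (hmem' (by omega))

/-- The span contains `1`, so stability under right multiplication by the `g_i` suffices. It is
evident for the first kind of elements; for the second kind it mirrors `g_mul_idealSpan`. -/
theorem mem_algSpan_of {n : ℕ} (hn : n + 2 ≤ r)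
    (hI : ∀ a ∈ F.alg (n + 2), a * F.e n ∈ F.idealSpan n) :
    ∀ a ∈ F.alg (n + 2), a ∈ F.algSpan (n + 2) := by
  intro a ha
  rw [← one_mul a]
  refine F.mul_alg_mem (fun i hi w hw => ?_) ha _ ?_
  · rw [← one_mul w]
    refine span_mul_mem ?_ _ hw
    rintro x (⟨j, k, a, h1, ha, rfl⟩ | ⟨j, k, b, h1, hb, rfl⟩)
    · rw [one_mul, mul_assoc]
      exact F.algSpan_up h1 (mul_mem ha (F.g_mem (by omega)))
    · rw [one_mul]
      rcases lt_trichotomy i j with h | h | h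
      · rcases Nat.lt_or_ge (i + 1) j with h2 | h2
        · have hc : Commute (dn F.g j k) (F.g i) := dn_commute fun t _ _ =>
            F.commute_gg (Or.inr (by omega)) (by omega) (by omega)
          rw [mul_assoc, hc.eq, ← mul_assoc]
          exact F.algSpan_dn h1 (mul_mem hb (F.g_mem (by omega)))
        · obtain rfl : j = i + 1 := by omega
          rw [mul_assoc, ← dn_succ']
          exact F.algSpan_dn (by omega) (by rwa [show i + (k + 1) = i + 1 + k by omega])
      · subst h
        obtain ⟨c, rfl⟩ : ∃ c, k = c + 1 := ⟨k - 1, by omega⟩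
        have e1 : b * dn F.g i (c + 1) * F.g i = b * dn F.g (i + 1) c +
            z • (b * dn F.g i (c + 1)) - (z * y) • (b * up F.gi i c * dn F.e i (c + 1)) := by
          rw [mul_assoc b (up _ _ _), ← F.dn_g_mul_e (by omega), mul_assoc, dn_succ', mul_assoc, F.g_sq (by omega)]
          simp only [mul_sub, mul_add, mul_one, mul_smul_comm]
        rw [e1]
        refine sub_mem (add_mem ?_ (Submodule.smul_mem _ _ ?_)) (Submodule.smul_mem _ _ ?_)
        · exact F.algSpan_dn (by omega) (by rwa [show i + 1 + c = i + (c + 1) by omega])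
        · exact F.algSpan_dn h1 hb
        · refine F.mul_dn_e_mem_algSpan hn hI (mul_mem ?_ ?_) (by omega)
          · rwa [show n + 1 = i + (c + 1) by omega]
          · exact up_mem fun t _ _ => F.gi_mem (by omega) (by omega)
      · obtain ⟨t, rfl⟩ : ∃ t, i = t + 1 := ⟨i - 1, by omega⟩
        rw [mul_assoc, F.dn_g_slide (by omega) (by omega) (by omega), ← mul_assoc]
        exact F.algSpan_dn h1 (mul_mem hb (F.g_mem (by omega)))
  · have := F.algSpan_dn (n := n + 2) (j := n + 1) (k := 0) (b := 1) rfl (one_mem _)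
    simpa using this

theorem mem_algSpan_one (a : A) (ha : a ∈ F.alg 1) : a ∈ F.algSpan 1 := by
  rw [← mul_one a]
  refine F.alg_mul_mem (fun i hi => by omega) ha _ ?_
  have := F.algSpan_dn (n := 1) (j := 0) (k := 0) (b := 1) rfl (one_mem _)
  simpa using this

/-- The two spanning statements feed each other: `A_n` uses the ideal for `n - 2`, and the ideal for
`n` uses `A_n` and the ideal for `n - 1`. -/
theorem span_main (n : ℕ) : (n ≤ r → 0 < n → ∀ a ∈ F.alg n, a ∈ F.algSpan n) ∧
    (n + 2 ≤ r → ∀ a ∈ F.alg (n + 2), a * F.e n ∈ F.idealSpan n) := by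
  induction n using Nat.strong_induction_on with
  | _ n ih =>
    have h1 : n ≤ r → 0 < n → ∀ a ∈ F.alg n, a ∈ F.algSpan n := by
      intro hn h0
      rcases n with _ | _ | n
      · omega
      · exact F.mem_algSpan_one
      · exact F.mem_algSpan_of hn ((ih n (by omega)).2 hn)
    refine ⟨h1, fun hn => ?_⟩
    exact F.mul_e_mem_idealSpan hn (h1 (by omega)) fun m hm => (ih m (by omega)).2 (by omega)

theorem mul_e_mem {n : ℕ} (hn : n + 2 ≤ r) {a : A} (ha : a ∈ F.alg (n + 2)) :
    a * F.e n ∈ F.idealSpan n := (F.span_main n).2 hn a ha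

theorem mem_algSpan {n : ℕ} (hn : n ≤ r) (h0 : 0 < n) {a : A} (ha : a ∈ F.alg n) :
    a ∈ F.algSpan n := (F.span_main n).1 hn h0 a ha

/-- `e_n A_{n+2} e_n ⊆ A_n e_n` -/
theorem e_mul_mul_e {n : ℕ} (hn : n + 2 ≤ r) {x : A} (hx : x ∈ F.alg (n + 2)) :
    ∃ a ∈ F.alg n, F.e n * x * F.e n = a * F.e n := by
  set W : Submodule K A := (Subalgebra.toSubmodule (F.alg n)).map (LinearMap.mulRight K (F.e n)) with hW
  have hmem : ∀ {a : A}, a ∈ F.alg n → a * F.e n ∈ W := fun ha => ⟨_, ha, rfl⟩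
  suffices h : F.e n * (x * F.e n) * 1 ∈ W by
    obtain ⟨a, ha, h⟩ := h
    exact ⟨a, ha, by rw [mul_assoc, ← mul_one (F.e n * _), ← h]; rfl⟩
  refine span_mul_mem ?_ _ (F.mul_e_mem hn hx)
  rintro x (⟨j, k, a, h1, ha, rfl⟩ | ⟨m, j, k, b, rfl, h1, hb, rfl⟩)
  · have ca := F.alg_comm_e ha le_rfl (by omega : n + 1 < r)
    rw [mul_one]
    rcases k with _ | k
    · rw [up_zero, one_mul, ← mul_assoc, ← ca.eq, mul_assoc, F.e_e (by omega), mul_smul_comm]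
      exact W.smul_mem _ (hmem ha)
    · obtain ⟨m, rfl⟩ : ∃ m, n = m + 1 := ⟨j + k, by omega⟩
      have hc : Commute (F.e (m + 1)) (up F.g j k) := (up_commute fun t _ _ =>
        F.commute_e_of (by omega) (F.commute_gg (Or.inl (by omega)) (by omega) (by omega))).symm
      have : F.e (m + 1) * (up F.g j (k + 1) * a * F.e (m + 1)) =
          y⁻¹ • ((up F.g j k * a) * F.e (m + 1)) := by
        rw [up_succ', show j + k = m by omega]
        simp only [mul_assoc]
        rw [hc.left_comm, ca.eq, ← mul_assoc (F.e (m + 1)), ← mul_assoc (F.e (m + 1) * F.g m),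
          F.e_g_e (m + 1) m (Or.inr rfl) (by omega) (by omega), smul_mul_assoc, mul_smul_comm]
      rw [this]
      exact W.smul_mem _ (hmem (mul_mem (up_mem fun t _ _ => F.g_mem (by omega)) ha))
  · have hb : b ∈ F.alg (m + 2) := hb
    have hw : dn F.g j k ∈ F.alg (m + 1) := dn_mem fun t _ _ => F.g_mem (by omega)
    have cw := F.alg_comm_e hw le_rfl (by omega : m + 1 + 1 < r)
    have e0 : F.e (m + 1) * (b * F.e m * F.e (m + 1) * dn F.g j k) * 1 =
        F.e (m + 1) * (b * F.e m) * (dn F.g j k * F.e (m + 1)) := by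
      rw [cw.eq]; simp only [mul_assoc, mul_one]
    rw [e0]
    -- After one more expansion of `b e_m`, all other factors commute with the outer `e_{m+1}`,
    -- which then enclose a single `e_m`, and `eee` applies.
    refine span_mul_mem ?_ _ (F.mul_e_mem (by omega) hb)
    have eee := F.eee (i := m + 1) (j := m) (Or.inr rfl) (by omega) (by omega)
    rintro x (⟨l, k', a, h2, ha, rfl⟩ | ⟨m', l, k', b, rfl, h2, hb, rfl⟩)
    · have hu : up F.g l k' * a ∈ F.alg (m + 1) :=
        mul_mem (up_mem fun t _ _ => F.g_mem (by omega)) (F.alg_mono (by omega) ha)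
      have cu := F.alg_comm_e hu le_rfl (by omega : m + 1 + 1 < r)
      have : F.e (m + 1) * (up F.g l k' * a * F.e m) * (dn F.g j k * F.e (m + 1)) =
          up F.g l k' * a * dn F.g j k * F.e (m + 1) := by
        rw [cw.eq, ← mul_assoc (F.e (m + 1)), ← cu.eq]
        simp only [mul_assoc]
        rw [asc3 eee, cw.eq]
      rw [this]
      exact hmem (mul_mem hu hw)
    · have hb : b ∈ F.alg (m' + 2) := hb
      have hbe : b * F.e m' ∈ F.alg (m' + 1 + 1) := mul_mem hb (F.e_mem (by omega) (by omega))
      have cb := F.alg_comm_e hbe le_rfl (by omega : m' + 1 + 1 + 1 < r)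
      have hw' : dn F.g l k' * dn F.g j k ∈ F.alg (m' + 1 + 1) :=
        mul_mem (dn_mem fun t _ _ => F.g_mem (by omega)) hw
      have cw' := F.alg_comm_e hw' le_rfl (by omega : m' + 1 + 1 + 1 < r)
      have : F.e (m' + 1 + 1) * (b * F.e m' * F.e (m' + 1) * dn F.g l k') *
          (dn F.g j k * F.e (m' + 1 + 1)) =
          b * F.e m' * (dn F.g l k' * dn F.g j k) * F.e (m' + 1 + 1) := by
        calc _ = (F.e (m' + 1 + 1) * (b * F.e m')) * F.e (m' + 1) *
              ((dn F.g l k' * dn F.g j k) * F.e (m' + 1 + 1)) := by simp only [mul_assoc]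
          _ = b * F.e m' * (F.e (m' + 1 + 1) * F.e (m' + 1) * F.e (m' + 1 + 1)) *
              (dn F.g l k' * dn F.g j k) := by rw [cw'.eq, ← cb.eq]; simp only [mul_assoc]
          _ = _ := by rw [eee, mul_assoc _ (F.e _), ← cw'.eq]; simp only [mul_assoc]
      rw [this]
      exact hmem (mul_mem hbe hw')

end BMWFamily

/-! ### Counting the spanning sets -/

/-- `(2n - 1)!!` -/
def oddFactorial : ℕ → ℕ
  | 0 => 1
  | n + 1 => (2 * n + 1) * oddFactorial n

/-- A set that is contained in the span of `N` elements. -/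
def SpannedBy {K A : Type*} [Field K] [AddCommGroup A] [Module K A] (S : Set A) (N : ℕ) : Prop :=
  ∃ s : Finset A, s.card ≤ N ∧ S ⊆ Submodule.span K (s : Set A)

section spanned
variable {K A B : Type*} [Field K] [AddCommGroup A] [Module K A] [AddCommGroup B] [Module K B]

theorem SpannedBy.mono {S T : Set A} {N : ℕ} (h : SpannedBy (K := K) T N)
    (hST : S ⊆ Submodule.span K T) : SpannedBy (K := K) S N := by
  obtain ⟨s, hs, h⟩ := h
  exact ⟨s, hs, hST.trans (Submodule.span_le.2 h)⟩

theorem SpannedBy.image {S : Set A} {N : ℕ} (h : SpannedBy (K := K) S N) (f : A →ₗ[K] B) :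
    SpannedBy (K := K) (f '' S) N := by
  classical
  obtain ⟨s, hs, h⟩ := h
  refine ⟨s.image f, Finset.card_image_le.trans hs, ?_⟩
  rintro _ ⟨x, hx, rfl⟩
  have : f x ∈ (Submodule.span K (s : Set A)).map f := ⟨x, h hx, rfl⟩
  rwa [Submodule.map_span, ← Finset.coe_image] at this

theorem SpannedBy.union {S T : Set A} {N M : ℕ} (h : SpannedBy (K := K) S N) (h' : SpannedBy (K := K) T M) :
    SpannedBy (K := K) (S ∪ T) (N + M) := by
  classical
  obtain ⟨s, hs, h⟩ := h
  obtain ⟨t, ht, h'⟩ := h'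
  refine ⟨s ∪ t, (Finset.card_union_le _ _).trans (add_le_add hs ht), ?_⟩
  rw [Finset.coe_union]
  rintro x (hx | hx)
  · exact Submodule.span_mono Set.subset_union_left (h hx)
  · exact Submodule.span_mono Set.subset_union_right (h' hx)

theorem SpannedBy.iUnion {N : ℕ} {k : ℕ} {S : ℕ → Set A} (h : ∀ i < k, SpannedBy (K := K) (S i) N) :
    SpannedBy (K := K) {x | ∃ i < k, x ∈ S i} (k * N) := by
  induction k with
  | zero => exact ⟨∅, by simp, fun x ⟨i, hi, _⟩ => by omega⟩
  | succ k ih =>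
    have := (ih fun i hi => h i (by omega)).union (h k (by omega))
    rw [add_mul, one_mul]
    refine this.mono (fun x ⟨i, hi, hx⟩ => Submodule.subset_span ?_)
    rcases Nat.lt_succ_iff_lt_or_eq.1 hi with h | rfl
    · exact Or.inl ⟨i, h, hx⟩
    · exact Or.inr hx

end spanned

namespace BMWFamily

theorem op_alg {K A : Type*} [Field K] [Ring A] [Algebra K A] {r : ℕ} {y z : K}
    (F : BMWFamily K A r y z) {n : ℕ} {x : A} (hx : x ∈ F.alg n) : MulOpposite.op x ∈ F.op.alg n := by
  induction hx using Algebra.adjoin_induction with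
  | mem x hx => obtain ⟨i, hi, rfl⟩ := hx; exact F.op.g_mem hi
  | algebraMap c => exact Subalgebra.algebraMap_mem _ c
  | add a b _ _ ha hb => rw [MulOpposite.op_add]; exact add_mem ha hb
  | mul a b _ _ ha hb => rw [MulOpposite.op_mul]; exact mul_mem hb ha

/-- The induction runs over all algebras at once, because the bound for the right ideal `e_n
A_{n+2}` is the bound for the left ideal of the opposite family. Both counts follow the partner of
the last top point; for `A_{n+2}` there are `(n+1) + (n+2)` positions, each contributing `(2n+1)!!`.
-/
theorem spannedBy_main {K : Type*} [Field K] {r : ℕ} {y z : K} (n : ℕ) :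
    ∀ {A : Type*} [Ring A] [Algebra K A] (F : BMWFamily K A r y z),
    (n ≤ r → SpannedBy (K := K) (F.alg n : Set A) (oddFactorial n)) ∧
    (n + 2 ≤ r → SpannedBy (K := K) ((fun a => a * F.e n) '' (F.alg (n + 2))) (oddFactorial (n + 1))) := by
  induction n using Nat.strong_induction_on with
  | _ n ih =>
    intro A _ _ F
    have h1 : n ≤ r → SpannedBy (K := K) (F.alg n : Set A) (oddFactorial n) := by
      intro hn
      rcases n with _ | _ | n
      · refine ⟨{1}, by simp [oddFactorial], fun x hx => ?_⟩
        rw [← mul_one x]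
        exact F.alg_mul_mem (fun i hi => by omega) hx _ (Submodule.subset_span (by simp))
      · refine ⟨{1}, by simp [oddFactorial], fun x hx => ?_⟩
        rw [← mul_one x]
        exact F.alg_mul_mem (fun i hi => by omega) hx _ (Submodule.subset_span (by simp))
      · have hop := ((ih n (by omega)) F.op).2 hn
        have hE : SpannedBy (K := K) ((fun a => F.e n * a) '' (F.alg (n + 2))) (oddFactorial (n + 1)) := by
          refine (hop.image (MulOpposite.opLinearEquiv K).symm.toLinearMap).mono ?_
          rintro _ ⟨a, ha, rfl⟩
          refine Submodule.subset_span ⟨_, ⟨_, F.op_alg ha, rfl⟩, ?_⟩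
          simp [op]
        have hA := ((ih (n + 1) (by omega)) F).1 (by omega)
        have hU := (SpannedBy.iUnion (k := n + 1)
          (S := fun j => LinearMap.mulLeft K (up F.g j (n - j)) '' ((fun a => F.e n * a) '' (F.alg (n + 2))))
          fun j _ => hE.image _)
        have hV := (SpannedBy.iUnion (k := n + 2)
          (S := fun j => LinearMap.mulRight K (dn F.g j (n + 1 - j)) '' (F.alg (n + 1)))
          fun j _ => hA.image _)
        have h3 := (hU.union hV)
        have e1 : (n + 1) * oddFactorial (n + 1) + (n + 2) * oddFactorial (n + 1) = oddFactorial (n + 1 + 1) := by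
          rw [show oddFactorial (n + 1 + 1) = (2 * (n + 1) + 1) * oddFactorial (n + 1) from rfl]; ring
        rw [e1] at h3
        refine h3.mono fun x hx => ?_
        have hx' := F.mem_algSpan hn (by omega) hx
        refine Submodule.span_mono ?_ hx'
        rintro x (⟨j, k, a, h1, ha, rfl⟩ | ⟨j, k, b, h1, hb, rfl⟩)
        · refine Or.inl ⟨j, by omega, _, ⟨a, ha, rfl⟩, ?_⟩
          obtain rfl : n = j + k := by omega
          simp [mul_assoc]
        · refine Or.inr ⟨j, by omega, b, ?_, ?_⟩
          · rwa [show n + 1 = j + k by omega]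
          · rw [show n + 1 - j = k by omega]; rfl
    refine ⟨h1, fun hn => ?_⟩
    have hU := (SpannedBy.iUnion (k := n + 1)
      (S := fun j => (LinearMap.mulLeft K (up F.g j (n - j)) ∘ₗ LinearMap.mulRight K (F.e n)) '' (F.alg n))
      fun j _ => (h1 (by omega)).image _)
    -- For `n = 0` no bottom point is free, so only elements of the first kind occur.
    rcases n with _ | m
    · refine (hU.mono (T := _) ?_)
      rintro _ ⟨a, ha, rfl⟩
      refine Submodule.span_mono ?_ (F.mul_e_mem hn ha)
      rintro x (⟨j, k, a, h1, ha, rfl⟩ | ⟨m, j, k, b, h0, h1, hb, rfl⟩)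
      · refine ⟨j, by omega, a, ha, ?_⟩
        obtain rfl : k = 0 - j := by omega
        simp
      · omega
    · have hV := (SpannedBy.iUnion (k := m + 1)
        (S := fun j => (LinearMap.mulRight K (F.e (m + 1) * dn F.g j (m - j))) ''
          ((fun a => a * F.e m) '' (F.alg (m + 2))))
        fun j _ => (((ih m (by omega)) F).2 (by omega)).image _)
      have h3 := (hU.union hV)
      have e1 : (m + 1 + 1) * oddFactorial (m + 1) + (m + 1) * oddFactorial (m + 1) =
          oddFactorial (m + 1 + 1) := by
        rw [show oddFactorial (m + 1 + 1) = (2 * (m + 1) + 1) * oddFactorial (m + 1) from rfl]; ring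
      rw [e1] at h3
      refine h3.mono ?_
      rintro _ ⟨a, ha, rfl⟩
      refine Submodule.span_mono ?_ (F.mul_e_mem hn ha)
      rintro x (⟨j, k, a, h1, ha, rfl⟩ | ⟨m', j, k, b, h0, h1, hb, rfl⟩)
      · refine Or.inl ⟨j, by omega, a, ha, ?_⟩
        rw [show m + 1 - j = k by omega]
        simp [mul_assoc]
      · obtain rfl : m' = m := by omega
        refine Or.inr ⟨j, by omega, _, ⟨b, hb, rfl⟩, ?_⟩
        rw [show m' - j = k by omega]
        simp [mul_assoc]

end BMWFamily
end OspBMW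

/-! ### Weights and simple roots of the natural module -/

namespace OspBMW
noncomputable section

section weights
variable {m n : ℕ}

/-- A weight of `V_q` is zero or `±` one basis vector of the lattice, so a linear functional sees a
single coordinate. Pairings, parities and heights are computed from this. -/
theorem sum_mul_wt (f : Fin (m / 2 + n) → ℤ) (a : Idx m n) :
    ∑ j, f j * wt a j =
      if h : a.val < m / 2 + n then f ⟨a, h⟩
      else if h : m + 2 * n - 1 - a.val < m / 2 + n then -f ⟨m + 2 * n - 1 - a.val, h⟩ else 0 := by
  have ha := a.isLt
  split_ifs with h h'
  · rw [Finset.sum_eq_single ⟨a, h⟩]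
    · simp [wt]
    · intro j _ hj
      have hj' : a.val ≠ j.val := fun e => hj (Fin.ext e.symm)
      have := j.isLt
      simp [wt, hj', show ¬ (a.val + j.val + 1 = m + 2 * n) by omega]
    · simp
  · rw [Finset.sum_eq_single ⟨_, h'⟩]
    · simp only [wt]
      rw [if_neg (by omega), if_pos (by omega)]; ring
    · intro j _ hj
      have hj' : m + 2 * n - 1 - a.val ≠ j.val := fun e => hj (Fin.ext e.symm)
      have := j.isLt
      simp only [wt]
      rw [if_neg (by omega), if_neg (by omega)]; ring
    · simp
  · refine Finset.sum_eq_zero fun j _ => ?_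
    have := j.isLt
    simp only [wt]
    rw [if_neg (by omega), if_neg (by omega)]; ring

theorem wt_rev (a : Idx m n) : wt a.rev = -wt a := by
  funext j
  have := j.isLt
  have := a.isLt
  simp only [wt, Fin.val_rev, Pi.neg_apply]
  by_cases h1 : a.val = j.val
  · rw [if_neg (by omega), if_pos (by omega), if_pos h1]
  · by_cases h2 : a.val + j.val + 1 = m + 2 * n
    · rw [if_pos (by omega), if_neg h1, if_pos h2]; rfl
    · rw [if_neg (by omega), if_neg (by omega), if_neg h1, if_neg h2]; rfl

theorem wt_injective : Function.Injective (wt : Idx m n → Wt m n) := by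
  intro a b h
  have ha := a.isLt
  have hb := b.isLt
  by_cases h1 : a.val < m / 2 + n
  · have := congrFun h ⟨a, h1⟩
    simp only [wt, if_true] at this
    split_ifs at this with h2 h3
    · exact Fin.ext h2.symm
    all_goals simp at this
  · by_cases h4 : m + 2 * n - 1 - a.val < m / 2 + n
    · have := congrFun h ⟨_, h4⟩
      simp only [wt] at this
      rw [if_neg (by omega), if_pos (by omega)] at this
      split_ifs at this with h2 h3
      exact Fin.ext (by omega)
    · have hm : ∀ j, wt b j = 0 := fun j => by
        rw [← h]; have := j.isLt; simp only [wt]; rw [if_neg (by omega), if_neg (by omega)]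
      by_cases h5 : b.val < m / 2 + n
      · have := hm ⟨b, h5⟩; simp [wt] at this
      · by_cases h6 : m + 2 * n - 1 - b.val < m / 2 + n
        · have := hm ⟨_, h6⟩
          simp only [wt] at this
          rw [if_neg (by omega), if_pos (by omega)] at this; simp at this
        · exact Fin.ext (by omega)

end weights

namespace RootDatum
variable {m n : ℕ} (D : RootDatum m n)

/-- Whether the basis vector `v_a` is odd. -/
def odd (a : Idx m n) : Bool :=
  if h : a.val < m / 2 + n then D.isDelta ⟨a, h⟩
  else if h : m + 2 * n - 1 - a.val < m / 2 + n then D.isDelta ⟨m + 2 * n - 1 - a.val, h⟩ else false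

/-- The sign `(-1)^{[a]}`. -/
def sg (a : Idx m n) : ℤ := if D.odd a then -1 else 1

theorem odd_rev (a : Idx m n) : D.odd a.rev = D.odd a := by
  have ha := a.isLt
  simp only [odd, Fin.val_rev]
  by_cases h1 : a.val < m / 2 + n
  · rw [dif_neg (by omega), dif_pos (by omega), dif_pos h1]
    congr 2; omega
  · by_cases h2 : m + 2 * n - 1 - a.val < m / 2 + n
    · rw [dif_pos (by omega), dif_neg h1, dif_pos h2]; congr 2; omega
    · rw [dif_neg (by omega), dif_neg (by omega), dif_neg h1, dif_neg h2]

theorem sg_rev (a : Idx m n) : D.sg a.rev = D.sg a := by rw [sg, sg, odd_rev]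

theorem odd_of_rev_eq {a : Idx m n} (h : a = a.rev) : D.odd a = false := by
  have ha := a.isLt
  have := congrArg Fin.val h
  rw [Fin.val_rev] at this
  rw [odd, dif_neg (by omega), dif_neg (by omega)]

theorem vpar_eq (a : Idx m n) : D.vpar a = if D.odd a then 1 else 0 := by
  have h : D.vpar a = ((∑ j, (if D.isDelta j = true then (1 : ℤ) else 0) * wt a j : ℤ) : ZMod 2) := by
    rw [vpar, par]
    push_cast
    refine Finset.sum_congr rfl fun j _ => ?_
    split_ifs <;> simp
  rw [h, sum_mul_wt, odd]
  have : ((-1 : ℤ) : ZMod 2) = 1 := by decide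
  split_ifs <;> simp_all
theorem vpar_rev (a : Idx m n) : D.vpar a.rev = D.vpar a := by rw [vpar_eq, vpar_eq, odd_rev]

theorem eq_rev_iff {a b : Idx m n} : a = b.rev ↔ a.val + b.val + 1 = m + 2 * n := by
  have := a.isLt
  have := b.isLt
  rw [Fin.ext_iff, Fin.val_rev]; omega

theorem ip_wt (a b : Idx m n) : D.ip (wt a) (wt b) =
    D.sg a * ((if a = b then 1 else 0) - (if a = b.rev then 1 else 0)) := by
  have ha := a.isLt
  have hb := b.isLt
  have hs : D.sg a * ((if a = b then 1 else 0) - (if a = b.rev then 1 else 0)) =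
      D.sg b * ((if a = b then 1 else 0) - (if a = b.rev then 1 else 0)) := by
    by_cases e1 : a = b
    · rw [e1]
    · by_cases e2 : a = b.rev
      · rw [e2, sg_rev]
      · simp [e1, e2]
  rw [hs, ip, sum_mul_wt]
  simp only [eq_rev_iff]
  simp only [Fin.ext_iff, sg, odd, wt]
  by_cases h1 : b.val < m / 2 + n
  · simp only [h1, dif_pos]
    congr 1
    split_ifs <;> omega
  · by_cases h2 : m + 2 * n - 1 - b.val < m / 2 + n
    · simp only [h1, h2, dif_pos, dif_neg, not_false_iff]
      rw [← mul_neg]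
      congr 1
      split_ifs <;> omega
    · simp only [h1, h2, dif_neg, not_false_iff]
      split_ifs <;> omega

theorem ip_add_left (x y u : Wt m n) : D.ip (x + y) u = D.ip x u + D.ip y u := by
  simp only [ip, ← Finset.sum_add_distrib, Pi.add_apply]; exact Finset.sum_congr rfl fun j _ => by ring
theorem ip_comm (x y : Wt m n) : D.ip x y = D.ip y x := by
  simp only [ip]; exact Finset.sum_congr rfl fun j _ => by ring
theorem ip_add_right (x y u : Wt m n) : D.ip u (x + y) = D.ip u x + D.ip u y := by
  rw [ip_comm, ip_add_left, ip_comm _ u, ip_comm _ u]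
theorem ip_neg_left (x u : Wt m n) : D.ip (-x) u = -D.ip x u := by
  simp only [ip, ← Finset.sum_neg_distrib, Pi.neg_apply]; exact Finset.sum_congr rfl fun j _ => by ring
theorem ip_neg_right (x u : Wt m n) : D.ip u (-x) = -D.ip u x := by
  rw [ip_comm, ip_neg_left, ip_comm]
theorem par_add (x y : Wt m n) : D.par (x + y) = D.par x + D.par y := by
  simp only [par, ← Finset.sum_add_distrib, Pi.add_apply]
  exact Finset.sum_congr rfl fun j _ => by split_ifs <;> simp

/-- Whether the last simple root is a sum of two `ε`'s. -/
def forked : Prop := m % 2 = 0 ∧ ∃ h : 0 < m / 2 + n, D.isDelta ⟨m / 2 + n - 1, by omega⟩ = false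

/-- The root `ℰ_{L-2} + ℰ_{L-1}` requires two coordinates; the excluded pair `(2, 0)` is exactly the
forked case in which there is only one. -/
theorem forked.two_le {D : RootDatum m n} (h : D.forked) (hmn : ¬ (m = 2 ∧ n = 0)) : 2 ≤ m / 2 + n := by
  obtain ⟨h0, h1, h2⟩ := h
  by_contra h3
  have hn := D.card_isDelta
  have : n = 0 := by
    rw [← hn, Finset.card_eq_zero, Finset.filter_eq_empty_iff]
    rintro ⟨j, hj⟩ _
    have : j = m / 2 + n - 1 := by omega
    subst this
    simp [h2]
  omega

section arrows
variable {D}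

theorem arrow_rev {p p' : Idx m n} {α : Wt m n} (h : wt p' = wt p + α) : wt p.rev = wt p'.rev + α := by
  rw [wt_rev, wt_rev, h]; abel

theorem arrow_lt {j : ℕ} (h : j + 1 < m / 2 + n) :
    wt (⟨j, by omega⟩ : Idx m n) = wt (⟨j + 1, by omega⟩ : Idx m n) + D.simpleRoot ⟨j, by omega⟩ := by
  funext t
  have := t.isLt
  simp only [wt, simpleRoot, Pi.add_apply, if_pos h, Fin.ext_iff]
  by_cases h1 : j = t.val
  · rw [if_pos h1, if_neg (by omega), if_neg (by omega), if_pos (by omega)]; simp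
  · by_cases h2 : j + 1 = t.val
    · rw [if_neg h1, if_neg (by omega), if_pos h2, if_neg (by omega), if_pos (by omega)]; simp
    · rw [if_neg h1, if_neg (by omega), if_neg h2, if_neg (by omega), if_neg (by omega),
        if_neg (by omega)]; simp

theorem arrow_last (hD : ¬ D.forked) (h : 0 < m / 2 + n) :
    wt (⟨m / 2 + n - 1, by omega⟩ : Idx m n) = wt (⟨m / 2 + n, by omega⟩ : Idx m n) +
      D.simpleRoot ⟨m / 2 + n - 1, by omega⟩ := by
  funext t
  have := t.isLt
  simp only [wt, simpleRoot, Pi.add_apply, Fin.ext_iff]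
  rw [if_neg (c := m / 2 + n - 1 + 1 < m / 2 + n) (by omega)]
  by_cases hm : m % 2 = 1
  · rw [if_pos hm]
    by_cases h1 : m / 2 + n - 1 = t.val
    · rw [if_pos h1, if_neg (by omega), if_neg (by omega), if_pos (by omega)]; simp
    · rw [if_neg h1, if_neg (by omega), if_neg (by omega), if_neg (by omega), if_neg (by omega)]; simp
  · rw [if_neg hm]
    have hd : D.isDelta ⟨m / 2 + n - 1, by omega⟩ = true := by
      by_contra h'
      exact hD ⟨by omega, h, by simpa using h'⟩
    rw [if_pos hd]
    by_cases h1 : m / 2 + n - 1 = t.val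
    · rw [if_pos h1, if_neg (by omega), if_pos (by omega), if_pos (by omega)]; simp
    · rw [if_neg h1, if_neg (by omega), if_neg (by omega), if_neg (by omega), if_neg (by omega)]; simp

theorem arrow_forked (hD : D.forked) (h : 2 ≤ m / 2 + n) :
    wt (⟨m / 2 + n - 2, by omega⟩ : Idx m n) = wt (⟨m / 2 + n, by omega⟩ : Idx m n) +
      D.simpleRoot ⟨m / 2 + n - 1, by omega⟩ := by
  obtain ⟨h0, h1, h2⟩ := hD
  funext t
  have := t.isLt
  simp only [wt, simpleRoot, Pi.add_apply, Fin.ext_iff]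
  rw [if_neg (c := m / 2 + n - 1 + 1 < m / 2 + n) (by omega), if_neg (c := m % 2 = 1) (by omega),
    if_neg (c := D.isDelta _ = true) (by simp [h2])]
  by_cases h1 : m / 2 + n - 2 = t.val
  · rw [if_pos h1, if_neg (by omega), if_neg (by omega), if_pos (by omega)]; simp
  · by_cases h2 : m / 2 + n - 1 = t.val
    · rw [if_neg h1, if_neg (by omega), if_neg (by omega), if_pos (by omega), if_pos (by omega)]; simp
    · rw [if_neg h1, if_neg (by omega), if_neg (by omega), if_neg (by omega), if_neg (by omega)]; simp

/-- Each basis vector but the last is obtained from a later one by some `e_i`. This connectedness of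
the weight diagram drives the inductions starting from the lowest weight vector. An index is skipped
only at the fork. -/
theorem exists_arrow (hmn : ¬ (m = 2 ∧ n = 0)) (x : ℕ) (hx : x + 1 < m + 2 * n) :
    ∃ (i : Fin (m / 2 + n)) (p : Idx m n), wt (⟨x, by omega⟩ : Idx m n) = wt p + D.simpleRoot i ∧
      (p.val = x + 1 ∨ D.forked ∧ x + 1 = m / 2 + n ∧ p.val = x + 2) := by
  have hrev : ∀ (a : ℕ) (ha : a < m + 2 * n) (b : ℕ) (hb : b < m + 2 * n), a + b + 1 = m + 2 * n →
      Fin.rev (⟨a, ha⟩ : Idx m n) = ⟨b, hb⟩ := fun a ha b hb h => by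
    ext; simp only [Fin.val_rev]; omega
  by_cases h1 : x + 1 < m / 2 + n
  · exact ⟨_, _, arrow_lt h1, Or.inl rfl⟩
  by_cases h2 : m / 2 + n = x + 1
  · by_cases hD : D.forked
    · have h2L := (hD.two_le hmn)
      have := hD.1
      have := arrow_rev (arrow_forked hD (hD.two_le hmn))
      rw [hrev _ _ x (by omega) (by omega), hrev _ _ (x + 2) (by omega) (by omega)] at this
      exact ⟨_, _, this, Or.inr ⟨hD, h2.symm, rfl⟩⟩
    · have := arrow_last hD (by omega)
      refine ⟨⟨m / 2 + n - 1, by omega⟩, ⟨m / 2 + n, by omega⟩, ?_, Or.inl h2⟩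
      rw [← this]
      congr 2; omega
  by_cases h3 : x + m / 2 + n + 1 = m + 2 * n ∧ m % 2 = 1
  · have := arrow_rev (arrow_last (D := D) (fun h => by have := h.1; omega) (by omega))
    rw [hrev _ _ x (by omega) (by omega), hrev _ _ (x + 1) (by omega) (by omega)] at this
    exact ⟨_, _, this, Or.inl rfl⟩
  · have := arrow_rev (arrow_lt (D := D) (j := m + 2 * n - 2 - x) (by omega))
    rw [hrev _ _ x (by omega) (by omega), hrev _ _ (x + 1) (by omega) (by omega)] at this
    exact ⟨_, _, this, Or.inl rfl⟩
end arrows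

open Classical in
/-- The height of a weight; simple roots have height two. -/
def ht (μ : Wt m n) : ℤ := ∑ j : Fin (m / 2 + n),
  (2 * ((m / 2 + n : ℕ) - (j.val : ℤ)) - (if m % 2 = 1 then 0 else if D.forked then 2 else 1)) * μ j

theorem ht_add (x y : Wt m n) : D.ht (x + y) = D.ht x + D.ht y := by
  simp only [ht, ← Finset.sum_add_distrib, Pi.add_apply]; exact Finset.sum_congr rfl fun j _ => by ring

theorem ht_wt (a : Idx m n) (hD : ¬ D.forked) : D.ht (wt a) = m + 2 * n - 1 - 2 * a.val := by
  have := a.isLt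
  rw [ht, sum_mul_wt]
  by_cases hm : m % 2 = 1
  · simp only [hm, if_true]; split_ifs <;> push_cast <;> omega
  · simp only [hm, hD, if_false]; split_ifs <;> push_cast <;> omega

theorem ht_wt_forked (a : Idx m n) (hD : D.forked) : D.ht (wt a) =
    if a.val < m / 2 + n then m + 2 * n - 2 - 2 * (a.val : ℤ) else m + 2 * n - 2 * a.val := by
  have := a.isLt
  have := hD.1
  rw [ht, sum_mul_wt]
  simp only [hD, if_true, show m % 2 ≠ 1 by omega, if_false]
  split_ifs <;> push_cast <;> omega

theorem ht_simpleRoot (hmn : ¬ (m = 2 ∧ n = 0)) (i : Fin (m / 2 + n)) : D.ht (D.simpleRoot i) = 2 := by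
  have key : ∀ p p' : Idx m n, wt p' = wt p + D.simpleRoot i → D.ht (wt p') = D.ht (wt p) + 2 →
      D.ht (D.simpleRoot i) = 2 := fun p p' h h' => by
    rw [h, ht_add] at h'; linarith
  have hi := i.isLt
  by_cases hD : D.forked
  · by_cases h1 : i.val + 1 < m / 2 + n
    · refine key _ _ (arrow_lt h1) ?_
      rw [ht_wt_forked _ _ hD, ht_wt_forked _ _ hD]; simp only; (split_ifs; all_goals (push_cast; omega))
    · have e : i = ⟨m / 2 + n - 1, by omega⟩ := Fin.ext (by simp only; omega)
      rw [e] at key ⊢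
      have := hD.two_le hmn
      have := hD.1
      refine key _ _ (arrow_forked hD (hD.two_le hmn)) ?_
      rw [ht_wt_forked _ _ hD, ht_wt_forked _ _ hD]; simp only; split_ifs <;> (push_cast; omega)
  · by_cases h1 : i.val + 1 < m / 2 + n
    · refine key _ _ (arrow_lt h1) ?_
      rw [ht_wt _ _ hD, ht_wt _ _ hD]; push_cast; ring
    · have e : i = ⟨m / 2 + n - 1, by omega⟩ := Fin.ext (by simp only; omega)
      rw [e] at key ⊢
      refine key _ _ (arrow_last hD (by omega)) ?_
      rw [ht_wt _ _ hD, ht_wt _ _ hD]; push_cast; omega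

/-- The inequality is not strict, since at the fork the two middle vectors have equal height. -/
theorem ht_wt_antitone {a b : Idx m n} (h : a ≤ b) : D.ht (wt b) ≤ D.ht (wt a) := by
  have h : a.val ≤ b.val := h
  by_cases hD : D.forked
  · have := hD.1
    rw [ht_wt_forked _ _ hD, ht_wt_forked _ _ hD]; split_ifs <;> omega
  · rw [ht_wt _ _ hD, ht_wt _ _ hD]; omega

variable {D} in
theorem lt_of_arrow (hmn : ¬ (m = 2 ∧ n = 0)) {p p' : Idx m n} {i} (h : wt p' = wt p + D.simpleRoot i) :
    p' < p := by
  by_contra h'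
  have := D.ht_wt_antitone (not_lt.1 h')
  rw [h, ht_add, ht_simpleRoot D hmn] at this
  omega

variable {D} in
theorem arrow_cases (hmn : ¬ (m = 2 ∧ n = 0)) {p p' : Idx m n} {i} (h : wt p' = wt p + D.simpleRoot i) :
    (p.val = p'.val + 1 ∧ ¬ (D.forked ∧ p'.val + 1 = m / 2 + n)) ∨ D.forked ∧ p.val = p'.val + 2 ∧
      (p.val = m / 2 + n ∨ p'.val + 1 = m / 2 + n) := by
  have h' := congrArg D.ht h
  rw [ht_add, ht_simpleRoot D hmn] at h'
  by_cases hD : D.forked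
  · have := hD.1
    rw [ht_wt_forked _ _ hD, ht_wt_forked _ _ hD] at h'
    simp only [hD, true_and]
    have := hD.two_le hmn
    have := p.isLt
    have := p'.isLt
    split_ifs at h' <;> omega
  · rw [ht_wt _ _ hD, ht_wt _ _ hD] at h'
    exact Or.inl ⟨by omega, fun h => hD h.1⟩

/-- Sums of simple roots. -/
def QPos (μ : Wt m n) : Prop := ∃ ν : Fin (m / 2 + n) → ℕ, μ = ∑ i, ν i • D.simpleRoot i

variable {D}
theorem QPos.zero : D.QPos 0 := ⟨0, by simp⟩
theorem QPos.root (i) : D.QPos (D.simpleRoot i) := ⟨Pi.single i 1, by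
  rw [Finset.sum_eq_single i] <;> simp +contextual⟩
theorem QPos.add {x y : Wt m n} (hx : D.QPos x) (hy : D.QPos y) : D.QPos (x + y) := by
  obtain ⟨ν, rfl⟩ := hx
  obtain ⟨ξ, rfl⟩ := hy
  exact ⟨ν + ξ, by simp [add_smul, Finset.sum_add_distrib]⟩

theorem ht_sum (ν : Fin (m / 2 + n) → ℕ) (hmn : ¬ (m = 2 ∧ n = 0)) :
    D.ht (∑ i, ν i • D.simpleRoot i) = 2 * ∑ i, (ν i : ℤ) := by
  let φ : Wt m n →+ ℤ := AddMonoidHom.mk' D.ht (D.ht_add)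
  change φ _ = _
  rw [map_sum, Finset.mul_sum]
  refine Finset.sum_congr rfl fun i _ => ?_
  rw [map_nsmul]
  change ν i • D.ht _ = _
  rw [ht_simpleRoot D hmn]; simp [mul_comm]

theorem sum_pos_of_ne_zero {ν : Fin (m / 2 + n) → ℕ} (h : ν ≠ 0) : 0 < ∑ i, (ν i : ℤ) := by
  obtain ⟨i, hi⟩ := Function.ne_iff.1 h
  exact Finset.sum_pos' (fun _ _ => by positivity) ⟨i, Finset.mem_univ _, by
    have : ν i ≠ 0 := hi; positivity⟩

/-- Non-zero sums of simple roots have height at least two, which is the height of a simple root;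
hence a simple root does not decompose. -/
theorem QPos.eq_or_eq (hmn : ¬ (m = 2 ∧ n = 0)) {x μ : Wt m n} {i} (h : D.QPos μ) (h' : D.QPos x)
    (e : x + μ = D.simpleRoot i) : μ = 0 ∨ x = 0 := by
  obtain ⟨ν, rfl⟩ := h
  obtain ⟨ξ, rfl⟩ := h'
  by_cases h1 : ν = 0
  · left; simp [h1]
  by_cases h2 : ξ = 0
  · right; simp [h2]
  have := congrArg D.ht e
  rw [ht_add, ht_sum ν hmn, ht_sum ξ hmn, ht_simpleRoot D hmn] at this
  have := sum_pos_of_ne_zero h1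
  have := sum_pos_of_ne_zero h2
  omega

/-- Arrows are followed downwards from `b` to `x`. The excluded pair is the two middle weights
`±ℰ_{L-1}` at the fork: they have the same height and are incomparable. -/
theorem QPos.of_lt (hmn : ¬ (m = 2 ∧ n = 0)) {b x : Idx m n} (h : b < x)
    (ht : ¬ (D.forked ∧ b.val + 1 = m / 2 + n ∧ x.val = m / 2 + n)) : D.QPos (wt b - wt x) := by
  have key : ∀ (d : ℕ) (b x : Idx m n), x.val = b.val + d → 0 < d →
      ¬ (D.forked ∧ b.val + 1 = m / 2 + n ∧ x.val = m / 2 + n) → D.QPos (wt b - wt x) := by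
    intro d
    induction d using Nat.strong_induction_on with
    | _ d ih =>
      intro b x hd hd0 ht
      -- From the index `L - 2` the arrow of `exists_arrow` leads to the wrong prong of the fork,
      -- from which `L` cannot be reached; the other arrow is taken instead.
      by_cases hs : D.forked ∧ b.val + 2 = m / 2 + n ∧ x.val = m / 2 + n
      · have := arrow_forked hs.1 (by omega)
        have hb : b = ⟨m / 2 + n - 2, by omega⟩ := Fin.ext (by simp only; omega)
        have hx : x = ⟨m / 2 + n, by omega⟩ := Fin.ext (by simp only; omega)
        have e : wt b = wt x + D.simpleRoot ⟨m / 2 + n - 1, by omega⟩ :=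
          (congrArg wt hb).trans (this.trans (congrArg (wt · + _) hx.symm))
        rw [e, add_sub_cancel_left]; exact QPos.root _
      · obtain ⟨i, p, hp, hp'⟩ := exists_arrow (D := D) hmn b.val (by omega)
        have hb : wt b - wt x = D.simpleRoot i + (wt p - wt x) := by
          rw [show wt b = _ from hp]; abel
        rw [hb]
        refine (QPos.root i).add ?_
        by_cases hpx : p = x
        · rw [hpx, sub_self]; exact QPos.zero
        have hpx' : p.val ≠ x.val := fun h => hpx (Fin.ext h)
        have h0 : ¬ (x.val < p.val) := fun hlt => by
          rcases hp' with hp' | ⟨h1, h2, h3⟩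
          · omega
          · exact ht ⟨h1, h2, by omega⟩
        refine ih (x.val - p.val) (by omega) p x (by omega) (by omega) ?_
        rintro ⟨h1, h2, h3⟩
        rcases hp' with hp' | ⟨h1', h2', h3'⟩
        · exact hs ⟨h1, by omega, h3⟩
        · omega
  exact key (x.val - b.val) b x (by have : b.val < x.val := h; omega)
    (by have : b.val < x.val := h; omega) ht

/-- Along arrows the pairing with `μ` is constant, so all weights of `V_q` pair with `μ` to the same
number. Mirror vectors have opposite weights, so this number is its own negative. -/
theorem eq_zero_of_ip_simpleRoot (hmn : ¬ (m = 2 ∧ n = 0)) {μ : Wt m n}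
    (h : ∀ i, D.ip (D.simpleRoot i) μ = 0) : μ = 0 := by
  have hip : ∀ (p p' : Idx m n) i, wt p' = wt p + D.simpleRoot i → D.ip (wt p') μ = D.ip (wt p) μ :=
    fun p p' i e => by rw [e, ip_add_left, h, add_zero]
  have hc : ∀ (d : ℕ) (x : ℕ) (hx : x < m + 2 * n), m + 2 * n = x + d + 1 →
      D.ip (wt ⟨x, hx⟩) μ = D.ip (wt (⟨m + 2 * n - 1, by omega⟩ : Idx m n)) μ := by
    intro d
    induction d using Nat.strong_induction_on with
    | _ d ih =>
      intro x hx hd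
      rcases Nat.eq_zero_or_pos d with h0 | h0
      · congr 3; omega
      · obtain ⟨i, p, hp, hp'⟩ := exists_arrow (D := D) hmn x (by omega)
        rw [hip _ _ _ hp]
        exact ih (m + 2 * n - 1 - p.val) (by omega) p.val p.isLt (by omega)
  have h0 : ∀ a : Idx m n, D.ip (wt a) μ = 0 := by
    intro a
    have h1 := hc (m + 2 * n - 1 - a.val) a.val a.isLt (by have := a.isLt; omega)
    have h2 := hc (m + 2 * n - 1 - a.rev.val) a.rev.val a.rev.isLt (by have := a.rev.isLt; omega)
    have h3 : D.ip (wt a.rev) μ = -D.ip (wt a) μ := by rw [wt_rev, ip_neg_left]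
    have h1' : D.ip (wt a) μ = _ := h1
    have h2' : D.ip (wt a.rev) μ = _ := h2
    rw [h3, ← h1'] at h2'
    omega
  funext j
  have hj := j.isLt
  have h1 := h0 ⟨j.val, by omega⟩
  rw [ip_comm, ip, show (∑ t, (if D.isDelta t = true then (-1 : ℤ) else 1) * μ t *
    wt (⟨j.val, by omega⟩ : Idx m n) t) = _ from sum_mul_wt _ _, dif_pos hj] at h1
  simp only [Fin.eta] at h1
  split_ifs at h1 <;> simpa using h1

end RootDatum
end
end OspBMW

/-! ### Tensor products of matrices and added strands -/

namespace OspBMW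
noncomputable section

section tensor
variable {m n : ℕ}

/-- The tensor product of two linear maps. -/
def tens {a b c d : ℕ} (A : TMat m n a b) (B : TMat m n c d) : TMat m n (a + c) (b + d) :=
  Matrix.of fun w' w => A (fun t => w' (Fin.castAdd d t)) (fun t => w (Fin.castAdd c t)) *
    B (fun t => w' (Fin.natAdd b t)) (fun t => w (Fin.natAdd a t))

theorem sum_word_add {M : Type*} [AddCommMonoid M] {a b : ℕ} (f : Word m n (a + b) → M) :
    ∑ w, f w = ∑ u : Word m n a, ∑ v : Word m n b, f (Fin.append u v) := by
  rw [← Fintype.sum_prod_type', ← (Fin.appendEquiv a b).sum_comp]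
  rfl

theorem sum_word_one {M : Type*} [AddCommMonoid M] (f : Word m n 1 → M) :
    ∑ w, f w = ∑ a : Idx m n, f (fun _ => a) :=
  (Fintype.sum_equiv (Equiv.funUnique (Fin 1) (Idx m n)) _ _ fun w => by
    congr 1; funext i; rw [Subsingleton.elim i 0]; rfl)

theorem sum_word_two {M : Type*} [AddCommMonoid M] (f : Word m n 2 → M) :
    ∑ w, f w = ∑ a : Idx m n, ∑ b : Idx m n, f ![a, b] := by
  rw [← Fintype.sum_prod_type', ← (finTwoArrowEquiv (Idx m n)).symm.sum_comp]
  rfl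

theorem word_ext_add {a b : ℕ} {w w' : Word m n (a + b)} : w = w' ↔
    (fun t => w (Fin.castAdd b t)) = (fun t => w' (Fin.castAdd b t)) ∧
    (fun t => w (Fin.natAdd a t)) = (fun t => w' (Fin.natAdd a t)) := by
  constructor
  · rintro rfl; exact ⟨rfl, rfl⟩
  · rintro ⟨h1, h2⟩
    funext t
    refine Fin.addCases (fun i => ?_) (fun i => ?_) t
    · exact congrFun h1 i
    · exact congrFun h2 i

theorem tens_mul {a b c d a' c' : ℕ} (A : TMat m n a b) (B : TMat m n c d) (A' : TMat m n a' a)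
    (B' : TMat m n c' c) : tens A B * tens A' B' = tens (A * A') (B * B') := by
  ext w' w
  simp only [Matrix.mul_apply, tens, Matrix.of_apply, sum_word_add, Fin.append_left, Fin.append_right,
    Finset.sum_mul_sum]
  refine Finset.sum_congr rfl fun u _ => Finset.sum_congr rfl fun v _ => ?_
  ring

theorem tens_one {a c : ℕ} : tens (1 : TMat m n a a) (1 : TMat m n c c) = 1 := by
  ext w' w
  simp only [tens, Matrix.of_apply, Matrix.one_apply, word_ext_add (w := w') (w' := w)]
  split_ifs <;> simp_all

/-- The map `id^{⊗i} ⊗ A ⊗ id^{⊗r}`. -/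
def pad (i r : ℕ) {s t k l : ℕ} (hk : k = i + s + r) (hl : l = i + t + r) (A : TMat m n s t) :
    TMat m n k l :=
  Matrix.of fun w' w =>
    if (∀ u : Fin i, w' ⟨u, by omega⟩ = w ⟨u, by omega⟩) ∧
        (∀ u : Fin r, w' ⟨i + t + u, by omega⟩ = w ⟨i + s + u, by omega⟩)
    then A (fun u => w' ⟨i + u, by omega⟩) (fun u => w ⟨i + u, by omega⟩)
    else 0

theorem whisker_eq_pad {k l : ℕ} (s : Slice k l) (A : TMat m n s.piece.src s.piece.tgt) :
    whisker s A = pad s.left s.right s.hk s.hl A := rfl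

theorem pad_eq_tens (i r : ℕ) {s t : ℕ} (A : TMat m n s t) :
    pad i r rfl rfl A = tens (tens (1 : TMat m n i i) A) (1 : TMat m n r r) := by
  ext w' w
  simp only [pad, tens, Matrix.of_apply, Matrix.one_apply, funext_iff]
  by_cases c1 : ∀ u : Fin i, w' (Fin.castAdd r (Fin.castAdd t u)) = w (Fin.castAdd r (Fin.castAdd s u))
  · by_cases c2 : ∀ u : Fin r, w' (Fin.natAdd (i + t) u) = w (Fin.natAdd (i + s) u)
    · refine (if_pos ⟨c1, c2⟩).trans ?_
      rw [if_pos c1, if_pos c2, one_mul, mul_one]; rfl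
    · refine (if_neg (fun h => c2 h.2)).trans ?_
      rw [if_neg c2, mul_zero]
  · refine (if_neg (fun h => c1 h.1)).trans ?_
    rw [if_neg c1, zero_mul, zero_mul]

theorem pad_eq_tens_one (r : ℕ) {s t : ℕ} (A : TMat m n s t) :
    pad 0 r (k := s + r) (l := t + r) (by omega) (by omega) A = tens A (1 : TMat m n r r) := by
  ext w' w
  simp only [pad, tens, Matrix.of_apply, Matrix.one_apply, funext_iff, zero_add]
  by_cases c2 : ∀ u : Fin r, w' (Fin.natAdd t u) = w (Fin.natAdd s u)
  · refine (if_pos ⟨fun u => u.elim0, c2⟩).trans ?_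
    rw [if_pos c2, mul_one]; rfl
  · refine (if_neg (fun h => c2 h.2)).trans ?_
    rw [if_neg c2, mul_zero]

theorem pad_eq_one_tens (i : ℕ) {s t : ℕ} (A : TMat m n s t) :
    pad i 0 (k := i + s) (l := i + t) (by omega) (by omega) A = tens (1 : TMat m n i i) A := by
  ext w' w
  simp only [pad, tens, Matrix.of_apply, Matrix.one_apply, funext_iff]
  by_cases c1 : ∀ u : Fin i, w' (Fin.castAdd t u) = w (Fin.castAdd s u)
  · refine (if_pos ⟨c1, fun u => u.elim0⟩).trans ?_
    rw [if_pos c1, one_mul]; rfl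
  · refine (if_neg (fun h => c1 h.1)).trans ?_
    rw [if_neg c1, zero_mul]

theorem pad_mul {i r s t u k l p : ℕ} (hk : k = i + s + r) (hl : l = i + t + r) (hp : p = i + u + r)
    (A : TMat m n t u) (B : TMat m n s t) : pad i r hl hp A * pad i r hk hl B = pad i r hk hp (A * B) := by
  subst hk hl hp
  rw [pad_eq_tens, pad_eq_tens, pad_eq_tens, tens_mul, tens_mul, one_mul, one_mul]

theorem pad_one {i r s k : ℕ} (hk : k = i + s + r) : pad i r hk hk (1 : TMat m n s s) = 1 := by
  subst hk
  rw [pad_eq_tens, tens_one, tens_one]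

theorem pad_zero_zero {s t : ℕ} (A : TMat m n s t) : pad 0 0 (by omega) (by omega) A = A := by
  ext w' w
  simp only [pad, Matrix.of_apply]
  rw [if_pos ⟨fun u => u.elim0, fun u => u.elim0⟩]
  congr 1 <;> · funext u; congr 1; ext; simp

theorem pad_pad {i r i' r' s t k l k' l' : ℕ} (hk' : k' = i' + s + r') (hl' : l' = i' + t + r')
    (hk : k = i + k' + r) (hl : l = i + l' + r) (A : TMat m n s t) :
    pad i r hk hl (pad i' r' hk' hl' A) = pad (i + i') (r' + r) (by omega) (by omega) A := by
  ext w' w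
  simp only [pad, Matrix.of_apply]
  rw [← ite_and]
  have e1 : (fun u : Fin t => w' ⟨i + (i' + u), by omega⟩) = fun u : Fin t => w' ⟨i + i' + u, by omega⟩ := by
    funext u; congr 2; omega
  have e2 : (fun u : Fin s => w ⟨i + (i' + u), by omega⟩) = fun u : Fin s => w ⟨i + i' + u, by omega⟩ := by
    funext u; congr 2; omega
  rw [e1, e2]
  refine if_congr ⟨?_, ?_⟩ rfl rfl
  · rintro ⟨⟨h1, h2⟩, h3, h4⟩
    refine ⟨fun u => ?_, fun u => ?_⟩
    · by_cases hu : u.val < i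
      · exact h1 ⟨u, hu⟩
      · have := h3 ⟨u - i, by omega⟩
        simp only [show i + (u.val - i) = u.val by omega] at this
        exact this
    · by_cases hu : u.val < r'
      · have := h4 ⟨u, hu⟩
        simp only [show i + (i' + t + u.val) = i + i' + t + u by omega,
          show i + (i' + s + u.val) = i + i' + s + u by omega] at this
        exact this
      · have := h2 ⟨u - r', by omega⟩
        simp only [show i + l' + (u.val - r') = i + i' + t + u by omega,
          show i + k' + (u.val - r') = i + i' + s + u by omega] at this
        exact this
  · rintro ⟨h1, h2⟩
    refine ⟨⟨fun u => h1 ⟨u, by omega⟩, fun u => ?_⟩, fun u => h1 ⟨i + u, by omega⟩, fun u => ?_⟩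
    · have := h2 ⟨r' + u, by omega⟩
      simp only [show i + i' + t + (r' + u.val) = i + l' + u by omega,
        show i + i' + s + (r' + u.val) = i + k' + u by omega] at this
      exact this
    · have := h2 ⟨u, by omega⟩
      simp only [show i + (i' + t + u.val) = i + i' + t + u by omega,
        show i + (i' + s + u.val) = i + i' + s + u by omega]
      exact this

theorem pad_congr {i r i' r' s t k l : ℕ} {hk : k = i + s + r} {hl : l = i + t + r}
    (hi : i = i') (hr : r = r') {A : TMat m n s t} :
    pad i r hk hl A = pad i' r' (by omega) (by omega) A := by
  subst hi hr; rfl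

theorem pad_smul {i r s t k l : ℕ} (hk : k = i + s + r) (hl : l = i + t + r) (x : Cq) (A : TMat m n s t) :
    pad i r hk hl (x • A) = x • pad i r hk hl A := by
  ext w' w; simp [pad]
theorem pad_sub {i r s t k l : ℕ} (hk : k = i + s + r) (hl : l = i + t + r) (A B : TMat m n s t) :
    pad i r hk hl (A - B) = pad i r hk hl A - pad i r hk hl B := by
  ext w' w; simp only [pad, Matrix.of_apply, Matrix.sub_apply]; split_ifs <;> simp

/-- Maps at disjoint places commute. -/
theorem pad_interchange {s t s' t' c k l p p' : ℕ} (A : TMat m n s t) (B : TMat m n s' t')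
    (hk : k = 0 + s + (c + s')) (hl : l = 0 + t + (c + s')) (hl' : l = (t + c) + s' + 0)
    (hp : p = (t + c) + t' + 0) (hk' : k = (s + c) + s' + 0) (hp' : p' = (s + c) + t' + 0)
    (hp'' : p' = 0 + s + (c + t')) (h : p = 0 + t + (c + t')) :
    pad (t + c) 0 hl' hp B * pad 0 (c + s') hk hl A =
      pad 0 (c + t') hp'' h A * pad (s + c) 0 hk' hp' B := by
  have hA : ∀ (u : ℕ), pad 0 (c + u) (k := s + c + u) (l := t + c + u) (by omega) (by omega) A =
      tens (pad 0 c (k := s + c) (l := t + c) (by omega) (by omega) A) (1 : TMat m n u u) := fun u => by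
    rw [← pad_eq_tens_one, pad_pad]
  obtain rfl : k = s + c + s' := by omega
  obtain rfl : l = t + c + s' := by omega
  obtain rfl : p = t + c + t' := by omega
  obtain rfl : p' = s + c + t' := by omega
  rw [hA, hA, pad_eq_one_tens, pad_eq_one_tens, tens_mul, tens_mul]
  simp only [Matrix.one_mul, Matrix.mul_one]

theorem powMat_add (A : Matrix (Idx m n) (Idx m n) Cq) (a b : ℕ) :
    powMat A (a + b) = tens (powMat A a) (powMat A b) := by
  ext w' w
  simp only [powMat, tens, Matrix.of_apply, Fin.prod_univ_add]

/-- This is the coassociativity of the iterated coproduct: the distinguished factor lies among the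
first `a` or the last `b`. -/
theorem sumMat_add (A X B : Matrix (Idx m n) (Idx m n) Cq) (a b : ℕ) :
    sumMat A X B (a + b) = tens (sumMat A X B a) (powMat B b) + tens (powMat A a) (sumMat A X B b) := by
  ext w' w
  simp only [sumMat, powMat, tens, Matrix.of_apply, Matrix.add_apply, Fin.sum_univ_add, Fin.prod_univ_add,
    Finset.sum_mul, Finset.mul_sum]
  congr 1
  · refine Finset.sum_congr rfl fun t _ => ?_
    congr 1
    · refine Finset.prod_congr rfl fun j _ => ?_
      simp only [Fin.lt_def, Fin.ext_iff, Fin.val_castAdd]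
    · refine Finset.prod_congr rfl fun j _ => ?_
      have := t.isLt
      rw [if_neg (by rw [Fin.lt_def]; simp only [Fin.val_natAdd, Fin.val_castAdd]; omega),
        if_neg (by rw [Fin.ext_iff]; simp only [Fin.val_natAdd, Fin.val_castAdd]; omega)]
  · refine Finset.sum_congr rfl fun t _ => ?_
    congr 1
    · refine Finset.prod_congr rfl fun j _ => ?_
      have := j.isLt
      rw [if_pos (by rw [Fin.lt_def]; simp only [Fin.val_natAdd, Fin.val_castAdd]; omega)]
    · refine Finset.prod_congr rfl fun j _ => ?_
      simp only [Fin.lt_def, Fin.ext_iff, Fin.val_natAdd, add_lt_add_iff_left, add_right_inj]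

theorem powMat_diagonal (f : Idx m n → Cq) (r : ℕ) :
    powMat (Matrix.diagonal f) r = Matrix.diagonal fun w => ∏ j, f (w j) := by
  ext w' w
  simp only [powMat, Matrix.of_apply, Matrix.diagonal_apply]
  split_ifs with h
  · subst h; simp
  · obtain ⟨j, hj⟩ := Function.ne_iff.1 h
    exact Finset.prod_eq_zero (Finset.mem_univ j) (if_neg hj)

theorem powMat_one (r : ℕ) : powMat (1 : Matrix (Idx m n) (Idx m n) Cq) r = 1 := by
  rw [← Matrix.diagonal_one, powMat_diagonal]; simp

end tensor

theorem ksign_add (s t u : ZMod 2) : ksign s (t + u) = ksign s t * ksign s u := by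
  have h : ∀ s : ZMod 2, s = 0 ∨ s = 1 := by decide
  have h2 : (1 + 1 : ZMod 2) = 0 := rfl
  rcases h s with rfl | rfl <;> rcases h t with rfl | rfl <;> rcases h u with rfl | rfl <;>
    simp [ksign, h2]

theorem ksign_zero_right (s : ZMod 2) : ksign s 0 = 1 := by simp [ksign]
theorem ksign_comm (s t : ZMod 2) : ksign s t = ksign t s := by simp [ksign, and_comm]
theorem ksign_add_left (s t u : ZMod 2) : ksign (s + t) u = ksign s u * ksign t u := by
  rw [ksign_comm, ksign_add, ksign_comm u, ksign_comm u]
theorem ksign_mul_self (s t : ZMod 2) : ksign s t * ksign s t = 1 := by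
  simp only [ksign]; split_ifs <;> simp

namespace RootDatum
variable {m n : ℕ} (D : RootDatum m n)

theorem wpar_add {a b : ℕ} (w : Word m n (a + b)) : D.wpar w =
    D.wpar (fun t => w (Fin.castAdd b t)) + D.wpar (fun t => w (Fin.natAdd a t)) := by
  simp only [wpar, Fin.sum_univ_add]

theorem powMat_parityMat (s : ZMod 2) (r : ℕ) :
    powMat (D.parityMat s) r = Matrix.diagonal fun w => ksign s (D.wpar w) := by
  rw [parityMat, powMat_diagonal]
  congr 1; funext w
  rw [wpar]
  induction r with
  | zero => simp [ksign]
  | succ r ih =>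
    rw [Fin.prod_univ_succ, Fin.sum_univ_succ, ksign_add]
    congr 1
    exact ih fun j => w j.succ

variable {D}

theorem IsHom.parity {k l : ℕ} {A : TMat m n k l} (hA : D.IsHom A) (s : ZMod 2) :
    A * powMat (D.parityMat s) k = powMat (D.parityMat s) l * A := by
  ext w' w
  rw [powMat_parityMat, powMat_parityMat, Matrix.mul_diagonal, Matrix.diagonal_mul]
  by_cases h : A w' w = 0
  · simp [h]
  · rw [hA.1 _ _ h, mul_comm]

theorem powMat_kInvMat_mul (i : Fin (m / 2 + n)) (s : ZMod 2) (r : ℕ) :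
    powMat (D.kInvMat i * D.parityMat s) r = powMat (D.kInvMat i) r * powMat (D.parityMat s) r := by
  simp only [parityMat, kInvMat, Matrix.diagonal_mul_diagonal, powMat_diagonal, Finset.prod_mul_distrib]

/-- By `sumMat_add` the action of `e_i` or `f_i` on one part comes with `k_i^{±1}` or parity
operators on the other. Homomorphisms commute with the former, and evenness is commutation with the
latter (`IsHom.parity`). -/
theorem IsHom.tens {a b c d : ℕ} {A : TMat m n a b} {B : TMat m n c d} (hA : D.IsHom A) (hB : D.IsHom B) :
    D.IsHom (tens A B) := by
  refine ⟨fun w' w h => ?_, fun x => ?_⟩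
  · rw [wpar_add, wpar_add, hA.1 _ _ (left_ne_zero_of_mul h), hB.1 _ _ (right_ne_zero_of_mul h)]
  · have hA' := hA.2 x
    have hB' := hB.2 x
    cases x with
    | e i =>
      have hk := hB.2 (.k i)
      simp only [genOp] at hA' hB' hk ⊢
      rw [sumMat_add, sumMat_add, Matrix.mul_add, Matrix.add_mul, tens_mul, tens_mul, tens_mul, tens_mul,
        hA', hB', hk, hA.parity]
    | f i =>
      have hk := hA.2 (.kInv i)
      simp only [genOp] at hA' hB' hk ⊢
      rw [sumMat_add, sumMat_add, Matrix.mul_add, Matrix.add_mul, tens_mul, tens_mul, tens_mul, tens_mul,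
        hA', hB', powMat_one, powMat_one, Matrix.mul_one, Matrix.one_mul, powMat_kInvMat_mul,
        powMat_kInvMat_mul, ← Matrix.mul_assoc, hk, Matrix.mul_assoc, hA.parity, ← Matrix.mul_assoc]
    | k i => simp only [genOp] at hA' hB' ⊢; rw [powMat_add, powMat_add, tens_mul, tens_mul, hA', hB']
    | kInv i => simp only [genOp] at hA' hB' ⊢; rw [powMat_add, powMat_add, tens_mul, tens_mul, hA', hB']
    | sigma h => simp only [genOp] at hA' hB' ⊢; rw [powMat_add, powMat_add, tens_mul, tens_mul, hA', hB']

theorem IsHom.one (r : ℕ) : D.IsHom (1 : TMat m n r r) := (D.endUq r).one_mem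

theorem IsHom.mul {k l p : ℕ} {A : TMat m n l p} {B : TMat m n k l} (hA : D.IsHom A) (hB : D.IsHom B) :
    D.IsHom (A * B) := by
  refine ⟨fun w' w h => ?_, fun x => ?_⟩
  · rw [Matrix.mul_apply] at h
    obtain ⟨u, -, hu⟩ := Finset.exists_ne_zero_of_sum_ne_zero h
    exact (hA.1 w' u (left_ne_zero_of_mul hu)).trans (hB.1 u w (right_ne_zero_of_mul hu))
  · rw [Matrix.mul_assoc, hB.2 x, ← Matrix.mul_assoc, hA.2 x, Matrix.mul_assoc]

theorem IsHom.sub {k l : ℕ} {A B : TMat m n k l} (hA : D.IsHom A) (hB : D.IsHom B) :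
    D.IsHom (A - B) := by
  refine ⟨fun w' w h => ?_, fun x => ?_⟩
  · by_cases h0 : A w' w = 0
    · refine hB.1 w' w fun h1 => h ?_
      simp [h0, h1]
    · exact hA.1 w' w h0
  · rw [Matrix.sub_mul, Matrix.mul_sub, hA.2, hB.2]

theorem IsHom.smul {k l : ℕ} {A : TMat m n k l} (hA : D.IsHom A) (x : Cq) :
    D.IsHom (x • A) := by
  refine ⟨fun w' w h => hA.1 w' w fun h0 => h (by simp [h0]), fun y => ?_⟩
  rw [Matrix.smul_mul, Matrix.mul_smul, hA.2]

theorem IsHom.pad {i r s t k l : ℕ} {hk : k = i + s + r} {hl : l = i + t + r} {A : TMat m n s t}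
    (hA : D.IsHom A) : D.IsHom (pad i r hk hl A) := by
  subst hk hl
  rw [pad_eq_tens]
  exact ((IsHom.one i).tens hA).tens (IsHom.one r)

end RootDatum
end
end OspBMW

/-! ### The field `ℂ(q)` and contravariant forms in the weight basis -/

namespace OspBMW
noncomputable section

theorem q_ne_zero : q ≠ 0 := RatFunc.X_ne_zero

theorem q_pow_ne_one {k : ℕ} (hk : k ≠ 0) : q ^ k ≠ 1 := by
  intro h
  have h' : algebraMap (Polynomial ℂ) (RatFunc ℂ) (Polynomial.X ^ k) = algebraMap _ _ 1 := by
    rw [map_pow, RatFunc.algebraMap_X, map_one]; exact h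
  have := congrArg Polynomial.natDegree (RatFunc.algebraMap_injective ℂ h')
  simp at this
  exact hk this

/-- As `q` is an indeterminate, pairings with simple roots can be read off from the eigenvalues of
the `k_i`. -/
theorem q_zpow_injective {k l : ℤ} (h : q ^ k = q ^ l) : k = l := by
  have key : ∀ j : ℤ, 0 ≤ j → q ^ j = 1 → j = 0 := fun j hj hq => by
    lift j to ℕ using hj
    by_contra hne
    exact q_pow_ne_one (k := j) (by exact_mod_cast hne) (by exact_mod_cast hq)
  rcases le_total k l with hkl | hkl
  · have := key (l - k) (by omega) (by rw [zpow_sub₀ q_ne_zero, h, div_self (zpow_ne_zero _ q_ne_zero)])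
    omega
  · have := key (k - l) (by omega) (by rw [zpow_sub₀ q_ne_zero, h, div_self (zpow_ne_zero _ q_ne_zero)])
    omega

theorem z_ne_zero : q - q⁻¹ ≠ 0 := by
  intro h
  have h1 : q ^ (1 : ℤ) = q ^ (-1 : ℤ) := by rw [zpow_one, zpow_neg_one]; exact sub_eq_zero.1 h
  have := q_zpow_injective h1
  omega

theorem q_add_inv_ne_zero : q + q⁻¹ ≠ 0 := by
  intro h
  have h0 := q_ne_zero
  have h1 : q * q = -1 := by
    have := congrArg (q * ·) h
    simp only [mul_add, mul_inv_cancel₀ h0, mul_zero] at this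
    exact eq_neg_of_add_eq_zero_left this
  refine q_pow_ne_one (k := 4) (by norm_num) ?_
  rw [show q ^ 4 = (q * q) * (q * q) by ring, h1]; ring

namespace RootDatum
variable {m n : ℕ} (D : RootDatum m n)

/-- The coefficients of an invariant form with respect to the weight basis. -/
structure IsKappa (κ : Idx m n → Cq) : Prop where
  ne_zero : ∀ a, κ a ≠ 0
  arrow : ∀ {i : Fin (m / 2 + n)} {p p' : Idx m n}, wt p' = wt p + D.simpleRoot i →
    κ p' = -(ksign (D.vpar p) (D.par (D.simpleRoot i)) * q ^ D.ip (D.simpleRoot i) (wt p') * κ p)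

/-- The form with coefficients `κ`. -/
def formMat (κ : Idx m n → Cq) : Matrix (Idx m n) (Idx m n) Cq :=
  Matrix.of fun a b => if b = a.rev then κ a else 0

theorem formMat_mul {κ : Idx m n → Cq} (h : ∀ a, κ a ≠ 0) :
    formMat κ * (Matrix.of fun a b => if b = a.rev then (κ b)⁻¹ else 0) = 1 := by
  ext a b
  simp only [Matrix.mul_apply, formMat, Matrix.of_apply, Matrix.one_apply]
  rw [Finset.sum_eq_single a.rev]
  · by_cases hab : a = b
    · subst hab; simp [h]
    · rw [if_neg hab, if_pos rfl, if_neg (fun h' => hab (by rw [h', Fin.rev_rev])), mul_zero]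
  · intro c _ hc; rw [if_neg hc, zero_mul]
  · simp

theorem formMat_inv {κ : Idx m n → Cq} (h : ∀ a, κ a ≠ 0) :
    (formMat κ)⁻¹ = Matrix.of fun a b => if b = a.rev then (κ b)⁻¹ else 0 :=
  Matrix.inv_eq_right_inv (formMat_mul h)

theorem formMat_isUnit {κ : Idx m n → Cq} (h : ∀ a, κ a ≠ 0) : IsUnit (formMat κ).det := by
  rw [← Matrix.isUnit_iff_isUnit_det]
  exact ⟨⟨_, _, formMat_mul h, mul_eq_one_comm.1 (formMat_mul h)⟩, rfl⟩

variable {D}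

theorem arrow_rev_iff {p p' : Idx m n} {α : Wt m n} : wt p.rev = wt p'.rev + α ↔ wt p' = wt p + α :=
  ⟨fun h => by simpa using arrow_rev h, arrow_rev⟩

theorem par_arrow {p p' : Idx m n} {α : Wt m n} (h : wt p' = wt p + α) : D.par α = D.vpar p + D.vpar p' := by
  have : D.vpar p' = D.vpar p + D.par α := by rw [vpar, h, par_add]; rfl
  rw [this, ← add_assoc, CharTwo.add_self_eq_zero, zero_add]

theorem ip_arrow {p p' : Idx m n} {α μ : Wt m n} (h : wt p' = wt p + α) :
    D.ip α μ = D.ip (wt p') μ - D.ip (wt p) μ := by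
  rw [h, ip_add_left]; ring

theorem sum_arrow {p p' : Idx m n} {α : Wt m n} (h : wt p' = wt p + α) (f : Idx m n → Cq) :
    (∑ s, f s * if wt s = wt p + α then 1 else 0) = f p' := by
  rw [Finset.sum_eq_single p']
  · rw [if_pos h, mul_one]
  · intro s _ hs
    rw [if_neg (fun hs' => hs (wt_injective (hs'.trans h.symm))), mul_zero]
  · simp

theorem sum_arrow' {p p' : Idx m n} {α : Wt m n} (h : wt p' = wt p + α) (f : Idx m n → Cq) :
    (∑ s, f s * if wt p' = wt s + α then 1 else 0) = f p := by
  rw [Finset.sum_eq_single p]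
  · rw [if_pos h, mul_one]
  · intro s _ hs
    rw [if_neg (fun hs' => hs (wt_injective (add_right_cancel (hs'.symm.trans h)))), mul_zero]
  · simp

theorem ip_rev (α : Wt m n) (a : Idx m n) : D.ip α (wt a.rev) = -D.ip α (wt a) := by
  rw [wt_rev, ip_neg_right]

theorem ksign_eq (s t : ZMod 2) : ksign s t = 1 ∨ ksign s t = -1 := by
  rw [ksign]; split_ifs <;> simp

theorem ksign_ne_zero (s t : ZMod 2) : ksign s t ≠ 0 := by
  rw [ksign]; split_ifs <;> simp

/-- Contravariance under the `k_i` makes only vectors of opposite weights pair non-trivially, and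
these are mirror images. Non-degeneracy then makes the remaining entries non-zero, and
contravariance under `e_i`, tested on `v_p` and the mirror of `v_{p'}`, is the recursion. -/
theorem IsContravariantForm.exists_kappa (hmn : ¬ (m = 2 ∧ n = 0)) {B : Matrix (Idx m n) (Idx m n) Cq}
    (hB : D.IsContravariantForm B) : ∃ κ, D.IsKappa κ ∧ B = formMat κ := by
  have hsupp : ∀ a b, b ≠ a.rev → B a b = 0 := by
    intro a b hab
    by_contra hne
    apply hab
    have : wt a + wt b = 0 := by
      refine eq_zero_of_ip_simpleRoot (D := D) hmn fun i => ?_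
      have := hB.contravariant (.k i) a b
      simp only [natOp, antipodeOp, genPar, kMat, kInvMat, Matrix.diagonal_apply, ite_mul, mul_ite, zero_mul,
        mul_zero, Finset.sum_ite_eq', Finset.mem_univ, if_true, ksign_zero_right,
        one_mul] at this
      rw [mul_comm, mul_right_inj' hne] at this
      rw [ip_add_right, q_zpow_injective this]; ring
    apply wt_injective
    rw [wt_rev, eq_neg_iff_add_eq_zero, add_comm, this]
  have hform : B = formMat fun a => B a a.rev := by
    ext a b
    rw [formMat, Matrix.of_apply]
    split_ifs with h
    · rw [h]
    · exact hsupp a b h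
  refine ⟨fun a => B a a.rev, ⟨fun a h0 => ?_, fun {i p p'} h => ?_⟩, hform⟩
  · have : B.det = 0 := by
      apply Matrix.det_eq_zero_of_row_eq_zero a
      intro b
      by_cases h : b = a.rev
      · rw [h, h0]
      · exact hsupp a b h
    exact hB.nondegenerate.ne_zero this
  · have h1 := hB.contravariant (.e i) p p'.rev
    simp only [natOp, antipodeOp, genPar, eMat, kInvMat, Matrix.mul_diagonal, Matrix.neg_apply,
      Matrix.of_apply] at h1
    have e1 : (∑ c, (if wt c = wt p + D.simpleRoot i then 1 else 0) * B c p'.rev) = B p' p'.rev := by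
      rw [← sum_arrow h fun c => B c p'.rev]
      exact Finset.sum_congr rfl fun c _ => mul_comm _ _
    have e2 : (∑ c, B p c * -((if wt c = wt p'.rev + D.simpleRoot i then 1 else 0) *
        q ^ (-D.ip (D.simpleRoot i) (wt p'.rev)))) = -(B p p.rev * q ^ D.ip (D.simpleRoot i) (wt p')) := by
      rw [ip_rev, neg_neg, ← sum_arrow (arrow_rev h) fun c => B p c, Finset.sum_mul, ← Finset.sum_neg_distrib]
      exact Finset.sum_congr rfl fun c _ => by ring
    rw [e1, e2] at h1
    rw [h1]; ring

/-- The factor in the matrix entries of `f_i`. -/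
def fCoeff (D : RootDatum m n) (i : Fin (m / 2 + n)) : Cq := if D.simpleRoot i i = 2 then q + q⁻¹ else 1

theorem fCoeff_ne_zero (i : Fin (m / 2 + n)) : D.fCoeff i ≠ 0 := by
  rw [fCoeff]; split_ifs
  · exact q_add_inv_ne_zero
  · exact one_ne_zero

/-- The sign `(-1)^{[a]}` in the field. -/
def sgq (D : RootDatum m n) (a : Idx m n) : Cq := if D.odd a then -1 else 1

theorem sgq_rev (a : Idx m n) : D.sgq a.rev = D.sgq a := by rw [sgq, sgq, odd_rev]
theorem sgq_ne_zero (a : Idx m n) : D.sgq a ≠ 0 := by rw [sgq]; split_ifs <;> simp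

theorem fMat_apply (i : Fin (m / 2 + n)) (b a : Idx m n) :
    D.fMat i b a = D.sgq a * D.fCoeff i * if wt a = wt b + D.simpleRoot i then 1 else 0 := by
  have : (if D.vpar a = 1 then (-1 : Cq) else 1) = D.sgq a := by
    rw [vpar_eq, sgq]; cases D.odd a <;> simp
  rw [fMat, Matrix.of_apply, this, fCoeff]; split_ifs <;> simp

theorem ksign_arrow_left {p p' : Idx m n} {α : Wt m n} (h : wt p' = wt p + α) :
    ksign (D.vpar p) (D.par α) = if D.odd p ∧ ¬ D.odd p' then -1 else 1 := by
  rw [par_arrow (D := D) h, vpar_eq, vpar_eq, ksign]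
  have h2 : (1 + 1 : ZMod 2) = 0 := rfl
  cases D.odd p <;> cases D.odd p' <;> simp [h2]

theorem ksign_arrow_right {p p' : Idx m n} {α : Wt m n} (h : wt p' = wt p + α) :
    ksign (D.vpar p') (D.par α) = if D.odd p' ∧ ¬ D.odd p then -1 else 1 := by
  rw [par_arrow (D := D) h, vpar_eq, vpar_eq, ksign]
  have h2 : (1 + 1 : ZMod 2) = 0 := rfl
  cases D.odd p <;> cases D.odd p' <;> simp [h2]

theorem sgq_arrow {p p' : Idx m n} {α : Wt m n} (h : wt p' = wt p + α) :
    D.sgq p = D.sgq p' * ksign (D.vpar p') (D.par α) * ksign (D.vpar p) (D.par α) := by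
  rw [ksign_arrow_left h, ksign_arrow_right h, sgq, sgq]
  cases D.odd p <;> cases D.odd p' <;> simp

section words

theorem word_two (w : Word m n 2) : w = ![w 0, w 1] := by
  funext i; fin_cases i <;> rfl

theorem matrix_ext_two {M N : TMat m n 2 2} (h : ∀ x y a b, M ![x, y] ![a, b] = N ![x, y] ![a, b]) : M = N := by
  ext w' w; rw [word_two w', word_two w]; exact h _ _ _ _

theorem sumMat_two (A X B : Matrix (Idx m n) (Idx m n) Cq) (x y a b : Idx m n) :
    sumMat A X B 2 ![x, y] ![a, b] = X x a * B y b + A x a * X y b := by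
  simp [sumMat, Fin.sum_univ_two, Fin.prod_univ_two]

theorem powMat_two (A : Matrix (Idx m n) (Idx m n) Cq) (x y a b : Idx m n) :
    powMat A 2 ![x, y] ![a, b] = A x a * A y b := by
  simp [powMat, Fin.prod_univ_two]

theorem sumMat_zero (A X B : Matrix (Idx m n) (Idx m n) Cq) : sumMat A X B 0 = 0 := by
  ext w' w; simp [sumMat]
theorem powMat_zero (A : Matrix (Idx m n) (Idx m n) Cq) : powMat A 0 = 1 := by
  ext w' w; rw [Subsingleton.elim w' w]; simp [powMat]

theorem wpar_two (a b : Idx m n) : D.wpar ![a, b] = D.vpar a + D.vpar b := by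
  simp [wpar, Fin.sum_univ_two]

end words

/-- The cap. -/
def capMat (κ : Idx m n → Cq) : TMat m n 2 0 := Matrix.of fun _ w => formMat κ (w 0) (w 1)
/-- The cup. -/
def cupMat (κ : Idx m n → Cq) : TMat m n 0 2 :=
  Matrix.of fun w _ => if w 1 = (w 0).rev then (κ (w 1))⁻¹ else 0

theorem word_two_eq_iff {w' w : Word m n 2} : w' = w ↔ w' 0 = w 0 ∧ w' 1 = w 1 := by
  rw [funext_iff, Fin.forall_fin_two]

theorem natOp_sigma_two (h : m % 2 = 1) : powMat (D.natOp (.sigma h)) 2 = 1 := by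
  ext w' w
  simp only [powMat, natOp, Fin.prod_univ_two, Matrix.of_apply, Matrix.neg_apply, neg_mul_neg,
    Matrix.one_apply, word_two_eq_iff]
  by_cases h1 : w' 0 = w 0 <;> by_cases h2 : w' 1 = w 1 <;> simp [h1, h2]

end RootDatum
end
end OspBMW

/-! ### Invariance of the form, the cap and the cup -/

namespace OspBMW
noncomputable section
namespace RootDatum
variable {m n : ℕ} {D : RootDatum m n}

theorem sum_mul_formMat (κ f : Idx m n → Cq) (b : Idx m n) :
    ∑ c, f c * formMat κ c b = f b.rev * κ b.rev := by
  rw [Finset.sum_eq_single b.rev]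
  · rw [formMat, Matrix.of_apply, if_pos (Fin.rev_rev b).symm]
  · intro c _ hc
    rw [formMat, Matrix.of_apply, if_neg (fun h => hc (by rw [h, Fin.rev_rev])), mul_zero]
  · simp

theorem sum_formMat_mul (κ f : Idx m n → Cq) (a : Idx m n) :
    ∑ c, formMat κ a c * f c = κ a * f a.rev := by
  rw [Finset.sum_eq_single a.rev]
  · rw [formMat, Matrix.of_apply, if_pos rfl]
  · intro c _ hc
    rw [formMat, Matrix.of_apply, if_neg hc, zero_mul]
  · simp

theorem kMat_apply (i : Fin (m / 2 + n)) (a b : Idx m n) :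
    D.kMat i a b = if a = b then q ^ D.ip (D.simpleRoot i) (wt b) else 0 := by
  rw [kMat, Matrix.diagonal_apply]; split_ifs with h
  · rw [h]
  · rfl

theorem kInvMat_apply (i : Fin (m / 2 + n)) (a b : Idx m n) :
    D.kInvMat i a b = if a = b then q ^ (-D.ip (D.simpleRoot i) (wt b)) else 0 := by
  rw [kInvMat, Matrix.diagonal_apply]; split_ifs with h
  · rw [h]
  · rfl

theorem parityMat_apply (s : ZMod 2) (a b : Idx m n) :
    D.parityMat s a b = if a = b then ksign s (D.vpar b) else 0 := by
  rw [parityMat, Matrix.diagonal_apply]; split_ifs with h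
  · rw [h]
  · rfl

theorem kInv_parity_apply (i : Fin (m / 2 + n)) (s : ZMod 2) (a b : Idx m n) :
    (D.kInvMat i * D.parityMat s) a b =
      if a = b then q ^ (-D.ip (D.simpleRoot i) (wt b)) * ksign s (D.vpar b) else 0 := by
  rw [parityMat, Matrix.mul_diagonal, kInvMat_apply]; split_ifs <;> simp

theorem eMat_apply (i : Fin (m / 2 + n)) (a b : Idx m n) :
    D.eMat i a b = if wt a = wt b + D.simpleRoot i then 1 else 0 := rfl

/-- The `f_i` impose no further condition on `κ`: the signs in their matrix entries are matched by
`sgq_arrow`, and the common factor `fCoeff` drops out. -/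
theorem IsKappa.arrow_f {κ : Idx m n → Cq} (hκ : D.IsKappa κ) {i : Fin (m / 2 + n)} {p p' : Idx m n}
    (h : wt p' = wt p + D.simpleRoot i) :
    D.sgq p' * κ p = -(ksign (D.vpar p') (D.par (D.simpleRoot i)) *
      (q ^ (-D.ip (D.simpleRoot i) (wt p')) * (D.sgq p * κ p'))) := by
  rw [hκ.arrow h, sgq_arrow h, zpow_neg]
  have := zpow_ne_zero (D.ip (D.simpleRoot i) (wt p')) q_ne_zero
  have h1 := ksign_mul_self (D.vpar p) (D.par (D.simpleRoot i))
  have h2 := ksign_mul_self (D.vpar p') (D.par (D.simpleRoot i))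
  set x := ksign (D.vpar p) (D.par (D.simpleRoot i))
  set y := ksign (D.vpar p') (D.par (D.simpleRoot i))
  field_simp
  linear_combination (-D.sgq p' * κ p) * (h2 * (x * x) + h1)

theorem IsKappa.isContravariantForm {κ : Idx m n → Cq} (hκ : D.IsKappa κ) :
    D.IsContravariantForm (formMat κ) where
  even a b h := by
    rw [formMat, Matrix.of_apply, ite_ne_right_iff] at h
    rw [h.1, vpar_rev]
  nondegenerate := formMat_isUnit hκ.ne_zero
  contravariant x a b := by
    rw [sum_mul_formMat κ (fun c => D.natOp x c a), sum_formMat_mul κ (fun c => D.antipodeOp x c b)]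
    have hc : a.rev = b ↔ b.rev = a := by
      constructor <;> (rintro rfl; rw [Fin.rev_rev])
    cases x with
    | e i =>
      simp only [natOp, antipodeOp, genPar, Matrix.neg_apply, kInvMat, Matrix.mul_diagonal, eMat_apply]
      have := arrow_rev_iff (p := a) (p' := b.rev) (α := D.simpleRoot i)
      rw [Fin.rev_rev] at this
      simp only [this]
      split_ifs with h
      · rw [hκ.arrow h, ip_rev, zpow_neg]; ring
      · simp
    | f i =>
      simp only [natOp, antipodeOp, genPar, Matrix.neg_apply, kMat, Matrix.diagonal_mul, fMat_apply]
      have := arrow_rev_iff (p := b.rev) (p' := a) (α := D.simpleRoot i)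
      rw [Fin.rev_rev] at this
      simp only [this]
      split_ifs with h
      · have := hκ.arrow_f h
        rw [sgq_rev] at this
        rw [ip_rev]
        linear_combination D.fCoeff i * this
      · simp
    | k i =>
      simp only [natOp, antipodeOp, genPar, kMat_apply, kInvMat_apply, ksign_zero_right, hc]
      split_ifs with h
      · rw [← h, ip_rev]; ring
      · simp
    | kInv i =>
      simp only [natOp, antipodeOp, genPar, kMat_apply, kInvMat_apply, ksign_zero_right, hc]
      split_ifs with h
      · rw [← h, ip_rev]; simp [mul_comm]
      · simp
    | sigma h =>
      simp only [natOp, antipodeOp, genPar, Matrix.neg_apply, Matrix.one_apply, ksign_zero_right, hc]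
      split_ifs with h
      · rw [h]; ring
      · simp

theorem capMat_apply (κ : Idx m n → Cq) (w' : Word m n 0) (a b : Idx m n) :
    capMat κ w' ![a, b] = formMat κ a b := rfl

theorem cupMat_apply (κ : Idx m n → Cq) (w : Word m n 0) (a b : Idx m n) :
    cupMat κ ![a, b] w = if b = a.rev then (κ b)⁻¹ else 0 := rfl

theorem cap_mul_apply (κ : Idx m n → Cq) {k : ℕ} (M : TMat m n k 2) (w' : Word m n 0) (w : Word m n k) :
    (capMat κ * M) w' w = ∑ s, κ s * M ![s, s.rev] w := by
  rw [Matrix.mul_apply, sum_word_two]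
  exact Finset.sum_congr rfl fun s _ => sum_formMat_mul κ (fun t => M ![s, t] w) s

theorem mul_cup_apply (κ : Idx m n → Cq) {k : ℕ} (M : TMat m n 2 k) (w' : Word m n k) (w : Word m n 0) :
    (M * cupMat κ) w' w = ∑ s, M w' ![s.rev, s] * (κ s)⁻¹ := by
  rw [Matrix.mul_apply, sum_word_two, Finset.sum_comm]
  refine Finset.sum_congr rfl fun s _ => ?_
  rw [Finset.sum_eq_single s.rev]
  · congr 1; simp [cupMat]
  · intro b _ hb
    have : cupMat κ ![b, s] w = 0 := if_neg fun h => hb (by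
      have h' : s = b.rev := h
      rw [h', Fin.rev_rev])
    rw [this, mul_zero]
  · simp

/-- For `e_i` and `f_i` only two terms contribute to an entry, one for each tensor factor, and the
recursion for `κ` says that they cancel. -/
theorem isHom_cap {κ : Idx m n → Cq} (hκ : D.IsKappa κ) : D.IsHom (capMat κ) := by
  refine ⟨fun w' w h => ?_, fun x => ?_⟩
  · have h : (if w 1 = (w 0).rev then κ (w 0) else 0) ≠ 0 := h
    rw [ite_ne_right_iff] at h
    rw [word_two w, wpar_two, h.1, vpar_rev, CharTwo.add_self_eq_zero]; rfl
  · ext w' w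
    rw [word_two w, cap_mul_apply]
    generalize w 0 = a
    generalize w 1 = b
    cases x with
    | e i =>
      simp only [genOp, sumMat_zero, Matrix.zero_mul, Matrix.zero_apply, sumMat_two, genPar, kMat_apply,
        parityMat_apply, eMat_apply, mul_add, Finset.sum_add_distrib]
      rw [Finset.sum_eq_single b.rev (fun c _ hc => by
          rw [if_neg (c := c.rev = b) (fun h => hc (by rw [← h, Fin.rev_rev])), mul_zero, mul_zero]) (by simp),
        Finset.sum_eq_single a (fun c _ hc => by rw [if_neg (c := c = a) hc, zero_mul, mul_zero]) (by simp)]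
      have := arrow_rev_iff (p := a) (p' := b.rev) (α := D.simpleRoot i)
      rw [Fin.rev_rev] at this
      simp only [this, Fin.rev_rev, if_true]
      split_ifs with h
      · rw [hκ.arrow h, ip_rev, zpow_neg, ksign_comm]
        have := zpow_ne_zero (D.ip (D.simpleRoot i) (wt b)) q_ne_zero
        field_simp; ring
      · simp
    | f i =>
      simp only [genOp, sumMat_zero, Matrix.zero_mul, Matrix.zero_apply, sumMat_two, genPar, fMat_apply,
        kInv_parity_apply, Matrix.one_apply, mul_add, Finset.sum_add_distrib]
      rw [Finset.sum_eq_single b.rev (fun c _ hc => by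
          rw [if_neg (c := c.rev = b) (fun h => hc (by rw [← h, Fin.rev_rev])), mul_zero, mul_zero]) (by simp),
        Finset.sum_eq_single a (fun c _ hc => by rw [if_neg (c := c = a) hc, zero_mul, mul_zero]) (by simp)]
      have := arrow_rev_iff (p := b.rev) (p' := a) (α := D.simpleRoot i)
      rw [Fin.rev_rev] at this
      simp only [this, Fin.rev_rev, if_true]
      split_ifs with h
      · have := hκ.arrow_f h
        rw [sgq_rev] at this
        rw [ksign_comm]
        linear_combination D.fCoeff i * this
      · simp
    | k i =>
      simp only [genOp, powMat_zero, Matrix.one_mul, powMat_two, kMat_apply]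
      rw [Finset.sum_eq_single a (fun c _ hc => by rw [if_neg (c := c = a) hc, zero_mul, mul_zero]) (by simp)]
      rw [capMat_apply, formMat, Matrix.of_apply, if_pos rfl]
      split_ifs with h1 h2 h2
      · rw [← h1, ip_rev, zpow_neg, mul_inv_cancel₀ (zpow_ne_zero _ q_ne_zero), mul_one]
      · exact absurd h1.symm h2
      · exact absurd h2.symm h1
      · simp
    | kInv i =>
      simp only [genOp, powMat_zero, Matrix.one_mul, powMat_two, kInvMat_apply]
      rw [Finset.sum_eq_single a (fun c _ hc => by rw [if_neg (c := c = a) hc, zero_mul, mul_zero]) (by simp)]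
      rw [capMat_apply, formMat, Matrix.of_apply, if_pos rfl]
      split_ifs with h1 h2 h2
      · rw [← h1, ip_rev, neg_neg, zpow_neg, inv_mul_cancel₀ (zpow_ne_zero _ q_ne_zero), mul_one]
      · exact absurd h1.symm h2
      · exact absurd h2.symm h1
      · simp
    | sigma h =>
      rw [← cap_mul_apply κ _ w']
      simp only [genOp, powMat_zero, Matrix.one_mul, natOp_sigma_two, Matrix.mul_one]

theorem isHom_cup {κ : Idx m n → Cq} (hκ : D.IsKappa κ) : D.IsHom (cupMat κ) := by
  refine ⟨fun w w' h => ?_, fun x => ?_⟩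
  · have h : (if w 1 = (w 0).rev then (κ (w 1))⁻¹ else 0) ≠ 0 := h
    rw [ite_ne_right_iff] at h
    rw [word_two w, wpar_two, h.1, vpar_rev, CharTwo.add_self_eq_zero]; rfl
  · ext w w'
    rw [word_two w, mul_cup_apply]
    generalize w 0 = a
    generalize w 1 = b
    have hr : ∀ c, c ≠ a.rev → a ≠ c.rev := fun c hc h => hc (by rw [h, Fin.rev_rev])
    cases x with
    | e i =>
      simp only [genOp, sumMat_zero, Matrix.mul_zero, Matrix.zero_apply, sumMat_two, genPar, kMat_apply,
        parityMat_apply, eMat_apply, add_mul, Finset.sum_add_distrib]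
      rw [Finset.sum_eq_single b (fun c _ hc => by
          rw [if_neg (c := b = c) hc.symm, mul_zero, zero_mul]) (by simp),
        Finset.sum_eq_single a.rev (fun c _ hc => by
          rw [if_neg (c := a = c.rev) (hr c hc), zero_mul, zero_mul]) (by simp)]
      have := arrow_rev_iff (p := b.rev) (p' := a) (α := D.simpleRoot i)
      rw [Fin.rev_rev] at this
      simp only [← this, Fin.rev_rev, if_true]
      split_ifs with h
      · rw [hκ.arrow h, vpar_rev, ksign_comm (D.par _)]
        have := zpow_ne_zero (D.ip (D.simpleRoot i) (wt b)) q_ne_zero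
        have := hκ.ne_zero a.rev
        rcases ksign_eq (D.vpar a) (D.par (D.simpleRoot i)) with h | h <;> rw [h] <;> field_simp <;> ring
      · simp
    | f i =>
      simp only [genOp, sumMat_zero, Matrix.mul_zero, Matrix.zero_apply, sumMat_two, genPar, fMat_apply,
        kInv_parity_apply, Matrix.one_apply, add_mul, Finset.sum_add_distrib]
      rw [Finset.sum_eq_single b (fun c _ hc => by
          rw [if_neg (c := b = c) hc.symm, mul_zero, zero_mul]) (by simp),
        Finset.sum_eq_single a.rev (fun c _ hc => by
          rw [if_neg (c := a = c.rev) (hr c hc), zero_mul, zero_mul]) (by simp)]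
      have := arrow_rev_iff (p := a) (p' := b.rev) (α := D.simpleRoot i)
      rw [Fin.rev_rev] at this
      simp only [← this, Fin.rev_rev, if_true]
      split_ifs with h
      · have := hκ.arrow_f h
        have h1 := hκ.ne_zero a.rev
        have h2 := hκ.ne_zero b
        rw [sgq_rev, ip_rev, neg_neg, vpar_rev] at this
        rw [ksign_comm, zpow_neg]
        have h3 := zpow_ne_zero (D.ip (D.simpleRoot i) (wt a)) q_ne_zero
        have h4 : D.sgq a = -(ksign (D.vpar a) (D.par (D.simpleRoot i)) *
            (q ^ D.ip (D.simpleRoot i) (wt a) * (D.sgq b * κ a.rev))) * (κ b)⁻¹ := by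
          rw [← this, mul_assoc, mul_inv_cancel₀ h2, mul_one]
        rw [sgq_rev, sgq_rev, h4]
        rcases ksign_eq (D.vpar a) (D.par (D.simpleRoot i)) with h | h <;> rw [h] <;> field_simp <;> ring
      · simp
    | k i =>
      simp only [genOp, powMat_zero, Matrix.mul_one, powMat_two, kMat_apply]
      rw [Finset.sum_eq_single b (fun c _ hc => by
          rw [if_neg (c := b = c) hc.symm, mul_zero, zero_mul]) (by simp)]
      rw [cupMat_apply]
      by_cases h : a = b.rev
      · subst h
        rw [if_pos rfl, if_pos (Fin.rev_rev b).symm, if_pos rfl, ip_rev, zpow_neg,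
          inv_mul_cancel₀ (zpow_ne_zero _ q_ne_zero), one_mul]
      · rw [if_neg h, if_neg (c := b = a.rev) (fun h' => h (by rw [h', Fin.rev_rev])), zero_mul, zero_mul]
    | kInv i =>
      simp only [genOp, powMat_zero, Matrix.mul_one, powMat_two, kInvMat_apply]
      rw [Finset.sum_eq_single b (fun c _ hc => by
          rw [if_neg (c := b = c) hc.symm, mul_zero, zero_mul]) (by simp)]
      rw [cupMat_apply]
      by_cases h : a = b.rev
      · subst h
        rw [if_pos rfl, if_pos (Fin.rev_rev b).symm, if_pos rfl, ip_rev, neg_neg, zpow_neg,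
          mul_inv_cancel₀ (zpow_ne_zero _ q_ne_zero), one_mul]
      · rw [if_neg h, if_neg (c := b = a.rev) (fun h' => h (by rw [h', Fin.rev_rev])), zero_mul, zero_mul]
    | sigma h =>
      rw [← mul_cup_apply κ _ _ w']
      simp only [genOp, powMat_zero, Matrix.one_mul, natOp_sigma_two, Matrix.mul_one]

variable (D) in
/-- The ratio of the coefficients of an invariant form at the two ends of an arrow `p → p'`. -/
def ratio (p' p : Idx m n) : Cq :=
  -(ksign (D.vpar p) (D.vpar p + D.vpar p') * q ^ (D.ip (wt p') (wt p') - D.ip (wt p) (wt p')))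

theorem isKappa_iff {κ : Idx m n → Cq} : D.IsKappa κ ↔ (∀ a, κ a ≠ 0) ∧
    ∀ {i : Fin (m / 2 + n)} {p p' : Idx m n}, wt p' = wt p + D.simpleRoot i → κ p' = D.ratio p' p * κ p := by
  have : ∀ {i : Fin (m / 2 + n)} {p p' : Idx m n}, wt p' = wt p + D.simpleRoot i →
      -(ksign (D.vpar p) (D.par (D.simpleRoot i)) * q ^ D.ip (D.simpleRoot i) (wt p') * κ p) =
      D.ratio p' p * κ p := fun h => by
    rw [ratio, par_arrow (D := D) h, ip_arrow h]; ring
  constructor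
  · exact fun h => ⟨h.ne_zero, fun e => by rw [h.arrow e, this e]⟩
  · exact fun h => ⟨h.1, fun e => by rw [h.2 e, this e]⟩

theorem ratio_ne_zero (p' p : Idx m n) : D.ratio p' p ≠ 0 :=
  neg_ne_zero.2 (mul_ne_zero (ksign_ne_zero _ _) (zpow_ne_zero _ q_ne_zero))

theorem ip_eq_zero {a b : Idx m n} (h : a ≠ b) (h' : a ≠ b.rev) : D.ip (wt a) (wt b) = 0 := by
  rw [ip_wt, if_neg h, if_neg h']; simp

/-- The two prongs of the fork are mirror images of each other; that the ratio is insensitive to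
mirroring one end makes the recursion consistent there. -/
theorem ratio_rev_left {p p' : Idx m n} (h : p ≠ p') (h' : p ≠ p'.rev) :
    D.ratio p'.rev p = D.ratio p' p := by
  rw [ratio, ratio, vpar_rev, ip_eq_zero h h', wt_rev, ip_neg_left, ip_neg_right, ip_neg_right,
    ip_eq_zero h h']
  simp

theorem ratio_rev_right {p p' : Idx m n} (h : p ≠ p') (h' : p ≠ p'.rev) :
    D.ratio p' p.rev = D.ratio p' p := by
  rw [ratio, ratio, vpar_rev, ip_eq_zero h h', wt_rev, ip_neg_left, ip_eq_zero h h']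
  simp

theorem rev_mk {a b : ℕ} (ha : a < m + 2 * n) (hb : b < m + 2 * n) (h : a + b + 1 = m + 2 * n) :
    Fin.rev (⟨a, ha⟩ : Idx m n) = ⟨b, hb⟩ := by
  ext; simp only [Fin.val_rev]; omega

/-- The coefficients are products of ratios, built up from the last index. Away from the fork the
arrows join consecutive indices, so nothing is left to check. At the fork the two middle
coefficients are set equal, and the arrows that skip an index follow from `ratio_rev_left` and
`ratio_rev_right`. -/
theorem exists_isKappa (hmn : ¬ (m = 2 ∧ n = 0)) : ∃ κ, D.IsKappa κ := by
  classical
  let step : ℕ → Cq := fun t => if h : t + 1 < m + 2 * n then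
    (if D.forked ∧ t + 1 = m / 2 + n then 1 else D.ratio ⟨t, by omega⟩ ⟨t + 1, h⟩) else 1
  have hstep : ∀ t, step t ≠ 0 := by
    intro t; simp only [step]; split_ifs
    exacts [one_ne_zero, ratio_ne_zero _ _, one_ne_zero]
  let κ : ℕ → Cq := fun a => ∏ t ∈ Finset.Ico a (m + 2 * n - 1), step t
  have hκ : ∀ a, a + 1 < m + 2 * n → κ a = step a * κ (a + 1) := fun a ha => by
    simp only [κ]; rw [Finset.prod_eq_prod_Ico_succ_bot (by omega)]
  have htie : ∀ a, D.forked → a + 1 = m / 2 + n → a + 1 < m + 2 * n → κ a = κ (a + 1) := fun a h h' h'' => by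
    rw [hκ a h'']; simp only [step]; rw [dif_pos h'', if_pos ⟨h, h'⟩, one_mul]
  have hrat : ∀ a, (h : a + 1 < m + 2 * n) → ¬ (D.forked ∧ a + 1 = m / 2 + n) →
      κ a = D.ratio ⟨a, by omega⟩ ⟨a + 1, h⟩ * κ (a + 1) := fun a h h' => by
    rw [hκ a h]; simp only [step]; rw [dif_pos h, if_neg h']
  refine ⟨fun a => κ a, isKappa_iff.2 ⟨fun a => Finset.prod_ne_zero_iff.2 fun t _ => hstep t, ?_⟩⟩
  rintro i ⟨p, hp⟩ ⟨p', hp'⟩ h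
  rcases arrow_cases hmn h with ⟨h1, h2⟩ | ⟨hD, h1, h2⟩
  · simp only at h1 h2 ⊢
    subst h1
    rw [hrat p' hp h2]
  · have := hD.1
    simp only at h1 h2 ⊢
    subst h1
    rcases h2 with h2 | h2
    · rw [hrat p' (by omega) (by omega), htie (p' + 1) hD (by omega) (by omega),
        ← rev_mk (a := p' + 1) (by omega) hp (by omega), ratio_rev_right]
      · simp [Fin.ext_iff]
      · rw [ne_eq, eq_rev_iff]; simp only; omega
    · rw [htie p' hD (by omega) (by omega), hrat (p' + 1) (by omega) (by omega),
        ← rev_mk hp' (b := p' + 1) (by omega) (by omega), ratio_rev_left]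
      · rw [ne_eq, Fin.ext_iff]; simp only; omega
      · rw [ne_eq, eq_rev_iff]; simp only; omega

/-- Both middle vectors are joined to the vector of index `L - 2` by arrows with the same ratio, so
the equality holds for every solution of the recursion. -/
theorem IsKappa.tie {κ : Idx m n → Cq} (hκ : D.IsKappa κ) (hmn : ¬ (m = 2 ∧ n = 0)) (hD : D.forked)
    {a b : Idx m n} (ha : a.val + 1 = m / 2 + n) (hb : b.val = m / 2 + n) : κ a = κ b := by
  have h2 := hD.two_le hmn
  have hm := hD.1
  have e1 := (isKappa_iff.1 hκ).2 (arrow_lt (D := D) (j := m / 2 + n - 2) (by omega))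
  have e2 := (isKappa_iff.1 hκ).2 (arrow_forked hD h2)
  obtain ⟨a, ha'⟩ := a
  obtain ⟨b, hb'⟩ := b
  simp only at ha hb
  subst hb
  obtain rfl : a = m / 2 + n - 2 + 1 := by omega
  have e3 : D.ratio (⟨m / 2 + n - 2, by omega⟩ : Idx m n) ⟨m / 2 + n, hb'⟩ =
      D.ratio ⟨m / 2 + n - 2, by omega⟩ ⟨m / 2 + n - 2 + 1, ha'⟩ := by
    refine (congrArg (D.ratio _) (rev_mk ha' hb' (by omega)).symm).trans (ratio_rev_right ?_ ?_)
    · rw [ne_eq, Fin.ext_iff]; simp only; omega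
    · rw [ne_eq, eq_rev_iff]; simp only; omega
  rw [e1, e3] at e2
  exact mul_left_cancel₀ (ratio_ne_zero _ _) e2

end RootDatum
end
end OspBMW

/-! ### The entries of the braiding -/

namespace OspBMW
noncomputable section

section identities

/-- The coincidences between two indices `p ≠ p'`, a third one `b`, and their mirror images:
`A : p = b`, `A' : p = b̄`, `C : p' = b`, `C' : p' = b̄`, `M : p = p̄`, `M' : p' = p̄'`, `X : p = p̄'`;
the parities are `o`, `o'`, `ob`. -/
structure Coincidence (A A' C C' M M' X : Prop) (o o' ob : Bool) : Prop where
  AC : ¬ (A ∧ C)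
  AC' : ¬ (A' ∧ C')
  A_iff : A → ((A' ↔ M) ∧ (C' ↔ X) ∧ ob = o)
  A'_iff : A' → ((A ↔ M) ∧ (C ↔ X) ∧ ob = o)
  C_iff : C → ((C' ↔ M') ∧ (A' ↔ X) ∧ ob = o')
  C'_iff : C' → ((C ↔ M') ∧ (A ↔ X) ∧ ob = o')
  M_imp : M → ¬ X ∧ ¬ M' ∧ o = false
  M'_imp : M' → ¬ X ∧ ¬ M ∧ o' = false
  X_imp : X → o = o'

variable {K : Type*} [Field K] {A A' C C' M M' X : Prop} {o o' ob : Bool}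
  [Decidable A] [Decidable A'] [Decidable C] [Decidable C'] [Decidable X]

/-- The equality of entries required in `braid_comm_e`. The consistency conditions leave finitely
many patterns of coincidences and parities, and for each of them it is an identity between powers of
`u`. -/
theorem Coincidence.identity_e [Decidable M'] (h : Coincidence A A' C C' M M' X o o' ob) {u : K} (hu : u ≠ 0)
    {pb p'b p'p' pp' : ℤ} {σ' σ kp kb : K}
    (h1 : pb = (if o then -1 else 1) * ((if A then 1 else 0) - (if A' then 1 else 0)))
    (h2 : p'b = (if o' then -1 else 1) * ((if C then 1 else 0) - (if C' then 1 else 0)))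
    (h3 : p'p' = (if o' then -1 else 1) * (1 - (if M' then 1 else 0)))
    (h4 : pp' = (if o then -1 else 1) * (0 - (if X then 1 else 0)))
    (h5 : σ' = if o' ∧ ob then -1 else 1) (h6 : σ = if o ∧ ob then -1 else 1)
    (h7 : kp = if o ∧ ¬ o' then -1 else 1) (h8 : kb = if ob ∧ ¬ (o = o') then -1 else 1) :
    σ' * u ^ p'b * u ^ (p'b - pb) + kp * ((u - u⁻¹) * ((if A then 1 else 0) -
        (if C' then -(kp * u ^ (-(p'p' - pp'))) else 0))) =
      u ^ (p'p' - pp') * ((u - u⁻¹) * ((if C then 1 else 0) -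
        (if A' then -(kp * u ^ (-(p'p' - pp'))) else 0))) + kb * (σ * u ^ pb) := by
  obtain ⟨a1, a2, a3, a4, a5, a6, a7, a8, a9⟩ := h
  subst h1 h2 h3 h4 h5 h6 h7 h8
  by_cases hM : M <;> by_cases hM' : M' <;> by_cases hX : X <;> by_cases hA : A <;> by_cases hC : C <;>
    by_cases hA' : A' <;> by_cases hC' : C' <;>
    simp only [hM, hM', hX, hA, hC, hA', hC', not_true_eq_false, and_self, and_true, and_false, true_and,
      false_and, not_false_eq_true, true_implies, false_implies, iff_true, iff_false, iff_self] at a1 a2 a3 a4 a5 a6 a7 a8 a9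
  all_goals cases o <;> cases o' <;> cases ob
  all_goals try simp only [Bool.false_eq_true, Bool.true_eq_false] at a3 a4 a5 a6 a7 a8 a9
  all_goals norm_num [hM, hM', hX, hA, hC, hA', hC']
  all_goals try field_simp
  all_goals try ring

theorem Coincidence.identity_f [Decidable M] (h : Coincidence A A' C C' M M' X o o' ob) {u : K} (hu : u ≠ 0)
    {pb p'b pp pp' : ℤ} {σ' σ kp kp' kb s s' sb : K}
    (h1 : pb = (if o then -1 else 1) * ((if A then 1 else 0) - (if A' then 1 else 0)))
    (h2 : p'b = (if o' then -1 else 1) * ((if C then 1 else 0) - (if C' then 1 else 0)))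
    (h3 : pp = (if o then -1 else 1) * (1 - (if M then 1 else 0)))
    (h4 : pp' = (if o then -1 else 1) * (0 - (if X then 1 else 0)))
    (h5 : σ' = if o' ∧ ob then -1 else 1) (h6 : σ = if o ∧ ob then -1 else 1)
    (h7 : kp = if o ∧ ¬ o' then -1 else 1) (h7' : kp' = if o' ∧ ¬ o then -1 else 1)
    (h8 : kb = if ob ∧ ¬ (o = o') then -1 else 1)
    (h9 : s = if o then -1 else 1) (h10 : s' = if o' then -1 else 1) (h11 : sb = if ob then -1 else 1) :
    sb * ((u - u⁻¹) * ((if C then 1 else 0) - (if A' then -(kp' * u ^ (pp' - pp)) else 0))) +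
        u ^ (-(p'b - pb)) * kb * (s' * (σ * u ^ pb)) =
      s' * (σ' * u ^ p'b) + u ^ (-(pp' - pp)) * kp * ((u - u⁻¹) * (s' * (if A then 1 else 0) -
        s * (if C' then -(kp' * u ^ (pp' - pp)) else 0))) := by
  obtain ⟨a1, a2, a3, a4, a5, a6, a7, a8, a9⟩ := h
  subst h1 h2 h3 h4 h5 h6 h7 h7' h8 h9 h10 h11
  by_cases hM : M <;> by_cases hM' : M' <;> by_cases hX : X <;> by_cases hA : A <;> by_cases hC : C <;>
    by_cases hA' : A' <;> by_cases hC' : C' <;>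
    simp only [hM, hM', hX, hA, hC, hA', hC', not_true_eq_false, and_self, and_true, and_false, true_and,
      false_and, not_false_eq_true, true_implies, false_implies, iff_true, iff_false, iff_self] at a1 a2 a3 a4 a5 a6 a7 a8 a9
  all_goals cases o <;> cases o' <;> cases ob
  all_goals try simp only [Bool.false_eq_true, Bool.true_eq_false] at a3 a4 a5 a6 a7 a8 a9
  all_goals norm_num [hM, hM', hX, hA, hC, hA', hC']
  all_goals try field_simp
  all_goals try ring

end identities

namespace RootDatum
variable {m n : ℕ} {D : RootDatum m n}

theorem eq_rev_comm {a b : Idx m n} : a = b.rev ↔ b = a.rev := by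
  rw [eq_rev_iff, eq_rev_iff]; omega

variable (D) in
theorem coincidence {p p' : Idx m n} (hpp : p ≠ p') (b : Idx m n) :
    Coincidence (p = b) (p = b.rev) (p' = b) (p' = b.rev) (p = p.rev) (p' = p'.rev) (p = p'.rev)
      (D.odd p) (D.odd p') (D.odd b) where
  AC h := hpp (h.1.trans h.2.symm)
  AC' h := hpp (h.1.trans h.2.symm)
  A_iff h := ⟨by rw [h], by rw [h, eq_rev_comm], by rw [h]⟩
  A'_iff h := ⟨by rw [h, Fin.rev_rev, eq_comm], by rw [h, Fin.rev_inj, eq_comm], by rw [h, odd_rev]⟩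
  C_iff h := ⟨by rw [h], by rw [h], by rw [h]⟩
  C'_iff h := ⟨by rw [h, Fin.rev_rev, eq_comm], by rw [h, Fin.rev_rev], by rw [h, odd_rev]⟩
  M_imp h := ⟨fun h' => hpp (Fin.rev_injective (h.symm.trans h')), fun h' => hpp (by
    rw [eq_rev_iff] at h h'; exact Fin.ext (by omega)), odd_of_rev_eq D h⟩
  M'_imp h := ⟨fun h' => hpp (h'.trans h.symm), fun h' => hpp (by
    rw [eq_rev_iff] at h h'; exact Fin.ext (by omega)), odd_of_rev_eq D h⟩
  X_imp h := by rw [h, odd_rev]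

theorem ksign_vpar (a b : Idx m n) : ksign (D.vpar a) (D.vpar b) = if D.odd a ∧ D.odd b then -1 else 1 := by
  rw [vpar_eq, vpar_eq, ksign]; cases D.odd a <;> cases D.odd b <;> simp

theorem ksign_vpar_add (a b c : Idx m n) : ksign (D.vpar c) (D.vpar a + D.vpar b) =
    if D.odd c ∧ ¬ (D.odd a = D.odd b) then -1 else 1 := by
  have h2 : (1 + 1 : ZMod 2) = 0 := rfl
  rw [vpar_eq, vpar_eq, vpar_eq, ksign]; cases D.odd a <;> cases D.odd b <;> cases D.odd c <;> simp [h2]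

/-- The entries of the braiding. -/
def braidEntry (D : RootDatum m n) (κ : Idx m n → Cq) (x y a b : Idx m n) : Cq :=
  (if x = b ∧ y = a then ksign (D.vpar a) (D.vpar b) * q ^ D.ip (wt a) (wt b) else 0) +
  (if b < x then (q - q⁻¹) * ((if x = a ∧ y = b then 1 else 0) -
    (if y = x.rev ∧ b = a.rev then κ a / κ y else 0)) else 0)

/-- The entries of the inverse of the braiding. -/
def braidInvEntry (D : RootDatum m n) (κ : Idx m n → Cq) (x y a b : Idx m n) : Cq :=
  (if x = b ∧ y = a then ksign (D.vpar a) (D.vpar b) * q ^ (-D.ip (wt a) (wt b)) else 0) -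
  (if x < b then (q - q⁻¹) * ((if x = a ∧ y = b then 1 else 0) -
    (if y = x.rev ∧ b = a.rev then κ a / κ y else 0)) else 0)

/-- The braiding. -/
def braidMat (D : RootDatum m n) (κ : Idx m n → Cq) : TMat m n 2 2 :=
  Matrix.of fun w' w => D.braidEntry κ (w' 0) (w' 1) (w 0) (w 1)

/-- The inverse of the braiding. -/
def braidInvMat (D : RootDatum m n) (κ : Idx m n → Cq) : TMat m n 2 2 :=
  Matrix.of fun w' w => D.braidInvEntry κ (w' 0) (w' 1) (w 0) (w 1)

theorem braidMat_apply (κ : Idx m n → Cq) (x y a b : Idx m n) :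
    D.braidMat κ ![x, y] ![a, b] = D.braidEntry κ x y a b := rfl

theorem braidInvMat_apply (κ : Idx m n → Cq) (x y a b : Idx m n) :
    D.braidInvMat κ ![x, y] ![a, b] = D.braidInvEntry κ x y a b := rfl

theorem IsKappa.div_eq {κ : Idx m n → Cq} (hκ : D.IsKappa κ) {i : Fin (m / 2 + n)} {p p' : Idx m n}
    (h : wt p' = wt p + D.simpleRoot i) :
    κ p / κ p' = -(ksign (D.vpar p) (D.par (D.simpleRoot i)) * q ^ (-D.ip (D.simpleRoot i) (wt p'))) := by
  have h1 := hκ.ne_zero p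
  have h2 := hκ.ne_zero p'
  have h3 := zpow_ne_zero (D.ip (D.simpleRoot i) (wt p')) q_ne_zero
  rw [div_eq_iff h2, hκ.arrow h, zpow_neg]
  rcases ksign_eq (D.vpar p) (D.par (D.simpleRoot i)) with h | h <;> rw [h] <;> field_simp

/-- For `x ≠ b` the two truncations complement each other. For `x = b` the swap terms must supply
the missing entry of `z (1 - U Ω)`, and they do, because the pairing of two weights of `V_q` is `0`
or `±1`. -/
theorem braid_sub_braidInv {κ : Idx m n → Cq} (hκ : ∀ a, κ a ≠ 0) :
    D.braidMat κ - D.braidInvMat κ = (q - q⁻¹) • (1 - cupMat κ * capMat κ) := by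
  apply matrix_ext_two
  intro x y a b
  rw [Matrix.sub_apply, braidMat_apply, braidInvMat_apply, Matrix.smul_apply, Matrix.sub_apply,
    Matrix.one_apply, Matrix.mul_apply, Fintype.sum_unique, cupMat_apply, capMat_apply, formMat,
    Matrix.of_apply, braidEntry, braidInvEntry]
  have e1 : (![x, y] = ![a, b]) ↔ (x = a ∧ y = b) := by rw [word_two_eq_iff]; rfl
  have e2 : (if y = x.rev then (κ y)⁻¹ else 0) * (if b = a.rev then κ a else 0) =
      (if y = x.rev ∧ b = a.rev then κ a / κ y else 0) := by
    by_cases h1 : y = x.rev <;> by_cases h2 : b = a.rev <;> simp [h1, h2]; field_simp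
  rw [e2, smul_eq_mul]
  simp only [e1]
  set w := (q - q⁻¹) * ((if x = a ∧ y = b then 1 else 0) -
    (if y = x.rev ∧ b = a.rev then κ a / κ y else 0)) with hw
  rcases lt_trichotomy b x with h | h | h
  · have hn : ¬ (x = b ∧ y = a) := fun h' => h.ne' h'.1
    rw [if_neg hn, if_neg hn, if_pos h, if_neg (not_lt.2 h.le)]; ring
  · subst h
    rw [if_neg (lt_irrefl _)]
    by_cases hy : y = a
    · subst hy
      have h0 := hκ y
      rw [if_pos ⟨rfl, rfl⟩, if_pos ⟨rfl, rfl⟩, hw, ip_wt, ksign_vpar]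
      have f1 : y = b ↔ b = y := eq_comm
      have f2 : y = b.rev ↔ b = y.rev := eq_rev_comm
      simp only [f1, f2, and_self]
      by_cases c1 : b = y <;> by_cases c2 : b = y.rev
      · rw [c1] at c2
        simp [c1, ← c2, h0]
      · subst c1
        simp only [c2, if_true, if_false, sg, and_self]
        cases D.odd b
        · simp
        · simp; ring
      · have ho : D.odd b = D.odd y := by rw [c2, odd_rev]
        rw [if_neg c1, if_pos c2]
        have c3 : ¬ y.rev = y := c2 ▸ c1
        simp only [c2, c3, if_true, if_false, sg, and_self, odd_rev]
        cases D.odd y <;> simp [h0]; ring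
      · simp [c1, c2]
    · rw [if_neg (fun h => hy h.2), if_neg (fun h => hy h.2), hw, if_neg, if_neg]
      · ring
      · rintro ⟨h1, h2⟩; exact hy (h1.trans (eq_rev_comm.1 h2).symm)
      · rintro ⟨h1, h2⟩; exact hy (h2.trans h1)
  · have hn : ¬ (x = b ∧ y = a) := fun h' => h.ne h'.1
    rw [if_neg hn, if_neg hn, if_pos h, if_neg (not_lt.2 h.le)]; ring

/-- The braiding is truncated by the order of the indices, which at the fork is finer than the order
of the weights. The entries of `1 - U Ω` in question vanish by `IsKappa.tie`, so triangularity with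
respect to the roots is not spoiled. -/
theorem tie_entry_eq_zero (hmn : ¬ (m = 2 ∧ n = 0)) {κ : Idx m n → Cq} (hκ : D.IsKappa κ) {x y a b : Idx m n}
    (hD : D.forked) (h : (b.val + 1 = m / 2 + n ∧ x.val = m / 2 + n) ∨ (x.val + 1 = m / 2 + n ∧ b.val = m / 2 + n)) :
    (if x = a ∧ y = b then (1 : Cq) else 0) - (if y = x.rev ∧ b = a.rev then κ a / κ y else 0) = 0 := by
  have hm := hD.1
  have hxb : x = b.rev := by rw [eq_rev_iff]; omega
  have hiff : (x = a ∧ y = b) ↔ (y = x.rev ∧ b = a.rev) := by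
    rw [hxb, Fin.rev_rev, and_comm, eq_comm (a := b.rev), eq_rev_comm]
  rw [if_congr hiff rfl rfl]
  split_ifs with h'
  · obtain ⟨rfl, rfl⟩ := hiff.2 h'
    have : κ x = κ y := by
      rcases h with h | h
      · exact (hκ.tie hmn hD h.1 h.2).symm
      · exact hκ.tie hmn hD h.1 h.2
    rw [this, div_self (hκ.ne_zero _), sub_self]
  · simp

theorem wt_add_wt_of_entry {κ : Idx m n → Cq} {x y a b : Idx m n}
    (h : (if x = a ∧ y = b then (1 : Cq) else 0) - (if y = x.rev ∧ b = a.rev then κ a / κ y else 0) ≠ 0) :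
    wt x + wt y = wt a + wt b ∧ D.vpar x + D.vpar y = D.vpar a + D.vpar b := by
  by_cases h1 : x = a ∧ y = b
  · rw [h1.1, h1.2]; exact ⟨rfl, rfl⟩
  · by_cases h2 : y = x.rev ∧ b = a.rev
    · rw [h2.1, h2.2, wt_rev, wt_rev, vpar_rev, vpar_rev, add_neg_cancel, add_neg_cancel,
        CharTwo.add_self_eq_zero, CharTwo.add_self_eq_zero]; exact ⟨rfl, rfl⟩
    · simp [h1, h2] at h

theorem braidEntry_support (hmn : ¬ (m = 2 ∧ n = 0)) {κ : Idx m n → Cq} (hκ : D.IsKappa κ) {x y a b : Idx m n}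
    (h : D.braidEntry κ x y a b ≠ 0) : D.QPos (wt b - wt x) ∧ wt x + wt y = wt a + wt b ∧
      D.vpar x + D.vpar y = D.vpar a + D.vpar b := by
  rw [braidEntry] at h
  by_cases h1 : x = b ∧ y = a
  · rw [h1.1, h1.2, sub_self]; exact ⟨QPos.zero, add_comm _ _, add_comm _ _⟩
  rw [if_neg h1, zero_add, ite_ne_right_iff] at h
  have h3 := right_ne_zero_of_mul h.2
  refine ⟨QPos.of_lt hmn h.1 fun ht => h3 (tie_entry_eq_zero hmn hκ ht.1 (Or.inl ht.2)), wt_add_wt_of_entry h3⟩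

theorem braidInvEntry_support (hmn : ¬ (m = 2 ∧ n = 0)) {κ : Idx m n → Cq} (hκ : D.IsKappa κ) {x y a b : Idx m n}
    (h : D.braidInvEntry κ x y a b ≠ 0) : D.QPos (wt x - wt b) ∧ wt x + wt y = wt a + wt b ∧
      D.vpar x + D.vpar y = D.vpar a + D.vpar b := by
  rw [braidInvEntry] at h
  by_cases h1 : x = b ∧ y = a
  · rw [h1.1, h1.2, sub_self]; exact ⟨QPos.zero, add_comm _ _, add_comm _ _⟩
  rw [if_neg h1, zero_sub, neg_ne_zero, ite_ne_right_iff] at h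
  have h3 := right_ne_zero_of_mul h.2
  refine ⟨QPos.of_lt hmn h.1 fun ht => h3 (tie_entry_eq_zero hmn hκ ht.1 (Or.inr ht.2)), wt_add_wt_of_entry h3⟩

end RootDatum
end
end OspBMW

/-! ### The braiding is a module homomorphism -/

namespace OspBMW
noncomputable section
namespace RootDatum
variable {m n : ℕ} {D : RootDatum m n}

section commutators
variable (M : TMat m n 2 2) (i : Fin (m / 2 + n)) (x y a b : Idx m n)

theorem mul_genOp_e : (M * D.genOp 2 (.e i)) ![x, y] ![a, b] =
    (∑ s, M ![x, y] ![s, b] * if wt s = wt a + D.simpleRoot i then 1 else 0) *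
      q ^ D.ip (D.simpleRoot i) (wt b) +
    ksign (D.par (D.simpleRoot i)) (D.vpar a) *
      ∑ t, M ![x, y] ![a, t] * if wt t = wt b + D.simpleRoot i then 1 else 0 := by
  rw [Matrix.mul_apply, sum_word_two]
  simp only [genOp, sumMat_two, genPar, kMat_apply, parityMat_apply, eMat_apply, mul_add,
    Finset.sum_add_distrib]
  congr 1
  · rw [Finset.sum_mul]
    refine Finset.sum_congr rfl fun s _ => ?_
    rw [Finset.sum_eq_single b (fun t _ ht => by rw [if_neg (c := t = b) ht]; simp) (by simp)]
    rw [if_pos (c := b = b) rfl]; ring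
  · rw [Finset.sum_eq_single a (fun s _ hs => Finset.sum_eq_zero fun t _ => by
      rw [if_neg (c := s = a) hs]; simp) (by simp), Finset.mul_sum]
    refine Finset.sum_congr rfl fun s _ => ?_
    rw [if_pos (c := a = a) rfl]; ring

theorem genOp_e_mul : (D.genOp 2 (.e i) * M) ![x, y] ![a, b] =
    q ^ D.ip (D.simpleRoot i) (wt y) *
      (∑ s, M ![s, y] ![a, b] * if wt x = wt s + D.simpleRoot i then 1 else 0) +
    ksign (D.par (D.simpleRoot i)) (D.vpar x) *
      ∑ t, M ![x, t] ![a, b] * if wt y = wt t + D.simpleRoot i then 1 else 0 := by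
  rw [Matrix.mul_apply, sum_word_two]
  simp only [genOp, sumMat_two, genPar, kMat_apply, parityMat_apply, eMat_apply, add_mul,
    Finset.sum_add_distrib]
  congr 1
  · rw [Finset.mul_sum]
    refine Finset.sum_congr rfl fun s _ => ?_
    rw [Finset.sum_eq_single y (fun t _ ht => by rw [if_neg (c := y = t) ht.symm]; simp) (by simp)]
    rw [if_pos (c := y = y) rfl]; ring
  · rw [Finset.sum_eq_single x (fun s _ hs => Finset.sum_eq_zero fun t _ => by
      rw [if_neg (c := x = s) hs.symm]; simp) (by simp), Finset.mul_sum]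
    refine Finset.sum_congr rfl fun s _ => ?_
    rw [if_pos (c := x = x) rfl]; ring

theorem mul_genOp_f : (M * D.genOp 2 (.f i)) ![x, y] ![a, b] = D.fCoeff i * (
    D.sgq a * (∑ s, M ![x, y] ![s, b] * if wt a = wt s + D.simpleRoot i then 1 else 0) +
    q ^ (-D.ip (D.simpleRoot i) (wt a)) * ksign (D.par (D.simpleRoot i)) (D.vpar a) * (D.sgq b *
      ∑ t, M ![x, y] ![a, t] * if wt b = wt t + D.simpleRoot i then 1 else 0)) := by
  rw [Matrix.mul_apply, sum_word_two]
  simp only [genOp, sumMat_two, genPar, kInv_parity_apply, Matrix.one_apply, fMat_apply, mul_add,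
    Finset.sum_add_distrib]
  congr 1
  · rw [Finset.mul_sum, Finset.mul_sum]
    refine Finset.sum_congr rfl fun s _ => ?_
    rw [Finset.sum_eq_single b (fun t _ ht => by rw [if_neg (c := t = b) ht]; simp) (by simp)]
    rw [if_pos (c := b = b) rfl]; ring
  · rw [Finset.sum_eq_single a (fun s _ hs => Finset.sum_eq_zero fun t _ => by
      rw [if_neg (c := s = a) hs]; simp) (by simp), Finset.mul_sum, Finset.mul_sum, Finset.mul_sum]
    refine Finset.sum_congr rfl fun s _ => ?_
    rw [if_pos (c := a = a) rfl]; ring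

theorem genOp_f_mul : (D.genOp 2 (.f i) * M) ![x, y] ![a, b] = D.fCoeff i * (
    (∑ s, D.sgq s * M ![s, y] ![a, b] * if wt s = wt x + D.simpleRoot i then 1 else 0) +
    q ^ (-D.ip (D.simpleRoot i) (wt x)) * ksign (D.par (D.simpleRoot i)) (D.vpar x) * (
      ∑ t, D.sgq t * M ![x, t] ![a, b] * if wt t = wt y + D.simpleRoot i then 1 else 0)) := by
  rw [Matrix.mul_apply, sum_word_two]
  simp only [genOp, sumMat_two, genPar, kInv_parity_apply, Matrix.one_apply, fMat_apply, add_mul, mul_add,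
    Finset.sum_add_distrib]
  congr 1
  · rw [Finset.mul_sum]
    refine Finset.sum_congr rfl fun s _ => ?_
    rw [Finset.sum_eq_single y (fun t _ ht => by rw [if_neg (c := y = t) ht.symm]; simp) (by simp)]
    rw [if_pos (c := y = y) rfl]; ring
  · rw [Finset.sum_eq_single x (fun s _ hs => Finset.sum_eq_zero fun t _ => by
      rw [if_neg (c := x = s) hs.symm]; simp) (by simp), Finset.mul_sum, Finset.mul_sum]
    refine Finset.sum_congr rfl fun s _ => ?_
    rw [if_pos (c := x = x) rfl]; ring

variable {M i x y a b}

theorem exists_of_sum_ne_zero {f : Idx m n → Cq} {P : Idx m n → Prop} [DecidablePred P]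
    (h : ∑ s, f s * (if P s then 1 else 0) ≠ 0) : ∃ s, f s ≠ 0 ∧ P s := by
  obtain ⟨s, -, hs⟩ := Finset.exists_ne_zero_of_sum_ne_zero h
  exact ⟨s, left_ne_zero_of_mul hs, by
    by_contra h'; rw [if_neg h'] at hs; simp at hs⟩

/-- In each of the four sums `e_i` either leaves the shift `wt b - wt x` alone or changes it by
`α_i`. -/
theorem commutator_e_support {R : Wt m n → Prop}
    (hM : ∀ x y a b, M ![x, y] ![a, b] ≠ 0 → R (wt b - wt x) ∧ wt x + wt y = wt a + wt b)
    (h : (M * D.genOp 2 (.e i) - D.genOp 2 (.e i) * M) ![x, y] ![a, b] ≠ 0) :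
    (R (wt b - wt x) ∨ R (wt b - wt x + D.simpleRoot i)) ∧ wt x + wt y = wt a + wt b + D.simpleRoot i := by
  rw [Matrix.sub_apply, mul_genOp_e, genOp_e_mul] at h
  by_cases h1 : (∑ s, M ![x, y] ![s, b] * if wt s = wt a + D.simpleRoot i then 1 else 0) = 0
  · by_cases h2 : (∑ t, M ![x, y] ![a, t] * if wt t = wt b + D.simpleRoot i then 1 else 0) = 0
    · by_cases h3 : (∑ s, M ![s, y] ![a, b] * if wt x = wt s + D.simpleRoot i then 1 else 0) = 0
      · by_cases h4 : (∑ t, M ![x, t] ![a, b] * if wt y = wt t + D.simpleRoot i then 1 else 0) = 0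
        · rw [h1, h2, h3, h4] at h; simp at h
        · obtain ⟨t, ht, ht'⟩ := exists_of_sum_ne_zero h4
          obtain ⟨e1, e2⟩ := hM _ _ _ _ ht
          exact ⟨Or.inl e1, by rw [ht', ← add_assoc, e2]⟩
      · obtain ⟨t, ht, ht'⟩ := exists_of_sum_ne_zero h3
        obtain ⟨e1, e2⟩ := hM _ _ _ _ ht
        refine ⟨Or.inr ?_, by rw [ht', ← e2]; abel⟩
        convert e1 using 1; rw [ht']; abel
    · obtain ⟨t, ht, ht'⟩ := exists_of_sum_ne_zero h2
      obtain ⟨e1, e2⟩ := hM _ _ _ _ ht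
      refine ⟨Or.inr ?_, by rw [e2, ht']; abel⟩
      convert e1 using 1; rw [ht']; abel
  · obtain ⟨t, ht, ht'⟩ := exists_of_sum_ne_zero h1
    obtain ⟨e1, e2⟩ := hM _ _ _ _ ht
    exact ⟨Or.inl e1, by rw [e2, ht']; abel⟩

theorem commutator_f_support {R : Wt m n → Prop}
    (hM : ∀ x y a b, M ![x, y] ![a, b] ≠ 0 → R (wt b - wt x) ∧ wt x + wt y = wt a + wt b)
    (h : (M * D.genOp 2 (.f i) - D.genOp 2 (.f i) * M) ![x, y] ![a, b] ≠ 0) :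
    (R (wt b - wt x) ∨ R (wt b - wt x - D.simpleRoot i)) ∧ wt x + wt y + D.simpleRoot i = wt a + wt b := by
  rw [Matrix.sub_apply, mul_genOp_f, genOp_f_mul] at h
  by_cases h1 : (∑ s, M ![x, y] ![s, b] * if wt a = wt s + D.simpleRoot i then 1 else 0) = 0
  · by_cases h2 : (∑ t, M ![x, y] ![a, t] * if wt b = wt t + D.simpleRoot i then 1 else 0) = 0
    · by_cases h3 : (∑ s, D.sgq s * M ![s, y] ![a, b] * if wt s = wt x + D.simpleRoot i then 1 else 0) = 0
      · by_cases h4 : (∑ t, D.sgq t * M ![x, t] ![a, b] * if wt t = wt y + D.simpleRoot i then 1 else 0) = 0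
        · rw [h1, h2, h3, h4] at h; simp at h
        · obtain ⟨t, ht, ht'⟩ := exists_of_sum_ne_zero h4
          obtain ⟨e1, e2⟩ := hM _ _ _ _ (right_ne_zero_of_mul ht)
          exact ⟨Or.inl e1, by rw [← e2, ht']; abel⟩
      · obtain ⟨t, ht, ht'⟩ := exists_of_sum_ne_zero h3
        obtain ⟨e1, e2⟩ := hM _ _ _ _ (right_ne_zero_of_mul ht)
        refine ⟨Or.inr ?_, by rw [← e2, ht']; abel⟩
        convert e1 using 1; rw [ht']; abel
    · obtain ⟨t, ht, ht'⟩ := exists_of_sum_ne_zero h2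
      obtain ⟨e1, e2⟩ := hM _ _ _ _ ht
      refine ⟨Or.inr ?_, by rw [e2, ht']; abel⟩
      convert e1 using 1; rw [ht']; abel
  · obtain ⟨t, ht, ht'⟩ := exists_of_sum_ne_zero h1
    obtain ⟨e1, e2⟩ := hM _ _ _ _ ht
    exact ⟨Or.inl e1, by rw [e2, ht']; abel⟩

end commutators

/-- By the skein relation the two matrices differ by a multiple of the homomorphism `1 - U Ω`.
Neither is known to be a homomorphism at this point. -/
theorem commutator_braid_eq {κ : Idx m n → Cq} (hκ : D.IsKappa κ) (g : Gen m n) :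
    D.braidMat κ * D.genOp 2 g - D.genOp 2 g * D.braidMat κ =
      D.braidInvMat κ * D.genOp 2 g - D.genOp 2 g * D.braidInvMat κ := by
  have h := ((IsHom.one (D := D) 2).sub ((isHom_cup hκ).mul (isHom_cap hκ))).smul (q - q⁻¹)
  have h2 := h.2 g
  rw [← braid_sub_braidInv hκ.ne_zero, Matrix.sub_mul, Matrix.mul_sub] at h2
  rw [sub_eq_sub_iff_add_eq_add] at h2 ⊢
  rw [h2, add_comm]

theorem braidEntry_diag (κ : Idx m n → Cq) (a b : Idx m n) :
    D.braidEntry κ b a a b = ksign (D.vpar a) (D.vpar b) * q ^ D.ip (wt a) (wt b) := by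
  rw [braidEntry, if_pos ⟨rfl, rfl⟩, if_neg (lt_irrefl _), add_zero]

theorem ksign_self_add (a b : Idx m n) : ksign (D.vpar a) (D.vpar a + D.vpar b) =
    if D.odd a ∧ ¬ D.odd b then -1 else 1 := by
  rw [ksign_vpar_add]; cases D.odd a <;> cases D.odd b <;> simp

/-- The commutator inherits the triangularity of the braiding and, by `commutator_braid_eq`, also
the opposite triangularity of the second matrix. What survives are shifts `wt x - wt b` that lie,
together with their complement to `α_i`, among the sums of simple roots; as `α_i` does not
decompose, the shift is `0` or `α_i`. -/
theorem braid_comm_e (hmn : ¬ (m = 2 ∧ n = 0)) {κ : Idx m n → Cq} (hκ : D.IsKappa κ) (i : Fin (m / 2 + n)) :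
    D.braidMat κ * D.genOp 2 (.e i) = D.genOp 2 (.e i) * D.braidMat κ := by
  rw [← sub_eq_zero]
  apply matrix_ext_two
  intro x y a b
  rw [Matrix.zero_apply]
  by_contra hne
  obtain ⟨h1, h2⟩ := commutator_e_support (R := fun μ => D.QPos μ) (fun x y a b h =>
    let h := braidEntry_support hmn hκ h; ⟨h.1, h.2.1⟩) hne
  have hne' := hne
  rw [commutator_braid_eq hκ] at hne'
  obtain ⟨h3, -⟩ := commutator_e_support (R := fun μ => D.QPos (-μ)) (fun x y a b h =>
    let h := braidInvEntry_support hmn hκ h; ⟨by simpa using h.1, h.2.1⟩) hne'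
  have k1 : D.QPos (wt b - wt x + D.simpleRoot i) := by
    rcases h1 with h1 | h1
    · exact h1.add (QPos.root i)
    · exact h1
  have k2 : D.QPos (wt x - wt b) := by
    rcases h3 with h3 | h3
    · simpa using h3
    · have := h3.add (QPos.root i)
      convert this using 1; abel
  apply hne
  rw [Matrix.sub_apply, mul_genOp_e, genOp_e_mul]
  -- On the stratum `x = b` the equality is `identity_e`; on the stratum `wt x = wt b + α_i` only
  -- swap terms remain.
  rcases QPos.eq_or_eq hmn k2 k1 (by abel : _ = D.simpleRoot i) with h | h
  · have hxb : x = b := wt_injective (sub_eq_zero.1 h)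
    subst hxb
    have hy : wt y = wt a + D.simpleRoot i := by
      have : wt x + wt y = wt x + (wt a + D.simpleRoot i) := by rw [h2]; abel
      exact add_left_cancel this
    have hlt := lt_of_arrow hmn hy
    rw [sum_arrow hy fun s => D.braidMat κ ![x, y] ![s, x], sum_arrow' hy fun t => D.braidMat κ ![x, t] ![a, x]]
    have e2 : (∑ t, D.braidMat κ ![x, y] ![a, t] * if wt t = wt x + D.simpleRoot i then 1 else 0) =
        (q - q⁻¹) * ((if a = x then 1 else 0) - (if y = x.rev then κ a / κ y else 0)) := by
      by_cases ht : ∃ t, wt t = wt x + D.simpleRoot i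
      · obtain ⟨t, ht⟩ := ht
        have hlt' := lt_of_arrow hmn ht
        rw [sum_arrow ht fun t => D.braidMat κ ![x, y] ![a, t], braidMat_apply, braidEntry, if_neg
          (fun h => hlt'.ne h.1.symm), if_pos hlt', zero_add]
        congr 2
        · refine if_congr ⟨fun h => h.1.symm, fun h => ⟨h.symm, wt_injective ?_⟩⟩ rfl rfl
          rw [hy, ht, h]
        · refine if_congr ⟨fun h => h.1, fun h => ⟨h, wt_injective ?_⟩⟩ rfl rfl
          subst h; rw [ht, arrow_rev hy, Fin.rev_rev]
      · rw [Finset.sum_eq_zero fun t _ => by rw [if_neg (fun h => ht ⟨t, h⟩), mul_zero], if_neg, if_neg]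
        · simp
        · rintro rfl; exact ht ⟨_, by simpa using arrow_rev hy⟩
        · rintro rfl; exact ht ⟨_, hy⟩
    have e3 : (∑ s, D.braidMat κ ![s, y] ![a, x] * if wt x = wt s + D.simpleRoot i then 1 else 0) =
        (q - q⁻¹) * ((if y = x then 1 else 0) - (if a = x.rev then κ a / κ y else 0)) := by
      by_cases ht : ∃ s, wt x = wt s + D.simpleRoot i
      · obtain ⟨s, hs⟩ := ht
        have hlt' := lt_of_arrow hmn hs
        rw [sum_arrow' hs fun s => D.braidMat κ ![s, y] ![a, x], braidMat_apply, braidEntry, if_neg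
          (fun h => hlt'.ne' h.1), if_pos hlt', zero_add]
        congr 2
        · refine if_congr ⟨fun h => h.2, fun h => ⟨wt_injective ?_, h⟩⟩ rfl rfl
          subst h; exact add_right_cancel (hs.symm.trans hy)
        · refine if_congr ⟨fun h => eq_rev_comm.1 h.2, fun h => ⟨?_, eq_rev_comm.1 h⟩⟩ rfl rfl
          subst h; rw [eq_rev_comm]; refine wt_injective ?_
          have := arrow_rev hy
          rw [Fin.rev_rev] at this
          exact add_right_cancel (hs.symm.trans this)
      · rw [Finset.sum_eq_zero fun t _ => by rw [if_neg (fun h => ht ⟨t, h⟩), mul_zero], if_neg, if_neg]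
        · simp
        · rintro rfl; exact ht ⟨_, by simpa using arrow_rev hy⟩
        · rintro rfl; exact ht ⟨_, hy⟩
    rw [e2, e3, hκ.div_eq hy, sub_eq_zero, braidMat_apply, braidMat_apply, braidEntry_diag, braidEntry_diag,
      par_arrow (D := D) hy, ip_arrow hy, ip_arrow hy, ksign_comm _ (D.vpar a), ksign_comm _ (D.vpar x)]
    exact (D.coincidence hlt.ne' x).identity_e q_ne_zero (ip_wt _ _ _) (ip_wt _ _ _)
      (by rw [ip_wt, if_pos rfl]; rfl) (by rw [ip_wt, if_neg hlt.ne']; rfl)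
      (by rw [ksign_comm]; exact ksign_vpar _ _)
      (ksign_vpar _ _)
      (ksign_self_add _ _) (by rw [ksign_comm]; exact ksign_vpar_add _ _ _)
  · have hb : wt x = wt b + D.simpleRoot i := by
      rw [← sub_eq_zero, ← neg_eq_zero, ← h]; abel
    have hya : y = a := by
      apply wt_injective
      have : wt x + wt y = wt x + wt a := by rw [h2, hb]; abel
      exact add_left_cancel this
    subst hya
    have hlt := lt_of_arrow hmn hb
    rw [sum_arrow hb fun t => D.braidMat κ ![x, y] ![y, t], sum_arrow' hb fun t => D.braidMat κ ![t, y] ![y, b]]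
    have hz : ∀ s t, D.braidMat κ ![x, s] ![t, b] = 0 := fun s t => by
      rw [braidMat_apply, braidEntry, if_neg (fun h => hlt.ne h.1), if_neg (not_lt.2 hlt.le), add_zero]
    rw [Finset.sum_eq_zero fun s _ => by rw [hz, zero_mul],
      Finset.sum_eq_zero fun s _ => by rw [hz, zero_mul], zero_mul, zero_add, mul_zero, add_zero,
      braidMat_apply, braidMat_apply, braidEntry_diag, braidEntry_diag, ip_arrow hb,
      par_arrow (D := D) hb, D.ip_comm (wt y), D.ip_comm (wt y), zpow_sub₀ q_ne_zero, ksign_add_left,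
      ksign_comm (D.vpar y), ksign_comm (D.vpar y)]
    have h0 := zpow_ne_zero (D.ip (wt b) (wt y)) q_ne_zero
    field_simp
    rcases ksign_eq (D.vpar x) (D.vpar y) with h | h <;> rw [h] <;> ring

theorem braid_comm_f (hmn : ¬ (m = 2 ∧ n = 0)) {κ : Idx m n → Cq} (hκ : D.IsKappa κ) (i : Fin (m / 2 + n)) :
    D.braidMat κ * D.genOp 2 (.f i) = D.genOp 2 (.f i) * D.braidMat κ := by
  rw [← sub_eq_zero]
  apply matrix_ext_two
  intro x y a b
  rw [Matrix.zero_apply]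
  by_contra hne
  obtain ⟨h1, h2⟩ := commutator_f_support (R := fun μ => D.QPos μ) (fun x y a b h =>
    let h := braidEntry_support hmn hκ h; ⟨h.1, h.2.1⟩) hne
  have hne' := hne
  rw [commutator_braid_eq hκ] at hne'
  obtain ⟨h3, -⟩ := commutator_f_support (R := fun μ => D.QPos (-μ)) (fun x y a b h =>
    let h := braidInvEntry_support hmn hκ h; ⟨by simpa using h.1, h.2.1⟩) hne'
  have k1 : D.QPos (wt b - wt x) := by
    rcases h1 with h1 | h1
    · exact h1
    · simpa using h1.add (QPos.root i)
  have k2 : D.QPos (wt x - wt b + D.simpleRoot i) := by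
    rcases h3 with h3 | h3
    · simpa using h3.add (QPos.root i)
    · convert h3 using 1; abel
  apply hne
  rw [Matrix.sub_apply, mul_genOp_f, genOp_f_mul, ← mul_sub]
  refine mul_eq_zero_of_right _ ?_
  -- The strata exchange their roles: `x = b` is now the easy one, and `wt b = wt x + α_i` is
  -- governed by `identity_f`.
  rcases QPos.eq_or_eq hmn k1 k2 (by abel : _ = D.simpleRoot i) with h | h
  · have hxb : x = b := (wt_injective (sub_eq_zero.1 h)).symm
    subst hxb
    have hy : wt a = wt y + D.simpleRoot i := by
      have : wt x + (wt y + D.simpleRoot i) = wt x + wt a := by rw [← add_assoc, h2]; abel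
      exact (add_left_cancel this).symm
    rw [sum_arrow' hy fun s => D.braidMat κ ![x, y] ![s, x],
      sum_arrow hy fun t => D.sgq t * D.braidMat κ ![x, t] ![a, x],
      Finset.sum_eq_zero fun t _ => ?_, Finset.sum_eq_zero fun t _ => ?_, mul_zero, mul_zero, add_zero, zero_add,
      braidMat_apply, braidMat_apply, braidEntry_diag, braidEntry_diag, ip_arrow hy, par_arrow (D := D) hy,
      zpow_neg, zpow_sub₀ q_ne_zero, ksign_add_left]
    · have h0 := zpow_ne_zero (D.ip (wt a) (wt x)) q_ne_zero
      have h0' := zpow_ne_zero (D.ip (wt y) (wt x)) q_ne_zero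
      field_simp
      rcases ksign_eq (D.vpar a) (D.vpar x) with h | h <;> rw [h] <;> ring
    · by_cases ht : wt t = wt x + D.simpleRoot i
      · have := lt_of_arrow hmn ht
        rw [braidMat_apply, braidEntry, if_neg (fun h => this.ne h.1), if_neg (not_lt.2 this.le), add_zero,
          mul_zero, zero_mul]
      · rw [if_neg ht, mul_zero]
    · by_cases ht : wt x = wt t + D.simpleRoot i
      · have := lt_of_arrow hmn ht
        rw [braidMat_apply, braidEntry, if_neg (fun h => this.ne h.1), if_neg (not_lt.2 this.le), add_zero,
          zero_mul]
      · rw [if_neg ht, mul_zero]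
  · have hb : wt b = wt x + D.simpleRoot i := by
      rw [← sub_eq_zero, ← neg_eq_zero, ← h]; abel
    have hya : y = a := by
      apply wt_injective
      have : wt b + wt y = wt b + wt a := by rw [add_comm (wt b) (wt a), ← h2, hb]; abel
      exact add_left_cancel this
    subst hya
    have hlt := lt_of_arrow hmn hb
    have hz : ∀ s t, D.braidMat κ ![x, s] ![t, b] = (q - q⁻¹) * ((if x = t ∧ s = b then 1 else 0) -
        (if s = x.rev ∧ b = t.rev then κ t / κ s else 0)) := fun s t => by
      rw [braidMat_apply, braidEntry, if_neg (fun h => hlt.ne' h.1), if_pos hlt, zero_add]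
    rw [sum_arrow' hb fun t => D.braidMat κ ![x, y] ![y, t],
      sum_arrow hb fun s => D.sgq s * D.braidMat κ ![s, y] ![y, b]]
    have hbx := arrow_rev hb
    have e1 : (∑ s, D.braidMat κ ![x, y] ![s, b] * if wt y = wt s + D.simpleRoot i then 1 else 0) =
        (q - q⁻¹) * ((if b = y then 1 else 0) - (if x = y.rev then κ b.rev / κ x.rev else 0)) := by
      by_cases ht : ∃ s, wt y = wt s + D.simpleRoot i
      · obtain ⟨s, hs⟩ := ht
        rw [sum_arrow' hs fun s => D.braidMat κ ![x, y] ![s, b], hz]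
        congr 2
        · refine if_congr ⟨fun h => h.2.symm, fun h => ⟨wt_injective ?_, h.symm⟩⟩ rfl rfl
          subst h; exact add_right_cancel (hb.symm.trans hs)
        · by_cases hxy : x = y.rev
          · have hyx := eq_rev_comm.1 hxy
            have : s = b.rev := wt_injective (add_right_cancel (hs.symm.trans (by rw [hyx]; exact hbx)))
            rw [if_pos hxy, if_pos ⟨hyx, eq_rev_comm.1 this⟩, this, hyx]
          · rw [if_neg hxy, if_neg (fun h => hxy (eq_rev_comm.1 h.1))]
      · rw [Finset.sum_eq_zero fun t _ => by rw [if_neg (fun h => ht ⟨t, h⟩), mul_zero], if_neg, if_neg]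
        · simp
        · intro h; exact ht ⟨_, by rw [eq_rev_comm.1 h]; exact hbx⟩
        · rintro rfl; exact ht ⟨_, hb⟩
    have e2 : (∑ t, D.sgq t * D.braidMat κ ![x, t] ![y, b] * if wt t = wt y + D.simpleRoot i then 1 else 0) =
        (q - q⁻¹) * (D.sgq b * (if x = y then 1 else 0) -
          D.sgq x * (if b = y.rev then κ b.rev / κ x.rev else 0)) := by
      by_cases ht : ∃ t, wt t = wt y + D.simpleRoot i
      · obtain ⟨t, hs⟩ := ht
        rw [sum_arrow hs fun t => D.sgq t * D.braidMat κ ![x, t] ![y, b], hz]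
        by_cases c1 : x = y
        · have ht : t = b := wt_injective (by rw [hs, hb, c1])
          by_cases c2 : b = y.rev
          · have : t = x.rev := by rw [ht, c2, c1]
            have hyb := eq_rev_comm.1 c2
            rw [if_pos ⟨c1, ht⟩, if_pos ⟨this, c2⟩, if_pos c1, if_pos c2, ← this, ← hyb, ht,
              show D.sgq x = D.sgq b by rw [c1, hyb, sgq_rev]]
            ring
          · rw [if_pos ⟨c1, ht⟩, if_neg (fun h => c2 h.2), if_pos c1, if_neg c2, ht]; ring
        · rw [if_neg (fun h => c1 h.1), if_neg c1]
          by_cases c2 : b = y.rev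
          · have hyb := eq_rev_comm.1 c2
            have : t = x.rev := wt_injective (by rw [hs, hyb]; exact hbx.symm)
            rw [if_pos ⟨this, c2⟩, if_pos c2, this, hyb, sgq_rev]; ring
          · rw [if_neg (fun h => c2 h.2), if_neg c2]; ring
      · rw [Finset.sum_eq_zero fun t _ => by rw [if_neg (fun h => ht ⟨t, h⟩), mul_zero], if_neg, if_neg]
        · simp
        · intro h; exact ht ⟨_, by rw [eq_rev_comm.1 h]; exact hbx⟩
        · rintro rfl; exact ht ⟨_, hb⟩
    have hdiv : κ b.rev / κ x.rev = -(ksign (D.vpar b) (D.vpar x + D.vpar b) *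
        q ^ (D.ip (wt x) (wt b) - D.ip (wt x) (wt x))) := by
      rw [hκ.div_eq hbx, par_arrow (D := D) hb, vpar_rev, ip_rev, neg_neg, ip_arrow hb, D.ip_comm (wt b)]
    rw [e1, e2, hdiv, sub_eq_zero, braidMat_apply, braidMat_apply, braidEntry_diag, braidEntry_diag,
      par_arrow (D := D) hb, ip_arrow hb, ip_arrow hb, ksign_comm _ (D.vpar x), ksign_comm _ (D.vpar y),
      ksign_comm (D.vpar y), ksign_comm (D.vpar y), D.ip_comm (wt y), D.ip_comm (wt y), D.ip_comm (wt b) (wt x)]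
    refine Eq.trans ?_ (((D.coincidence hlt.ne' y).identity_f q_ne_zero (s := D.sgq x) (s' := D.sgq b)
      (sb := D.sgq y) (ip_wt _ x y) (ip_wt _ b y)
      (pp := D.ip (wt x) (wt x)) (pp' := D.ip (wt x) (wt b))
      (by rw [ip_wt, if_pos rfl]; rfl) (by rw [ip_wt, if_neg hlt.ne']; rfl) (ksign_vpar b y) (ksign_vpar x y)
      (ksign_self_add x b) (ksign_self_add b x) (ksign_vpar_add x b y) rfl rfl rfl).trans ?_)
    · rw [add_comm (D.vpar b) (D.vpar x), ksign_comm (D.vpar x + D.vpar b)]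
    · rw [add_comm (D.vpar b) (D.vpar x), ksign_comm (D.vpar x + D.vpar b)]

theorem isHom_braid (hmn : ¬ (m = 2 ∧ n = 0)) {κ : Idx m n → Cq} (hκ : D.IsKappa κ) :
    D.IsHom (D.braidMat κ) := by
  refine ⟨fun w' w h => ?_, fun g => ?_⟩
  · rw [word_two w', word_two w] at h ⊢
    rw [wpar_two, wpar_two]
    exact (braidEntry_support hmn hκ h).2.2
  · cases g with
    | e i => exact braid_comm_e hmn hκ i
    | f i => exact braid_comm_f hmn hκ i
    | k i =>
      ext w' w
      rw [genOp, kMat, powMat_diagonal, Matrix.mul_diagonal, Matrix.diagonal_mul]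
      by_cases h : D.braidMat κ w' w = 0
      · rw [h]; simp
      · have := (braidEntry_support hmn hκ h).2.1
        rw [Fin.prod_univ_two, Fin.prod_univ_two, ← zpow_add₀ q_ne_zero, ← zpow_add₀ q_ne_zero, ← ip_add_right,
          ← ip_add_right, this, mul_comm]
    | kInv i =>
      ext w' w
      rw [genOp, kInvMat, powMat_diagonal, Matrix.mul_diagonal, Matrix.diagonal_mul]
      by_cases h : D.braidMat κ w' w = 0
      · rw [h]; simp
      · have := (braidEntry_support hmn hκ h).2.1
        rw [Fin.prod_univ_two, Fin.prod_univ_two, ← zpow_add₀ q_ne_zero, ← zpow_add₀ q_ne_zero, ← neg_add,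
          ← neg_add, ← ip_add_right, ← ip_add_right, this, mul_comm]
    | sigma h => rw [genOp, natOp_sigma_two, Matrix.mul_one, Matrix.one_mul]

theorem isHom_braidInv (hmn : ¬ (m = 2 ∧ n = 0)) {κ : Idx m n → Cq} (hκ : D.IsKappa κ) :
    D.IsHom (D.braidInvMat κ) := by
  have h := ((IsHom.one (D := D) 2).sub ((isHom_cup hκ).mul (isHom_cap hκ))).smul (q - q⁻¹)
  rw [← braid_sub_braidInv hκ.ne_zero] at h
  have := (isHom_braid hmn hκ).sub h
  rwa [sub_sub_cancel] at this

end RootDatum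
end
end OspBMW

/-! ### Reduction to the lowest weight vector: uniqueness of `R` and the braid relation -/

namespace OspBMW
noncomputable section

section words
variable {m n : ℕ}

theorem powMat_one_apply (A : Matrix (Idx m n) (Idx m n) Cq) (v' v : Word m n 1) :
    powMat A 1 v' v = A (v' 0) (v 0) := by simp [powMat]

theorem sumMat_one_apply (A X B : Matrix (Idx m n) (Idx m n) Cq) (v' v : Word m n 1) :
    sumMat A X B 1 v' v = X (v' 0) (v 0) := by simp [sumMat]

theorem sum_word_three {M : Type*} [AddCommMonoid M] (f : Word m n 3 → M) :
    ∑ w, f w = ∑ a : Idx m n, ∑ b : Idx m n, ∑ c : Idx m n, f ![a, b, c] := by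
  rw [← (Fin.consEquiv fun _ : Fin 3 => Idx m n).sum_comp, Fintype.sum_prod_type]
  exact Finset.sum_congr rfl fun a _ => sum_word_two fun v => f (Fin.cons a v)

theorem word_three (w : Word m n 3) : w = ![w 0, w 1, w 2] := by
  funext i; fin_cases i <;> rfl

theorem word_one (w : Word m n 1) : w = ![w 0] := by
  funext i; fin_cases i; rfl

section pads
variable (A : TMat m n 2 2) (K : TMat m n 2 0) (C : TMat m n 0 2)

theorem pad_left_apply (x y t a b d : Idx m n) :
    pad 0 1 (k := 3) (l := 3) rfl rfl A ![x, y, t] ![a, b, d] =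
      if t = d then A ![x, y] ![a, b] else 0 := by
  simp only [pad, Matrix.of_apply]
  refine (if_congr (Q := t = d) ⟨fun h => h.2 0, fun h => ⟨fun u => u.elim0, fun u => ?_⟩⟩ ?_ rfl)
  · fin_cases u; exact h
  · congr 1 <;> · funext u; fin_cases u <;> rfl

theorem pad_right_apply (x y t a b d : Idx m n) :
    pad 1 0 (k := 3) (l := 3) rfl rfl A ![x, y, t] ![a, b, d] =
      if x = a then A ![y, t] ![b, d] else 0 := by
  simp only [pad, Matrix.of_apply]
  refine (if_congr (Q := x = a) ⟨fun h => h.1 0, fun h => ⟨fun u => ?_, fun u => u.elim0⟩⟩ ?_ rfl)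
  · fin_cases u; exact h
  · congr 1 <;> · funext u; fin_cases u <;> rfl

theorem pad_left_cap_apply (t a b d : Idx m n) :
    pad 0 1 (k := 3) (l := 1) rfl rfl K ![t] ![a, b, d] = if t = d then K ![] ![a, b] else 0 := by
  simp only [pad, Matrix.of_apply]
  refine (if_congr (Q := t = d) ⟨fun h => h.2 0, fun h => ⟨fun u => u.elim0, fun u => ?_⟩⟩ ?_ rfl)
  · fin_cases u; exact h
  · congr 1 <;> · funext u; fin_cases u <;> rfl

theorem pad_right_cap_apply (t a b d : Idx m n) :
    pad 1 0 (k := 3) (l := 1) rfl rfl K ![t] ![a, b, d] = if t = a then K ![] ![b, d] else 0 := by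
  simp only [pad, Matrix.of_apply]
  refine (if_congr (Q := t = a) ⟨fun h => h.1 0, fun h => ⟨fun u => ?_, fun u => u.elim0⟩⟩ ?_ rfl)
  · fin_cases u; exact h
  · congr 1 <;> · funext u; fin_cases u <;> rfl

theorem pad_left_cup_apply (t a b d : Idx m n) :
    pad 0 1 (k := 1) (l := 3) rfl rfl C ![a, b, d] ![t] = if d = t then C ![a, b] ![] else 0 := by
  simp only [pad, Matrix.of_apply]
  refine (if_congr (Q := d = t) ⟨fun h => h.2 0, fun h => ⟨fun u => u.elim0, fun u => ?_⟩⟩ ?_ rfl)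
  · fin_cases u; exact h
  · congr 1 <;> · funext u; fin_cases u <;> rfl

theorem pad_right_cup_apply (t a b d : Idx m n) :
    pad 1 0 (k := 1) (l := 3) rfl rfl C ![a, b, d] ![t] = if a = t then C ![b, d] ![] else 0 := by
  simp only [pad, Matrix.of_apply]
  refine (if_congr (Q := a = t) ⟨fun h => h.1 0, fun h => ⟨fun u => ?_, fun u => u.elim0⟩⟩ ?_ rfl)
  · fin_cases u; exact h
  · congr 1 <;> · funext u; fin_cases u <;> rfl

end pads

section products
open RootDatum
variable {k : ℕ} (A : TMat m n 2 2) (κ : Idx m n → Cq)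

theorem pad_left_mul_apply (M : TMat m n k 3) (x y t : Idx m n) (w : Word m n k) :
    (pad 0 1 (k := 3) (l := 3) rfl rfl A * M) ![x, y, t] w = ∑ a, ∑ b, A ![x, y] ![a, b] * M ![a, b, t] w := by
  rw [Matrix.mul_apply, sum_word_three]
  simp only [pad_left_apply, ite_mul, zero_mul, Finset.sum_ite_eq, Finset.mem_univ, if_true]

theorem pad_right_mul_apply (M : TMat m n k 3) (x y t : Idx m n) (w : Word m n k) :
    (pad 1 0 (k := 3) (l := 3) rfl rfl A * M) ![x, y, t] w = ∑ a, ∑ b, A ![y, t] ![a, b] * M ![x, a, b] w := by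
  rw [Matrix.mul_apply, sum_word_three, Finset.sum_eq_single x]
  · simp only [pad_right_apply, if_true]
  · intro b _ hb
    refine Finset.sum_eq_zero fun _ _ => Finset.sum_eq_zero fun _ _ => ?_
    rw [pad_right_apply, if_neg hb.symm, zero_mul]
  · exact fun h => absurd (Finset.mem_univ _) h

theorem pad_left_cap_mul_apply (M : TMat m n k 3) (t : Idx m n) (w : Word m n k) :
    (pad 0 1 (k := 3) (l := 1) rfl rfl (capMat κ) * M) ![t] w = ∑ s, κ s * M ![s, s.rev, t] w := by
  rw [Matrix.mul_apply, sum_word_three]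
  simp only [pad_left_cap_apply, ite_mul, zero_mul, Finset.sum_ite_eq, Finset.mem_univ, if_true]
  exact Finset.sum_congr rfl fun s _ => sum_formMat_mul κ (fun b => M ![s, b, t] w) s

theorem pad_right_cap_mul_apply (M : TMat m n k 3) (t : Idx m n) (w : Word m n k) :
    (pad 1 0 (k := 3) (l := 1) rfl rfl (capMat κ) * M) ![t] w = ∑ s, κ s * M ![t, s, s.rev] w := by
  rw [Matrix.mul_apply, sum_word_three, Finset.sum_eq_single t]
  · simp only [pad_right_cap_apply, if_true]
    exact Finset.sum_congr rfl fun s _ => sum_formMat_mul κ (fun b => M ![t, s, b] w) s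
  · intro b _ hb
    refine Finset.sum_eq_zero fun _ _ => Finset.sum_eq_zero fun _ _ => ?_
    rw [pad_right_cap_apply, if_neg hb.symm, zero_mul]
  · exact fun h => absurd (Finset.mem_univ _) h

theorem sum_mul_cup (f : Idx m n → Cq) (a : Idx m n) (w : Word m n 0) :
    ∑ b, f b * cupMat κ ![a, b] w = f a.rev * (κ a.rev)⁻¹ := by
  simp only [cupMat_apply, mul_ite, mul_zero, Finset.sum_ite_eq', Finset.mem_univ, if_true]

theorem mul_pad_left_cup_apply (M : TMat m n 3 k) (t : Idx m n) (w : Word m n k) :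
    (M * pad 0 1 (k := 1) (l := 3) rfl rfl (cupMat κ)) w ![t] = ∑ s, M w ![s, s.rev, t] * (κ s.rev)⁻¹ := by
  rw [Matrix.mul_apply, sum_word_three]
  simp only [pad_left_cup_apply, mul_ite, mul_zero, Finset.sum_ite_eq', Finset.mem_univ, if_true]
  exact Finset.sum_congr rfl fun s _ => sum_mul_cup κ (fun b => M w ![s, b, t]) s _

theorem mul_pad_right_cup_apply (M : TMat m n 3 k) (t : Idx m n) (w : Word m n k) :
    (M * pad 1 0 (k := 1) (l := 3) rfl rfl (cupMat κ)) w ![t] = ∑ s, M w ![t, s, s.rev] * (κ s.rev)⁻¹ := by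
  rw [Matrix.mul_apply, sum_word_three, Finset.sum_eq_single t]
  · simp only [pad_right_cup_apply, if_true]
    exact Finset.sum_congr rfl fun s _ => sum_mul_cup κ (fun b => M w ![t, s, b]) s _
  · intro b _ hb
    refine Finset.sum_eq_zero fun _ _ => Finset.sum_eq_zero fun _ _ => ?_
    rw [pad_right_cup_apply, if_neg hb, mul_zero]
  · exact fun h => absurd (Finset.mem_univ _) h

end products

end words

namespace RootDatum
variable {m n : ℕ} {D : RootDatum m n}

/-- Frobenius reciprocity: a homomorphism into `V^{⊗l} ⊗ V` is determined by the component in which the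
last factor is the lowest weight vector. -/
theorem IsHom.eq_zero_of_last (hmn : ¬ (m = 2 ∧ n = 0)) {k l : ℕ} {X : TMat m n k (l + 1)} (hX : D.IsHom X)
    (h : ∀ w' w, (w' (Fin.natAdd l 0)).val + 1 = m + 2 * n → X w' w = 0) : X = 0 := by
  have key : ∀ (d : ℕ) (u : Word m n l) (b : Idx m n) (w : Word m n k), b.val + 1 + d = m + 2 * n →
      X (Fin.append u fun _ : Fin 1 => b) w = 0 := by
    intro d
    induction d using Nat.strong_induction_on with
    | _ d ih =>
      intro u b w hb
      rcases Nat.eq_zero_or_pos d with rfl | hd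
      · exact h _ _ (by rw [Fin.append_right]; exact hb)
      obtain ⟨i, p, hp, hp'⟩ := D.exists_arrow hmn b.val (by omega)
      have hpb : b.val < p.val := by omega
      have hp0 : ∀ u' w, X (Fin.append u' fun _ : Fin 1 => p) w = 0 := fun u' w =>
        ih (m + 2 * n - 1 - p.val) (by have := p.isLt; omega) u' p w (by have := p.isLt; omega)
      -- Equivariance under `f_i` is read at the component with last letter `p`. All components of
      -- `X` with last letter `p` vanish already, so the one surviving term is that of `f_i` acting
      -- on the last factor, `v_b ↦ v_p`, with a non-zero coefficient.
      have e := congrFun (congrFun (hX.2 (.f i)) (Fin.append u fun _ : Fin 1 => p)) w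
      rw [Matrix.mul_apply, Finset.sum_eq_zero fun v _ => by rw [hp0, zero_mul], genOp, sumMat_add,
        Matrix.add_mul, Matrix.add_apply, Matrix.mul_apply, Matrix.mul_apply, sum_word_add, sum_word_add] at e
      simp only [sum_word_one, OspBMW.tens, Matrix.of_apply, Fin.append_left, Fin.append_right, powMat_one_apply,
        sumMat_one_apply, fMat_apply] at e
      rw [Finset.sum_eq_zero, zero_add, Finset.sum_eq_single u, Finset.sum_eq_single b, if_pos hp] at e
      · rw [kInvMat, parityMat, Matrix.diagonal_mul_diagonal, powMat_diagonal, Matrix.diagonal_apply_eq] at e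
        refine (mul_eq_zero.1 e.symm).resolve_left (mul_ne_zero (Finset.prod_ne_zero_iff.2 fun j _ => ?_) ?_)
        · exact mul_ne_zero (zpow_ne_zero _ q_ne_zero) (ksign_ne_zero _ _)
        · rw [mul_one]; exact mul_ne_zero (sgq_ne_zero _) (fCoeff_ne_zero _)
      · intro c _ hc
        rw [if_neg fun hh => hc (wt_injective (hh.trans hp.symm)), mul_zero, mul_zero, zero_mul]
      · exact fun h => absurd (Finset.mem_univ _) h
      · intro v _ hv
        refine Finset.sum_eq_zero fun c _ => ?_
        rw [kInvMat, parityMat, Matrix.diagonal_mul_diagonal, powMat_diagonal,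
          Matrix.diagonal_apply_ne _ hv.symm, zero_mul, zero_mul]
      · exact fun h => absurd (Finset.mem_univ _) h
      · intro v _
        refine Finset.sum_eq_zero fun c _ => ?_
        by_cases hc : p = c
        · rw [← hc, hp0, mul_zero]
        · rw [Matrix.one_apply_ne, mul_zero, zero_mul]
          intro he
          rw [Fin.append_right, Fin.append_right] at he
          exact hc he
  ext w' w
  have e : w' = Fin.append (fun t => w' (Fin.castAdd 1 t)) (fun _ : Fin 1 => w' (Fin.natAdd l 0)) := by
    refine word_ext_add.2 ⟨?_, ?_⟩
    · funext t; rw [Fin.append_left]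
    · funext t; rw [Fin.append_right, Subsingleton.elim t 0]
  rw [e]
  exact key (m + 2 * n - 1 - (w' (Fin.natAdd l 0)).val) _ _ _ (by have := (w' (Fin.natAdd l 0)).isLt; omega)

theorem flip_mul_apply {k : ℕ} (M : TMat m n k 2) (x y : Idx m n) (w : Word m n k) :
    (D.flip * M) ![x, y] w = ksign (D.vpar y) (D.vpar x) * M ![y, x] w := by
  rw [Matrix.mul_apply, sum_word_two, Finset.sum_eq_single y, Finset.sum_eq_single x]
  · simp [flip]
  · intro b _ hb
    rw [flip, Matrix.of_apply, if_neg (fun h => hb h.1.symm), zero_mul]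
  · exact fun h => absurd (Finset.mem_univ _) h
  · intro b _ hb
    refine Finset.sum_eq_zero fun c _ => ?_
    rw [flip, Matrix.of_apply, if_neg (fun h => hb h.2.symm), zero_mul]
  · exact fun h => absurd (Finset.mem_univ _) h

theorem flip_mul_flip_mul {k : ℕ} (M : TMat m n k 2) : D.flip * (D.flip * M) = M := by
  ext w' w
  rw [word_two w', flip_mul_apply, flip_mul_apply, ← mul_assoc, ksign_comm, ksign_mul_self, one_mul]

theorem isRMatrix (hmn : ¬ (m = 2 ∧ n = 0)) {κ : Idx m n → Cq} (hκ : D.IsKappa κ) :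
    D.IsRMatrix (D.flip * D.braidMat κ) where
  intertwines := by rw [flip_mul_flip_mul]; exact isHom_braid hmn hκ
  diag w := by
    rw [word_two w, flip_mul_apply, braidMat_apply, braidEntry_diag, ← mul_assoc, ksign_comm, ksign_mul_self,
      one_mul]; rfl
  triangular w' w hne h := by
    rw [word_two w', word_two w, flip_mul_apply, braidMat_apply] at h
    obtain ⟨⟨ν, hν⟩, h2, -⟩ := braidEntry_support hmn hκ (right_ne_zero_of_mul h)
    refine ⟨ν, ?_, ?_, ?_⟩
    · rintro rfl
      apply hne
      have e1 : wt (w 1) = wt (w' 1) := by rw [← sub_eq_zero, hν]; simp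
      rw [e1] at h2
      rw [word_two_eq_iff]
      exact ⟨wt_injective (add_left_cancel (h2.trans (add_comm _ _))), (wt_injective e1).symm⟩
    · rw [← hν]
      have : wt (w' 0) = wt (w 0) + wt (w 1) - wt (w' 1) := by rw [← h2]; abel
      rw [this]; abel
    · rw [← hν]; abel

/-- In a row whose first letter is the lowest weight vector, triangularity leaves the diagonal entry
only, since raising a weight never yields the lowest one; that entry is prescribed. After the flip,
these are the rows that determine a homomorphism. -/
theorem IsRMatrix.unique (hmn : ¬ (m = 2 ∧ n = 0)) {R R' : TMat m n 2 2} (hR : D.IsRMatrix R)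
    (hR' : D.IsRMatrix R') : R = R' := by
  have key : ∀ {R : TMat m n 2 2}, D.IsRMatrix R → ∀ (x y : Idx m n) (w : Word m n 2), y.val + 1 = m + 2 * n →
      ![y, x] ≠ w → R ![y, x] w = 0 := by
    intro R hR x y w hy hw
    by_contra hne
    obtain ⟨ν, hν, h1, -⟩ := hR.triangular _ _ hw hne
    have h2 := congrArg D.ht h1
    have h3 : D.ht (wt y) ≤ D.ht (wt (w 0)) := D.ht_wt_antitone (Fin.le_def.2 (by have := (w 0).isLt; omega))
    rw [ht_add, ht_sum ν hmn] at h2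
    have h4 := sum_pos_of_ne_zero hν
    have h5 : D.ht (wt (![y, x] 0)) = D.ht (wt y) := rfl
    linarith
  have h := (hR.intertwines.sub hR'.intertwines).eq_zero_of_last hmn (l := 1) fun w' w hw' => by
    have hw' : (w' 1).val + 1 = m + 2 * n := hw'
    rw [word_two w', Matrix.sub_apply, flip_mul_apply, flip_mul_apply, ← mul_sub]
    refine mul_eq_zero_of_right _ ?_
    by_cases hw : ![w' 1, w' 0] = w
    · rw [← hw, hR.diag, hR'.diag, sub_self]
    · rw [key hR _ _ _ hw' hw, key hR' _ _ _ hw' hw, sub_self]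
  have h' := congrArg (D.flip * ·) (sub_eq_zero.1 h)
  simpa only [flip_mul_flip_mul] using h'

section lowest
variable (hmn : ¬ (m = 2 ∧ n = 0)) {κ : Idx m n → Cq} (hκ : D.IsKappa κ)

/-- The scalar in `c (v_a ⊗ v_b)` for extremal `v_b`. -/
def swapCoeff (D : RootDatum m n) (a b : Idx m n) : Cq :=
  ksign (D.vpar a) (D.vpar b) * q ^ D.ip (wt a) (wt b)

/-- The scalar for moving two letters past `t` depends only on their total weight and parity, which
the braiding preserves. -/
theorem swapCoeff_mul_eq {a b x y t : Idx m n} (h : D.braidEntry κ x y a b ≠ 0) (hmn : ¬ (m = 2 ∧ n = 0))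
    (hκ : D.IsKappa κ) : D.swapCoeff t a * D.swapCoeff t b = D.swapCoeff t x * D.swapCoeff t y := by
  have h := braidEntry_support hmn hκ h
  have e : ∀ a b, D.swapCoeff t a * D.swapCoeff t b = ksign (D.vpar t) (D.vpar a + D.vpar b) *
      q ^ D.ip (wt t) (wt a + wt b) := fun a b => by
    rw [swapCoeff, swapCoeff, ksign_add, ip_add_right, zpow_add₀ q_ne_zero]; ring
  rw [e, e, h.2.1, h.2.2]

/-- The correction terms need `b < x` together with `b = t` or with `x` the mirror of `t`. As `t` is
the last index, either makes `b < x` impossible. -/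
theorem braidMat_lowest (κ : Idx m n → Cq) {t : Idx m n} (ht : t.val + 1 = m + 2 * n) (x a b : Idx m n) :
    D.braidMat κ ![x, t] ![a, b] = if a = t ∧ b = x then D.swapCoeff t x else 0 := by
  rw [braidMat_apply, braidEntry]
  have h2 : (if b < x then (q - q⁻¹) * ((if x = a ∧ t = b then 1 else 0) -
      (if t = x.rev ∧ b = a.rev then κ a / κ t else 0)) else 0) = 0 := by
    split_ifs with h1 h2 h3 h3
    · have := Fin.lt_def.1 h1; have := x.isLt; have := congrArg Fin.val h2.2; omega
    · have := Fin.lt_def.1 h1; have := x.isLt; have := congrArg Fin.val h2.2; omega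
    · have := Fin.lt_def.1 h1; have := eq_rev_iff.1 h3.1; omega
    · simp
    · rfl
  rw [h2, add_zero]
  by_cases h : x = b ∧ t = a
  · rw [if_pos h, if_pos ⟨h.2.symm, h.1.symm⟩, h.1, h.2]; rfl
  · rw [if_neg h, if_neg fun h' => h ⟨h'.2.symm, h'.1.symm⟩]

theorem sum_braid_lowest (κ : Idx m n → Cq) {t : Idx m n} (ht : t.val + 1 = m + 2 * n) (x : Idx m n)
    (f : Idx m n → Idx m n → Cq) :
    ∑ a, ∑ b, D.braidMat κ ![x, t] ![a, b] * f a b = D.swapCoeff t x * f t x := by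
  rw [Finset.sum_eq_single t, Finset.sum_eq_single x, braidMat_lowest κ ht, if_pos ⟨rfl, rfl⟩]
  · intro b _ hb
    rw [braidMat_lowest κ ht, if_neg fun h => hb h.2, zero_mul]
  · exact fun h => absurd (Finset.mem_univ _) h
  · intro a _ ha
    refine Finset.sum_eq_zero fun b _ => ?_
    rw [braidMat_lowest κ ht, if_neg fun h => ha h.1, zero_mul]
  · exact fun h => absurd (Finset.mem_univ _) h

theorem braid_mul_lowest (κ : Idx m n → Cq) {t : Idx m n} (ht : t.val + 1 = m + 2 * n) {k : ℕ} (M : TMat m n k 2)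
    (x : Idx m n) (w : Word m n k) :
    (D.braidMat κ * M) ![x, t] w = D.swapCoeff t x * M ![t, x] w := by
  rw [Matrix.mul_apply, sum_word_two]
  exact sum_braid_lowest κ ht x fun a b => M ![a, b] w

include hmn hκ

theorem braid_mul_braidInv : D.braidMat κ * D.braidInvMat κ = 1 := by
  rw [← sub_eq_zero]
  refine (((isHom_braid hmn hκ).mul (isHom_braidInv hmn hκ)).sub (IsHom.one 2)).eq_zero_of_last hmn (l := 1)
    fun w' w hw' => ?_
  have ht : (w' 1).val + 1 = m + 2 * n := hw'
  rw [word_two w', word_two w, Matrix.sub_apply, braid_mul_lowest κ ht, braidInvMat_apply, braidInvEntry,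
    if_neg (show ¬ w' 1 < w 1 from fun h => by have := Fin.lt_def.1 h; have := (w 1).isLt; omega), sub_zero,
    Matrix.one_apply]
  by_cases h : w' 1 = w 1 ∧ w' 0 = w 0
  · rw [if_pos h, if_pos (by rw [h.1, h.2]), h.1, h.2, swapCoeff, zpow_neg, D.ip_comm, ksign_comm]
    have h0 := zpow_ne_zero (D.ip (wt (w 0)) (wt (w 1))) q_ne_zero
    rw [mul_mul_mul_comm, ksign_mul_self, mul_inv_cancel₀ h0, mul_one, sub_self]
  · rw [if_neg h, if_neg, mul_zero, sub_zero]
    rw [word_two_eq_iff]; exact fun h' => h ⟨h'.2, h'.1⟩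

theorem braidInv_mul_braid : D.braidInvMat κ * D.braidMat κ = 1 :=
  mul_eq_one_comm.1 (braid_mul_braidInv hmn hκ)

theorem braidMat_inv : (D.braidMat κ)⁻¹ = D.braidInvMat κ :=
  Matrix.inv_eq_right_inv (braid_mul_braidInv hmn hκ)

/-- By uniqueness the explicit braiding is the one of any `R`; in particular it does not depend on
the choice of `κ`. -/
theorem IsRMatrix.flip_mul_eq {R : TMat m n 2 2} (hR : D.IsRMatrix R) : D.flip * R = D.braidMat κ := by
  rw [hR.unique hmn (isRMatrix hmn hκ), flip_mul_flip_mul]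

/-- Both sides are homomorphisms, so only rows with lowest last letter matter. Crossings with that
letter are swaps, and both sides reduce to one braiding of the two other letters; the scalars agree
by `swapCoeff_mul_eq`. -/
theorem braid_relation :
    pad 0 1 (k := 3) (l := 3) rfl rfl (D.braidMat κ) * (pad 1 0 rfl rfl (D.braidMat κ) *
      pad 0 1 (k := 3) rfl rfl (D.braidMat κ)) =
    pad 1 0 (k := 3) (l := 3) rfl rfl (D.braidMat κ) * (pad 0 1 rfl rfl (D.braidMat κ) *
      pad 1 0 (k := 3) rfl rfl (D.braidMat κ)) := by
  have h1 := (isHom_braid hmn hκ).pad (i := 0) (r := 1) (k := 3) (l := 3) (hk := rfl) (hl := rfl)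
  have h2 := (isHom_braid hmn hκ).pad (i := 1) (r := 0) (k := 3) (l := 3) (hk := rfl) (hl := rfl)
  rw [← sub_eq_zero]
  refine ((h1.mul (h2.mul h1)).sub (h2.mul (h1.mul h2))).eq_zero_of_last hmn (l := 2) fun w' w hw' => ?_
  have ht : (w' 2).val + 1 = m + 2 * n := hw'
  rw [word_three w', word_three w, Matrix.sub_apply, pad_left_mul_apply, pad_right_mul_apply,
    sum_braid_lowest κ ht (w' 1) fun a b => (pad 0 1 rfl rfl (D.braidMat κ) *
      pad 1 0 (k := 3) rfl rfl (D.braidMat κ)) ![w' 0, a, b] ![w 0, w 1, w 2], pad_left_mul_apply,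
    sum_braid_lowest κ ht (w' 0) fun a b => pad 1 0 (k := 3) rfl rfl (D.braidMat κ) ![a, b, w' 1] ![w 0, w 1, w 2],
    pad_right_apply]
  have e : ∀ a b, D.braidMat κ ![w' 0, w' 1] ![a, b] * (pad 1 0 rfl rfl (D.braidMat κ) *
      pad 0 1 (k := 3) rfl rfl (D.braidMat κ)) ![a, b, w' 2] ![w 0, w 1, w 2] =
      D.swapCoeff (w' 2) (w' 1) * D.swapCoeff (w' 2) (w' 0) *
        (if w 0 = w' 2 ∧ w 1 = a ∧ w 2 = b then D.braidMat κ ![w' 0, w' 1] ![a, b] else 0) := by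
    intro a b
    rw [pad_right_mul_apply, sum_braid_lowest κ ht b fun a' b' =>
      pad 0 1 (k := 3) rfl rfl (D.braidMat κ) ![a, a', b'] ![w 0, w 1, w 2], pad_left_apply, braidMat_lowest κ ht]
    by_cases h0 : D.braidMat κ ![w' 0, w' 1] ![a, b] = 0
    · rw [h0]; simp
    by_cases h3 : w 0 = w' 2 ∧ w 1 = a
    · by_cases h4 : b = w 2
      · rw [if_pos h4, if_pos h3, if_pos ⟨h3.1, h3.2, h4.symm⟩, mul_comm (D.swapCoeff _ b),
          swapCoeff_mul_eq (t := w' 2) (show D.braidEntry κ (w' 0) (w' 1) a b ≠ 0 from h0) hmn hκ]; ring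
      · rw [if_neg h4, if_neg fun h => h4 h.2.2.symm]; simp
    · rw [if_neg h3, ite_self, if_neg fun h => h3 ⟨h.1, h.2.1⟩]; simp
  simp only [e]
  rw [← mul_assoc, sub_eq_zero]
  simp only [← Finset.mul_sum]
  congr 1
  by_cases h : w 0 = w' 2
  · rw [if_pos h.symm, Finset.sum_eq_single (w 1), Finset.sum_eq_single (w 2), if_pos ⟨h, rfl, rfl⟩]
    · intro b _ hb; rw [if_neg fun h => hb h.2.2.symm]
    · exact fun h => absurd (Finset.mem_univ _) h
    · intro b _ hb; exact Finset.sum_eq_zero fun c _ => by rw [if_neg fun h => hb h.2.1.symm]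
    · exact fun h => absurd (Finset.mem_univ _) h
  · rw [if_neg (Ne.symm h)]
    exact Finset.sum_eq_zero fun b _ => Finset.sum_eq_zero fun c _ => by rw [if_neg fun h' => h h'.1]

end lowest

end RootDatum
end
end OspBMW

/-! ### Slides, zigzags and the twist -/

namespace OspBMW
noncomputable section

namespace RootDatum
variable {m n : ℕ} {D : RootDatum m n} {κ : Idx m n → Cq}

section slides

theorem braidEntry_eq (D : RootDatum m n) (κ : Idx m n → Cq) (x y a b : Idx m n) : D.braidEntry κ x y a b =
    (if x = b ∧ y = a then ksign (D.vpar a) (D.vpar b) * q ^ D.ip (wt a) (wt b) else 0) +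
    (q - q⁻¹) * ((if b < x ∧ x = a ∧ y = b then 1 else 0) -
      (if b < x ∧ y = x.rev ∧ b = a.rev then κ a / κ y else 0)) := by
  rw [braidEntry, ite_and (b < x), ite_and (b < x)]
  congr 1; split_ifs <;> ring

theorem braidInvEntry_eq (D : RootDatum m n) (κ : Idx m n → Cq) (x y a b : Idx m n) :
    D.braidInvEntry κ x y a b =
    (if x = b ∧ y = a then ksign (D.vpar a) (D.vpar b) * q ^ (-D.ip (wt a) (wt b)) else 0) -
    (q - q⁻¹) * ((if x < b ∧ x = a ∧ y = b then 1 else 0) -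
      (if x < b ∧ y = x.rev ∧ b = a.rev then κ a / κ y else 0)) := by
  rw [braidInvEntry, ite_and (x < b), ite_and (x < b)]
  congr 1; split_ifs <;> ring

theorem mul_ite_eq_mul_ite {P Q : Prop} [Decidable P] [Decidable Q] {a b x y : Cq} (h : P ↔ Q)
    (e : Q → a * x = b * y) : a * (if P then x else 0) = b * (if Q then y else 0) := by
  by_cases hQ : Q
  · rw [if_pos hQ, if_pos (h.2 hQ), e hQ]
  · rw [if_neg hQ, if_neg (fun hP => hQ (h.1 hP)), mul_zero, mul_zero]

theorem lt_rev_iff {a b : Idx m n} : a < b.rev ↔ b < a.rev := by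
  rw [← Fin.rev_lt_rev, Fin.rev_rev]

variable (D) (hκ : ∀ a, κ a ≠ 0)
include hκ

/-- Turning a crossing by a right angle exchanges the identity term and the cup-cap term of the
truncation, which accounts for their opposite sign in the inverse. The swap term stays a swap term,
and `q^{(λ,μ)}` is inverted because one weight changes its sign. -/
theorem cap_slide_entry (a b d e : Idx m n) :
    κ a * D.braidEntry κ a.rev d b e = κ e.rev * D.braidInvEntry κ d e.rev a b := by
  have h1 : κ a * (if a.rev = e ∧ d = b then ksign (D.vpar b) (D.vpar e) * q ^ D.ip (wt b) (wt e) else 0) =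
      κ e.rev * (if d = b ∧ e.rev = a then ksign (D.vpar a) (D.vpar b) * q ^ (-D.ip (wt a) (wt b)) else 0) := by
    refine mul_ite_eq_mul_ite (by rw [and_comm, Fin.rev_eq_iff, eq_comm (a := a)]) ?_
    rintro ⟨rfl, rfl⟩
    rw [vpar_rev, wt_rev, ip_neg_left, neg_neg, ksign_comm, D.ip_comm]
  have h2 : κ a * (if e < a.rev ∧ a.rev = b ∧ d = e then 1 else 0) =
      κ e.rev * (if d < b ∧ e.rev = d.rev ∧ b = a.rev then κ a / κ e.rev else 0) := by
    refine mul_ite_eq_mul_ite ⟨?_, ?_⟩ ?_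
    · rintro ⟨h, rfl, rfl⟩; exact ⟨h, rfl, rfl⟩
    · rintro ⟨h, h', rfl⟩; obtain rfl := Fin.rev_inj.1 h'; exact ⟨h, rfl, rfl⟩
    · intro _; have := hκ e.rev; field_simp
  have h3 : κ a * (if e < a.rev ∧ d = a.rev.rev ∧ e = b.rev then κ b / κ d else 0) =
      κ e.rev * (if d < b ∧ d = a ∧ e.rev = b then 1 else 0) := by
    refine mul_ite_eq_mul_ite ⟨?_, ?_⟩ ?_
    · rintro ⟨h, rfl, rfl⟩; rw [Fin.rev_rev, Fin.rev_rev]; exact ⟨by simpa using h, rfl, rfl⟩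
    · rintro ⟨h, rfl, rfl⟩; rw [Fin.rev_rev, Fin.rev_rev]; exact ⟨lt_rev_iff.1 h, rfl, rfl⟩
    · rintro ⟨_, rfl, rfl⟩; have := hκ d; field_simp
  rw [braidEntry_eq, braidInvEntry_eq]
  linear_combination h1 + (q - q⁻¹) * h2 - (q - q⁻¹) * h3

theorem cup_slide_entry (a b d e : Idx m n) :
    (κ a.rev)⁻¹ * D.braidEntry κ b e a.rev d = (κ e)⁻¹ * D.braidInvEntry κ a b d e.rev := by
  have h1 : (κ a.rev)⁻¹ * (if b = d ∧ e = a.rev then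
        ksign (D.vpar a.rev) (D.vpar d) * q ^ D.ip (wt a.rev) (wt d) else 0) =
      (κ e)⁻¹ * (if a = e.rev ∧ b = d then
        ksign (D.vpar d) (D.vpar e.rev) * q ^ (-D.ip (wt d) (wt e.rev)) else 0) := by
    refine mul_ite_eq_mul_ite (by rw [and_comm, eq_rev_comm]) ?_
    rintro ⟨rfl, rfl⟩
    rw [Fin.rev_rev, vpar_rev, wt_rev, ip_neg_right, neg_neg, ksign_comm, D.ip_comm]
  have h2 : (κ a.rev)⁻¹ * (if d < b ∧ b = a.rev ∧ e = d then 1 else 0) =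
      (κ e)⁻¹ * (if a < e.rev ∧ b = a.rev ∧ e.rev = d.rev then κ d / κ b else 0) := by
    refine mul_ite_eq_mul_ite ⟨?_, ?_⟩ ?_
    · rintro ⟨h, rfl, rfl⟩; exact ⟨lt_rev_iff.1 h, rfl, rfl⟩
    · rintro ⟨h, rfl, h'⟩; obtain rfl := Fin.rev_inj.1 h'; exact ⟨lt_rev_iff.1 h, rfl, rfl⟩
    · rintro ⟨_, rfl, h'⟩; obtain rfl := Fin.rev_inj.1 h'; have := hκ e; field_simp
  have h3 : (κ a.rev)⁻¹ * (if d < b ∧ e = b.rev ∧ d = a.rev.rev then κ a.rev / κ e else 0) =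
      (κ e)⁻¹ * (if a < e.rev ∧ a = d ∧ b = e.rev then 1 else 0) := by
    refine mul_ite_eq_mul_ite ⟨?_, ?_⟩ ?_
    · rintro ⟨h, rfl, rfl⟩; rw [Fin.rev_rev, Fin.rev_rev] at *; exact ⟨h, rfl, rfl⟩
    · rintro ⟨h, rfl, rfl⟩; rw [Fin.rev_rev, Fin.rev_rev]; exact ⟨h, rfl, rfl⟩
    · rintro ⟨_, rfl, rfl⟩; have := hκ a.rev; field_simp
  rw [braidEntry_eq, braidInvEntry_eq]
  linear_combination h1 + (q - q⁻¹) * h2 - (q - q⁻¹) * h3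

theorem cap_slide : pad 0 1 (k := 3) (l := 1) rfl rfl (capMat κ) * pad 1 0 (k := 3) rfl rfl (D.braidMat κ) =
    pad 1 0 (k := 3) (l := 1) rfl rfl (capMat κ) * pad 0 1 (k := 3) rfl rfl (D.braidInvMat κ) := by
  ext w' w
  rw [word_one w', word_three w, pad_left_cap_mul_apply, pad_right_cap_mul_apply,
    Finset.sum_eq_single (w 0), Finset.sum_eq_single (w 2).rev, pad_left_apply, pad_right_apply, if_pos rfl,
    if_pos (Fin.rev_rev _), braidMat_apply, braidInvMat_apply]
  · exact cap_slide_entry D hκ _ _ _ _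
  · intro b _ hb
    rw [pad_left_apply, if_neg (fun h => hb (Fin.rev_eq_iff.1 h)), mul_zero]
  · exact fun h => absurd (Finset.mem_univ _) h
  · intro b _ hb
    rw [pad_right_apply, if_neg hb, mul_zero]
  · exact fun h => absurd (Finset.mem_univ _) h

theorem cup_slide : pad 1 0 (k := 3) (l := 3) rfl rfl (D.braidMat κ) * pad 0 1 (k := 1) rfl rfl (cupMat κ) =
    pad 0 1 (k := 3) (l := 3) rfl rfl (D.braidInvMat κ) * pad 1 0 (k := 1) rfl rfl (cupMat κ) := by
  ext w' w
  rw [word_one w, word_three w', mul_pad_left_cup_apply, mul_pad_right_cup_apply,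
    Finset.sum_eq_single (w' 0), Finset.sum_eq_single (w' 2).rev, pad_left_apply, pad_right_apply, if_pos rfl,
    if_pos (Fin.rev_rev _).symm, braidMat_apply, braidInvMat_apply, Fin.rev_rev, mul_comm,
    mul_comm (D.braidInvEntry _ _ _ _ _)]
  · exact cup_slide_entry D hκ _ _ _ _
  · intro b _ hb
    rw [pad_left_apply, if_neg (fun h => hb (Fin.rev_eq_iff.1 h.symm)), zero_mul]
  · exact fun h => absurd (Finset.mem_univ _) h
  · intro b _ hb
    rw [pad_right_apply, if_neg hb.symm, zero_mul]
  · exact fun h => absurd (Finset.mem_univ _) h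

omit D in
theorem zigzag_left : pad 0 1 (k := 3) (l := 1) rfl rfl (capMat κ) * pad 1 0 (k := 1) rfl rfl (cupMat κ) = 1 := by
  ext w' w
  rw [word_one w', word_one w, pad_left_cap_mul_apply, Finset.sum_eq_single (w 0), pad_right_cup_apply,
    if_pos rfl, cupMat_apply, Fin.rev_rev, Matrix.one_apply]
  · have := hκ (w 0)
    by_cases h : w' 0 = w 0
    · rw [if_pos h, if_pos (by rw [h]), h, mul_inv_cancel₀ this]
    · rw [if_neg h, if_neg, mul_zero]
      intro h'; exact h (congrFun h' 0)
  · intro b _ hb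
    rw [pad_right_cup_apply, if_neg hb, mul_zero]
  · exact fun h => absurd (Finset.mem_univ _) h

omit D in
theorem zigzag_right : pad 1 0 (k := 3) (l := 1) rfl rfl (capMat κ) * pad 0 1 (k := 1) rfl rfl (cupMat κ) = 1 := by
  ext w' w
  rw [word_one w', word_one w, pad_right_cap_mul_apply, Finset.sum_eq_single (w 0).rev, pad_left_cup_apply,
    Fin.rev_rev, if_pos rfl, cupMat_apply, Matrix.one_apply]
  · have := hκ (w 0).rev
    by_cases h : w' 0 = w 0
    · rw [if_pos (by rw [h]), if_pos (by rw [h]), mul_inv_cancel₀ this]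
    · rw [if_neg (fun h' => h (Fin.rev_inj.1 h').symm), if_neg, mul_zero]
      intro h'; exact h (congrFun h' 0)
  · intro b _ hb
    rw [pad_left_cup_apply, if_neg (fun h => hb (Fin.rev_eq_iff.1 h)), mul_zero]
  · exact fun h => absurd (Finset.mem_univ _) h

theorem pad_braid_sub (i r : ℕ) {k : ℕ} (hk : k = i + 2 + r) : pad i r hk hk (D.braidMat κ) =
    pad i r hk hk (D.braidInvMat κ) + (q - q⁻¹) • (1 - pad i r (k := i + r) rfl hk (cupMat κ) *
      pad i r hk (l := i + r) rfl (capMat κ)) := by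
  rw [pad_mul, ← pad_one hk, ← pad_sub, ← pad_smul, ← braid_sub_braidInv hκ, pad_sub, add_sub_cancel]

omit hκ in
theorem add_smul_sub_add_smul_sub {k l : ℕ} (X A B : TMat m n k l) (z : Cq) :
    X + z • (A - B) + z • (B - A) = X := by
  ext; simp only [Matrix.add_apply, Matrix.smul_apply, Matrix.sub_apply, smul_eq_mul]; ring

/-- The skein relation is applied to both sides of `cap_slide`; the correction terms match by the
zigzag identities, so no second computation of entries is needed. -/
theorem cap_slide_inv :
    pad 0 1 (k := 3) (l := 1) rfl rfl (capMat κ) * pad 1 0 (k := 3) rfl rfl (D.braidInvMat κ) =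
    pad 1 0 (k := 3) (l := 1) rfl rfl (capMat κ) * pad 0 1 (k := 3) rfl rfl (D.braidMat κ) := by
  have h := cap_slide D hκ
  rw [pad_braid_sub D hκ 1 0 rfl, Matrix.mul_add, Matrix.mul_smul, Matrix.mul_sub, ← Matrix.mul_assoc,
    show pad 0 1 (k := 3) (l := 1) rfl rfl (capMat κ) * pad 1 0 (k := 1 + 0) (l := 3) rfl rfl (cupMat κ) = 1
      from zigzag_left hκ, Matrix.one_mul, Matrix.mul_one] at h
  rw [pad_braid_sub D hκ 0 1 rfl, Matrix.mul_add, ← h, Matrix.mul_smul, Matrix.mul_sub, ← Matrix.mul_assoc,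
    show pad 1 0 (k := 3) (l := 1) rfl rfl (capMat κ) * pad 0 1 (k := 0 + 1) (l := 3) rfl rfl (cupMat κ) = 1
      from zigzag_right hκ, Matrix.one_mul, Matrix.mul_one]
  exact (add_smul_sub_add_smul_sub _ _ _ _).symm

theorem cup_slide_inv :
    pad 1 0 (k := 3) (l := 3) rfl rfl (D.braidInvMat κ) * pad 0 1 (k := 1) rfl rfl (cupMat κ) =
    pad 0 1 (k := 3) (l := 3) rfl rfl (D.braidMat κ) * pad 1 0 (k := 1) rfl rfl (cupMat κ) := by
  have h := cup_slide D hκ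
  rw [pad_braid_sub D hκ 1 0 rfl, Matrix.add_mul, Matrix.smul_mul, Matrix.sub_mul, Matrix.mul_assoc,
    show pad 1 0 (k := 3) (l := 1 + 0) rfl rfl (capMat κ) * pad 0 1 (k := 1) (l := 3) rfl rfl (cupMat κ) = 1
      from zigzag_right hκ, Matrix.one_mul, Matrix.mul_one] at h
  rw [pad_braid_sub D hκ 0 1 rfl, Matrix.add_mul, ← h, Matrix.smul_mul, Matrix.sub_mul, Matrix.mul_assoc,
    show pad 0 1 (k := 3) (l := 0 + 1) rfl rfl (capMat κ) * pad 1 0 (k := 1) (l := 3) rfl rfl (cupMat κ) = 1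
      from zigzag_left hκ, Matrix.one_mul, Matrix.mul_one]
  exact (add_smul_sub_add_smul_sub _ _ _ _).symm

end slides

section twist
variable (hmn : ¬ (m = 2 ∧ n = 0)) (hκ : D.IsKappa κ)

/-- Through this sum the numbers of `ε`'s and `δ`'s enter the twist, which therefore does not depend
on the chosen ordering. -/
theorem sum_sg (D : RootDatum m n) :
    ∑ j ∈ Finset.range (m / 2 + n), (if h : j < m + 2 * n then D.sg ⟨j, h⟩ else 0) = ((m / 2 : ℕ) : ℤ) - n := by
  rw [Finset.sum_range]
  have e : ∀ j : Fin (m / 2 + n), (if h : j.val < m + 2 * n then D.sg ⟨j, h⟩ else 0) =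
      1 - 2 * (if D.isDelta j = true then 1 else 0) := fun j => by
    rw [dif_pos (show j.val < m + 2 * n by have := j.isLt; omega), sg, odd, dif_pos j.isLt]
    cases D.isDelta j <;> simp
  rw [Finset.sum_congr rfl fun j _ => e j, Finset.sum_sub_distrib, ← Finset.mul_sum, Finset.sum_boole,
    D.card_isDelta]
  simp; ring

theorem ratio_mul_ratio {t s : Idx m n} (h : t ≠ s) (h' : t ≠ s.rev) :
    D.ratio t s * D.ratio s.rev t.rev = D.sgq t * D.sgq s * q ^ (D.ip (wt t) (wt t) + D.ip (wt s) (wt s)) := by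
  rw [ratio, ratio, vpar_rev, vpar_rev, wt_rev, wt_rev, ip_neg_left, ip_neg_left, ip_neg_right, ip_neg_right,
    D.ip_comm (wt s) (wt t), ip_eq_zero h h', ksign_vpar_add, ksign_vpar_add,
    zpow_add₀ q_ne_zero, sgq, sgq]
  cases D.odd t <;> cases D.odd s <;> simp

include hmn hκ in
-- Induction from the middle of the weight diagram outwards: the step passes from `t + 1` to `t`
-- along an arrow and its mirror, whose ratios multiply as in `ratio_mul_ratio`. In the middle there
-- are three cases: a fork, a zero weight between two arrows, or a single arrow for the root
-- `2ℰ_{L-1}`.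
theorem IsKappa.div_rev (t : ℕ) (ht : t < m / 2 + n) :
    κ ⟨t, by omega⟩ = D.sgq ⟨t, by omega⟩ * q ^ (D.sg ⟨t, by omega⟩ +
      2 * (∑ j ∈ Finset.Ico (t + 1) (m / 2 + n), if h : j < m + 2 * n then D.sg ⟨j, h⟩ else 0) +
      (m % 2 : ℕ) - 1) * κ ⟨m + 2 * n - 1 - t, by omega⟩ := by
  have arr : ∀ {i : Fin (m / 2 + n)} {p p' : Idx m n}, wt p' = wt p + D.simpleRoot i → κ p' = D.ratio p' p * κ p :=
    (isKappa_iff.1 hκ).2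
  induction h : m / 2 + n - 1 - t generalizing t with
  | zero =>
    obtain rfl : t = m / 2 + n - 1 := by omega
    rw [Finset.Ico_eq_empty (by omega), Finset.sum_empty, mul_zero, add_zero]
    by_cases hD : D.forked
    · have hm := hD.1
      have h1 : D.odd ⟨m / 2 + n - 1, by omega⟩ = false := by
        obtain ⟨_, h0, h1⟩ := hD
        rw [odd, dif_pos ht]; exact h1
      rw [hκ.tie hmn hD (a := ⟨m / 2 + n - 1, by omega⟩) (b := ⟨m + 2 * n - 1 - (m / 2 + n - 1), by omega⟩)
        (by simp only; omega) (by simp only; omega), sg, sgq, h1, hm]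
      simp
    · have a1 := arrow_last hD (by omega)
      have hs : ¬ ((⟨m / 2 + n - 1, by omega⟩ : Idx m n) = Fin.rev ⟨m / 2 + n - 1, by omega⟩) := by
        rw [eq_rev_iff]; simp only; omega
      by_cases hm : m % 2 = 1
      · have a2 := arrow_rev a1
        rw [rev_mk (a := m / 2 + n) (b := m / 2 + n) (by omega) (by omega) (by omega),
          rev_mk (a := m / 2 + n - 1) (b := m + 2 * n - 1 - (m / 2 + n - 1)) (by omega) (by omega)
            (by omega)] at a2
        have hc : (⟨m / 2 + n, by omega⟩ : Idx m n) = Fin.rev ⟨m / 2 + n, by omega⟩ := by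
          rw [rev_mk _ (b := m / 2 + n) (by omega) (by omega)]
        have hw : wt (⟨m / 2 + n, by omega⟩ : Idx m n) = 0 := by
          have := congrArg wt hc
          rw [wt_rev] at this
          exact self_eq_neg.1 this
        have hb : (⟨m + 2 * n - 1 - (m / 2 + n - 1), by omega⟩ : Idx m n) = Fin.rev ⟨m / 2 + n - 1, by omega⟩ :=
          (rev_mk _ _ (by omega)).symm
        have h0 : ∀ μ, D.ip 0 μ = 0 := fun μ => by simp [ip]
        have h0' : ∀ μ, D.ip μ 0 = 0 := fun μ => by simp [ip]
        rw [arr a1, arr a2, ratio, ratio, ksign_vpar_add, ksign_vpar_add, D.odd_of_rev_eq hc, hw, hb, odd_rev, h0, h0',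
          h0', ip_wt, if_pos rfl, if_neg hs, hm, sgq, sg]
        cases D.odd ⟨m / 2 + n - 1, by omega⟩ <;> simp
      · have hb : (⟨m / 2 + n, by omega⟩ : Idx m n) = Fin.rev ⟨m / 2 + n - 1, by omega⟩ :=
          (rev_mk _ _ (by omega)).symm
        have e : (⟨m + 2 * n - 1 - (m / 2 + n - 1), by omega⟩ : Idx m n) = ⟨m / 2 + n, by omega⟩ := by
          ext; simp only; omega
        have ho : D.odd ⟨m / 2 + n - 1, by omega⟩ = true := by
          by_contra h1
          refine hD ⟨by omega, by omega, ?_⟩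
          rw [odd, dif_pos ht] at h1
          simpa using h1
        rw [arr a1, e, ratio, hb, ksign_vpar_add, odd_rev, wt_rev, ip_neg_left, ip_wt, if_pos rfl, if_neg hs, sgq, sg,
          ho, show m % 2 = 0 by omega]
        simp
  | succ d ih =>
    have ht' : t + 1 < m / 2 + n := by omega
    have a1 := arrow_lt (D := D) ht'
    have a2 := arrow_rev a1
    have i1 := ih (t + 1) ht' (by omega)
    have hne : (⟨t, by omega⟩ : Idx m n) ≠ ⟨t + 1, by omega⟩ := fun h => by simp at h
    have hne' : (⟨t, by omega⟩ : Idx m n) ≠ Fin.rev ⟨t + 1, by omega⟩ := by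
      rw [Ne, eq_rev_iff]; simp only; omega
    have hr := ratio_mul_ratio (D := D) hne hne'
    rw [Finset.sum_eq_sum_Ico_succ_bot ht', dif_pos (show t + 1 < m + 2 * n by omega), arr a1, i1,
      ← rev_mk (a := t + 1) (b := m + 2 * n - 1 - (t + 1)) (by omega) (by omega) (by omega), arr a2,
      rev_mk (a := t) (b := m + 2 * n - 1 - t) (by omega) (by omega) (by omega)]
    have hip : ∀ s : Idx m n, s ≠ s.rev → D.ip (wt s) (wt s) = D.sg s := fun s hs => by
      rw [ip_wt, if_pos rfl, if_neg hs]; ring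
    rw [rev_mk (a := t) (b := m + 2 * n - 1 - t) (by omega) (by omega) (by omega), hip _ (by
      rw [Ne, eq_rev_iff]; simp only; omega), hip _ (by rw [Ne, eq_rev_iff]; simp only; omega)] at hr
    generalize (∑ j ∈ Finset.Ico (t + 1 + 1) (m / 2 + n), if h : j < m + 2 * n then D.sg ⟨j, h⟩ else 0) = S at *
    set σ0 := D.sg ⟨t, by omega⟩
    set σ1 := D.sg ⟨t + 1, by omega⟩
    have e : σ0 + 2 * (σ1 + S) + ((m % 2 : ℕ) : ℤ) - 1 = (σ0 + σ1) + (σ1 + 2 * S + ((m % 2 : ℕ) : ℤ) - 1) := by ring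
    rw [e, zpow_add₀ q_ne_zero (σ0 + σ1)]
    have hs : D.sgq ⟨t + 1, by omega⟩ * D.sgq ⟨t + 1, by omega⟩ = 1 := by rw [sgq]; split_ifs <;> simp
    linear_combination (D.sgq ⟨t + 1, by omega⟩ * q ^ (σ1 + 2 * S + ((m % 2 : ℕ) : ℤ) - 1) *
      κ ⟨m + 2 * n - 1 - t, by omega⟩) * hr + (D.sgq ⟨t, by omega⟩ * q ^ (σ0 + σ1) *
      q ^ (σ1 + 2 * S + ((m % 2 : ℕ) : ℤ) - 1) * κ ⟨m + 2 * n - 1 - t, by omega⟩) * hs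

/-- The eigenvalue of the braiding on the invariant vector. -/
def twist (m n : ℕ) : Cq := q ^ (-(m : ℤ) + 2 * (n : ℤ) + 1)

include hmn hκ

/-- This is the component of `c U = y U` with the lowest last letter. It follows from `div_rev` for
the outermost pair and `sum_sg`. -/
theorem twist_eq {t : Idx m n} (ht : t.val + 1 = m + 2 * n) :
    twist m n * (κ t)⁻¹ = D.swapCoeff t t.rev * (κ t.rev)⁻¹ := by
  have h0 := hκ.ne_zero t
  have h0' := hκ.ne_zero t.rev
  by_cases hL : m / 2 + n = 0
  · have hr : t.rev = t := by ext; rw [Fin.val_rev]; omega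
    have hw : wt t = 0 := by funext j; exact absurd j.isLt (by omega)
    have hm : m = 1 := by omega
    have hn : n = 0 := by omega
    rw [hr, twist, swapCoeff, hw, ksign_vpar, D.odd_of_rev_eq hr.symm]
    subst hm hn
    simp [ip]
  · have h := hκ.div_rev hmn 0 (by omega)
    have e1 : (⟨m + 2 * n - 1 - 0, by omega⟩ : Idx m n) = t := by ext; simp only; omega
    have e2 : (⟨0, by omega⟩ : Idx m n) = t.rev := by ext; rw [Fin.val_rev]; simp only; omega
    have hs := D.sum_sg
    rw [Finset.range_eq_Ico, Finset.sum_eq_sum_Ico_succ_bot (by omega), dif_pos (by omega)] at hs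
    rw [e1, e2] at h
    simp only [zero_add] at hs h
    rw [e2] at hs
    rw [swapCoeff, wt_rev, ip_neg_right, ip_wt, if_pos rfl, if_neg (by rw [eq_rev_iff]; omega), h, vpar_rev,
      ksign_vpar, sg_rev, sgq_rev, twist]
    rw [sg_rev] at hs
    have e3 : -(D.sg t * (1 - 0)) = (-(m : ℤ) + 2 * (n : ℤ) + 1) + (D.sg t + 2 * (∑ j ∈ Finset.Ico 1 (m / 2 + n),
        if h : j < m + 2 * n then D.sg ⟨j, h⟩ else 0) + ((m % 2 : ℕ) : ℤ) - 1) := by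
      push_cast at hs ⊢
      omega
    rw [e3, zpow_add₀ q_ne_zero (-(m : ℤ) + 2 * (n : ℤ) + 1), sgq]
    have h4 := zpow_ne_zero (D.sg t + 2 * (∑ j ∈ Finset.Ico 1 (m / 2 + n),
        if h : j < m + 2 * n then D.sg ⟨j, h⟩ else 0) + ((m % 2 : ℕ) : ℤ) - 1) q_ne_zero
    generalize D.sg t + 2 * (∑ j ∈ Finset.Ico 1 (m / 2 + n),
        if h : j < m + 2 * n then D.sg ⟨j, h⟩ else 0) + ((m % 2 : ℕ) : ℤ) - 1 = M at h4 ⊢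
    cases D.odd t <;> simp <;> field_simp

theorem braid_mul_cup : D.braidMat κ * cupMat κ = twist m n • cupMat κ := by
  rw [← sub_eq_zero]
  refine (((isHom_braid hmn hκ).mul (isHom_cup hκ)).sub ((isHom_cup hκ).smul _)).eq_zero_of_last hmn (l := 1)
    fun w' w hw' => ?_
  have ht : (w' 1).val + 1 = m + 2 * n := hw'
  rw [word_two w', Matrix.sub_apply, braid_mul_lowest κ ht, Matrix.smul_apply, cupMat_apply, cupMat_apply]
  by_cases h : w' 0 = (w' 1).rev
  · rw [if_pos h, if_pos (eq_rev_comm.1 h), smul_eq_mul, twist_eq hmn hκ ht, h, sub_self]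
  · rw [if_neg h, if_neg (fun h' => h (eq_rev_comm.1 h')), smul_zero, mul_zero, sub_zero]

omit hmn in
theorem cup_mul_cancel {k : ℕ} {A B : TMat m n k 0} (h : cupMat κ * A = cupMat κ * B) (hN : 0 < m + 2 * n) : A = B := by
  ext w' w
  have e := congrFun (congrFun h ![Fin.rev ⟨0, hN⟩, ⟨0, hN⟩]) w
  rw [Matrix.mul_apply, Matrix.mul_apply, Fintype.sum_unique, Fintype.sum_unique, cupMat_apply, Fin.rev_rev,
    if_pos rfl] at e
  rw [Subsingleton.elim w' default]
  exact mul_left_cancel₀ (inv_ne_zero (hκ.ne_zero _)) e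

/-- By the skein relation `U Ω` is a combination of `1`, `c` and `c⁻¹`, so it commutes with `c`.
Hence `U (Ω c) = c U Ω = y U Ω`, and `U` is cancelled. -/
theorem cap_mul_braid : capMat κ * D.braidMat κ = twist m n • capMat κ := by
  rcases Nat.eq_zero_or_pos (m + 2 * n) with hN | hN
  -- For `m = n = 0` the module is zero and `U` cannot be cancelled, but there are no entries to
  -- compare either.
  · ext w' w; exact absurd (w 0).isLt (by omega)
  refine cup_mul_cancel hκ ?_ hN
  have h := braid_sub_braidInv (D := D) hκ.ne_zero
  have e : cupMat κ * capMat κ = 1 - (q - q⁻¹)⁻¹ • (D.braidMat κ - D.braidInvMat κ) := by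
    rw [h, smul_smul, inv_mul_cancel₀ z_ne_zero, one_smul, sub_sub_cancel]
  rw [← Matrix.mul_assoc, e, Matrix.sub_mul, Matrix.smul_mul, Matrix.sub_mul, braidInv_mul_braid hmn hκ,
    Matrix.one_mul, ← braid_mul_braidInv hmn hκ, ← Matrix.mul_sub, ← Matrix.mul_smul, Matrix.mul_smul]
  have e2 : D.braidMat κ - (q - q⁻¹)⁻¹ • (D.braidMat κ * (D.braidMat κ - D.braidInvMat κ)) =
      D.braidMat κ * (cupMat κ * capMat κ) := by
    rw [e, Matrix.mul_sub (D.braidMat κ) 1, Matrix.mul_one, Matrix.mul_smul]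
  rw [e2, ← Matrix.mul_assoc, braid_mul_cup hmn hκ, Matrix.smul_mul, Matrix.mul_smul]

omit hmn hκ in
theorem twist_ne_zero : twist m n ≠ 0 := zpow_ne_zero _ q_ne_zero

theorem braidInv_mul_cup : D.braidInvMat κ * cupMat κ = (twist m n)⁻¹ • cupMat κ := by
  have h := congrArg (fun X : TMat m n 0 2 => D.braidInvMat κ * X) (braid_mul_cup hmn hκ)
  simp only [← Matrix.mul_assoc, braidInv_mul_braid hmn hκ, Matrix.one_mul, Matrix.mul_smul] at h
  conv_rhs => rw [h, smul_smul, inv_mul_cancel₀ twist_ne_zero, one_smul]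

end twist
end RootDatum
end
end OspBMW

/-! ### The functor on ribbon graphs -/

namespace OspBMW
noncomputable section

theorem RibbonGraph.induction {k : ℕ} {P : ∀ l, RibbonGraph k l → Prop} (id : P k (𝟙 (pts k)))
    (comp : ∀ (l l' : ℕ) (Γ : RibbonGraph k l) (s : Slice l l'), P l Γ → P l' (Γ ≫ ofSlice s))
    {l : ℕ} (Γ : RibbonGraph k l) : P l Γ := by
  have key : ∀ (l : Strands) (p : Quiver.Path (⟨k⟩ : Strands) l),
      P l.num ((CategoryTheory.Quotient.functor ribbonRel).map (X := (Paths.of Strands).obj ⟨k⟩)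
        (Y := (Paths.of Strands).obj l) p) := by
    intro l p
    induction p with
    | nil => exact id
    | cons p s ih => exact comp _ _ _ s ih
  obtain ⟨p, rfl⟩ := (CategoryTheory.Quotient.functor ribbonRel).map_surjective Γ
  exact key ⟨l⟩ p

/-- The evaluation of a sequence of generators when `val` gives the values of the generators. -/
inductive Evaluates {m n : ℕ} (val : (g : Piece) → TMat m n g.src g.tgt) :
    (k l : ℕ) → List (Piece × ℕ) → TMat m n k l → Prop
  | nil (k : ℕ) : Evaluates val k k [] 1
  | cons {k b l : ℕ} {w w' : List (Piece × ℕ)} {M : TMat m n k b} (h : Evaluates val k b w M) (g : Piece)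
      (j r : ℕ) (hw : w' = w ++ [(g, j)]) (hk : b = j + g.src + r) (hl : l = j + g.tgt + r) :
      Evaluates val k l w' (pad j r hk hl (val g) * M)

namespace Evaluates
variable {m n : ℕ} {val : (g : Piece) → TMat m n g.src g.tgt}

theorem of_nil {k l : ℕ} {M : TMat m n k l} (h : Evaluates val k l [] M) : k = l := by
  generalize hw : ([] : List (Piece × ℕ)) = w at h
  cases h with
  | nil => rfl
  | cons h g j r hw' => exact absurd (hw.trans hw') (by simp)

theorem of_snoc {k l : ℕ} {w : List (Piece × ℕ)} {g : Piece} {j : ℕ} {M : TMat m n k l}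
    (h : Evaluates val k l (w ++ [(g, j)]) M) : ∃ (b r : ℕ) (hk : b = j + g.src + r) (hl : l = j + g.tgt + r)
      (M' : TMat m n k b), Evaluates val k b w M' ∧ M = pad j r hk hl (val g) * M' := by
  generalize hw : w ++ [(g, j)] = w' at h
  cases h with
  | nil => simp at hw
  | cons h g' j' r hw' hk hl =>
    obtain ⟨rfl, h2⟩ := List.append_inj' (hw.trans hw') rfl
    obtain ⟨rfl, rfl⟩ := Prod.mk.inj (List.singleton_inj.1 h2)
    exact ⟨_, r, hk, hl, _, h, rfl⟩

/-- The number of strands to the right of a generator is not recorded in the list; it is recovered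
from the number of strands at the ends. -/
theorem unique {k l : ℕ} {w : List (Piece × ℕ)} {M M' : TMat m n k l} (h : Evaluates val k l w M)
    (h' : Evaluates val k l w M') : M = M' := by
  induction w using List.reverseRecOn generalizing l with
  | nil =>
    have := h.of_nil
    subst this
    have key : ∀ {l : ℕ} {M : TMat m n k l}, Evaluates val k l [] M → ∀ e : k = l, M = e ▸ (1 : TMat m n k k) := by
      intro l M h e
      generalize hw : ([] : List (Piece × ℕ)) = w at h
      cases h with
      | nil => rfl
      | cons h g j r hw' => exact absurd (hw.trans hw') (by simp)
    exact (key h rfl).trans (key h' rfl).symm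
  | append_singleton w x ih =>
    obtain ⟨g, j⟩ := x
    obtain ⟨b, r, hk, hl, N, hN, rfl⟩ := h.of_snoc
    obtain ⟨b', r', hk', hl', N', hN', rfl⟩ := h'.of_snoc
    obtain rfl : r = r' := by omega
    obtain rfl : b = b' := by omega
    rw [ih hN hN']

theorem pad {s t : ℕ} {w : List (Piece × ℕ)} {M : TMat m n s t} (h : Evaluates val s t w M) (i r : ℕ) :
    Evaluates val (i + s + r) (i + t + r) (w.map fun x => (x.1, i + x.2)) (pad i r rfl rfl M) := by
  induction h with
  | nil => rw [pad_one]; exact .nil _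
  | @cons b l w w' M h g j r' hw hk hl ih =>
    rw [← pad_mul rfl (l := i + b + r) rfl rfl, pad_pad hk hl]
    exact ih.cons g (i + j) (r' + r) (by rw [hw, List.map_append]; rfl) _ _

end Evaluates

namespace RootDatum
variable {m n : ℕ} (D : RootDatum m n) (κ : Idx m n → Cq)

/-- The images of the generators. -/
def genVal : (g : Piece) → TMat m n g.src g.tgt
  | .xPos => D.braidMat κ
  | .xNeg => D.braidInvMat κ
  | .cup => cupMat κ
  | .cap => capMat κ

variable {D κ}

theorem genVal_isHom (hmn : ¬ (m = 2 ∧ n = 0)) (hκ : D.IsKappa κ) : ∀ g, D.IsHom (D.genVal κ g)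
  | .xPos => isHom_braid hmn hκ
  | .xNeg => isHom_braidInv hmn hκ
  | .cup => isHom_cup hκ
  | .cap => isHom_cap hκ

theorem pieceVal_eq (hmn : ¬ (m = 2 ∧ n = 0)) (hκ : D.IsKappa κ) {R : TMat m n 2 2} (hR : D.IsRMatrix R) :
    D.pieceVal R (formMat κ) = D.genVal κ := by
  funext g
  cases g with
  | xPos => exact hR.flip_mul_eq hmn hκ
  | xNeg => rw [pieceVal, hR.flip_mul_eq hmn hκ, braidMat_inv hmn hκ]; rfl
  | cup => rw [pieceVal, formMat_inv hκ.ne_zero]; rfl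
  | cap => rfl

theorem curl_right (hmn : ¬ (m = 2 ∧ n = 0)) (hκ : D.IsKappa κ) :
    pad 1 0 (k := 3) (l := 1) rfl rfl (capMat κ) * (pad 0 1 (k := 3) rfl rfl (D.braidMat κ) *
      pad 1 0 (k := 1) rfl rfl (cupMat κ)) = (twist m n)⁻¹ • 1 := by
  rw [← Matrix.mul_assoc, ← cap_slide_inv D hκ.ne_zero, Matrix.mul_assoc, pad_mul, braidInv_mul_cup hmn hκ,
    pad_smul, Matrix.mul_smul, zigzag_left hκ.ne_zero]

theorem curl_left (hmn : ¬ (m = 2 ∧ n = 0)) (hκ : D.IsKappa κ) :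
    pad 0 1 (k := 3) (l := 1) rfl rfl (capMat κ) * (pad 1 0 (k := 3) rfl rfl (D.braidMat κ) *
      pad 0 1 (k := 1) rfl rfl (cupMat κ)) = (twist m n)⁻¹ • 1 := by
  rw [← Matrix.mul_assoc, cap_slide D hκ.ne_zero, Matrix.mul_assoc, pad_mul, braidInv_mul_cup hmn hκ,
    pad_smul, Matrix.mul_smul, zigzag_right hκ.ne_zero]

/-- Each relation is verified once, with the fewest strands possible. The last clause ensures that
an occurrence of the relation between given numbers of strands is this instance with `i` strands
added on the left and `r` on the right. -/
theorem evaluates_localRel (hmn : ¬ (m = 2 ∧ n = 0)) (hκ : D.IsKappa κ) {w w' : List (Piece × ℕ)}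
    (h : LocalRel w w') : ∃ (s t : ℕ) (M : TMat m n s t), Evaluates (D.genVal κ) s t w M ∧
      Evaluates (D.genVal κ) s t w' M ∧ ∀ (i k l : ℕ) (X Y : TMat m n k l),
      Evaluates (D.genVal κ) k l (w.map fun x => (x.1, i + x.2)) X →
      Evaluates (D.genVal κ) k l (w'.map fun x => (x.1, i + x.2)) Y →
      ∃ r, k = i + s + r ∧ l = i + t + r := by
  have inv1 : ∀ {k l g j w} {M : TMat m n k l}, Evaluates (D.genVal κ) k l (w ++ [(g, j)]) M →
      ∃ (b r : ℕ) (M' : TMat m n k b), b = j + g.src + r ∧ l = j + g.tgt + r ∧ Evaluates (D.genVal κ) k b w M' :=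
    fun h => let ⟨b, r, hk, hl, M', h, _⟩ := h.of_snoc; ⟨b, r, M', hk, hl, h⟩
  have n0 := fun k => Evaluates.nil (val := D.genVal κ) k
  have cv : ∀ {k l w} {M M' : TMat m n k l}, Evaluates (D.genVal κ) k l w M → M = M' →
      Evaluates (D.genVal κ) k l w M' := fun h e => e ▸ h
  cases h with
  | interchange g h c =>
    refine ⟨g.src + c + h.src, g.tgt + c + h.tgt, _, ((n0 _).cons g 0 (c + h.src) rfl (by omega) rfl).cons h
      (g.tgt + c) 0 rfl (by omega) (by omega), cv (((n0 _).cons h (g.src + c) 0 rfl (by omega) rfl).cons g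
      0 (c + h.tgt) rfl (by omega) (by omega)) ?_, ?_⟩
    · rw [Matrix.mul_one, Matrix.mul_one, pad_interchange]
    · intro i k l X Y hX hY
      obtain ⟨b, r, M, h1, h2, hX⟩ := inv1 (w := [_]) hX
      obtain ⟨b', r', M', h1', h2', hX⟩ := inv1 (w := []) hX
      have := hX.of_nil
      exact ⟨r, by simp only at *; omega, by simp only at *; omega⟩
  | zigzag_left =>
    refine ⟨1, 1, _, (((n0 1).cons .cup 1 0 (l := 3) rfl rfl rfl).cons .cap 0 1 (l := 1) rfl rfl rfl),
      cv (n0 1) ?_, ?_⟩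
    · simp only [Matrix.mul_one]
      exact (zigzag_left hκ.ne_zero).symm
    · intro i k l X Y hX hY
      obtain ⟨_, a, _, _, _, hX⟩ := inv1 (w := [_]) hX
      obtain ⟨_, r, _, _, _, hX⟩ := inv1 (w := []) hX
      have := hX.of_nil
      have := hY.of_nil
      simp only [Piece.src, Piece.tgt] at *
      exact ⟨r, by omega, by omega⟩
  | zigzag_right =>
    refine ⟨1, 1, _, (((n0 1).cons .cup 0 1 (l := 3) rfl rfl rfl).cons .cap 1 0 (l := 1) rfl rfl rfl),
      cv (n0 1) ?_, ?_⟩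
    · simp only [Matrix.mul_one]
      exact (zigzag_right hκ.ne_zero).symm
    · intro i k l X Y hX hY
      obtain ⟨_, r, _, _, _, hX⟩ := inv1 (w := [_]) hX
      have := hY.of_nil
      simp only [Piece.src, Piece.tgt] at *
      exact ⟨r, by omega, by omega⟩
  | neg_pos =>
    refine ⟨2, 2, _, (((n0 2).cons .xPos 0 0 (l := 2) rfl rfl rfl).cons .xNeg 0 0 (l := 2) rfl rfl rfl),
      cv (n0 2) ?_, ?_⟩
    · simp only [Matrix.mul_one]
      exact (braidInv_mul_braid hmn hκ).symm
    · intro i k l X Y hX hY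
      obtain ⟨_, r, _, _, _, hX⟩ := inv1 (w := [_]) hX
      have := hY.of_nil
      simp only [Piece.src, Piece.tgt] at *
      exact ⟨r, by omega, by omega⟩
  | pos_neg =>
    refine ⟨2, 2, _, (((n0 2).cons .xNeg 0 0 (l := 2) rfl rfl rfl).cons .xPos 0 0 (l := 2) rfl rfl rfl),
      cv (n0 2) ?_, ?_⟩
    · simp only [Matrix.mul_one]
      exact (braid_mul_braidInv hmn hκ).symm
    · intro i k l X Y hX hY
      obtain ⟨_, r, _, _, _, hX⟩ := inv1 (w := [_]) hX
      have := hY.of_nil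
      simp only [Piece.src, Piece.tgt] at *
      exact ⟨r, by omega, by omega⟩
  | braid =>
    refine ⟨3, 3, _, ((((n0 3).cons .xPos 0 1 (l := 3) rfl rfl rfl).cons .xPos 1 0 (l := 3) rfl rfl rfl).cons .xPos 0 1 (l := 3) rfl rfl rfl),
      cv ((((n0 3).cons .xPos 1 0 (l := 3) rfl rfl rfl).cons .xPos 0 1 (l := 3) rfl rfl rfl).cons .xPos 1 0 (l := 3) rfl rfl rfl) ?_, ?_⟩
    · simp only [Matrix.mul_one]
      exact (braid_relation hmn hκ).symm
    · intro i k l X Y hX hY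
      obtain ⟨_, a, _, _, _, hX⟩ := inv1 (w := [_, _]) hX
      obtain ⟨_, r, _, _, _, hX⟩ := inv1 (w := [_]) hX
      obtain ⟨_, b, _, _, _, hX⟩ := inv1 (w := []) hX
      have := hX.of_nil
      simp only [Piece.src, Piece.tgt] at *
      exact ⟨r, by omega, by omega⟩
  | cap_pos =>
    refine ⟨3, 1, _, (((n0 3).cons .xPos 1 0 (l := 3) rfl rfl rfl).cons .cap 0 1 (l := 1) rfl rfl rfl),
      cv (((n0 3).cons .xNeg 0 1 (l := 3) rfl rfl rfl).cons .cap 1 0 (l := 1) rfl rfl rfl) ?_, ?_⟩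
    · simp only [Matrix.mul_one]
      exact (cap_slide D hκ.ne_zero).symm
    · intro i k l X Y hX hY
      obtain ⟨_, a, _, _, _, hX⟩ := inv1 (w := [_]) hX
      obtain ⟨_, r, _, _, _, hX⟩ := inv1 (w := []) hX
      have := hX.of_nil
      simp only [Piece.src, Piece.tgt] at *
      exact ⟨r, by omega, by omega⟩
  | cap_neg =>
    refine ⟨3, 1, _, (((n0 3).cons .xNeg 1 0 (l := 3) rfl rfl rfl).cons .cap 0 1 (l := 1) rfl rfl rfl),
      cv (((n0 3).cons .xPos 0 1 (l := 3) rfl rfl rfl).cons .cap 1 0 (l := 1) rfl rfl rfl) ?_, ?_⟩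
    · simp only [Matrix.mul_one]
      exact (cap_slide_inv D hκ.ne_zero).symm
    · intro i k l X Y hX hY
      obtain ⟨_, a, _, _, _, hX⟩ := inv1 (w := [_]) hX
      obtain ⟨_, r, _, _, _, hX⟩ := inv1 (w := []) hX
      have := hX.of_nil
      simp only [Piece.src, Piece.tgt] at *
      exact ⟨r, by omega, by omega⟩
  | cup_pos =>
    refine ⟨1, 3, _, (((n0 1).cons .cup 0 1 (l := 3) rfl rfl rfl).cons .xPos 1 0 (l := 3) rfl rfl rfl),
      cv (((n0 1).cons .cup 1 0 (l := 3) rfl rfl rfl).cons .xNeg 0 1 (l := 3) rfl rfl rfl) ?_, ?_⟩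
    · simp only [Matrix.mul_one]
      exact (cup_slide D hκ.ne_zero).symm
    · intro i k l X Y hX hY
      obtain ⟨_, r, _, _, _, hX⟩ := inv1 (w := [_]) hX
      obtain ⟨_, a, _, _, _, hX⟩ := inv1 (w := []) hX
      have := hX.of_nil
      simp only [Piece.src, Piece.tgt] at *
      exact ⟨r, by omega, by omega⟩
  | cup_neg =>
    refine ⟨1, 3, _, (((n0 1).cons .cup 0 1 (l := 3) rfl rfl rfl).cons .xNeg 1 0 (l := 3) rfl rfl rfl),
      cv (((n0 1).cons .cup 1 0 (l := 3) rfl rfl rfl).cons .xPos 0 1 (l := 3) rfl rfl rfl) ?_, ?_⟩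
    · simp only [Matrix.mul_one]
      exact (cup_slide_inv D hκ.ne_zero).symm
    · intro i k l X Y hX hY
      obtain ⟨_, r, _, _, _, hX⟩ := inv1 (w := [_]) hX
      obtain ⟨_, a, _, _, _, hX⟩ := inv1 (w := []) hX
      have := hX.of_nil
      simp only [Piece.src, Piece.tgt] at *
      exact ⟨r, by omega, by omega⟩
  | curl =>
    refine ⟨1, 1, _, ((((n0 1).cons .cup 1 0 (l := 3) rfl rfl rfl).cons .xPos 0 1 (l := 3) rfl rfl rfl).cons .cap 1 0 (l := 1) rfl rfl rfl),
      cv ((((n0 1).cons .cup 0 1 (l := 3) rfl rfl rfl).cons .xPos 1 0 (l := 3) rfl rfl rfl).cons .cap 0 1 (l := 1) rfl rfl rfl) ?_, ?_⟩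
    · simp only [Matrix.mul_one]
      exact (curl_left hmn hκ).trans (curl_right hmn hκ).symm
    · intro i k l X Y hX hY
      obtain ⟨_, r, _, _, _, hX⟩ := inv1 (w := [_, _]) hX
      obtain ⟨_, a, _, _, _, hX⟩ := inv1 (w := [_]) hX
      obtain ⟨_, b, _, _, _, hX⟩ := inv1 (w := []) hX
      have := hX.of_nil
      simp only [Piece.src, Piece.tgt] at *
      exact ⟨r, by omega, by omega⟩

theorem evaluates_unique_of_localRel (hmn : ¬ (m = 2 ∧ n = 0)) (hκ : D.IsKappa κ) {w w' : List (Piece × ℕ)}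
    (h : LocalRel w w') {i k l : ℕ} {X Y : TMat m n k l}
    (hX : Evaluates (D.genVal κ) k l (w.map fun x => (x.1, i + x.2)) X)
    (hY : Evaluates (D.genVal κ) k l (w'.map fun x => (x.1, i + x.2)) Y) : X = Y := by
  obtain ⟨s, t, M, h1, h2, h3⟩ := evaluates_localRel hmn hκ h
  obtain ⟨r, rfl, rfl⟩ := h3 i k l X Y hX hY
  exact (hX.unique (h1.pad i r)).trans ((h2.pad i r).unique hY)

/-- The tensor powers of the natural module, as the objects of a category. -/
structure TensorPower (m n : ℕ) where
  num : ℕ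

instance : Category (TensorPower m n) where
  Hom k l := TMat m n k.num l.num
  id k := (1 : TMat m n k.num k.num)
  comp {k l p} A B := ((show TMat m n l.num p.num from B) * (show TMat m n k.num l.num from A) : TMat m n k.num p.num)
  id_comp A := Matrix.mul_one (show TMat m n _ _ from A)
  comp_id A := Matrix.one_mul (show TMat m n _ _ from A)
  assoc A B C := (Matrix.mul_assoc (show TMat m n _ _ from C) (show TMat m n _ _ from B) (show TMat m n _ _ from A)).symm

/-- The evaluation of sequences of slices. -/
def pathFunctor (D : RootDatum m n) (κ : Idx m n → Cq) : Paths Strands ⥤ TensorPower m n :=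
  Paths.lift { obj := fun k => ⟨k.num⟩, map := fun {k l} (s : Slice k.num l.num) => whisker s (D.genVal κ s.piece) }

theorem evaluates_path {k l : Strands} (p : Quiver.Path k l) :
    Evaluates (D.genVal κ) k.num l.num (pieces p) ((D.pathFunctor κ).map p) := by
  induction p with
  | nil => exact .nil _
  | cons p s ih => exact ih.cons _ _ s.right rfl s.hk s.hl

/-- The functor given by the braiding, the cup and the cap. -/
def ribbonEval (hmn : ¬ (m = 2 ∧ n = 0)) (hκ : D.IsKappa κ) : RibbonCat ⥤ TensorPower m n :=
  CategoryTheory.Quotient.lift ribbonRel (D.pathFunctor κ) fun _ _ p p' ⟨i, _, _, h, e, e'⟩ =>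
    evaluates_unique_of_localRel hmn hκ h (i := i) (e ▸ evaluates_path (D := D) (κ := κ) p)
      (e' ▸ evaluates_path (D := D) (κ := κ) p')

/-- Every ribbon graph is a composite of slices, and the values on slices are prescribed. -/
theorem ribbonFunctor_ext {R : TMat m n 2 2} {B : Matrix (Idx m n) (Idx m n) Cq} (F G : D.RibbonFunctor R B) :
    F = G := by
  have h : @F.map = @G.map := by
    funext k l Γ
    induction Γ using RibbonGraph.induction with
    | id => rw [F.map_id, G.map_id]
    | comp l l' Γ s ih => rw [F.map_comp, G.map_comp, ih, F.map_slice, G.map_slice]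
  cases F; cases G; cases h; rfl

theorem IsHom.whisker {k l : ℕ} {s : Slice k l} {A : TMat m n s.piece.src s.piece.tgt} (hA : D.IsHom A) :
    D.IsHom (OspBMW.whisker s A) := by
  rw [whisker_eq_pad]; exact hA.pad

/-- The linear map given by a ribbon graph. -/
def ribbonMap (hmn : ¬ (m = 2 ∧ n = 0)) (hκ : D.IsKappa κ) {k l : ℕ} (Γ : RibbonGraph k l) : TMat m n k l :=
  (ribbonEval hmn hκ).map Γ

theorem ribbonMap_id (hmn : ¬ (m = 2 ∧ n = 0)) (hκ : D.IsKappa κ) (k : ℕ) :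
    ribbonMap hmn hκ (𝟙 (pts k)) = 1 := CategoryTheory.Functor.map_id _ _

theorem ribbonMap_comp (hmn : ¬ (m = 2 ∧ n = 0)) (hκ : D.IsKappa κ) {k l p : ℕ} (Γ : RibbonGraph k l)
    (Γ' : RibbonGraph l p) : ribbonMap hmn hκ (Γ ≫ Γ') = ribbonMap hmn hκ Γ' * ribbonMap hmn hκ Γ :=
  CategoryTheory.Functor.map_comp _ _ _

theorem ribbonMap_slice (hmn : ¬ (m = 2 ∧ n = 0)) (hκ : D.IsKappa κ) {k l : ℕ} (s : Slice k l) :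
    ribbonMap hmn hκ (ofSlice s) = OspBMW.whisker s (D.genVal κ s.piece) :=
  Matrix.mul_one (OspBMW.whisker s (D.genVal κ s.piece))

/-- The functor from ribbon graphs to tensor modules. -/
def ribbonFunctor (hmn : ¬ (m = 2 ∧ n = 0)) (hκ : D.IsKappa κ) {R : TMat m n 2 2} (hR : D.IsRMatrix R) :
    D.RibbonFunctor R (formMat κ) where
  map Γ := ribbonMap hmn hκ Γ
  isHom_map Γ := by
    induction Γ using RibbonGraph.induction with
    | id => rw [ribbonMap_id]; exact IsHom.one _
    | comp l l' Γ s ih =>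
      rw [ribbonMap_comp, ribbonMap_slice]
      exact (genVal_isHom hmn hκ s.piece).whisker.mul ih
  map_id k := ribbonMap_id hmn hκ k
  map_comp Γ Γ' := ribbonMap_comp hmn hκ Γ Γ'
  map_slice s := by rw [pieceVal_eq hmn hκ hR, ribbonMap_slice]

theorem nonempty_unique_ribbonFunctor (hmn : ¬ (m = 2 ∧ n = 0)) {R : TMat m n 2 2}
    {B : Matrix (Idx m n) (Idx m n) Cq} (hR : D.IsRMatrix R) (hB : D.IsContravariantForm B) :
    Nonempty (Unique (D.RibbonFunctor R B)) := by
  obtain ⟨κ, hκ, rfl⟩ := hB.exists_kappa hmn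
  exact ⟨⟨⟨ribbonFunctor hmn hκ hR⟩, fun F => ribbonFunctor_ext _ _⟩⟩

end RootDatum
end
end OspBMW

/-! ### The BMW algebra: universal property and dimension bound -/

namespace OspBMW
noncomputable section

namespace BMWFamily
variable {K A : Type*} [Field K] [Ring A] [Algebra K A] {r : ℕ} {y z : K} (F : BMWFamily K A r y z)

/-- The homomorphism from the BMW algebra given by a family. -/
def lift : BMW r y z →ₐ[K] A :=
  RingQuot.liftAlgHom K ⟨FreeAlgebra.lift K fun
    | .g i => F.g i
    | .gInv i => F.gi i
    | .e i => F.e i, by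
    intro a b h
    cases h with
    | g_gInv i => simpa using F.g_gi i (by have := i.isLt; omega)
    | gInv_g i => simpa using F.gi_g i (by have := i.isLt; omega)
    | comm i j h => simpa using F.comm i j h (by have := j.isLt; omega)
    | braid i j h => simpa [h] using F.braid i (by have := j.isLt; omega)
    | skein i => simpa using F.skein i (by have := i.isLt; omega)
    | g_e i => simpa using F.g_e i (by have := i.isLt; omega)
    | e_g i => simpa using F.e_g i (by have := i.isLt; omega)
    | e_g_e i j h => simpa using F.e_g_e i j h (by have := i.isLt; omega) (by have := j.isLt; omega)
    | e_gInv_e i j h => simpa using F.e_gi_e i j h (by have := i.isLt; omega) (by have := j.isLt; omega)⟩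

theorem lift_g (i : Fin (r - 1)) : F.lift (BMW.g y z i) = F.g i := by
  rw [lift, BMW.g, RingQuot.liftAlgHom_mkAlgHom_apply, FreeAlgebra.lift_ι_apply]

theorem lift_e (i : Fin (r - 1)) : F.lift (BMW.e y z i) = F.e i := by
  rw [lift, BMW.e, RingQuot.liftAlgHom_mkAlgHom_apply, FreeAlgebra.lift_ι_apply]

theorem lift_gInv (i : Fin (r - 1)) : F.lift (RingQuot.mkAlgHom K (BMWRel y z) (FreeAlgebra.ι K (BMWGen.gInv i))) =
    F.gi i := by
  rw [lift, RingQuot.liftAlgHom_mkAlgHom_apply, FreeAlgebra.lift_ι_apply]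

theorem bmw_induction {P : BMW r y z → Prop} (h0 : ∀ c, P (algebraMap K _ c))
    (hg : ∀ i, P (BMW.g y z i)) (hgi : ∀ i, P (RingQuot.mkAlgHom K (BMWRel y z) (FreeAlgebra.ι K (BMWGen.gInv i))))
    (he : ∀ i, P (BMW.e y z i)) (hm : ∀ a b, P a → P b → P (a * b)) (ha : ∀ a b, P a → P b → P (a + b))
    (x : BMW r y z) : P x := by
  obtain ⟨x, rfl⟩ := RingQuot.mkAlgHom_surjective K (BMWRel y z) x
  induction x using FreeAlgebra.induction with
  | grade0 c => rw [AlgHom.commutes]; exact h0 c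
  | grade1 x =>
    cases x with
    | g i => exact hg i
    | gInv i => exact hgi i
    | e i => exact he i
  | mul a b iha ihb => rw [map_mul]; exact hm _ _ iha ihb
  | add a b iha ihb => rw [map_add]; exact ha _ _ iha ihb

theorem mem_range_lift {x : A} (hx : x ∈ F.alg r) : x ∈ F.lift.range := by
  have : F.alg r ≤ F.lift.range := by
    refine Algebra.adjoin_le ?_
    rintro x ⟨i, hi, rfl⟩
    exact ⟨BMW.g y z ⟨i, by omega⟩, F.lift_g _⟩
  exact this hx

/-- The generators of the BMW algebra. -/
def bmw (hy : y ≠ 0) (hz : z ≠ 0) : BMWFamily K (BMW r y z) r y z where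
  g i := if h : i < r - 1 then BMW.g y z ⟨i, h⟩ else 0
  gi i := if h : i < r - 1 then RingQuot.mkAlgHom K (BMWRel y z) (FreeAlgebra.ι K (BMWGen.gInv ⟨i, h⟩)) else 0
  e i := if h : i < r - 1 then BMW.e y z ⟨i, h⟩ else 0
  y_ne := hy
  z_ne := hz
  g_gi i hi := by
    have h : i < r - 1 := by omega
    simpa [h, BMW.g] using RingQuot.mkAlgHom_rel K (BMWRel.g_gInv (y := y) (z := z) (⟨i, h⟩ : Fin (r - 1)))
  gi_g i hi := by
    have h : i < r - 1 := by omega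
    simpa [h, BMW.g] using RingQuot.mkAlgHom_rel K (BMWRel.gInv_g (y := y) (z := z) (⟨i, h⟩ : Fin (r - 1)))
  comm i j h1 h2 := by
    have h : i < r - 1 := by omega
    have h' : j < r - 1 := by omega
    simpa [h, h', BMW.g] using RingQuot.mkAlgHom_rel K (BMWRel.comm (y := y) (z := z) (⟨i, h⟩ : Fin (r - 1)) ⟨j, h'⟩ h1)
  braid i h1 := by
    have h : i < r - 1 := by omega
    have h' : i + 1 < r - 1 := by omega
    simpa [h, h', BMW.g] using RingQuot.mkAlgHom_rel K (BMWRel.braid (y := y) (z := z) (⟨i, h⟩ : Fin (r - 1)) ⟨i + 1, h'⟩ rfl)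
  skein i hi := by
    have h : i < r - 1 := by omega
    simpa [h, BMW.g, BMW.e] using RingQuot.mkAlgHom_rel K (BMWRel.skein (y := y) (z := z) (⟨i, h⟩ : Fin (r - 1)))
  g_e i hi := by
    have h : i < r - 1 := by omega
    simpa [h, BMW.g, BMW.e] using RingQuot.mkAlgHom_rel K (BMWRel.g_e (y := y) (z := z) (⟨i, h⟩ : Fin (r - 1)))
  e_g i hi := by
    have h : i < r - 1 := by omega
    simpa [h, BMW.g, BMW.e] using RingQuot.mkAlgHom_rel K (BMWRel.e_g (y := y) (z := z) (⟨i, h⟩ : Fin (r - 1)))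
  e_g_e i j h1 h2 h3 := by
    have h : i < r - 1 := by omega
    have h' : j < r - 1 := by omega
    simpa [h, h', BMW.g, BMW.e] using
      RingQuot.mkAlgHom_rel K (BMWRel.e_g_e (y := y) (z := z) (⟨i, h⟩ : Fin (r - 1)) ⟨j, h'⟩ h1)
  e_gi_e i j h1 h2 h3 := by
    have h : i < r - 1 := by omega
    have h' : j < r - 1 := by omega
    simpa [h, h', BMW.g, BMW.e] using
      RingQuot.mkAlgHom_rel K (BMWRel.e_gInv_e (y := y) (z := z) (⟨i, h⟩ : Fin (r - 1)) ⟨j, h'⟩ h1)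

theorem bmw_alg_eq_top (hy : y ≠ 0) (hz : z ≠ 0) : (bmw (r := r) hy hz).alg r = ⊤ := by
  rw [eq_top_iff]
  rintro x -
  induction x using bmw_induction with
  | h0 c => exact algebraMap_mem _ c
  | hg i =>
    have := (bmw (r := r) hy hz).g_mem (k := r) (i := i) (by have := i.isLt; omega)
    simpa [bmw] using this
  | hgi i =>
    have := (bmw (r := r) hy hz).gi_mem (k := r) (i := i) (by have := i.isLt; omega) (by have := i.isLt; omega)
    simpa [bmw] using this
  | he i =>
    have := (bmw (r := r) hy hz).e_mem (k := r) (i := i) (by have := i.isLt; omega) (by have := i.isLt; omega)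
    simpa [bmw] using this
  | hm a b ha hb => exact mul_mem ha hb
  | ha a b ha hb => exact add_mem ha hb

end BMWFamily

section finite
variable {K : Type*} [Field K] {r : ℕ} {y z : K}

/-- The generators of the BMW algebra form a family whose subalgebra `alg r` is everything, so
`spannedBy_main` applies. Only this upper bound is needed. -/
theorem bmw_finrank_le (hy : y ≠ 0) (hz : z ≠ 0) :
    Module.Finite K (BMW r y z) ∧ Module.finrank K (BMW r y z) ≤ oddFactorial r := by
  obtain ⟨s, hs, h⟩ := (BMWFamily.spannedBy_main r (BMWFamily.bmw (r := r) hy hz)).1 le_rfl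
  rw [BMWFamily.bmw_alg_eq_top] at h
  have htop : Submodule.span K (s : Set (BMW r y z)) = ⊤ := by
    rw [eq_top_iff]; exact fun x _ => h (Algebra.mem_top)
  refine ⟨⟨⟨s, htop⟩⟩, ?_⟩
  rw [← finrank_top, ← htop]
  exact (finrank_span_finset_le_card s).trans hs

end finite
end
end OspBMW

/-! ### BMW operators on tensor powers, for all modules of one twist -/

namespace OspBMW
noncomputable section

section slot
variable {m n : ℕ}

/-- The operator `A` on the factors `i, i + 1` of the tensor power. -/
def slot (i r : ℕ) (A : TMat m n 2 2) : TMat m n r r :=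
  if h : i + 2 ≤ r then pad i (r - 2 - i) (by omega) (by omega) A else 0

theorem slot_eq {i r : ℕ} (s : ℕ) (h : r = i + 2 + s) (A : TMat m n 2 2) :
    slot i r A = pad i s h h A := by
  rw [slot, dif_pos (by omega)]; exact pad_congr rfl (by omega)

theorem slot_mul {i r : ℕ} (A B : TMat m n 2 2) : slot i r A * slot i r B = slot i r (A * B) := by
  by_cases h : i + 2 ≤ r
  · rw [slot, slot, slot, dif_pos h, dif_pos h, dif_pos h, pad_mul]
  · rw [slot, dif_neg h, Matrix.zero_mul, slot, dif_neg h]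

theorem slot_one {i r : ℕ} (h : i + 2 ≤ r) : slot i r (1 : TMat m n 2 2) = 1 := by
  rw [slot, dif_pos h, pad_one]

theorem slot_smul {i r : ℕ} (x : Cq) (A : TMat m n 2 2) : slot i r (x • A) = x • slot i r A := by
  by_cases h : i + 2 ≤ r
  · rw [slot, slot, dif_pos h, dif_pos h, pad_smul]
  · rw [slot, slot, dif_neg h, dif_neg h, smul_zero]

theorem slot_sub {i r : ℕ} (A B : TMat m n 2 2) : slot i r (A - B) = slot i r A - slot i r B := by
  by_cases h : i + 2 ≤ r
  · rw [slot, slot, slot, dif_pos h, dif_pos h, dif_pos h, pad_sub]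
  · rw [slot, slot, slot, dif_neg h, dif_neg h, dif_neg h, sub_zero]

theorem pad_slot {i a b r r' : ℕ} (hr : r' = a + r + b) (h : i + 2 ≤ r) (A : TMat m n 2 2) :
    pad a b hr hr (slot i r A) = slot (a + i) r' A := by
  rw [slot, dif_pos h, pad_pad, slot_eq (r - 2 - i + b) (by omega)]

theorem slot_comm {i j r : ℕ} (h : i + 1 < j) (hj : j + 1 < r) (A B : TMat m n 2 2) :
    slot i r A * slot j r B = slot j r B * slot i r A := by
  obtain ⟨c, rfl⟩ := Nat.exists_eq_add_of_lt h
  obtain ⟨s, rfl⟩ := Nat.exists_eq_add_of_lt hj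
  have e := pad_interchange (k := 2 + c + 2) (l := 2 + c + 2) (p := 2 + c + 2) (p' := 2 + c + 2) (c := c) A B
    (by omega) (by omega) (by omega) (by omega) (by omega) (by omega) (by omega) (by omega)
  have e1 : slot i (i + 1 + c + 1 + 1 + s + 1) A = pad i s (k := i + 1 + c + 1 + 1 + s + 1) (by omega) (by omega)
      (pad 0 (c + 2) (k := 2 + c + 2) (l := 2 + c + 2) (by omega) (by omega) A) := by
    rw [pad_pad, slot_eq (c + 2 + s) (by omega)]; rfl
  have e2 : slot (i + 1 + c + 1) (i + 1 + c + 1 + 1 + s + 1) B =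
      pad i s (k := i + 1 + c + 1 + 1 + s + 1) (by omega) (by omega)
      (pad (2 + c) 0 (k := 2 + c + 2) (l := 2 + c + 2) (by omega) (by omega) B) := by
    rw [pad_pad, slot_eq s (by omega)]; exact pad_congr (by omega) (by omega)
  rw [e1, e2, pad_mul, pad_mul, e]

theorem slot_three {i r : ℕ} (h : i + 2 < r) (A : TMat m n 2 2) : slot i r A =
    pad i (r - 3 - i) (k := r) (by omega) (by omega) (pad 0 1 (k := 3) (l := 3) rfl rfl A) := by
  rw [pad_pad, slot_eq (r - 2 - i) (by omega)]; exact pad_congr (by omega) (by omega)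

theorem slot_succ_three {i r : ℕ} (h : i + 2 < r) (A : TMat m n 2 2) : slot (i + 1) r A =
    pad i (r - 3 - i) (k := r) (by omega) (by omega) (pad 1 0 (k := 3) (l := 3) rfl rfl A) := by
  rw [pad_pad, slot_eq (r - 3 - i) (by omega)]; exact pad_congr (by omega) (by omega)

end slot

namespace RootDatum
variable {m n : ℕ} {D : RootDatum m n} {κ : Idx m n → Cq} (hmn : ¬ (m = 2 ∧ n = 0)) (hκ : D.IsKappa κ)

/-- The cap of one `e` and the cup of the other close a strand of the crossing between them, which
leaves a curl; the scalar of the curl is the delooping scalar. -/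
theorem e_c_e_left {A : TMat m n 2 2} {x : Cq} (h : pad 0 1 (k := 3) (l := 1) rfl rfl (capMat κ) *
      (pad 1 0 (k := 3) (l := 3) rfl rfl A * pad 0 1 (k := 1) (l := 3) rfl rfl (cupMat κ)) = x • 1) {i r : ℕ}
    (hr : i + 2 < r) : slot i r (cupMat κ * capMat κ) * slot (i + 1) r A * slot i r (cupMat κ * capMat κ) =
      x • slot i r (cupMat κ * capMat κ) := by
  rw [slot_three hr, slot_succ_three hr, pad_mul, pad_mul, ← pad_smul, ← pad_mul rfl (l := 1) rfl rfl]
  congr 1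
  rw [← Matrix.mul_assoc, Matrix.mul_assoc (pad 0 1 rfl rfl (cupMat κ)), Matrix.mul_assoc (pad 0 1 rfl rfl (cupMat κ)),
    Matrix.mul_assoc (pad 0 1 rfl rfl (capMat κ)), h, Matrix.mul_smul, Matrix.mul_one, Matrix.smul_mul]

theorem e_c_e_right {A : TMat m n 2 2} {x : Cq} (h : pad 1 0 (k := 3) (l := 1) rfl rfl (capMat κ) *
      (pad 0 1 (k := 3) (l := 3) rfl rfl A * pad 1 0 (k := 1) (l := 3) rfl rfl (cupMat κ)) = x • 1) {i r : ℕ}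
    (hr : i + 2 < r) : slot (i + 1) r (cupMat κ * capMat κ) * slot i r A * slot (i + 1) r (cupMat κ * capMat κ) =
      x • slot (i + 1) r (cupMat κ * capMat κ) := by
  rw [slot_three hr, slot_succ_three hr, pad_mul, pad_mul, ← pad_smul, ← pad_mul rfl (l := 1) rfl rfl]
  congr 1
  rw [← Matrix.mul_assoc, Matrix.mul_assoc (pad 1 0 rfl rfl (cupMat κ)), Matrix.mul_assoc (pad 1 0 rfl rfl (cupMat κ)),
    Matrix.mul_assoc (pad 1 0 rfl rfl (capMat κ)), h, Matrix.mul_smul, Matrix.mul_one, Matrix.smul_mul]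

include hmn hκ in
theorem curl_left_inv :
    pad 0 1 (k := 3) (l := 1) rfl rfl (capMat κ) * (pad 1 0 (k := 3) rfl rfl (D.braidInvMat κ) *
      pad 0 1 (k := 1) rfl rfl (cupMat κ)) = twist m n • 1 := by
  rw [← Matrix.mul_assoc, cap_slide_inv D hκ.ne_zero, Matrix.mul_assoc, pad_mul, braid_mul_cup hmn hκ,
    pad_smul, Matrix.mul_smul, zigzag_right hκ.ne_zero]

include hmn hκ in
theorem curl_right_inv :
    pad 1 0 (k := 3) (l := 1) rfl rfl (capMat κ) * (pad 0 1 (k := 3) rfl rfl (D.braidInvMat κ) *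
      pad 1 0 (k := 1) rfl rfl (cupMat κ)) = twist m n • 1 := by
  rw [← Matrix.mul_assoc, ← cap_slide D hκ.ne_zero, Matrix.mul_assoc, pad_mul, braid_mul_cup hmn hκ,
    pad_smul, Matrix.mul_smul, zigzag_left hκ.ne_zero]

/-- The operators on `V_q^{⊗r}` that satisfy the BMW relations. -/
def tensorFamily {y : Cq} (hy : twist m n = y) (r : ℕ) : BMWFamily Cq (TMat m n r r) r y (q - q⁻¹) where
  g i := slot i r (D.braidMat κ)
  gi i := slot i r (D.braidInvMat κ)
  e i := slot i r (cupMat κ * capMat κ)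
  y_ne := hy ▸ twist_ne_zero
  z_ne := z_ne_zero
  g_gi i hi := by rw [slot_mul, braid_mul_braidInv hmn hκ, slot_one (by omega)]
  gi_g i hi := by rw [slot_mul, braidInv_mul_braid hmn hκ, slot_one (by omega)]
  comm i j h hj := slot_comm h hj _ _
  braid i hi := by
    rw [slot_three hi, slot_succ_three hi, pad_mul, pad_mul, pad_mul, pad_mul, Matrix.mul_assoc, Matrix.mul_assoc,
      braid_relation hmn hκ]
  skein i hi := by
    rw [← slot_sub, braid_sub_braidInv hκ.ne_zero, slot_smul, slot_sub, slot_one (by omega)]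
  g_e i hi := by subst hy; rw [slot_mul, ← Matrix.mul_assoc, braid_mul_cup hmn hκ, Matrix.smul_mul, slot_smul]
  e_g i hi := by subst hy; rw [slot_mul, Matrix.mul_assoc, cap_mul_braid hmn hκ, Matrix.mul_smul, slot_smul]
  e_g_e i j h hi hj := by
    subst hy; rcases h with rfl | rfl
    · exact e_c_e_left (curl_left hmn hκ) (by omega)
    · exact e_c_e_right (curl_right hmn hκ) (by omega)
  e_gi_e i j h hi hj := by
    subst hy; rcases h with rfl | rfl
    · exact e_c_e_left (curl_left_inv hmn hκ) (by omega)
    · exact e_c_e_right (curl_right_inv hmn hκ) (by omega)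

end RootDatum

/-- The data of a natural module with a braiding and an invariant form, with prescribed twist. -/
structure Datum (y : Cq) where
  m : ℕ
  n : ℕ
  hmn : ¬ (m = 2 ∧ n = 0)
  D : RootDatum m n
  κ : Idx m n → Cq
  hκ : D.IsKappa κ
  hy : RootDatum.twist m n = y

namespace Datum
variable {y : Cq} (d : Datum y)

/-- The algebra of endomorphisms of the tensor powers of all natural modules of a given twist. -/
abbrev EndAll (y : Cq) (r : ℕ) : Type := ∀ d : Datum y, TMat d.m d.n r r

/-- The operators that satisfy the BMW relations, for one module. -/
abbrev family (r : ℕ) : BMWFamily Cq (TMat d.m d.n r r) r y (q - q⁻¹) := RootDatum.tensorFamily d.hmn d.hκ d.hy r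

/-- The operators that satisfy the BMW relations, for all modules of a given twist. -/
def familyAll (hy : y ≠ 0) (r : ℕ) : BMWFamily Cq (EndAll y r) r y (q - q⁻¹) where
  g i d := (d.family r).g i
  gi i d := (d.family r).gi i
  e i d := (d.family r).e i
  y_ne := hy
  z_ne := z_ne_zero
  g_gi i h := funext fun d => (d.family r).g_gi i h
  gi_g i h := funext fun d => (d.family r).gi_g i h
  comm i j h h' := funext fun d => (d.family r).comm i j h h'
  braid i h := funext fun d => (d.family r).braid i h
  skein i h := funext fun d => (d.family r).skein i h
  g_e i h := funext fun d => (d.family r).g_e i h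
  e_g i h := funext fun d => (d.family r).e_g i h
  e_g_e i j h h' h'' := funext fun d => (d.family r).e_g_e i j h h' h''
  e_gi_e i j h h' h'' := funext fun d => (d.family r).e_gi_e i j h h' h''

end Datum
end
end OspBMW

/-! ### Ribbon graphs act through the BMW generators -/

namespace OspBMW
noncomputable section

section pad
variable {m n : ℕ}

theorem pad_interchange' {s t s' t' i c r k l p p' : ℕ} (A : TMat m n s t) (B : TMat m n s' t')
    (hk : k = i + s + (c + s' + r)) (hl : l = i + t + (c + s' + r)) (hl' : l = (i + t + c) + s' + r)
    (hp : p = (i + t + c) + t' + r) (hk' : k = (i + s + c) + s' + r) (hp' : p' = (i + s + c) + t' + r)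
    (hp'' : p' = i + s + (c + t' + r)) (h : p = i + t + (c + t' + r)) :
    pad (i + t + c) r hl' hp B * pad i (c + s' + r) hk hl A =
      pad i (c + t' + r) hp'' h A * pad (i + s + c) r hk' hp' B := by
  have e := pad_interchange (c := c) A B rfl (l := 0 + t + (c + s')) rfl (by omega) rfl (by omega) rfl
    (by omega) (by omega)
  have e' := congrArg (pad i r (k := k) (l := p) (by omega) (by omega)) e
  rw [← pad_mul (l := l) _ (by omega), ← pad_mul (l := p') _ (by omega), pad_pad, pad_pad, pad_pad, pad_pad] at e'
  convert e' using 2 <;> exact pad_congr (by omega) (by omega)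

/-- Maps commute with a map that is applied behind them. -/
theorem pad_mul_pad {s t k l k' l' : ℕ} (X : TMat m n k l) (A : TMat m n s t)
    (hk : k' = k + s + 0) (hl : l' = l + t + 0) (a : ℕ) (ha : a = l + s + 0) (b : ℕ) (hb : b = k + t + 0) :
    pad l 0 (k := a) (l := l') ha hl A * pad 0 s (k := k') (l := a) (by omega) (by omega) X =
      pad 0 t (k := b) (l := l') (by omega) (by omega) X * pad k 0 hk hb A := by
  have e := pad_interchange' (i := 0) (c := 0) (r := 0) X A (k := k') (l := a) (p := l') (p' := b) (by omega)
    (by omega) (by omega) (by omega) (by omega) (by omega) (by omega) (by omega)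
  convert e using 2 <;> exact pad_congr (by omega) (by omega)

theorem pad_add {i r s t k l : ℕ} (hk : k = i + s + r) (hl : l = i + t + r) (A B : TMat m n s t) :
    pad i r hk hl (A + B) = pad i r hk hl A + pad i r hk hl B := by
  ext w' w; simp only [pad, Matrix.of_apply, Matrix.add_apply]; split_ifs <;> simp

end pad

namespace Datum
variable {y : Cq}

/-- The addition of two strands on the right. -/
def addStrands (y : Cq) (l : ℕ) : EndAll y l →ₐ[Cq] EndAll y (l + 2) where
  toFun x d := pad 0 2 (by omega) (by omega) (x d)
  map_one' := funext fun d => pad_one _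
  map_mul' x x' := funext fun d => (pad_mul _ _ _ _ _).symm
  map_zero' := funext fun d => by
    have := pad_smul (m := d.m) (n := d.n) (i := 0) (r := 2) (k := l + 2) (l := l + 2) (s := l) (t := l) (by omega) (by omega) 0 0
    simpa using this
  map_add' x x' := funext fun d => pad_add _ _ _ _
  commutes' c := funext fun d => by
    show pad 0 2 _ _ (algebraMap Cq (TMat d.m d.n l l) c) = algebraMap Cq (TMat d.m d.n (l + 2) (l + 2)) c
    rw [Algebra.algebraMap_eq_smul_one, pad_smul, pad_one, Algebra.algebraMap_eq_smul_one]

variable (hy : y ≠ 0)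

theorem map_addStrands {l k : ℕ} (hk : k ≤ l) :
    ((familyAll hy l).alg k).map (addStrands y l) = (familyAll hy (l + 2)).alg k := by
  have h : ∀ i, i + 1 < k → addStrands y l ((familyAll hy l).g i) = (familyAll hy (l + 2)).g i := fun i hi =>
    funext fun d => (pad_slot (by omega) (by omega) _).trans (by rw [Nat.zero_add]; rfl)
  rw [BMWFamily.alg, BMWFamily.alg, AlgHom.map_adjoin]
  congr 1
  ext x
  constructor
  · rintro ⟨_, ⟨i, hi, rfl⟩, rfl⟩; exact ⟨i, hi, h i hi⟩
  · rintro ⟨i, hi, rfl⟩; exact ⟨_, ⟨i, hi, rfl⟩, h i hi⟩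

theorem addStrands_mem {l k : ℕ} (hk : k ≤ l) {x : EndAll y l} (hx : x ∈ (familyAll hy l).alg k) :
    addStrands y l x ∈ (familyAll hy (l + 2)).alg k := by
  rw [← map_addStrands hy hk]; exact ⟨x, hx, rfl⟩

/-- The cup to the right of `l` strands. -/
abbrev lastCup (d : Datum y) (l : ℕ) : TMat d.m d.n l (l + 2) := pad l 0 rfl rfl (RootDatum.cupMat d.κ)

/-- The cap to the right of `l` strands. -/
abbrev lastCap (d : Datum y) (l : ℕ) : TMat d.m d.n (l + 2) l := pad l 0 rfl rfl (RootDatum.capMat d.κ)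

theorem lastCup_mul (d : Datum y) (l : ℕ) (x : EndAll y l) :
    d.lastCup l * x d = addStrands y l x d * d.lastCup l := by
  have e := pad_mul_pad (x d) (RootDatum.cupMat d.κ) rfl rfl l rfl (l + 2) rfl
  exact (congrArg (_ * ·) (pad_zero_zero (x d)).symm).trans e

theorem mul_lastCap (d : Datum y) (l : ℕ) (x : EndAll y l) :
    x d * d.lastCap l = d.lastCap l * addStrands y l x d := by
  have e := pad_mul_pad (x d) (RootDatum.capMat d.κ) rfl rfl (l + 2) rfl l rfl
  exact (congrArg (· * _) (pad_zero_zero (x d)).symm).trans e.symm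

theorem lastCup_mul_lastCap (d : Datum y) (l : ℕ) : d.lastCup l * d.lastCap l = (familyAll hy (l + 2)).e l d := by
  show _ = slot l (l + 2) _
  rw [slot_eq 0 rfl, pad_mul]

/-- By a zigzag, `e_i` turns the cup at the place `i + 1` into the cup at the place `i`. A chain of
`e`'s therefore brings the rightmost cup to any place. -/
theorem cup_eq {i s l : ℕ} (hl : l = i + s) : ∃ x ∈ (familyAll hy (l + 2)).alg (l + 2), ∀ d : Datum y,
    pad i s (k := l) (l := l + 2) (by omega) (by omega) (RootDatum.cupMat d.κ) = x d * d.lastCup l := by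
  induction s generalizing i with
  | zero => obtain rfl : l = i := hl; exact ⟨1, one_mem _, fun d => (Matrix.one_mul _).symm⟩
  | succ s ih =>
    obtain ⟨x, hx, h⟩ := ih (i := i + 1) (by omega)
    refine ⟨(familyAll hy (l + 2)).e i * x, mul_mem (BMWFamily.e_mem _ (by omega) (by omega)) hx, fun d => ?_⟩
    have he : ((familyAll hy (l + 2)).e i * x) d =
      slot i (l + 2) (RootDatum.cupMat d.κ * RootDatum.capMat d.κ) * x d := rfl
    rw [he, Matrix.mul_assoc, ← h, slot_eq (s + 1) (by omega), ← pad_mul (l := l) _ (by omega) _, Matrix.mul_assoc]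
    have e : pad i (s + 1) (k := l + 2) (l := l) (by omega) (by omega) (RootDatum.capMat d.κ) *
        pad (i + 1) s (k := l) (l := l + 2) (by omega) (by omega) (RootDatum.cupMat d.κ) = 1 := by
      have e := congrArg (pad i s (k := l) (l := l) (by omega) (by omega)) (RootDatum.zigzag_left d.hκ.ne_zero)
      rw [← pad_mul (l := l + 2) _ (by omega), pad_pad, pad_pad, pad_one] at e
      rw [← e]
      congr 1 <;> exact pad_congr (by omega) (by omega)
    rw [e, Matrix.mul_one]

theorem cap_eq {i s l : ℕ} (hl : l = i + s) : ∃ x ∈ (familyAll hy (l + 2)).alg (l + 2), ∀ d : Datum y,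
    pad i s (k := l + 2) (l := l) (by omega) (by omega) (RootDatum.capMat d.κ) = d.lastCap l * x d := by
  induction s generalizing i with
  | zero => obtain rfl : l = i := hl; exact ⟨1, one_mem _, fun d => (Matrix.mul_one _).symm⟩
  | succ s ih =>
    obtain ⟨x, hx, h⟩ := ih (i := i + 1) (by omega)
    refine ⟨x * (familyAll hy (l + 2)).e i, mul_mem hx (BMWFamily.e_mem _ (by omega) (by omega)), fun d => ?_⟩
    have he : (x * (familyAll hy (l + 2)).e i) d =
      x d * slot i (l + 2) (RootDatum.cupMat d.κ * RootDatum.capMat d.κ) := rfl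
    rw [he, ← Matrix.mul_assoc, ← h, slot_eq (s + 1) (by omega), ← pad_mul (l := l) _ (by omega) _, ← Matrix.mul_assoc]
    have e : pad (i + 1) s (k := l + 2) (l := l) (by omega) (by omega) (RootDatum.capMat d.κ) *
        pad i (s + 1) (k := l) (l := l + 2) (by omega) (by omega) (RootDatum.cupMat d.κ) = 1 := by
      have e := congrArg (pad i s (k := l) (l := l) (by omega) (by omega)) (RootDatum.zigzag_right d.hκ.ne_zero)
      rw [← pad_mul (l := l + 2) _ (by omega), pad_pad, pad_pad, pad_one] at e
      rw [← e]
      congr 1 <;> exact pad_congr (by omega) (by omega)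
    rw [e, Matrix.one_mul]

theorem lastCap_mul_lastCup_pred (d : Datum y) (l : ℕ) :
    d.lastCap (l + 1) * pad l 1 (k := l + 1) (l := l + 3) (by omega) (by omega) (RootDatum.cupMat d.κ) = 1 := by
  have e := congrArg (pad l 0 (k := l + 1) (l := l + 1) (by omega) (by omega)) (RootDatum.zigzag_right d.hκ.ne_zero)
  rw [← pad_mul (l := l + 3) _ (by omega), pad_pad, pad_pad, pad_one] at e
  exact e

theorem lastCap_pred_mul_lastCup (d : Datum y) (l : ℕ) :
    pad l 1 (k := l + 3) (l := l + 1) (by omega) (by omega) (RootDatum.capMat d.κ) * d.lastCup (l + 1) = 1 := by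
  have e := congrArg (pad l 0 (k := l + 1) (l := l + 1) (by omega) (by omega)) (RootDatum.zigzag_left d.hκ.ne_zero)
  rw [← pad_mul (l := l + 3) _ (by omega), pad_pad, pad_pad, pad_one] at e
  exact e

/-- The partial trace of an element of the algebra generated by the `g_i` belongs to that algebra. -/
theorem lastCap_mul_mul_lastCup {l : ℕ} (hl : 1 ≤ l) {x : EndAll y (l + 2)}
    (hx : x ∈ (familyAll hy (l + 2)).alg (l + 2)) :
    ∃ a ∈ (familyAll hy l).alg l, ∀ d : Datum y, d.lastCap l * (x d * d.lastCup l) = a d := by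
  -- This is the desired equality with an extra cup in front and an extra cap behind. Both are
  -- removed by zigzags with the neighbouring strand on the left, which exists because `1 ≤ l`.
  obtain ⟨a', ha', h⟩ := (familyAll hy (l + 2)).e_mul_mul_e le_rfl hx
  rw [← map_addStrands hy le_rfl] at ha'
  obtain ⟨a, ha, rfl⟩ := ha'
  refine ⟨a, ha, fun d => ?_⟩
  obtain ⟨l, rfl⟩ := Nat.exists_eq_add_of_le' hl
  have h1 := congrFun h d
  have h2 : (familyAll hy (l + 1 + 2)).e (l + 1) d * x d * (familyAll hy (l + 1 + 2)).e (l + 1) d =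
    addStrands y (l + 1) a d * (familyAll hy (l + 1 + 2)).e (l + 1) d := h1
  rw [← lastCup_mul_lastCap, ← Matrix.mul_assoc (addStrands y _ a d), ← lastCup_mul] at h2
  have h3 := congrArg (fun Y : TMat d.m d.n (l + 3) (l + 3) => pad l 1 (k := l + 3) (l := l + 1) (by omega) (by omega) (RootDatum.capMat d.κ) *
    (Y * pad l 1 (k := l + 1) (l := l + 3) (by omega) (by omega) (RootDatum.cupMat d.κ))) h2
  simp only [Matrix.mul_assoc, lastCap_mul_lastCup_pred, Matrix.mul_one] at h3
  rwa [← Matrix.mul_assoc, ← Matrix.mul_assoc (pad l 1 _ _ _), lastCap_pred_mul_lastCup, Matrix.one_mul,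
    Matrix.one_mul] at h3

/-- The maps given by nested cups on the right. -/
inductive IsCups (r : ℕ) : (l : ℕ) → (∀ d : Datum y, TMat d.m d.n r l) → Prop
  | refl : IsCups r r fun _ => 1
  | step {l : ℕ} {η : ∀ d : Datum y, TMat d.m d.n r l} (h : IsCups r l η) :
      IsCups r (l + 2) fun d => d.lastCup l * η d

/-- The maps given by nested caps on the right. -/
inductive IsCaps (r : ℕ) : (l : ℕ) → (∀ d : Datum y, TMat d.m d.n r l) → Prop
  | refl : IsCaps r r fun _ => 1
  | step {l : ℕ} {η : ∀ d : Datum y, TMat d.m d.n r (l + 2)} (h : IsCaps r (l + 2) η) :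
      IsCaps r l fun d => d.lastCap l * η d

theorem IsCups.le {r l : ℕ} {η : ∀ d : Datum y, TMat d.m d.n r l} (h : IsCups r l η) : r ≤ l := by
  induction h with
  | refl => exact le_rfl
  | step _ ih => omega

theorem IsCaps.mul_eq {r l : ℕ} {η : ∀ d : Datum y, TMat d.m d.n r l} (h : IsCaps r l η) {x : EndAll y l}
    (hx : x ∈ (familyAll hy l).alg l) : ∃ x' ∈ (familyAll hy r).alg r, ∀ d, x d * η d = η d * x' d := by
  induction h with
  | refl => exact ⟨x, hx, fun d => by rw [Matrix.mul_one, Matrix.one_mul]⟩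
  | step _ ih =>
    obtain ⟨x', hx', h⟩ := ih (BMWFamily.alg_mono _ (by omega) (addStrands_mem hy le_rfl hx))
    exact ⟨x', hx', fun d => by rw [← Matrix.mul_assoc, mul_lastCap, Matrix.mul_assoc, h, Matrix.mul_assoc]⟩

/-- The linear maps given by the ribbon `(r, l)`-graphs, uniformly for all modules of a given twist. -/
def HasNormalForm (r l : ℕ) (A : ∀ d : Datum y, TMat d.m d.n r l) : Prop :=
  (∃ η, IsCups r l η ∧ ∃ x ∈ (familyAll hy l).alg l, ∀ d, A d = x d * η d) ∨
  (∃ η, IsCaps r l η ∧ ∃ x ∈ (familyAll hy r).alg r, ∀ d, A d = η d * x d)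

variable {hy}

theorem HasNormalForm.mul {r l : ℕ} {A : ∀ d : Datum y, TMat d.m d.n r l} (h : HasNormalForm hy r l A)
    {x : EndAll y l} (hx : x ∈ (familyAll hy l).alg l) : HasNormalForm hy r l fun d => x d * A d := by
  rcases h with ⟨η, hη, x', hx', h⟩ | ⟨η, hη, x', hx', h⟩
  · exact .inl ⟨η, hη, x * x', mul_mem hx hx', fun d => by beta_reduce; rw [h, ← Matrix.mul_assoc]; rfl⟩
  · obtain ⟨x'', hx'', h'⟩ := hη.mul_eq hy hx
    exact .inr ⟨η, hη, x'' * x', mul_mem hx'' hx', fun d => by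
      beta_reduce; rw [h, ← Matrix.mul_assoc, h', Matrix.mul_assoc]; rfl⟩

/-- If the form contains caps, the new cup and the topmost cap combine into `e_l`, which is
absorbed; otherwise the cup is stacked on the others. -/
theorem HasNormalForm.lastCup_mul {r l : ℕ} {A : ∀ d : Datum y, TMat d.m d.n r l} (h : HasNormalForm hy r l A) :
    HasNormalForm hy r (l + 2) fun d => d.lastCup l * A d := by
  rcases h with ⟨η, hη, x, hx, h⟩ | ⟨η, hη, x, hx, h⟩
  · exact .inl ⟨_, hη.step, addStrands y l x, BMWFamily.alg_mono _ (by omega) (addStrands_mem hy le_rfl hx),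
      fun d => by beta_reduce; rw [h, ← Matrix.mul_assoc, Datum.lastCup_mul, Matrix.mul_assoc]⟩
  · cases hη with
    | refl => exact .inl ⟨_, IsCups.refl.step, addStrands y _ x,
        BMWFamily.alg_mono _ (by omega) (addStrands_mem hy le_rfl hx), fun d => by
          beta_reduce; rw [h, Matrix.one_mul, Matrix.mul_one, Datum.lastCup_mul]⟩
    | @step _ η hη =>
      have h' : HasNormalForm hy r (l + 2) fun d => η d * x d := .inr ⟨η, hη, x, hx, fun d => rfl⟩
      have h'' := h'.mul (BMWFamily.e_mem (familyAll hy (l + 2)) (i := l) (by omega) (by omega))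
      simpa only [h, ← lastCup_mul_lastCap, Matrix.mul_assoc] using h''

/-- A cap that meets a cup is a partial trace, which stays in the algebra by
`lastCap_mul_mul_lastCup`. As there are no fewer strands than `r ≥ 1` at this point, the
neighbouring strand needed there is present. -/
theorem HasNormalForm.lastCap_mul {r l : ℕ} (hr : 1 ≤ r) {A : ∀ d : Datum y, TMat d.m d.n r (l + 2)}
    (h : HasNormalForm hy r (l + 2) A) : HasNormalForm hy r l fun d => d.lastCap l * A d := by
  rcases h with ⟨η, hη, x, hx, h⟩ | ⟨η, hη, x, hx, h⟩
  · cases hη with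
    | refl => exact .inr ⟨_, IsCaps.refl.step, x, hx, fun d => by beta_reduce; rw [h]; simp⟩
    | @step _ η hη =>
      obtain ⟨a, ha, h'⟩ := lastCap_mul_mul_lastCup hy (hr.trans hη.le) hx
      exact .inl ⟨η, hη, a, ha, fun d => by beta_reduce; rw [h, ← h']; simp only [Matrix.mul_assoc]⟩
  · exact .inr ⟨_, hη.step, x, hx, fun d => by beta_reduce; rw [h, Matrix.mul_assoc]⟩

variable (hy)

theorem hasNormalForm_ribbonMap {r : ℕ} (hr : 1 ≤ r) {l : ℕ} (Γ : RibbonGraph r l) :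
    HasNormalForm hy r l fun d => RootDatum.ribbonMap d.hmn d.hκ Γ := by
  induction Γ using RibbonGraph.induction with
  | id => exact .inl ⟨_, .refl, 1, one_mem _, fun d => by beta_reduce; rw [RootDatum.ribbonMap_id]; exact (one_mul _).symm⟩
  | comp l l' Γ s ih =>
    simp only [RootDatum.ribbonMap_comp, RootDatum.ribbonMap_slice, whisker_eq_pad]
    obtain ⟨g, i, s, hk, hl⟩ := s
    cases g with
    | xPos =>
      change l = i + 2 + s at hk
      obtain rfl : l' = l := hl.trans hk.symm
      have h := ih.mul (BMWFamily.g_mem (familyAll hy l') (i := i) (k := l') (by omega))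
      simp only [familyAll, RootDatum.tensorFamily, slot_eq s hk] at h
      exact h
    | xNeg =>
      change l = i + 2 + s at hk
      obtain rfl : l' = l := hl.trans hk.symm
      have h := ih.mul (BMWFamily.gi_mem (familyAll hy l') (i := i) (k := l') (by omega) (by omega))
      simp only [familyAll, RootDatum.tensorFamily, slot_eq s hk] at h
      exact h
    | cup =>
      change l = i + 0 + s at hk
      change l' = i + 2 + s at hl
      obtain rfl : l' = l + 2 := by omega
      obtain ⟨x, hx, h⟩ := cup_eq hy hk
      have h' := ih.lastCup_mul.mul hx
      simp only [← Matrix.mul_assoc, ← h] at h'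
      exact h'
    | cap =>
      change l = i + 2 + s at hk
      change l' = i + 0 + s at hl
      obtain rfl : l = l' + 2 := by omega
      obtain ⟨x, hx, h⟩ := cap_eq hy hl
      have h' := (ih.mul hx).lastCap_mul hr
      simp only [← Matrix.mul_assoc, ← h] at h'
      exact h'

/-- The linear maps given by the ribbon `(r, r)`-graphs belong to the algebra generated by the braidings. -/
theorem exists_mem_alg_ribbonMap {r : ℕ} (hr : 1 ≤ r) (Γ : RibbonGraph r r) :
    ∃ x ∈ (familyAll hy r).alg r, ∀ d, RootDatum.ribbonMap d.hmn d.hκ Γ = x d := by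
  rcases hasNormalForm_ribbonMap hy hr Γ with ⟨η, hη, x, hx, h⟩ | ⟨η, hη, x, hx, h⟩
  · cases hη with
    | refl => exact ⟨x, hx, fun d => (h d).trans (Matrix.mul_one _)⟩
    | step hη => have := hη.le; omega
  · have key : ∀ {l : ℕ} {η : ∀ d : Datum y, TMat d.m d.n r l}, IsCaps r l η → l ≤ r := fun h => by
      induction h with
      | refl => exact le_rfl
      | step _ ih => omega
    cases hη with
    | refl => exact ⟨x, hx, fun d => (h d).trans (Matrix.one_mul _)⟩
    | step hη => have := key hη; omega

end Datum
end
end OspBMW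

/-! ### Linearly independent invariants given by ribbon graphs -/

namespace OspBMW
noncomputable section

namespace RootDatum
variable {m n : ℕ} {D : RootDatum m n} {κ : Idx m n → Cq}

theorem braidEntry_eq_zero {x y a b : Idx m n} (h : x < b) : D.braidEntry κ x y a b = 0 := by
  rw [braidEntry, if_neg, if_neg, add_zero]
  · exact not_lt_of_gt h
  · rintro ⟨rfl, -⟩; exact lt_irrefl _ h

theorem braidEntry_self (x y a : Idx m n) : D.braidEntry κ x y a x = if y = a then D.swapCoeff a x else 0 := by
  rw [braidEntry, if_neg (lt_irrefl x), add_zero, swapCoeff]; simp only [true_and]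

theorem swapCoeff_ne_zero (a b : Idx m n) : D.swapCoeff a b ≠ 0 := by
  refine mul_ne_zero ?_ (zpow_ne_zero _ q_ne_zero)
  rw [ksign]; split_ifs
  exacts [neg_ne_zero.2 one_ne_zero, one_ne_zero]

end RootDatum

section slot
variable {m n : ℕ}

theorem slot_apply {i r : ℕ} (h : i + 2 ≤ r) (A : TMat m n 2 2) (w u : Word m n r) : slot i r A w u =
    if ∀ t : Fin r, t.val ≠ i → t.val ≠ i + 1 → w t = u t then
      A ![w ⟨i, by omega⟩, w ⟨i + 1, by omega⟩] ![u ⟨i, by omega⟩, u ⟨i + 1, by omega⟩] else 0 := by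
  rw [slot, dif_pos h, pad, Matrix.of_apply]
  refine if_congr ⟨fun ⟨h1, h2⟩ t ht ht' => ?_, fun h => ⟨fun t => ?_, fun t => ?_⟩⟩ ?_ rfl
  · rcases lt_or_ge t.val i with hi | hi
    · exact h1 ⟨t, hi⟩
    · have := h2 ⟨t - (i + 2), by omega⟩
      simpa only [show i + 2 + (t.val - (i + 2)) = t.val by omega] using this
  · exact h _ (by simp only; omega) (by simp only; omega)
  · exact h _ (by simp only; omega) (by simp only; omega)
  · rw [RootDatum.word_two (fun t : Fin 2 => w ⟨i + t, _⟩), RootDatum.word_two (fun t : Fin 2 => u ⟨i + t, _⟩)]; rfl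

/-- The word `w` without the letter at the place `j` and the last letter. -/
def deleteLetter {p : ℕ} (j : ℕ) (w : Word m n (p + 2)) : Word m n p := fun u =>
  if u.val < j then w ⟨u, by omega⟩ else w ⟨u + 1, by omega⟩

end slot

namespace RootDatum
variable {m n : ℕ} (D : RootDatum m n) (κ : Idx m n → Cq)

/-- The vector `v ⊗ U`, with the left end of the cup moved over `s` strands to the left. -/
def addCup {p : ℕ} (v : TMat m n 0 p) : ℕ → TMat m n 0 (p + 2)
  | 0 => pad p 0 (k := p) (l := p + 2) rfl rfl (cupMat κ) * v
  | s + 1 => slot (p - 1 - s) (p + 2) (D.braidMat κ) * addCup v s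

variable {D κ}

theorem addCup_zero_apply {p : ℕ} (v : TMat m n 0 p) (w : Word m n (p + 2)) (z : Word m n 0) :
    D.addCup κ v 0 w z = (if w ⟨p + 1, by omega⟩ = (w ⟨p, by omega⟩).rev then (κ (w ⟨p + 1, by omega⟩))⁻¹ else 0) *
      v (deleteLetter p w) z := by
  rw [addCup, Matrix.mul_apply, Finset.sum_eq_single (deleteLetter p w)]
  · rw [pad, Matrix.of_apply, if_pos]
    · rfl
    · exact ⟨fun u => by simp [deleteLetter], fun u => u.elim0⟩
  · intro u _ hu
    rw [pad, Matrix.of_apply, if_neg, zero_mul]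
    exact fun h => hu (funext fun t => by rw [deleteLetter, if_pos t.isLt]; exact (h.1 t).symm)
  · exact fun h => absurd (Finset.mem_univ _) h

/-- The cup pairs mirror letters. As an entry of the braiding vanishes for `x < b`, the letter at
the moving end never decreases with further crossings, so it cannot be smaller than the mirror of
the last letter. -/
theorem addCup_apply_of_lt {p : ℕ} (v : TMat m n 0 p) {s : ℕ} (hs : s ≤ p) (w : Word m n (p + 2)) (z : Word m n 0)
    (h : w ⟨p - s, by omega⟩ < (w ⟨p + 1, by omega⟩).rev) : D.addCup κ v s w z = 0 := by
  induction s generalizing w with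
  | zero =>
    rw [addCup_zero_apply, if_neg, zero_mul]
    intro h'
    rw [h', Fin.rev_rev] at h
    exact lt_irrefl _ h
  | succ s ih =>
    rw [addCup, Matrix.mul_apply]
    refine Finset.sum_eq_zero fun u _ => ?_
    rw [slot_apply (by omega)]
    split_ifs with hu
    · by_cases hlt : w ⟨p - 1 - s, by omega⟩ < u ⟨p - 1 - s + 1, by omega⟩
      · rw [braidMat_apply, braidEntry_eq_zero hlt, zero_mul]
      · rw [ih (by omega), mul_zero]
        rw [← hu ⟨p + 1, by omega⟩ (by simp only; omega) (by simp only; omega)]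
        refine lt_of_le_of_lt ?_ h
        have e2 : p - 1 - s + 1 = p - s := by omega
        have e1 : p - 1 - s = p - (s + 1) := by omega
        have := not_lt.1 hlt
        simp only [e2] at this
        simpa only [e1] using this
    · rw [zero_mul]

/-- In the extremal case of `addCup_apply_of_lt` the letter at the moving end must stay the same at
every crossing. So each crossing contributes a pure swap, and a single term with non-zero
coefficient survives. -/
theorem addCup_apply (hκ : ∀ a, κ a ≠ 0) {p s : ℕ} (hs : s ≤ p) (w : Word m n (p + 2)) (z : Word m n 0)
    (h : w ⟨p - s, by omega⟩ = (w ⟨p + 1, by omega⟩).rev) :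
    ∃ c : Cq, c ≠ 0 ∧ ∀ v : TMat m n 0 p, D.addCup κ v s w z = c * v (deleteLetter (p - s) w) z := by
  induction s generalizing w with
  | zero =>
    refine ⟨(κ (w ⟨p + 1, by omega⟩))⁻¹, inv_ne_zero (hκ _), fun v => ?_⟩
    rw [addCup_zero_apply, if_pos]
    · rfl
    · have h' : w ⟨p, by omega⟩ = (w ⟨p + 1, by omega⟩).rev := h
      rw [h', Fin.rev_rev]
  | succ s ih =>
    have e1 : p - 1 - s = p - (s + 1) := by omega
    have e2 : p - 1 - s + 1 = p - s := by omega
    -- The only intermediate word that contributes: `w` with the two letters at the last crossing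
    -- exchanged.
    let u : Word m n (p + 2) := fun t => if t.val = p - 1 - s then w ⟨p - 1 - s + 1, by omega⟩ else
      if t.val = p - 1 - s + 1 then w ⟨p - 1 - s, by omega⟩ else w t
    have hu0 : u ⟨p - 1 - s, by omega⟩ = w ⟨p - 1 - s + 1, by omega⟩ := if_pos rfl
    have hu1 : u ⟨p - 1 - s + 1, by omega⟩ = w ⟨p - 1 - s, by omega⟩ :=
      (if_neg (by simp only; omega)).trans (if_pos rfl)
    have hut : ∀ t : Fin (p + 2), t.val ≠ p - 1 - s → t.val ≠ p - 1 - s + 1 → w t = u t := fun t h1 h2 =>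
      ((if_neg h1).trans (if_neg h2)).symm
    have hlast : u ⟨p + 1, by omega⟩ = w ⟨p + 1, by omega⟩ :=
      (hut _ (by simp only; omega) (by simp only; omega)).symm
    have h' : w ⟨p - 1 - s, by omega⟩ = (w ⟨p + 1, by omega⟩).rev := by simpa only [e1] using h
    have hdel : deleteLetter (p - s) u = deleteLetter (p - (s + 1)) w := by
      funext t
      simp only [deleteLetter]
      rcases lt_trichotomy t.val (p - 1 - s) with ht | ht | ht
      · rw [if_pos (by omega), if_pos (by omega), ← hut _ (by simp only; omega) (by simp only; omega)]
      · rw [if_pos (by omega), if_neg (by omega)]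
        simp only [ht]; exact hu0
      · rw [if_neg (by omega), if_neg (by omega), ← hut _ (by simp only; omega) (by simp only; omega)]
    obtain ⟨c, hc, hv⟩ := ih (by omega) u (by rw [hlast, ← h', ← hu1]; simp only [e2])
    refine ⟨D.swapCoeff (w ⟨p - 1 - s + 1, by omega⟩) (w ⟨p - 1 - s, by omega⟩) * c,
      mul_ne_zero (swapCoeff_ne_zero _ _) hc, fun v => ?_⟩
    rw [addCup, Matrix.mul_apply, Finset.sum_eq_single u]
    · rw [slot_apply (by omega), if_pos hut, braidMat_apply, hu0, hu1, braidEntry_self, if_pos rfl, hv, hdel,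
        mul_assoc]
    · intro u' _ hu'
      rw [slot_apply (by omega)]
      split_ifs with hut'
      · rcases lt_trichotomy (w ⟨p - 1 - s, by omega⟩) (u' ⟨p - 1 - s + 1, by omega⟩) with hlt | heq | hgt
        · rw [braidMat_apply, braidEntry_eq_zero hlt, zero_mul]
        · rw [braidMat_apply, ← heq, braidEntry_self, if_neg, zero_mul]
          intro h0
          refine hu' (funext fun t => ?_)
          by_cases h1 : t.val = p - 1 - s
          · rw [show t = ⟨p - 1 - s, by omega⟩ from Fin.ext h1, hu0, h0]
          by_cases h2 : t.val = p - 1 - s + 1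
          · rw [show t = ⟨p - 1 - s + 1, by omega⟩ from Fin.ext h2, hu1, heq]
          rw [← hut t h1 h2, hut' t h1 h2]
        · rw [addCup_apply_of_lt v (by omega), mul_zero]
          rw [← hut' ⟨p + 1, by omega⟩ (by simp only; omega) (by simp only; omega), ← h']
          simpa only [e2] using hgt
      · rw [zero_mul]
    · exact fun h => absurd (Finset.mem_univ _) h

end RootDatum

/-- The word `w` with the letter `b` inserted at the place `j` and the last letter `a`. -/
def insertLetter {m n p : ℕ} (j : ℕ) (b a : Idx m n) (w : Word m n p) : Word m n (p + 2) := fun u =>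
  if h : u.val < j ∧ u.val < p then w ⟨u, h.2⟩ else if h : j < u.val ∧ u.val < p + 1 then w ⟨u - 1, by omega⟩
  else if u.val = j then b else a

theorem deleteLetter_insertLetter {m n p : ℕ} {j : ℕ} (b a : Idx m n) (w : Word m n p) :
    deleteLetter j (insertLetter j b a w) = w := by
  funext u
  simp only [deleteLetter, insertLetter]
  by_cases h : u.val < j
  · rw [if_pos h, dif_pos ⟨h, u.isLt⟩]
  · rw [if_neg h, dif_neg (by omega), dif_pos (by omega)]; rfl

namespace RootDatum
variable {m n : ℕ} {D : RootDatum m n} {κ : Idx m n → Cq} (hmn : ¬ (m = 2 ∧ n = 0)) (hκ : D.IsKappa κ)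

theorem exists_ribbonMap_eq_addCup {p s : ℕ} (hs : s ≤ p) (Γ : RibbonGraph 0 p) : ∃ Γ' : RibbonGraph 0 (p + 2),
    ribbonMap hmn hκ Γ' = D.addCup κ (ribbonMap hmn hκ Γ) s := by
  induction s with
  | zero =>
    exact ⟨Γ ≫ ofSlice ⟨.cup, p, 0, rfl, rfl⟩, by rw [ribbonMap_comp, ribbonMap_slice]; rfl⟩
  | succ s ih =>
    obtain ⟨Γ', h⟩ := ih (by omega)
    refine ⟨Γ' ≫ ofSlice ⟨.xPos, p - 1 - s, s + 1, by simp only [Piece.src]; omega, by simp only [Piece.tgt]; omega⟩, ?_⟩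
    rw [ribbonMap_comp, ribbonMap_slice, h, addCup, slot_eq (s + 1) (by omega)]; rfl

/-- There are `(2t - 1)!!` linearly independent invariants of `V_q^{⊗2t}` that are given by ribbon graphs. -/
theorem exists_independent_ribbonMap (t : ℕ) {a : ℕ} (ha : 2 * (a + t) ≤ m + 2 * n) :
    ∃ x : Fin (oddFactorial t) → RibbonGraph 0 (2 * t), ∀ c : Fin (oddFactorial t) → Cq,
      (∀ (w : Word m n (2 * t)) (z : Word m n 0), (∀ u, (w u).val + a < m + 2 * n) →
        ∑ i, c i * ribbonMap hmn hκ (x i) w z = 0) → ∀ i, c i = 0 := by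
  induction t generalizing a with
  | zero =>
    refine ⟨fun _ => 𝟙 (pts 0), fun c h i => ?_⟩
    have h' := h (fun u => u.elim0) (fun u => u.elim0) (fun u => u.elim0)
    have hone : ribbonMap hmn hκ (𝟙 (pts 0)) (fun u : Fin 0 => u.elim0) (fun u : Fin 0 => u.elim0) = 1 := by
      rw [ribbonMap_id, Matrix.one_apply_eq]
    have : Subsingleton (Fin (oddFactorial 0)) := inferInstanceAs (Subsingleton (Fin 1))
    have e := (Fintype.sum_subsingleton _ i).symm.trans h'
    rwa [hone, mul_one] at e
  | succ t ih =>
    -- The letter `a` and its mirror are reserved for detecting the new cup; the induction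
    -- hypothesis is tested only on words whose letters are smaller than that mirror.
    obtain ⟨x, hx⟩ := ih (a := a + 1) (by omega)
    choose Γ hΓ using fun (ji : Fin (2 * t + 1) × Fin (oddFactorial t)) =>
      exists_ribbonMap_eq_addCup hmn hκ (p := 2 * t) (s := 2 * t - ji.1) (by omega) (x ji.2)
    let e : Fin (oddFactorial (t + 1)) ≃ Fin (2 * t + 1) × Fin (oddFactorial t) := finProdFinEquiv.symm
    refine ⟨fun i => Γ (e i), fun c h => ?_⟩
    have key : ∀ j i, c (e.symm (j, i)) = 0 := by
      intro j
      refine hx _ fun w z hw => ?_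
      have hN : a < m + 2 * n := by omega
      let b : Idx m n := ⟨a, hN⟩
      have hj := j.isLt
      -- On this word a new cup whose left end is at a place other than `j` contributes zero by
      -- `addCup_apply_of_lt`, because the letter there is smaller than the mirror of the last one.
      -- The terms with left end at `j` reduce to the word `w`.
      let w' : Word m n (2 * t + 2) := insertLetter j b.rev b w
      have hw'j : w' ⟨j, by omega⟩ = b.rev := by
        simp only [w', insertLetter, lt_irrefl, false_and, dite_false, if_true]
      have hw'l : w' ⟨2 * t + 1, by omega⟩ = b := by
        simp only [w', insertLetter]
        rw [dif_neg (by omega), dif_neg (by omega), if_neg (by omega)]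
      have hw'lt : ∀ j' : Fin (2 * t + 1), j' ≠ j → w' ⟨j', by omega⟩ < b.rev := by
        intro j' hj'
        have hne : j'.val ≠ j.val := fun h => hj' (Fin.ext h)
        have hlt : ∀ u, w u < b.rev := fun u => by
          rw [Fin.lt_def, Fin.val_rev]
          have := hw u
          simp only [b]; omega
        simp only [w', insertLetter]
        have := j'.isLt
        by_cases h1 : j'.val < j
        · rw [dif_pos (by omega)]; exact hlt _
        · rw [dif_neg (by omega), dif_pos (by omega)]; exact hlt _
      have hs := h w' z (fun u => by
        have hb : b.rev.val + a < m + 2 * n := by rw [Fin.val_rev]; simp only [b]; omega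
        by_cases hu : u.val = 2 * t + 1
        · rw [show u = ⟨2 * t + 1, by omega⟩ from Fin.ext hu, hw'l]; simp only [b]; omega
        · by_cases hu' : u.val = j
          · rw [show u = ⟨j, by omega⟩ from Fin.ext hu', hw'j]; exact hb
          · have := hw'lt ⟨u, by have := u.isLt; omega⟩ (fun h => hu' (congrArg Fin.val h))
            rw [Fin.lt_def] at this
            exact lt_trans (Nat.add_lt_add_right this a) hb)
      obtain ⟨y, hy, hv⟩ := addCup_apply (D := D) hκ.ne_zero (s := 2 * t - j) (by omega) w' z (by
        rw [hw'l, ← hw'j]; simp only [show 2 * t - (2 * t - j.val) = j.val by omega])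
      rw [← e.symm.sum_comp, Fintype.sum_prod_type, Finset.sum_eq_single j] at hs
      · simp only [Equiv.apply_symm_apply, hΓ, hv] at hs
        rw [show 2 * t - (2 * t - j.val) = j.val by omega, deleteLetter_insertLetter] at hs
        simp only [mul_left_comm _ y, ← Finset.mul_sum] at hs
        exact (mul_eq_zero.1 hs).resolve_left hy
      · intro j' _ hj'
        refine Finset.sum_eq_zero fun i _ => ?_
        refine (congrArg (c _ * ·) ?_).trans (mul_zero _)
        show ribbonMap hmn hκ (Γ (e (e.symm (j', i)))) w' z = 0
        rw [Equiv.apply_symm_apply, hΓ, addCup_apply_of_lt _ (by omega)]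
        have := hw'lt j' hj'
        have := j'.isLt
        rw [hw'l]; simpa only [show 2 * t - (2 * t - j'.val) = j'.val by omega]
      · exact fun h => absurd (Finset.mem_univ _) h
    intro i
    have := key (e i).1 (e i).2
    rwa [Prod.mk.eta, Equiv.symm_apply_apply] at this

end RootDatum
end
end OspBMW

/-! ### Bending strands, faithfulness and the factorization -/

namespace OspBMW
noncomputable section

namespace RootDatum
variable {m n : ℕ} {D : RootDatum m n} {κ : Idx m n → Cq}

/-- The operation that bends the last strand at the top down to the bottom. -/
def bend (κ : Idx m n → Cq) (s l : ℕ) : TMat m n s (l + 1) →ₗ[Cq] TMat m n (s + 1) l where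
  toFun A := pad l 0 (k := l + 2) rfl rfl (capMat κ) * pad 0 1 (k := s + 1) (l := l + 2) (by omega) (by omega) A
  map_add' A B := by rw [pad_add, Matrix.mul_add]
  map_smul' x A := by rw [pad_smul, Matrix.mul_smul]; rfl

/-- Bending the strand back up with a cup is a left inverse, by a zigzag. -/
theorem bend_injective (hκ : ∀ a, κ a ≠ 0) (s l : ℕ) : Function.Injective (bend κ s l) := by
  refine Function.LeftInverse.injective (g := fun B : TMat m n (s + 1) l =>
    pad 0 1 (k := s + 2) (l := l + 1) (by omega) (by omega) B * pad s 0 (k := s) (l := s + 2) rfl rfl (cupMat κ)) fun A => ?_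
  have e := pad_mul_pad A (cupMat κ) (k' := s) (l' := l + 3) rfl rfl (l + 1) rfl (s + 2) rfl
  have z := congrArg (pad l 0 (k := l + 1) (l := l + 1) (by omega) (by omega)) (zigzag_left hκ)
  rw [← pad_mul (l := l + 3) _ (by omega), pad_pad, pad_pad, pad_one] at z
  show pad 0 1 (k := s + 2) (l := l + 1) (by omega) (by omega) (pad l 0 (k := l + 2) rfl rfl (capMat κ) *
    pad 0 1 (k := s + 1) (l := l + 2) (by omega) (by omega) A) * _ = A
  rw [← pad_mul (l := l + 3) _ (by omega), pad_pad, pad_pad, Matrix.mul_assoc]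
  have e' : pad (0 + 0) (1 + 1) (k := s + 2) (l := l + 3) (by omega) (by omega) A *
      pad s 0 (k := s) rfl rfl (cupMat κ) = pad (l + 1) (0 + 0) (k := l + 1) (by omega) (by omega) (cupMat κ) * A := by
    rw [pad_zero_zero] at e
    exact e.symm
  rw [e', ← Matrix.mul_assoc]
  have z' : pad (0 + l) (0 + 1) (k := l + 3) (l := l + 1) (by omega) (by omega) (capMat κ) *
      pad (l + 1) (0 + 0) (k := l + 1) (l := l + 3) (by omega) (by omega) (cupMat κ) = 1 := by
    rw [← z]
    congr 1; exact pad_congr (by omega) (by omega)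
  rw [z', Matrix.one_mul]

variable (hmn : ¬ (m = 2 ∧ n = 0)) (hκ : D.IsKappa κ)

theorem exists_ribbonMap_eq_pad {k l : ℕ} (Γ : RibbonGraph k l) : ∃ Γ' : RibbonGraph (k + 1) (l + 1),
    ribbonMap hmn hκ Γ' = pad 0 1 (by omega) (by omega) (ribbonMap hmn hκ Γ) := by
  induction Γ using RibbonGraph.induction with
  | id => exact ⟨𝟙 _, by rw [ribbonMap_id, ribbonMap_id, pad_one]⟩
  | comp l l' Γ s ih =>
    obtain ⟨Γ', h⟩ := ih
    obtain ⟨g, i, j, hk, hl⟩ := s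
    refine ⟨Γ' ≫ ofSlice ⟨g, i, j + 1, by omega, by omega⟩, ?_⟩
    rw [ribbonMap_comp, ribbonMap_comp, ribbonMap_slice, ribbonMap_slice, h, whisker_eq_pad, whisker_eq_pad,
      ← pad_mul (l := l + 1) _ (by omega), pad_pad]
    congr 1; exact pad_congr (by simp only; omega) rfl

/-- The space spanned by the linear maps given by the ribbon `(k, l)`-graphs. -/
def graphSpan (k l : ℕ) : Submodule Cq (TMat m n k l) :=
  Submodule.span Cq (Set.range fun Γ : RibbonGraph k l => ribbonMap hmn hκ Γ)

theorem finrank_graphSpan_le_bend (s l : ℕ) :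
    Module.finrank Cq (graphSpan hmn hκ s (l + 1)) ≤ Module.finrank Cq (graphSpan hmn hκ (s + 1) l) := by
  rw [(Submodule.equivMapOfInjective _ (bend_injective hκ.ne_zero s l) (graphSpan hmn hκ s (l + 1))).finrank_eq]
  refine Submodule.finrank_mono ?_
  rw [graphSpan, Submodule.map_span, Submodule.span_le]
  rintro _ ⟨_, ⟨Γ, rfl⟩, rfl⟩
  obtain ⟨Γ', h⟩ := exists_ribbonMap_eq_pad hmn hκ Γ
  refine Submodule.subset_span ⟨Γ' ≫ ofSlice ⟨.cap, l, 0, rfl, rfl⟩, ?_⟩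
  show ribbonMap hmn hκ _ = _
  rw [ribbonMap_comp, ribbonMap_slice, h]; rfl

theorem finrank_graphSpan_le (c : ℕ) {s l k t : ℕ} (hk : k = l + c) (ht : t = s + c) :
    Module.finrank Cq (graphSpan hmn hκ s k) ≤ Module.finrank Cq (graphSpan hmn hκ t l) := by
  induction c generalizing s k with
  | zero => subst hk ht; exact le_rfl
  | succ c ih =>
    subst hk
    exact (finrank_graphSpan_le_bend hmn hκ s (l + c)).trans (ih rfl (by omega))

/-- The independent invariants live in `V_q^{⊗2r}`; bending `r` of the strands down turns them into
endomorphisms without loss of dimension. -/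
theorem oddFactorial_le_finrank {r : ℕ} (h : 2 * r ≤ m + 2 * n) :
    oddFactorial r ≤ Module.finrank Cq (graphSpan hmn hκ r r) := by
  obtain ⟨x, hx⟩ := exists_independent_ribbonMap hmn hκ r (a := 0) (by omega)
  refine le_trans ?_ (finrank_graphSpan_le hmn hκ (s := 0) (k := 2 * r) r (by omega) (by omega))
  have hli : LinearIndependent Cq fun i => (⟨ribbonMap hmn hκ (x i), Submodule.subset_span ⟨x i, rfl⟩⟩ :
      graphSpan hmn hκ 0 (2 * r)) := by
    rw [Fintype.linearIndependent_iff]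
    intro c hc
    refine hx c fun w z _ => ?_
    have h' := congrFun (congrFun (congrArg Subtype.val hc) w) z
    simpa [Matrix.sum_apply] using h'
  simpa using hli.fintype_card_le_finrank

end RootDatum

namespace Datum

/-- Adding `2(r+1)` to `m` and `r+1` to `n` preserves `-m + 2n` and hence the twist, while the
dimension grows. Any admissible ordering would do; the `δ`'s are put first. -/
theorem exists_large (m n r : ℕ) : ∃ d : Datum (RootDatum.twist m n), 2 * r ≤ d.m + 2 * d.n := by
  have hmn : ¬ (m + 2 * (r + 1) = 2 ∧ n + (r + 1) = 0) := by omega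
  let D : RootDatum (m + 2 * (r + 1)) (n + (r + 1)) :=
    { isDelta := fun j => decide (j.val < n + (r + 1))
      card_isDelta := by
        simp only [decide_eq_true_eq]
        rw [Fin.card_filter_val_lt]; omega }
  obtain ⟨κ, hκ⟩ := D.exists_isKappa hmn
  refine ⟨⟨_, _, hmn, D, κ, hκ, ?_⟩, by simp only; omega⟩
  rw [RootDatum.twist, RootDatum.twist]; congr 1; push_cast; ring

variable {y : Cq} (hy : y ≠ 0)

theorem lift_familyAll (d : Datum y) {r : ℕ} (b : BMW r y (q - q⁻¹)) :
    (familyAll hy r).lift b d = (d.family r).lift b := by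
  have h : (Pi.evalAlgHom Cq (fun d : Datum y => TMat d.m d.n r r) d).comp (familyAll hy r).lift = (d.family r).lift := by
    refine RingQuot.ringQuot_ext' _ _ _ (FreeAlgebra.hom_ext (funext fun x => ?_))
    cases x <;> simp [BMWFamily.lift, familyAll]
  exact DFunLike.congr_fun h b

include hy in
-- One `b` serves all modules of twist `y`, so what is decided on a large module is valid on the
-- given one as well.
theorem exists_lift_eq_ribbonMap {r : ℕ} (hr : 1 ≤ r) (Γ : RibbonGraph r r) :
    ∃ b : BMW r y (q - q⁻¹), ∀ d : Datum y, RootDatum.ribbonMap d.hmn d.hκ Γ = (d.family r).lift b := by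
  obtain ⟨x, hx, h⟩ := exists_mem_alg_ribbonMap hy hr Γ
  obtain ⟨b, rfl⟩ := (familyAll hy r).mem_range_lift hx
  exact ⟨b, fun d => (h d).trans (lift_familyAll hy d b)⟩

/-- A dimension squeeze: the operators of ribbon graphs span at least `(2r-1)!!` dimensions and lie
in the image of the BMW algebra, whose dimension is at most `(2r-1)!!`. So the kernel is zero. -/
theorem lift_injective (d : Datum y) {r : ℕ} (hr : 1 ≤ r) (h : 2 * r ≤ d.m + 2 * d.n) :
    Function.Injective (d.family r).lift := by
  have hy : y ≠ 0 := d.hy ▸ RootDatum.twist_ne_zero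
  obtain ⟨hfin, hle⟩ := bmw_finrank_le (r := r) hy z_ne_zero
  have hle' : RootDatum.graphSpan d.hmn d.hκ r r ≤ LinearMap.range (d.family r).lift.toLinearMap := by
    rw [RootDatum.graphSpan, Submodule.span_le]
    rintro _ ⟨Γ, rfl⟩
    obtain ⟨b, hb⟩ := exists_lift_eq_ribbonMap hy hr Γ
    exact ⟨b, (hb d).symm⟩
  have h1 := Submodule.finrank_mono hle'
  have h2 := RootDatum.oddFactorial_le_finrank d.hmn d.hκ h
  have h3 := LinearMap.finrank_range_add_finrank_ker (d.family r).lift.toLinearMap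
  have h4 : Module.finrank Cq (LinearMap.ker (d.family r).lift.toLinearMap) = 0 := by omega
  exact LinearMap.ker_eq_bot.1 (Submodule.finrank_eq_zero.1 h4)

/-- The element of the BMW algebra that is given by a ribbon graph. -/
theorem exists_bmw_hom (hy : ∃ m n, y = RootDatum.twist m n) {r : ℕ} (hr : 1 ≤ r) :
    ∃ π : End (pts r) →* BMW r y (q - q⁻¹),
      (∀ (Γ : End (pts r)) (d : Datum y), RootDatum.ribbonMap d.hmn d.hκ Γ = (d.family r).lift (π Γ)) ∧
      ∀ (Γ : End (pts r)) (b : BMW r y (q - q⁻¹)),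
        (∀ d : Datum y, RootDatum.ribbonMap d.hmn d.hκ Γ = (d.family r).lift b) → π Γ = b := by
  obtain ⟨m, n, rfl⟩ := hy
  obtain ⟨d₀, hd₀⟩ := exists_large m n r
  have inj := lift_injective d₀ hr hd₀
  -- The choice is arbitrary, but faithfulness on `d₀` determines it uniquely and makes it
  -- multiplicative.
  choose f hf using fun Γ : End (pts r) => exists_lift_eq_ribbonMap (RootDatum.twist_ne_zero (m := m) (n := n)) hr Γ
  refine ⟨⟨⟨f, inj ?_⟩, fun Γ Γ' => inj ?_⟩, hf, fun Γ b hb => inj ?_⟩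
  · rw [map_one, ← hf]; exact RootDatum.ribbonMap_id _ _ r
  · show (d₀.family r).lift (f (Γ * Γ')) = (d₀.family r).lift (f Γ * f Γ')
    rw [map_mul, ← hf, ← hf, ← hf]; exact RootDatum.ribbonMap_comp _ _ Γ' Γ
  · exact (hf Γ d₀).symm.trans (hb d₀)

end Datum

namespace RootDatum
variable {m n : ℕ} {D : RootDatum m n} {κ : Idx m n → Cq} (hmn : ¬ (m = 2 ∧ n = 0)) (hκ : D.IsKappa κ)

theorem isHom_slot {i r : ℕ} {A : TMat m n 2 2} (h : i + 2 ≤ r) (hA : D.IsHom A) : D.IsHom (slot i r A) := by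
  rw [slot, dif_pos h]; exact hA.pad

theorem lift_mem_endUq {y : Cq} (hy : twist m n = y) {r : ℕ} (b : BMW r y (q - q⁻¹)) :
    (tensorFamily hmn hκ hy r).lift b ∈ D.endUq r := by
  induction b using BMWFamily.bmw_induction with
  | h0 c => rw [AlgHom.commutes]; exact (D.endUq r).algebraMap_mem c
  | hg i =>
    rw [BMWFamily.lift_g]; exact isHom_slot (by have := i.isLt; omega) (isHom_braid hmn hκ)
  | hgi i =>
    rw [BMWFamily.lift_gInv]; exact isHom_slot (by have := i.isLt; omega) (isHom_braidInv hmn hκ)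
  | he i =>
    rw [BMWFamily.lift_e]
    exact isHom_slot (by have := i.isLt; omega) ((isHom_cup hκ).mul (isHom_cap hκ))
  | hm a b ha hb => rw [map_mul]; exact mul_mem ha hb
  | ha a b ha hb => rw [map_add]; exact add_mem ha hb

/-- The representation of the BMW algebra on a tensor power. -/
def bmwRep {y : Cq} (hy : twist m n = y) (r : ℕ) : BMW r y (q - q⁻¹) →ₐ[Cq] D.endUq r :=
  (tensorFamily hmn hκ hy r).lift.codRestrict _ (lift_mem_endUq hmn hκ hy)

theorem ribbonMap_graphX {y : Cq} (hy : twist m n = y) {r : ℕ} (i : Fin (r - 1)) :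
    ribbonMap hmn hκ (graphX i) = (tensorFamily hmn hκ hy r).g i := by
  have := i.isLt
  rw [graphX, ribbonMap_slice, whisker_eq_pad]
  exact (slot_eq (r - 2 - i.val) (show r = i.val + 2 + (r - 2 - i.val) by omega) _).symm

theorem ribbonMap_graphE {y : Cq} (hy : twist m n = y) {r : ℕ} (i : Fin (r - 1)) :
    ribbonMap hmn hκ (graphE i) = (tensorFamily hmn hκ hy r).e i := by
  have := i.isLt
  rw [graphE, ribbonMap_comp, ribbonMap_slice, ribbonMap_slice, whisker_eq_pad, whisker_eq_pad]
  refine Eq.trans ?_ (slot_eq (r - 2 - i) (by omega) _).symm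
  exact pad_mul _ _ _ _ _

/-- The entry of an endomorphism of `V_q^{⊗0}`. -/
def emptyEntry : TMat m n 0 0 →ₐ[Cq] Cq :=
  AlgHom.ofLinearMap (Matrix.entryLinearMap Cq Cq (default : Word m n 0) default) (Matrix.one_apply_eq _)
    fun A B => by
      simp only [Matrix.entryLinearMap_apply, Matrix.mul_apply]
      exact Fintype.sum_subsingleton _ default

theorem algebraMap_emptyEntry (A : TMat m n 0 0) : algebraMap Cq (TMat m n 0 0) (emptyEntry A) = A := by
  ext w w'
  obtain rfl : w = default := Subsingleton.elim _ _
  obtain rfl : w' = default := Subsingleton.elim _ _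
  rw [Matrix.algebraMap_matrix_apply, if_pos rfl]; rfl

include hmn hκ in
theorem exists_bmw_factorization {R : TMat m n 2 2} (hR : D.IsRMatrix R) (F : D.RibbonFunctor R (formMat κ)) (r : ℕ)
    {y z : Cq} (hy : twist m n = y) (hz : z = q - q⁻¹) :
    ∃ (π : RibbonAlg r →ₐ[Cq] BMW r y z) (ρ : BMW r y z →ₐ[Cq] D.endUq r),
      (∀ i, π (MonoidAlgebra.of Cq _ (graphX i)) = BMW.g y z i) ∧
      (∀ i, π (MonoidAlgebra.of Cq _ (graphE i)) = BMW.e y z i) ∧ F.nu r = ρ.comp π := by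
  subst hz
  obtain rfl : F = ribbonFunctor hmn hκ hR := ribbonFunctor_ext _ _
  -- For `r = 0` the normal form argument has no strand to work with. Here the tensor power is
  -- one-dimensional and there are no generators, so `π` is read off from the functor itself.
  rcases Nat.eq_zero_or_pos r with rfl | hr
  · refine ⟨(Algebra.ofId Cq (BMW 0 y (q - q⁻¹))).comp
      (emptyEntry.comp ((D.endUq 0).val.comp ((ribbonFunctor hmn hκ hR).nu 0))),
      bmwRep hmn hκ hy 0, fun i => i.elim0, fun i => i.elim0, AlgHom.ext fun x => ?_⟩
    show _ = bmwRep hmn hκ hy 0 (algebraMap Cq _ (emptyEntry ((ribbonFunctor hmn hκ hR).nu 0 x).val))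
    rw [AlgHom.commutes]
    exact Subtype.ext (algebraMap_emptyEntry _).symm
  · obtain ⟨π, hπ, hπ'⟩ := Datum.exists_bmw_hom (y := y) ⟨m, n, hy.symm⟩ hr
    refine ⟨MonoidAlgebra.lift Cq _ _ π, bmwRep hmn hκ hy r, fun i => ?_, fun i => ?_, ?_⟩
    · rw [MonoidAlgebra.lift_of]
      exact hπ' _ _ fun d => (ribbonMap_graphX d.hmn d.hκ d.hy i).trans (BMWFamily.lift_g _ i).symm
    · rw [MonoidAlgebra.lift_of]
      exact hπ' _ _ fun d => (ribbonMap_graphE d.hmn d.hκ d.hy i).trans (BMWFamily.lift_e _ i).symm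
    · apply MonoidAlgebra.algHom_ext
      rotate_left
      · exact Subsingleton.elim _ _
      intro Γ
      rw [AlgHom.comp_apply, RibbonFunctor.nu, MonoidAlgebra.lift_single, MonoidAlgebra.lift_single, one_smul, one_smul]
      -- The uniform equality over all modules of twist `y` is specialised to the given module.
      exact Subtype.ext (hπ Γ ⟨m, n, hmn, D, κ, hκ, hy⟩)

end RootDatum
end
end OspBMW

theorem mainTheorem8 (m n : ℕ) (hmn : ¬ (m = 2 ∧ n = 0)) (D : OspBMW.RootDatum m n) :
    (∃! R : OspBMW.TMat m n 2 2, D.IsRMatrix R) ∧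
    (∃ B : Matrix (OspBMW.Idx m n) (OspBMW.Idx m n) OspBMW.Cq, D.IsContravariantForm B) ∧
    ∀ (R : OspBMW.TMat m n 2 2) (B : Matrix (OspBMW.Idx m n) (OspBMW.Idx m n) OspBMW.Cq),
      D.IsRMatrix R → D.IsContravariantForm B →
      Nonempty (Unique (D.RibbonFunctor R B)) ∧
      ∀ (𝓕 : D.RibbonFunctor R B) (r : ℕ) (y z : OspBMW.Cq),
        y = OspBMW.q ^ (-(m : ℤ) + 2 * (n : ℤ) + 1) → z = OspBMW.q - OspBMW.q⁻¹ →
        ∃ (π : OspBMW.RibbonAlg r →ₐ[OspBMW.Cq] OspBMW.BMW r y z)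
          (ρ : OspBMW.BMW r y z →ₐ[OspBMW.Cq] D.endUq r),
          (∀ i, π (MonoidAlgebra.of OspBMW.Cq _ (OspBMW.graphX i)) = OspBMW.BMW.g y z i) ∧
          (∀ i, π (MonoidAlgebra.of OspBMW.Cq _ (OspBMW.graphE i)) = OspBMW.BMW.e y z i) ∧
          𝓕.nu r = ρ.comp π := by
  obtain ⟨κ, hκ⟩ := D.exists_isKappa hmn
  refine ⟨⟨_, OspBMW.RootDatum.isRMatrix hmn hκ, fun R hR => ?_⟩, ⟨_, hκ.isContravariantForm⟩,
    fun R B hR hB => ⟨OspBMW.RootDatum.nonempty_unique_ribbonFunctor hmn hR hB, fun F r y z hy hz => ?_⟩⟩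
  · exact OspBMW.RootDatum.IsRMatrix.unique hmn hR (OspBMW.RootDatum.isRMatrix hmn hκ)
  -- The form is arbitrary here and brings its own coefficients; `κ` above served only for existence
  -- and uniqueness.
  · obtain ⟨κ', hκ', rfl⟩ := hB.exists_kappa hmn
    exact OspBMW.RootDatum.exists_bmw_factorization hmn hκ' hR F r hy.symm hz
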